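/- Let $(\dot\Delta_j)_{j\in\mathbb Z}$ be a homogeneous Littlewood--Paley decomposition of $\mathbb R^3$: $\dot\Delta_j=\varphi(2^{-j}D)$, $\dot S_j=\chi(2^{-j}D)$, $\varphi(\xi)=\chi(\xi/2)-\chi(\xi)$, where $\chi$ is smooth, nonnegative, radially non-increasing, equal to $1$ for $|\xi|\le 3/4$ and to $0$ for $|\xi|\ge 4/3$. Put $$\|z\|_{\dot B^s_{2,1}}=\sum_{j\in\mathbb Z}2^{js}\|\dot\Delta_jz\|_{L^2},\qquad \|z\|_{\tilde B^{s,\pm}_1}=\sum_{j\in\mathbb Z}2^{js}\bigl(\min(1,2^j)\bigr)^{\pm1}\|\dot\Delta_jz\|_{L^2},$$ and let $\|\cdot\|_{\tilde L^\infty_t(\dot B^s_{2,1})}$, $\|\cdot\|_{\tilde L^\infty_t(\tilde B^{s,\pm}_1)}$ be the same sums with $\|\dot\Delta_jz\|_{L^2}$ replaced by $\|\dot\Delta_jz\|_{L^\infty(0,t;L^2)}$. Let $\Lambda=|D|$, and let $T_fg=\sum_j\dot S_{j-1}f\,\dot\Delta_jg$ be the paraproduct. For given $\tilde\mu,\tilde\kappa>0$,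 a time-dependent (real) vector field $v$ on $\mathbb R^3$, locally integrable in time and Lipschitz in space, with $\nabla v\in L^1(0,T;L^\infty)$, and source terms $B,D,G,W$ such that $B\in L^1(0,T;\tilde B^{s+1,-}_1)$, $D,W\in L^1(0,T;\dot B^s_{2,1})$, $G\in L^1(0,T;\tilde B^{s-1,+}_1)$, consider on $[0,T]\times\mathbb R^3$ the paralinearized system (summation over $k$) $$\left\{\begin{aligned}&\partial_tb+\Lambda d+T_{v^k}\partial_kb=B,\\&\partial_td+T_{v^k}\partial_kd-\Delta d-\Lambda(b+\theta)=D,\\&\partial_t\theta+\Lambda d+T_{v^k}\partial_k\theta-\tilde\kappa\Delta\theta=G,\\&\partial_tw+T_{v^k}\partial_kw-\tilde\mu\Delta w=W,\end{aligned}\right.$$ where $b,d,\theta$ are scalar and $w$ takes values in three-dimensional space; the equations are understood in the sense of distributions after application of each $\dot\Delta_j$. Let $\check\kappa=\min(1,\tilde\kappa)$ and $\mathcal V(t)=\int_0^t\|\nabla v\|_{L^\infty}\,d\tau$. **Proposition.** For every $s\in\mathbb R$ there exist a constant $K$ depending (besides $s$ and $\chi$) only on $\tilde\mu$ and $\check\kappa$,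 and a constant $C$ depending only on $s$ and $\chi$ (in particular not on $\tilde\mu,\tilde\kappa,T,v$, the sources or the solution), such that every solution $(b,d,\theta,w)$ on $[0,T]$ with $b$ bounded in $\tilde B^{s+1,-}_1$, $d$ and $w$ bounded in $\dot B^s_{2,1}$ and $\theta$ bounded in $\tilde B^{s-1,+}_1$ on $[0,T]$, with initial values $(b_0,d_0,\theta_0,w_0)$, satisfies for all $t\in[0,T]$ $$\begin{aligned}&\|b\|_{\tilde L^\infty_t(\tilde B^{s+1,-}_1)}+\|(d,w)\|_{\tilde L^\infty_t(\dot B^s_{2,1})}+\|\theta\|_{\tilde L^\infty_t(\tilde B^{s-1,+}_1)}+\int_0^t\bigl(\|b\|_{\tilde B^{s+1,+}_1}+\|(d,w)\|_{\dot B^{s+2}_{2,1}}+\|\theta\|_{\tilde B^{s+1,+}_1}\bigr)d\tau\\&\quad\le Ke^{C\mathcal V(t)}\Bigl(\|b_0\|_{\tilde B^{s+1,-}_1}+\|(d_0,w_0)\|_{\dot B^s_{2,1}}+\|\theta_0\|_{\tilde B^{s-1,+}_1}\\&\qquad\qquad+\int_0^te^{-C\mathcal V(\tau)}\bigl(\|B\|_{\tilde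 B^{s+1,-}_1}+\|(D,W)\|_{\dot B^s_{2,1}}+\|G\|_{\tilde B^{s-1,+}_1}\bigr)d\tau\Bigr),\end{aligned}$$ where $\|(f,g)\|:=\|f\|+\|g\|$. -/

import Mathlib

open MeasureTheory Set
open scoped SchwartzMap ENNReal NNReal LineDeriv Laplacian FourierTransform

noncomputable section

/-- The space `ℝ³`. -/
abbrev R3 : Type := EuclideanSpace ℝ (Fin 3)

/-- `χ` is a low frequency cut-off on `ℝ³`: a smooth, nonnegative, radially non-increasing
function (in particular radial) with value `1` on `B(0,3/4)` and `0` outside of `B(0,4/3)`. -/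
structure IsLPCutoff (χ : R3 → ℝ) : Prop where
  smooth : ContDiff ℝ (⊤ : ℕ∞) χ
  nonneg : ∀ ξ, 0 ≤ χ ξ
  antitone : ∀ ξ η : R3, ‖ξ‖ ≤ ‖η‖ → χ η ≤ χ ξ
  eq_one : ∀ ξ : R3, ‖ξ‖ ≤ 3 / 4 → χ ξ = 1
  eq_zero : ∀ ξ : R3, 4 / 3 ≤ ‖ξ‖ → χ ξ = 0

section LittlewoodPaley

variable {F : Type*} [NormedAddCommGroup F] [NormedSpace ℂ F]

/-- The Fourier multiplier `m(D)` with `D = -i∇`, acting on tempered distributions.  The factor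
`2π` translates between `D` and Mathlib's normalisation `e^{2πi x·ξ}` of the Fourier transform. -/
def symbolD (m : R3 → ℝ) : 𝓢'(R3, F) →L[ℂ] 𝓢'(R3, F) :=
  TemperedDistribution.fourierMultiplierCLM F (fun ξ : R3 => ((m ((2 * Real.pi) • ξ) : ℝ) : ℂ))

/-- The symbol `φ(2^{-j} ξ)`, where `φ(ξ) = χ(ξ/2) - χ(ξ)`. -/
def dyadicSymbol (χ : R3 → ℝ) (j : ℤ) (ξ : R3) : ℝ :=
  χ ((2 : ℝ)⁻¹ • ((2 : ℝ) ^ (-j) • ξ)) - χ ((2 : ℝ) ^ (-j) • ξ)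

/-- The homogeneous dyadic block `Δ_j = φ(2^{-j} D)`. -/
def lpBlock (χ : R3 → ℝ) (j : ℤ) : 𝓢'(R3, F) →L[ℂ] 𝓢'(R3, F) :=
  symbolD (dyadicSymbol χ j)

/-- The operator `Λ Δ_j = |D| φ(2^{-j} D)`, whose symbol is smooth and compactly supported. -/
def lambdaBlock (χ : R3 → ℝ) (j : ℤ) : 𝓢'(R3, F) →L[ℂ] 𝓢'(R3, F) :=
  symbolD (fun ξ => ‖ξ‖ * dyadicSymbol χ j ξ)

/-- The low frequency cut-off `S_j f = χ(2^{-j} D) f` of a function `f`, written as the convolution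
of `f` with the inverse Fourier transform of `χ(2^{-j} ·)`. -/
def lowFreq (χ : R3 → ℝ) (j : ℤ) (f : R3 → ℝ) (x : R3) : ℂ :=
  ∫ y : R3,
    𝓕⁻ (fun ξ : R3 => ((χ ((2 : ℝ) ^ (-j) • ((2 * Real.pi) • ξ)) : ℝ) : ℂ)) (x - y) * (f y : ℂ)

/-- The block `Δ_j (T_{v^k} ∂_k z)` (summation over `k`) of the paraconvection term
`T_{v^k} ∂_k z = ∑_{j'} (S_{j'-1} v^k) Δ_{j'} ∂_k z`.  By spectral localization
only finitely many `j'` contribute to the sum below. -/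
def paraconvBlock (χ : R3 → ℝ) (j : ℤ) (v : R3 → R3) (z : 𝓢'(R3, F)) : 𝓢'(R3, F) :=
  ∑' j' : ℤ, lpBlock χ j (∑ k : Fin 3,
    TemperedDistribution.smulLeftCLM F (lowFreq χ (j' - 1) (fun x => v x k))
      (lpBlock χ j' (∂_{(EuclideanSpace.single k 1 : R3)} z)))

/-- The `L²(ℝ³)` norm of a tempered distribution; it is `∞` if the distribution is not (represented
by) an `L²` function. -/
def l2Norm [CompleteSpace F] (z : 𝓢'(R3, F)) : ℝ≥0∞ :=
  ⨅ (f : Lp F 2 (volume : Measure R3)) (_ : (f : 𝓢'(R3, F)) = z), ‖f‖ₑ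

variable [CompleteSpace F]

/-- The norm of `\dot B^s_{2,1}`. -/
def besovNorm (χ : R3 → ℝ) (s : ℝ) (z : 𝓢'(R3, F)) : ℝ≥0∞ :=
  ∑' j : ℤ, ENNReal.ofReal ((2 : ℝ) ^ ((j : ℝ) * s)) * l2Norm (lpBlock χ j z)

/-- The weight `2^{js} (min(α⁻¹, 2^j))^σ` of the hybrid Besov spaces; `σ = 1` or `σ = -1`. -/
def hybridWeight (α s : ℝ) (σ : ℤ) (j : ℤ) : ℝ≥0∞ :=
  ENNReal.ofReal ((2 : ℝ) ^ ((j : ℝ) * s) * (min α⁻¹ ((2 : ℝ) ^ j)) ^ σ)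

/-- The norm of the hybrid Besov space `\tilde B^{s,±}_α` (with `p = 2`); the sign is that of
`σ = ±1`. -/
def hybridNorm (χ : R3 → ℝ) (α s : ℝ) (σ : ℤ) (z : 𝓢'(R3, F)) : ℝ≥0∞ :=
  ∑' j : ℤ, hybridWeight α s σ j * l2Norm (lpBlock χ j z)

/-- `‖Δ_j u‖_{L^∞(0,t; L²)}`. -/
def blockSup (χ : R3 → ℝ) (t : ℝ) (j : ℤ) (u : ℝ → 𝓢'(R3, F)) : ℝ≥0∞ :=
  essSup (fun τ => l2Norm (lpBlock χ j (u τ))) (volume.restrict (Ioc 0 t))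

/-- The norm of `\tilde L^∞_t(\dot B^s_{2,1})`: the time norm is taken before the summation. -/
def tildeBesovNorm (χ : R3 → ℝ) (t s : ℝ) (u : ℝ → 𝓢'(R3, F)) : ℝ≥0∞ :=
  ∑' j : ℤ, ENNReal.ofReal ((2 : ℝ) ^ ((j : ℝ) * s)) * blockSup χ t j u

/-- The norm of `\tilde L^∞_t(\tilde B^{s,±}_α)`. -/
def tildeHybridNorm (χ : R3 → ℝ) (t α s : ℝ) (σ : ℤ) (u : ℝ → 𝓢'(R3, F)) : ℝ≥0∞ :=
  ∑' j : ℤ, hybridWeight α s σ j * blockSup χ t j u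

/-- `∂_t u = R` on `(0,T)`, where the right-hand side is given through its dyadic blocks
`rhs τ j = Δ_j R(τ)`: for every `j`, the identity `Δ_j u(t) = Δ_j u(0) + ∫₀ᵗ Δ_j R(τ) dτ` holds
for all `t ∈ [0,T]`, when tested against Schwartz functions. -/
def EvolvesBy (χ : R3 → ℝ) (T : ℝ) (u : ℝ → 𝓢'(R3, F)) (rhs : ℝ → ℤ → 𝓢'(R3, F)) : Prop :=
  ∀ (j : ℤ) (ψ : 𝓢(R3, ℂ)),
    IntervalIntegrable (fun τ => rhs τ j ψ) volume 0 T ∧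
    ∀ t ∈ Icc (0 : ℝ) T,
      lpBlock χ j (u t) ψ = lpBlock χ j (u 0) ψ + ∫ τ in (0 : ℝ)..t, rhs τ j ψ

/-- Weak measurability in time, on `(0,T)`, of the dyadic blocks of a time-dependent tempered
distribution. -/
def WeaklyMeasurable (χ : R3 → ℝ) (T : ℝ) (f : ℝ → 𝓢'(R3, F)) : Prop :=
  ∀ (j : ℤ) (ψ : 𝓢(R3, ℂ)),
    AEStronglyMeasurable (fun τ => lpBlock χ j (f τ) ψ) (volume.restrict (Ioc 0 T))

end LittlewoodPaley

/-- `𝓥(t) = ∫₀ᵗ ‖∇v(τ)‖_{L^∞} dτ`. -/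
def gradIntegral (v : ℝ → R3 → R3) (t : ℝ) : ℝ≥0∞ :=
  ∫⁻ τ in Ioc 0 t, eLpNorm (fderiv ℝ (v τ)) ∞ (volume : Measure R3)

/-- The vector field `v` is locally integrable in time, Lipschitz in space for almost every time,
and `∇v ∈ L¹(0,T; L^∞)`. -/
structure IsVelocity (T : ℝ) (v : ℝ → R3 → R3) : Prop where
  integrable : ∀ x, IntervalIntegrable (fun τ => v τ x) volume 0 T
  lipschitz : ∀ᵐ τ ∂(volume.restrict (Ioc 0 T)), ∃ L : ℝ≥0, LipschitzWith L (v τ)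
  grad_finite : gradIntegral v T < ∞

/-- `(b, d, θ, w)` solves on `[0,T]` the paralinearized system with viscosity `μ`,
conductivity `κ`, velocity field `v` and source terms `(B, D, G, W)`:
`∂_t b + Λ d + T_{v^k} ∂_k b = B`,
`∂_t d + T_{v^k} ∂_k d - Δ d - Λ (b + θ) = D`,
`∂_t θ + Λ d + T_{v^k} ∂_k θ - κ Δ θ = G`,
`∂_t w + T_{v^k} ∂_k w - μ Δ w = W`. -/
structure IsParalinearSolution (χ : R3 → ℝ) (T μ κ : ℝ) (v : ℝ → R3 → R3)
    (B D G : ℝ → 𝓢'(R3, ℂ)) (W : ℝ → 𝓢'(R3, EuclideanSpace ℂ (Fin 3)))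
    (b d θ : ℝ → 𝓢'(R3, ℂ)) (w : ℝ → 𝓢'(R3, EuclideanSpace ℂ (Fin 3))) : Prop where
  eq_b : EvolvesBy χ T b (fun τ j =>
    lpBlock χ j (B τ) - lambdaBlock χ j (d τ) - paraconvBlock χ j (v τ) (b τ))
  eq_d : EvolvesBy χ T d (fun τ j =>
    lpBlock χ j (D τ) + lpBlock χ j (Δ (d τ)) + lambdaBlock χ j (b τ + θ τ)
      - paraconvBlock χ j (v τ) (d τ))
  eq_θ : EvolvesBy χ T θ (fun τ j =>
    lpBlock χ j (G τ) + (κ : ℂ) • lpBlock χ j (Δ (θ τ)) - lambdaBlock χ j (d τ)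
      - paraconvBlock χ j (v τ) (θ τ))
  eq_w : EvolvesBy χ T w (fun τ j =>
    lpBlock χ j (W τ) + (μ : ℂ) • lpBlock χ j (Δ (w τ)) - paraconvBlock χ j (v τ) (w τ))

end

noncomputable section

/-! ### Calculus in time for absolutely continuous functions -/

section TimeRegularity

open Filter Topology

/-! The estimate is proved for each dyadic block and then summed. Fix `j` and put λ = 2^j. After
localization by Δ_j, each unknown is transported by the full field `v`, up to an error: replacing
Δ_j(S_{i-1}v^k ∂_k Δ_i z) by v^k ∂_k Δ_j z costs ‖∇v‖_∞ times the `L²` norms of the blocks with |i -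
j| ≤ 5 (`exists_commutator`, `exists_paraconvBlock_eq`). Transport by a Lipschitz field changes the
`L²` norm only through div v (`IsTransport.exists_hasPrimitive`). Since `v` may be unbounded, this
is shown by spatial truncation.

What remains is algebra on one frequency shell, where A = Λ is comparable to λ. The function e = Λb
- d satisfies an equation without Λ²d but with the damping term -Λb. In α²‖b‖² + ‖Λb - d‖² + (α² -
1)‖d‖² the couplings between b and d cancel (`block_identity`) and leave the dissipation ‖Λb‖² + (α²
- 1)‖Λd‖². The coupling with θ depends on the frequency. For λ ≤ α², adding α²‖θ‖² cancels it up to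
⟨Λb, Λθ⟩, which is absorbed because α²κ ≥ 1 (`BlockSystem.low`). For λ ≥ α², θ is treated as a
source for (b, d) and conversely. The smoothing of d and θ gains λ², so the loop closes for large α
when θ carries the weight α³/λ (`BlockSystem.high`). Square roots of energies obey linear integral
inequalities by `HasPrimitive.sqrt_le`.

The weights α + λ, α and `thetaWeight` agree, up to powers of α, with those of the hybrid norms. In
these weights the supremum bound of a block has an absolute constant. Hence the Grönwall argument
over all blocks (`tsum_gronwall`) has a rate depending only on s and χ, while K collects the powers
of α = 10⁸ / min(1, κ) and the term 9/μ. -/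

theorem AbsolutelyContinuousOnInterval.of_dist_le {X Y : Type*} [PseudoMetricSpace X]
    [PseudoMetricSpace Y] {f : ℝ → X} {P : ℝ → Y} {a b K : ℝ}
    (h : ∀ s ∈ uIcc a b, ∀ t ∈ uIcc a b, dist (f s) (f t) ≤ K * dist (P s) (P t))
    (hP : AbsolutelyContinuousOnInterval P a b) : AbsolutelyContinuousOnInterval f a b := by
  have hP' := Tendsto.const_mul K hP
  rw [mul_zero] at hP'
  refine squeeze_zero' (Eventually.of_forall fun E => Finset.sum_nonneg fun _ _ => dist_nonneg)
    ?_ hP'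
  rw [eventually_inf_principal]
  refine Eventually.of_forall fun E hE => ?_
  rw [Finset.mul_sum]
  exact Finset.sum_le_sum fun i hi => h _ (hE.1 i hi).1 _ (hE.1 i hi).2

/-- `y` is a primitive of the integrable function `p` on `[0,T]`. -/
structure HasPrimitive {E : Type*} [NormedAddCommGroup E] [NormedSpace ℝ E]
    (T : ℝ) (y p : ℝ → E) : Prop where
  integrable : IntervalIntegrable p volume 0 T
  eq : ∀ t ∈ Icc (0 : ℝ) T, y t = y 0 + ∫ τ in (0 : ℝ)..t, p τ

namespace HasPrimitive

variable {E : Type*} [NormedAddCommGroup E] [NormedSpace ℝ E] {T : ℝ} {y p z q : ℝ → E}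

theorem integrable_sub (h : HasPrimitive T y p) {s t : ℝ} (hs : s ∈ Icc 0 T) (ht : t ∈ Icc 0 T) :
    IntervalIntegrable p volume s t :=
  h.integrable.mono_set <| by
    rw [uIcc_of_le (hs.1.trans hs.2)]
    exact uIcc_subset_Icc hs ht

theorem sub_eq (h : HasPrimitive T y p) {s t : ℝ} (hs : s ∈ Icc 0 T) (ht : t ∈ Icc 0 T) :
    y t - y s = ∫ τ in s..t, p τ := by
  have h0 : (0 : ℝ) ∈ Icc 0 T := ⟨le_rfl, hs.1.trans hs.2⟩
  rw [h.eq t ht, h.eq s hs, ← intervalIntegral.integral_interval_sub_left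
    (h.integrable_sub h0 ht) (h.integrable_sub h0 hs)]
  abel

theorem mono (h : HasPrimitive T y p) {t : ℝ} (ht : t ∈ Icc 0 T) : HasPrimitive t y p :=
  ⟨h.integrable_sub ⟨le_rfl, ht.1.trans ht.2⟩ ht, fun s hs => h.eq s ⟨hs.1, hs.2.trans ht.2⟩⟩

theorem add (h : HasPrimitive T y p) (h' : HasPrimitive T z q) :
    HasPrimitive T (fun t => y t + z t) (fun t => p t + q t) :=
  ⟨h.integrable.add h'.integrable, fun t ht => by
    have h0 : (0 : ℝ) ∈ Icc 0 T := ⟨le_rfl, ht.1.trans ht.2⟩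
    rw [intervalIntegral.integral_add (h.integrable_sub h0 ht) (h'.integrable_sub h0 ht),
      h.eq t ht, h'.eq t ht]
    abel⟩

theorem const_mul {y p : ℝ → ℝ} (h : HasPrimitive T y p) (c : ℝ) :
    HasPrimitive T (fun t => c * y t) (fun t => c * p t) :=
  ⟨h.integrable.const_mul c, fun t ht => by
    rw [intervalIntegral.integral_const_mul, h.eq t ht, mul_add]⟩

theorem absolutelyContinuous (h : HasPrimitive T y p) (hT : 0 ≤ T) :
    AbsolutelyContinuousOnInterval y 0 T := by
  refine AbsolutelyContinuousOnInterval.of_dist_le (K := 1)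
    (P := fun t => ∫ τ in (0 : ℝ)..t, ‖p τ‖) (fun s hs t ht => ?_)
    (h.integrable.norm.absolutelyContinuousOnInterval_intervalIntegral left_mem_uIcc)
  rw [uIcc_of_le hT] at hs ht
  have h0 : (0 : ℝ) ∈ Icc 0 T := ⟨le_rfl, hT⟩
  rw [dist_comm (y s), dist_eq_norm, h.sub_eq hs ht, one_mul, dist_comm, Real.dist_eq,
    intervalIntegral.integral_interval_sub_left
      (h.integrable_sub h0 ht).norm (h.integrable_sub h0 hs).norm]
  exact intervalIntegral.norm_integral_le_abs_integral_norm

theorem continuousOn (h : HasPrimitive T y p) : ContinuousOn y (Icc 0 T) := by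
  rcases le_or_gt 0 T with hT | hT
  · rw [← uIcc_of_le hT]
    exact (h.absolutelyContinuous hT).continuousOn
  · simp [Icc_eq_empty (not_le.2 hT)]

theorem ae_hasDerivAt [CompleteSpace E] (h : HasPrimitive T y p) (hT : 0 ≤ T) :
    ∀ᵐ τ, τ ∈ Icc 0 T → HasDerivAt y (p τ) τ := by
  have h₁ : ∀ᵐ x : ℝ, x ≠ 0 := by simp [ae_iff, measure_singleton]
  have h₂ : ∀ᵐ x : ℝ, x ≠ T := by simp [ae_iff, measure_singleton]
  filter_upwards [h.integrable.ae_hasDerivAt_integral, h₁, h₂] with τ hτ h0 hT' hmem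
  have hI : τ ∈ Ioo 0 T := ⟨lt_of_le_of_ne hmem.1 (Ne.symm h0), lt_of_le_of_ne hmem.2 hT'⟩
  have := (hτ (by rwa [uIcc_of_le hT]) 0 left_mem_uIcc).const_add (y 0)
  refine this.congr_of_eventuallyEq ?_
  filter_upwards [Ioo_mem_nhds hI.1 hI.2] with t ht
  exact h.eq t ⟨ht.1.le, ht.2.le⟩

theorem of_absolutelyContinuous {y p : ℝ → ℝ} (hT : 0 ≤ T)
    (h : AbsolutelyContinuousOnInterval y 0 T)
    (hp : ∀ᵐ τ, τ ∈ Icc 0 T → HasDerivAt y (p τ) τ) : HasPrimitive T y p := by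
  refine ⟨?_, fun t ht => ?_⟩
  · refine h.intervalIntegrable_deriv.congr_ae ?_
    rw [uIoc_of_le hT, EventuallyEq, ae_restrict_iff' measurableSet_Ioc]
    filter_upwards [hp] with τ hτ hmem
    exact (hτ (Ioc_subset_Icc_self hmem)).deriv
  · have hsub : uIcc 0 t ⊆ uIcc 0 T := by
      rw [uIcc_of_le ht.1, uIcc_of_le hT]
      exact Icc_subset_Icc_right ht.2
    have := (h.mono hsub).integral_deriv_eq_sub
    rw [← sub_eq_iff_eq_add', ← this]
    refine intervalIntegral.integral_congr_ae ?_
    filter_upwards [hp] with τ hτ hmem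
    rw [uIoc_of_le ht.1] at hmem
    exact (hτ ⟨hmem.1.le, hmem.2.trans ht.2⟩).deriv

/-- If `q² ` is a primitive of `h` and `h ≤ -2rq² + 2fq`, then `q + r ∫ q ≤ q(0) + ∫ f`. -/
theorem sqrt_le {q h f : ℝ → ℝ} {r : ℝ} (hT : 0 ≤ T) (hr : 0 ≤ r) (hq : ∀ t, 0 ≤ q t)
    (hy : HasPrimitive T (fun t => q t ^ 2) h) (hf : IntervalIntegrable f volume 0 T)
    (hf0 : ∀ t, 0 ≤ f t)
    (hle : ∀ᵐ τ, τ ∈ Icc 0 T → h τ ≤ -2 * r * q τ ^ 2 + 2 * f τ * q τ) :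
    q T + r * ∫ τ in (0 : ℝ)..T, q τ ≤ q 0 + ∫ τ in (0 : ℝ)..T, f τ := by
  have hqc : ContinuousOn q (Icc 0 T) := by
    have := hy.continuousOn.sqrt
    simpa [Real.sqrt_sq (hq _)] using this
  have hqi : IntervalIntegrable q volume 0 T :=
    ContinuousOn.intervalIntegrable (by rwa [uIcc_of_le hT])
  -- The square root may fail to be absolutely continuous where `q` vanishes. Therefore `q` is
  -- replaced by √(q² + ε²) ≥ ε, and ε tends to zero at the end.
  have key : ∀ ε > 0, q T + r * ∫ τ in (0 : ℝ)..T, q τ ≤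
      q 0 + (∫ τ in (0 : ℝ)..T, f τ) + ε * (1 + r * T) := by
    intro ε hε
    set n : ℝ → ℝ := fun t => √(q t ^ 2 + ε ^ 2) with hn
    have hnpos : ∀ t, 0 < n t := fun t => Real.sqrt_pos.2 (by positivity)
    have hnsq : ∀ t, n t ^ 2 = q t ^ 2 + ε ^ 2 := fun t => Real.sq_sqrt (by positivity)
    have hnε : ∀ t, ε ≤ n t := fun t => Real.le_sqrt_of_sq_le (by nlinarith [sq_nonneg (q t)])
    have hnq : ∀ t, q t ≤ n t := fun t => Real.le_sqrt_of_sq_le (by nlinarith [sq_nonneg ε])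
    have hac : AbsolutelyContinuousOnInterval n 0 T := by
      refine AbsolutelyContinuousOnInterval.of_dist_le (K := (2 * ε)⁻¹) (fun s _ t _ => ?_)
        (hy.absolutelyContinuous hT)
      rw [Real.dist_eq, Real.dist_eq, inv_mul_eq_div, le_div_iff₀ (by positivity)]
      have : q s ^ 2 - q t ^ 2 = (n s - n t) * (n s + n t) := by
        linear_combination hnsq t - hnsq s
      rw [this, abs_mul]
      gcongr
      exact (by linarith [hnε s, hnε t] : 2 * ε ≤ n s + n t).trans (le_abs_self _)
    have hder : ∀ᵐ τ, τ ∈ Icc 0 T → HasDerivAt n (h τ / (2 * n τ)) τ := by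
      filter_upwards [hy.ae_hasDerivAt hT] with τ hτ hmem
      exact ((hτ hmem).add_const (ε ^ 2)).sqrt (by positivity)
    have hprim := of_absolutelyContinuous hT hac hder
    have h1 := hprim.eq T ⟨hT, le_rfl⟩
    have h2 : ∫ τ in (0 : ℝ)..T, h τ / (2 * n τ) ≤ ∫ τ in (0 : ℝ)..T, (f τ - r * q τ + r * ε) := by
      refine intervalIntegral.integral_mono_ae_restrict hT hprim.integrable
        ((hf.sub (hqi.const_mul r)).add (by simp)) ?_
      rw [EventuallyLE, ae_restrict_iff' measurableSet_Icc]
      filter_upwards [hle] with τ hτ hmem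
      rw [div_le_iff₀ (by linarith [hnpos τ])]
      have h3 := hτ hmem
      have h4 : 0 ≤ f τ * (n τ - q τ) := mul_nonneg (hf0 τ) (by linarith [hnq τ])
      -- With n² = q² + ε², one has q² - (q - ε)n = n(n - q) + ε(n - ε) ≥ 0.
      have h5 : 0 ≤ r * (q τ ^ 2 - (q τ - ε) * n τ) := by
        refine mul_nonneg hr ?_
        nlinarith [hnsq τ, hnq τ, hnε τ, hq τ, hnpos τ]
      nlinarith
    have h3 : ∫ τ in (0 : ℝ)..T, (f τ - r * q τ + r * ε)
        = (∫ τ in (0 : ℝ)..T, f τ) - r * (∫ τ in (0 : ℝ)..T, q τ) + r * ε * T := by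
      rw [intervalIntegral.integral_add (hf.sub (hqi.const_mul r)) (by simp),
        intervalIntegral.integral_sub hf (hqi.const_mul r), intervalIntegral.integral_const_mul]
      simp
      ring
    have h4 : n 0 ≤ q 0 + ε := by
      rw [hn]
      exact Real.sqrt_le_iff.2 ⟨by linarith [hq 0], by nlinarith [hq 0]⟩
    have h5 := hnq T
    have h6 : ε * (1 + r * T) = ε + r * ε * T := by ring
    linarith
  refine le_of_forall_pos_le_add fun δ hδ => ?_
  have hpos : 0 < 1 + r * T := by positivity
  refine (key (δ / (1 + r * T)) (by positivity)).trans_eq ?_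
  rw [div_mul_cancel₀ _ hpos.ne']

/-- Grönwall's inequality with integrable coefficients. -/
theorem gronwall {Y p g S V : ℝ → ℝ} {c : ℝ} (hT : 0 ≤ T) (hc : 0 ≤ c)
    (hY : HasPrimitive T Y p) (hV : HasPrimitive T V g) (hV0 : ∀ t, 0 ≤ V t)
    (hS : IntervalIntegrable S volume 0 T)
    (hle : ∀ᵐ τ, τ ∈ Icc 0 T → p τ ≤ S τ + c * g τ * Y τ) :
    Real.exp (-(c * V T)) * Y T ≤ Real.exp (-(c * V 0)) * Y 0 +
      ∫ τ in (0 : ℝ)..T, Real.exp (-(c * V τ)) * S τ := by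
  -- The map x ↦ exp(-cx) is c-Lipschitz on x ≥ 0, so absolute continuity passes from `V` to the
  -- integrating factor.
  have hE : AbsolutelyContinuousOnInterval (fun t => Real.exp (-(c * V t))) 0 T := by
    refine AbsolutelyContinuousOnInterval.of_dist_le (K := c) (fun s _ t _ => ?_)
      (hV.absolutelyContinuous hT)
    wlog hst : V t ≤ V s generalizing s t
    · rw [dist_comm, dist_comm (V s)]
      exact this t ‹_› s ‹_› (le_of_not_ge hst)
    have h1 : Real.exp (-(c * V s)) ≤ Real.exp (-(c * V t)) :=
      Real.exp_le_exp.2 (neg_le_neg (mul_le_mul_of_nonneg_left hst hc))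
    rw [dist_comm, Real.dist_eq, Real.dist_eq, abs_of_nonneg (by linarith),
      abs_of_nonneg (by linarith)]
    have h2 : Real.exp (-(c * V s)) = Real.exp (-(c * V t)) * Real.exp (-(c * (V s - V t))) := by
      rw [← Real.exp_add]; congr 1; ring
    have h3 := Real.add_one_le_exp (-(c * (V s - V t)))
    have h4 : Real.exp (-(c * V t)) ≤ 1 :=
      Real.exp_le_one_iff.2 (neg_nonpos.2 (mul_nonneg hc (hV0 t)))
    have h5 : 0 ≤ c * (V s - V t) := mul_nonneg hc (by linarith)
    have h6 := Real.exp_pos (-(c * V t))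
    nlinarith
  have hac : AbsolutelyContinuousOnInterval (fun t => Real.exp (-(c * V t)) * Y t) 0 T :=
    hE.mul (hY.absolutelyContinuous hT)
  have hprim := of_absolutelyContinuous (p := fun τ => Real.exp (-(c * V τ)) *
      (p τ - c * g τ * Y τ)) hT hac (by
    filter_upwards [hY.ae_hasDerivAt hT, hV.ae_hasDerivAt hT] with τ h1 h2 hmem
    refine ((((h2 hmem).const_mul c).neg).exp.mul (h1 hmem)).congr_deriv ?_
    simp only [Pi.neg_apply]
    ring)
  have h1 := hprim.eq T ⟨hT, le_rfl⟩
  rw [h1]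
  gcongr
  refine intervalIntegral.integral_mono_ae_restrict hT hprim.integrable
    (hS.continuousOn_mul hE.continuousOn) ?_
  rw [EventuallyLE, ae_restrict_iff' measurableSet_Icc]
  filter_upwards [hle] with τ hτ hmem
  exact mul_le_mul_of_nonneg_left (by linarith [hτ hmem]) (Real.exp_pos _).le

theorem norm_sq {H : Type*} [NormedAddCommGroup H] [InnerProductSpace ℂ H] [CompleteSpace H]
    {y p : ℝ → H} (hT : 0 ≤ T) (h : HasPrimitive T y p) :
    HasPrimitive T (fun t => ‖y t‖ ^ 2) (fun t => 2 * (inner ℂ (y t) (p t)).re) := by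
  let _ : InnerProductSpace ℝ H := InnerProductSpace.rclikeToReal ℂ H
  refine of_absolutelyContinuous hT ?_ ?_
  · obtain ⟨M, hM⟩ := (h.absolutelyContinuous hT).exists_bound
    refine AbsolutelyContinuousOnInterval.of_dist_le (K := 2 * M) (fun s hs t ht => ?_)
      (h.absolutelyContinuous hT)
    have h1 := hM s hs
    have h2 := hM t ht
    have h3 : ‖y s‖ ^ 2 - ‖y t‖ ^ 2 = (‖y s‖ + ‖y t‖) * (‖y s‖ - ‖y t‖) := by ring
    rw [Real.dist_eq, h3, abs_mul, abs_of_nonneg (by positivity), dist_eq_norm]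
    exact mul_le_mul (by linarith) (abs_norm_sub_norm_le _ _) (abs_nonneg _)
      (by linarith [norm_nonneg (y s)])
  · filter_upwards [h.ae_hasDerivAt hT] with τ hτ hmem
    exact (hτ hmem).norm_sq

end HasPrimitive

/-- In a separable Hilbert space, weak measurability implies strong measurability. -/
theorem aestronglyMeasurable_of_inner {α H : Type*} [MeasurableSpace α] {μ : Measure α}
    [NormedAddCommGroup H] [InnerProductSpace ℂ H] [CompleteSpace H] [TopologicalSpace.SeparableSpace H]
    {f : α → H} {D : Set H} (hD : Dense D)
    (h : ∀ e ∈ D, AEStronglyMeasurable (fun a => inner ℂ e (f a)) μ) :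
    AEStronglyMeasurable f μ := by
  have hall : ∀ e : H, AEStronglyMeasurable (fun a => inner ℂ e (f a)) μ := by
    intro e
    obtain ⟨u, hu, hlim⟩ := mem_closure_iff_seq_limit.1 (hD e)
    refine aestronglyMeasurable_of_tendsto_ae atTop (fun n => h (u n) (hu n)) ?_
    exact Eventually.of_forall fun a => hlim.inner tendsto_const_nhds
  obtain ⟨w, b, hb⟩ := exists_hilbertBasis ℂ H
  -- Distinct basis vectors are at distance √2, so balls of radius 1/2 around them are disjoint and
  -- separability leaves countably many. Limits along finite subsets of `w` are then limits along a
  -- countably generated filter.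
  have hw : Countable w := by
    refine (Set.PairwiseDisjoint.countable_of_isOpen (s := fun x : H => Metric.ball x (1 / 2))
      (a := w) ?_ (fun _ _ => Metric.isOpen_ball) fun x _ =>
        ⟨x, Metric.mem_ball_self (by norm_num)⟩).to_subtype
    intro x hx y hy hxy
    refine Metric.ball_disjoint_ball ?_
    have hon : Orthonormal ℂ ((↑) : w → H) := hb ▸ b.orthonormal
    have h1 : ‖x - y‖ ^ 2 = 2 := by
      have h0 : inner ℂ x y = 0 := hon.2 (i := ⟨x, hx⟩) (j := ⟨y, hy⟩) (by simpa using hxy)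
      have h2 : ‖x‖ = 1 := hon.1 ⟨x, hx⟩
      have h3 : ‖y‖ = 1 := hon.1 ⟨y, hy⟩
      rw [@norm_sub_sq ℂ, h0, h2, h3]
      norm_num
    rw [dist_eq_norm]
    nlinarith [norm_nonneg (x - y)]
  refine aestronglyMeasurable_of_tendsto_ae (u := (atTop : Filter (Finset w)))
    (f := fun s a => ∑ i ∈ s, b.repr (f a) i • b i) ?_
    (Eventually.of_forall fun a => b.hasSum_repr (f a))
  intro s
  refine Finset.aestronglyMeasurable_fun_sum s fun i _ => ?_
  simp only [b.repr_apply_apply]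
  exact (hall (b i)).smul_const (b i)

end TimeRegularity

/-! ### Fourier multipliers on `L²` -/

section MultiplierOperators

variable {F : Type*} [NormedAddCommGroup F] [InnerProductSpace ℂ F] [CompleteSpace F]

theorem toTemperedDistribution_injective {f g : Lp F 2 (volume : Measure R3)}
    (h : (f : 𝓢'(R3, F)) = g) : f = g := by
  have := Lp.ker_toTemperedDistributionCLM_eq_bot (F := F) (p := 2) (μ := (volume : Measure R3))
  exact LinearMap.ker_eq_bot.1 this h

theorem coe_add_eq (f g : Lp F 2 (volume : Measure R3)) :
    ((f + g : Lp F 2 (volume : Measure R3)) : 𝓢'(R3, F)) = (f : 𝓢'(R3, F)) + g :=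
  map_add (Lp.toTemperedDistributionCLM F volume 2) f g

theorem coe_sum_eq {ι : Type*} (s : Finset ι) (f : ι → Lp F 2 (volume : Measure R3)) :
    ((∑ i ∈ s, f i : Lp F 2 (volume : Measure R3)) : 𝓢'(R3, F)) = ∑ i ∈ s, (f i : 𝓢'(R3, F)) :=
  map_sum (Lp.toTemperedDistributionCLM F volume 2) f s

/-- The pairing of an `L²` function with a Schwartz function, as a continuous linear map. -/
def pairL (ψ : 𝓢(R3, ℂ)) : Lp F 2 (volume : Measure R3) →L[ℂ] F :=
  ((ContinuousLinearMap.lsmul ℂ ℂ (E := F)).flip.lpPairing volume 2 2).flip (ψ.toLp 2 volume)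

theorem pairL_apply (ψ : 𝓢(R3, ℂ)) (f : Lp F 2 (volume : Measure R3)) :
    pairL ψ f = (f : 𝓢'(R3, F)) ψ := by
  rw [Lp.toTemperedDistribution_apply, pairL, ContinuousLinearMap.flip_apply,
    ContinuousLinearMap.lpPairing_eq_integral]
  refine integral_congr_ae ?_
  filter_upwards [ψ.coeFn_toLp 2 volume] with x hx
  simp [hx]

/-- The Fourier multiplier on `L²` with a Schwartz symbol. -/
def multL2 (m : 𝓢(R3, ℂ)) : Lp F 2 (volume : Measure R3) →L[ℂ] Lp F 2 (volume : Measure R3) :=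
  ((Lp.fourierTransformₗᵢ R3 F).symm.toContinuousLinearEquiv :
      Lp F 2 (volume : Measure R3) →L[ℂ] Lp F 2 (volume : Measure R3)) ∘L
    ((ContinuousLinearMap.lsmul ℂ ℂ (E := F)).holderL volume ∞ 2 2 (m.toLp ∞ volume)) ∘L
    ((Lp.fourierTransformₗᵢ R3 F).toContinuousLinearEquiv :
      Lp F 2 (volume : Measure R3) →L[ℂ] Lp F 2 (volume : Measure R3))

theorem multL2_apply (m : 𝓢(R3, ℂ)) (f : Lp F 2 (volume : Measure R3)) :
    multL2 m f = 𝓕⁻ (m.toLp ∞ volume • 𝓕 f : Lp F 2 (volume : Measure R3)) := rfl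

theorem fourier_multL2 (m : 𝓢(R3, ℂ)) (f : Lp F 2 (volume : Measure R3)) :
    𝓕 (multL2 m f) = (m.toLp ∞ volume • 𝓕 f : Lp F 2 (volume : Measure R3)) := by
  rw [multL2_apply, FourierTransform.fourier_fourierInv_eq]

theorem coe_multL2 (m : 𝓢(R3, ℂ)) (f : Lp F 2 (volume : Measure R3)) :
    (multL2 m f : 𝓢'(R3, F)) =
      TemperedDistribution.fourierMultiplierCLM F (m : R3 → ℂ) (f : 𝓢'(R3, F)) := by
  rw [TemperedDistribution.fourierMultiplierCLM_apply, Lp.fourier_toTemperedDistribution_eq,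
    ← Lp.toTemperedDistribution_smul_eq (p := ∞) (q := 2) (r := 2) m.hasTemperateGrowth (m.memLp ∞ volume),
    Lp.fourierInv_toTemperedDistribution_eq, multL2_apply]
  rfl

/-- By Plancherel the operator norm is at most the supremum of the symbol. -/
theorem norm_multL2_le {m : 𝓢(R3, ℂ)} {C : ℝ} (hm : ∀ ξ, ‖m ξ‖ ≤ C)
    (f : Lp F 2 (volume : Measure R3)) : ‖multL2 m f‖ ≤ C * ‖f‖ := by
  have hC : 0 ≤ C := (norm_nonneg _).trans (hm 0)
  rw [← Lp.norm_fourier_eq, fourier_multL2, ← Lp.norm_fourier_eq f]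
  refine (Lp.norm_smul_le _ _).trans ?_
  gcongr
  rw [SchwartzMap.norm_toLp]
  refine ENNReal.toReal_le_of_le_ofReal hC ?_
  exact eLpNormEssSup_le_of_ae_bound (.of_forall hm)

theorem inner_multL2_left {m : 𝓢(R3, ℂ)} (hm : ∀ ξ, starRingEnd ℂ (m ξ) = m ξ)
    (f g : Lp F 2 (volume : Measure R3)) :
    inner ℂ (multL2 m f) g = inner ℂ f (multL2 m g) := by
  rw [← Lp.inner_fourier_eq, ← Lp.inner_fourier_eq f, fourier_multL2, fourier_multL2,
    L2.inner_def, L2.inner_def]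
  refine integral_congr_ae ?_
  filter_upwards [Lp.coeFn_lpSMul (r := 2) (m.toLp ∞ volume) (𝓕 f),
    Lp.coeFn_lpSMul (r := 2) (m.toLp ∞ volume) (𝓕 g), m.coeFn_toLp ∞ volume] with x h1 h2 h3
  rw [h1, h2, Pi.smul_apply', Pi.smul_apply', h3, inner_smul_left, inner_smul_right, hm]

/-- An `L²` representative of a distribution is unique, so the infimum in `l2Norm` runs over a
single function here. -/
theorem l2Norm_coe (f : Lp F 2 (volume : Measure R3)) : l2Norm (f : 𝓢'(R3, F)) = ‖f‖ₑ := by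
  refine le_antisymm (iInf_le_of_le f (iInf_le_of_le rfl le_rfl)) (le_iInf₂ fun g hg => ?_)
  rw [toTemperedDistribution_injective hg]

theorem exists_eq_coe_of_l2Norm_ne_top {z : 𝓢'(R3, F)} (h : l2Norm z ≠ ∞) :
    ∃ f : Lp F 2 (volume : Measure R3), (f : 𝓢'(R3, F)) = z := by
  by_contra! hcon
  exact h (by simp [l2Norm, hcon])

end MultiplierOperators

/-! ### Symbols of the dyadic blocks, and of Λ and ∂_k on them -/

section Symbols

variable {χ : R3 → ℝ}

theorem norm_two_pi_smul (ξ : R3) : ‖(2 * Real.pi) • ξ‖ = 2 * Real.pi * ‖ξ‖ := by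
  rw [norm_smul, Real.norm_of_nonneg (by positivity)]

theorem norm_zpow_smul (j : ℤ) (ξ : R3) : ‖(2 : ℝ) ^ j • ξ‖ = (2 : ℝ) ^ j * ‖ξ‖ := by
  rw [norm_smul, Real.norm_of_nonneg (by positivity)]

theorem norm_inv_two_smul (ξ : R3) : ‖(2 : ℝ)⁻¹ • ξ‖ = (2 : ℝ)⁻¹ * ‖ξ‖ := by
  rw [norm_smul, Real.norm_of_nonneg (by positivity)]

namespace IsLPCutoff

theorem le_one (hχ : IsLPCutoff χ) (ξ : R3) : χ ξ ≤ 1 := by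
  rw [← hχ.eq_one 0 (by norm_num)]
  exact hχ.antitone 0 ξ (by simp)

theorem dyadicSymbol_nonneg (hχ : IsLPCutoff χ) (j : ℤ) (ξ : R3) : 0 ≤ dyadicSymbol χ j ξ := by
  refine sub_nonneg.2 (hχ.antitone _ _ ?_)
  rw [norm_inv_two_smul]
  linarith [norm_nonneg ((2 : ℝ) ^ (-j) • ξ)]

theorem dyadicSymbol_eq_zero_of_le (hχ : IsLPCutoff χ) {j : ℤ} {ξ : R3}
    (h : ‖ξ‖ ≤ 3 / 4 * (2 : ℝ) ^ j) : dyadicSymbol χ j ξ = 0 := by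
  have h1 : ‖(2 : ℝ) ^ (-j) • ξ‖ ≤ 3 / 4 := by
    rw [norm_zpow_smul, zpow_neg, inv_mul_le_iff₀ (by positivity)]
    linarith
  rw [dyadicSymbol, hχ.eq_one _ h1, hχ.eq_one, sub_self]
  rw [norm_inv_two_smul]
  linarith [norm_nonneg ((2 : ℝ) ^ (-j) • ξ)]

theorem dyadicSymbol_eq_zero_of_ge (hχ : IsLPCutoff χ) {j : ℤ} {ξ : R3}
    (h : 8 / 3 * (2 : ℝ) ^ j ≤ ‖ξ‖) : dyadicSymbol χ j ξ = 0 := by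
  have h1 : 8 / 3 ≤ ‖(2 : ℝ) ^ (-j) • ξ‖ := by
    rw [norm_zpow_smul, zpow_neg, le_inv_mul_iff₀ (by positivity)]
    linarith
  have h2 : 4 / 3 ≤ ‖(2 : ℝ)⁻¹ • ((2 : ℝ) ^ (-j) • ξ)‖ := by
    rw [norm_inv_two_smul]
    linarith
  rw [dyadicSymbol, hχ.eq_zero _ h2, hχ.eq_zero _ (by linarith), sub_self]

/-- The shell of index i ends at 8/3·2^i, and the shell of index j begins at 3/4·2^j ≥ 3·2^i. -/
theorem dyadicSymbol_mul_eq_zero (hχ : IsLPCutoff χ) {i j : ℤ} (h : i + 2 ≤ j) (ξ : R3) :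
    dyadicSymbol χ i ξ * dyadicSymbol χ j ξ = 0 := by
  rcases le_total ‖ξ‖ (3 / 4 * (2 : ℝ) ^ j) with h1 | h1
  · rw [hχ.dyadicSymbol_eq_zero_of_le h1, mul_zero]
  · rw [hχ.dyadicSymbol_eq_zero_of_ge, zero_mul]
    have : (2 : ℝ) ^ (i + 2) ≤ 2 ^ j := zpow_le_zpow_right₀ (by norm_num) h
    rw [zpow_add₀ (by norm_num)] at this
    have h2 : (0 : ℝ) < 2 ^ i := by positivity
    norm_num at this
    linarith

theorem dyadicSymbol_eq_sub (j : ℤ) (ξ : R3) :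
    dyadicSymbol χ j ξ = χ ((2 : ℝ) ^ (-(j + 1)) • ξ) - χ ((2 : ℝ) ^ (-j) • ξ) := by
  rw [dyadicSymbol, smul_smul]
  congr 3
  rw [neg_add, zpow_add₀ (by norm_num)]
  simp [mul_comm]

/-- The fattened symbol is equal to one on the support of the symbol of the `j`-th block. -/
theorem sum_dyadicSymbol (hχ : IsLPCutoff χ) {j : ℤ} {ξ : R3} (h : dyadicSymbol χ j ξ ≠ 0) :
    dyadicSymbol χ (j - 1) ξ + dyadicSymbol χ j ξ + dyadicSymbol χ (j + 1) ξ = 1 := by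
  have h1 : 3 / 4 * (2 : ℝ) ^ j < ‖ξ‖ := by
    by_contra! hcon
    exact h (hχ.dyadicSymbol_eq_zero_of_le hcon)
  have h2 : ‖ξ‖ < 8 / 3 * (2 : ℝ) ^ j := by
    by_contra! hcon
    exact h (hχ.dyadicSymbol_eq_zero_of_ge hcon)
  have hj : (0 : ℝ) < 2 ^ j := by positivity
  -- The three differences telescope to χ(2^{-(j+2)}ξ) - χ(2^{-(j-1)}ξ), which is 1 - 0 on this
  -- shell.
  rw [dyadicSymbol_eq_sub, dyadicSymbol_eq_sub, dyadicSymbol_eq_sub, sub_add_cancel,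
    hχ.eq_one ((2 : ℝ) ^ (-(j + 1 + 1)) • ξ), hχ.eq_zero ((2 : ℝ) ^ (-(j - 1)) • ξ)]
  · ring
  · rw [norm_zpow_smul, zpow_neg, zpow_sub₀ (by norm_num), le_inv_mul_iff₀ (by positivity)]
    norm_num
    linarith
  · rw [norm_zpow_smul, zpow_neg, zpow_add₀ (by norm_num), zpow_add₀ (by norm_num),
      inv_mul_le_iff₀ (by positivity)]
    norm_num
    linarith

theorem dyadicSymbol_add (i j : ℤ) (ξ : R3) :
    dyadicSymbol χ (j + i) ξ = dyadicSymbol χ i ((2 : ℝ) ^ (-j) • ξ) := by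
  rw [dyadicSymbol, dyadicSymbol, smul_smul ((2 : ℝ) ^ (-i)), ← zpow_add₀ (by norm_num),
    neg_add, add_comm (-j)]

theorem contDiff_dyadicSymbol (hχ : IsLPCutoff χ) (j : ℤ) :
    ContDiff ℝ (⊤ : ℕ∞) (dyadicSymbol χ j) := by
  have := hχ.smooth
  unfold dyadicSymbol
  fun_prop

end IsLPCutoff

/-- A function on the frequency space which is smooth away from the origin, and which vanishes near
the origin and near infinity, is a Schwartz function. -/
theorem hasCompactSupport_of_norm {f : R3 → ℂ} {r : ℝ} (h : ∀ ξ, r ≤ ‖ξ‖ → f ξ = 0) :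
    HasCompactSupport f := by
  refine HasCompactSupport.intro (isCompact_closedBall (0 : R3) r) fun ξ hξ => h ξ ?_
  rw [Metric.mem_closedBall, dist_zero_right, not_le] at hξ
  exact hξ.le

/-- The symbol of `Δ_j` in Mathlib's normalisation. -/
def phiS (hχ : IsLPCutoff χ) (j : ℤ) : 𝓢(R3, ℂ) :=
  HasCompactSupport.toSchwartzMap
    (f := fun ξ : R3 => ((dyadicSymbol χ j ((2 * Real.pi) • ξ) : ℝ) : ℂ))
    (hasCompactSupport_of_norm (r := 8 / 3 * 2 ^ j / (2 * Real.pi)) fun ξ hξ => by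
      rw [hχ.dyadicSymbol_eq_zero_of_ge, Complex.ofReal_zero]
      rwa [norm_two_pi_smul, ← div_le_iff₀' (by positivity)])
    (by
      have := hχ.contDiff_dyadicSymbol j
      exact Complex.ofRealCLM.contDiff.comp (this.comp (contDiff_const_smul _)))

theorem phiS_apply (hχ : IsLPCutoff χ) (j : ℤ) (ξ : R3) :
    phiS hχ j ξ = ((dyadicSymbol χ j ((2 * Real.pi) • ξ) : ℝ) : ℂ) := rfl

theorem lpBlock_eq {F : Type*} [NormedAddCommGroup F] [NormedSpace ℂ F] (hχ : IsLPCutoff χ)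
    (j : ℤ) : (lpBlock χ j : 𝓢'(R3, F) →L[ℂ] 𝓢'(R3, F)) =
      TemperedDistribution.fourierMultiplierCLM F (phiS hχ j : R3 → ℂ) := rfl

/-- The symbol of the fattened block `Δ_{j-1} + Δ_j + Δ_{j+1}`. -/
def fatS (hχ : IsLPCutoff χ) (j : ℤ) : 𝓢(R3, ℂ) :=
  phiS hχ (j - 1) + phiS hχ j + phiS hχ (j + 1)

theorem fatS_mul_phiS (hχ : IsLPCutoff χ) (j : ℤ) (ξ : R3) :
    fatS hχ j ξ * phiS hχ j ξ = phiS hχ j ξ := by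
  by_cases h : dyadicSymbol χ j ((2 * Real.pi) • ξ) = 0
  · simp [phiS_apply, h]
  · have := hχ.sum_dyadicSymbol h
    simp only [fatS, add_apply, phiS_apply]
    rw [← Complex.ofReal_add, ← Complex.ofReal_add, this]
    simp

theorem fatS_eq (hχ : IsLPCutoff χ) (j : ℤ) (ξ : R3) :
    fatS hχ j ξ = ((dyadicSymbol χ (j - 1) ((2 * Real.pi) • ξ) + dyadicSymbol χ j
      ((2 * Real.pi) • ξ) + dyadicSymbol χ (j + 1) ((2 * Real.pi) • ξ) : ℝ) : ℂ) := by
  simp [fatS, phiS_apply]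

theorem norm_fatS_le (hχ : IsLPCutoff χ) (j : ℤ) (ξ : R3) : ‖fatS hχ j ξ‖ ≤ 1 := by
  rw [fatS_eq, Complex.norm_real, Real.norm_of_nonneg (add_nonneg (add_nonneg
    (hχ.dyadicSymbol_nonneg _ _) (hχ.dyadicSymbol_nonneg _ _)) (hχ.dyadicSymbol_nonneg _ _)),
    IsLPCutoff.dyadicSymbol_eq_sub, IsLPCutoff.dyadicSymbol_eq_sub,
    IsLPCutoff.dyadicSymbol_eq_sub, sub_add_cancel]
  have h1 := hχ.le_one ((2 : ℝ) ^ (-(j + 1 + 1)) • (2 * Real.pi) • ξ)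
  have h2 := hχ.nonneg ((2 : ℝ) ^ (-(j - 1)) • (2 * Real.pi) • ξ)
  linarith

theorem fatS_eq_zero_of_le (hχ : IsLPCutoff χ) {j : ℤ} {ξ : R3}
    (h : ‖(2 * Real.pi) • ξ‖ ≤ 3 / 8 * 2 ^ j) : fatS hχ j ξ = 0 := by
  have h0 : (0 : ℝ) < 2 ^ j := by positivity
  rw [fatS_eq, hχ.dyadicSymbol_eq_zero_of_le, hχ.dyadicSymbol_eq_zero_of_le,
    hχ.dyadicSymbol_eq_zero_of_le]
  · simp
  · rw [zpow_add₀ (by norm_num)]; norm_num; linarith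
  · linarith
  · rw [zpow_sub₀ (by norm_num)]; norm_num; linarith

theorem fatS_eq_zero_of_ge (hχ : IsLPCutoff χ) {j : ℤ} {ξ : R3}
    (h : 16 / 3 * 2 ^ j ≤ ‖(2 * Real.pi) • ξ‖) : fatS hχ j ξ = 0 := by
  have h0 : (0 : ℝ) < 2 ^ j := by positivity
  rw [fatS_eq, hχ.dyadicSymbol_eq_zero_of_ge, hχ.dyadicSymbol_eq_zero_of_ge,
    hχ.dyadicSymbol_eq_zero_of_ge]
  · simp
  · rw [zpow_add₀ (by norm_num)]; norm_num; linarith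
  · linarith
  · rw [zpow_sub₀ (by norm_num)]; norm_num; linarith

/-- The radial symbol `g(2π|ξ|)` times the fattened block symbol. -/
def radS (hχ : IsLPCutoff χ) {g : ℝ → ℝ} (hg : ContDiffOn ℝ (⊤ : ℕ∞) g (Ioi 0)) (j : ℤ) :
    𝓢(R3, ℂ) :=
  HasCompactSupport.toSchwartzMap
    (f := fun ξ : R3 => ((g ‖(2 * Real.pi) • ξ‖ : ℝ) : ℂ) * fatS hχ j ξ)
    (hasCompactSupport_of_norm (r := 16 / 3 * 2 ^ j / (2 * Real.pi)) fun ξ hξ => by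
      rw [fatS_eq_zero_of_ge, mul_zero]
      rwa [norm_two_pi_smul, ← div_le_iff₀' (by positivity)])
    (by
      rw [contDiff_iff_contDiffAt]
      intro ξ
      rcases eq_or_ne ξ 0 with rfl | hξ
      -- Near the origin `fatS` vanishes, so the singularities of `g` and of the norm there are
      -- harmless.
      · refine (contDiffAt_const (c := (0 : ℂ))).congr_of_eventuallyEq ?_
        have : ∀ᶠ η in nhds (0 : R3), ‖(2 * Real.pi) • η‖ < 3 / 8 * 2 ^ j := by
          refine ContinuousAt.eventually_lt (by fun_prop) continuousAt_const ?_
          simp only [smul_zero, norm_zero]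
          positivity
        filter_upwards [this] with η hη
        rw [fatS_eq_zero_of_le hχ hη.le, mul_zero]
      · refine ContDiffAt.mul ?_ ((fatS hχ j).contDiffAt _)
        have h1 : ContDiffAt ℝ (⊤ : ℕ∞) (fun η : R3 => ‖(2 * Real.pi) • η‖) ξ := by
          refine (contDiffAt_norm ℝ ?_).comp ξ (contDiff_const_smul _).contDiffAt
          exact smul_ne_zero (by positivity) hξ
        have h2 : ContDiffAt ℝ (⊤ : ℕ∞) g ‖(2 * Real.pi) • ξ‖ :=
          hg.contDiffAt (Ioi_mem_nhds (by
            rw [norm_pos_iff]; exact smul_ne_zero (by positivity) hξ))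
        exact Complex.ofRealCLM.contDiff.contDiffAt.comp ξ (h2.comp ξ h1))

section

variable {g : ℝ → ℝ} (hg : ContDiffOn ℝ (⊤ : ℕ∞) g (Ioi 0))

theorem radS_apply (hχ : IsLPCutoff χ) (j : ℤ) (ξ : R3) :
    radS hχ hg j ξ = ((g ‖(2 * Real.pi) • ξ‖ : ℝ) : ℂ) * fatS hχ j ξ := rfl

theorem conj_radS (hχ : IsLPCutoff χ) (j : ℤ) (ξ : R3) :
    starRingEnd ℂ (radS hχ hg j ξ) = radS hχ hg j ξ := by
  rw [radS_apply, fatS_eq, ← Complex.ofReal_mul, Complex.conj_ofReal]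

/-- The fattened symbol is at most one and lives on 3/8·2^j ≤ |2πξ| ≤ 16/3·2^j, so only the values
of `g` on this interval count. -/
theorem norm_radS_le (hχ : IsLPCutoff χ) (j : ℤ) {C : ℝ} (hC : 0 ≤ C)
    (h : ∀ r ∈ Icc (3 / 8 * (2 : ℝ) ^ j) (16 / 3 * 2 ^ j), |g r| ≤ C) (ξ : R3) :
    ‖radS hχ hg j ξ‖ ≤ C := by
  rw [radS_apply]
  rcases le_total ‖(2 * Real.pi) • ξ‖ (3 / 8 * 2 ^ j) with h1 | h1
  · simpa [fatS_eq_zero_of_le hχ h1]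
  rcases le_total (16 / 3 * 2 ^ j) ‖(2 * Real.pi) • ξ‖ with h2 | h2
  · simpa [fatS_eq_zero_of_ge hχ h2]
  rw [norm_mul, Complex.norm_real, Real.norm_eq_abs]
  exact (mul_le_mul (h _ ⟨h1, h2⟩) (norm_fatS_le hχ j ξ) (norm_nonneg _) hC).trans_eq (mul_one C)

end

theorem contDiffOn_self : ContDiffOn ℝ (⊤ : ℕ∞) (fun x : ℝ => x) (Ioi 0) :=
  contDiffOn_id

theorem contDiffOn_inv_Ioi : ContDiffOn ℝ (⊤ : ℕ∞) (fun x : ℝ => x⁻¹) (Ioi 0) :=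
  contDiffOn_id.inv fun _ hx => ne_of_gt hx

/-- The symbol of `Λ` on the fattened block. -/
def lamS (hχ : IsLPCutoff χ) (j : ℤ) : 𝓢(R3, ℂ) := radS hχ contDiffOn_self j

/-- The symbol of `Λ⁻¹` on the fattened block. -/
def invLamS (hχ : IsLPCutoff χ) (j : ℤ) : 𝓢(R3, ℂ) := radS hχ contDiffOn_inv_Ioi j

theorem norm_lamS_le (hχ : IsLPCutoff χ) (j : ℤ) (ξ : R3) : ‖lamS hχ j ξ‖ ≤ 6 * 2 ^ j := by
  have h0 : (0 : ℝ) < 2 ^ j := by positivity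
  refine norm_radS_le _ hχ j (by positivity) (fun r hr => ?_) ξ
  rw [abs_of_nonneg (by linarith [hr.1])]
  linarith [hr.2]

theorem norm_invLamS_le (hχ : IsLPCutoff χ) (j : ℤ) (ξ : R3) :
    ‖invLamS hχ j ξ‖ ≤ 3 * (2 ^ j)⁻¹ := by
  have h0 : (0 : ℝ) < 2 ^ j := by positivity
  refine norm_radS_le _ hχ j (by positivity) (fun r hr => ?_) ξ
  have h1 : 0 < r := by linarith [hr.1]
  rw [abs_of_nonneg (by positivity), ← div_eq_mul_inv, inv_le_iff_one_le_mul₀ h1, div_mul_eq_mul_div, one_le_div h0]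
  linarith [hr.1]

/-- The symbol of `∂_k` on the fattened block. -/
def derS (hχ : IsLPCutoff χ) (j : ℤ) (k : Fin 3) : 𝓢(R3, ℂ) :=
  SchwartzMap.smulLeftCLM ℂ (fun ξ : R3 => (2 * Real.pi * Complex.I) *
    ((inner ℝ ξ (EuclideanSpace.single k 1 : R3) : ℝ) : ℂ)) (fatS hχ j)

theorem derS_apply (hχ : IsLPCutoff χ) (j : ℤ) (k : Fin 3) (ξ : R3) :
    derS hχ j k ξ = (2 * Real.pi * Complex.I) *
      ((inner ℝ ξ (EuclideanSpace.single k 1 : R3) : ℝ) : ℂ) * fatS hχ j ξ := by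
  rw [derS, SchwartzMap.smulLeftCLM_apply_apply (by fun_prop), smul_eq_mul]

theorem norm_derS_le (hχ : IsLPCutoff χ) (j : ℤ) (k : Fin 3) (ξ : R3) :
    ‖derS hχ j k ξ‖ ≤ 6 * 2 ^ j := by
  have h0 : (0 : ℝ) < 2 ^ j := by positivity
  rw [derS_apply]
  rcases le_total (16 / 3 * 2 ^ j) ‖(2 * Real.pi) • ξ‖ with h2 | h2
  · simp only [fatS_eq_zero_of_ge hχ h2, mul_zero, norm_zero]
    positivity
  rw [norm_two_pi_smul] at h2
  have h3 : |inner ℝ ξ (EuclideanSpace.single k 1 : R3)| ≤ ‖ξ‖ := by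
    refine (abs_real_inner_le_norm _ _).trans_eq ?_
    simp
  rw [norm_mul, norm_mul, norm_mul, norm_mul, Complex.norm_real, Complex.norm_real,
    Complex.norm_I, Real.norm_eq_abs, Real.norm_eq_abs, abs_of_pos Real.pi_pos]
  norm_num
  calc 2 * Real.pi * |inner ℝ ξ (EuclideanSpace.single k 1 : R3)| * ‖fatS hχ j ξ‖
      ≤ 2 * Real.pi * ‖ξ‖ * 1 := by
        gcongr
        exact norm_fatS_le hχ j ξ
    _ ≤ 6 * 2 ^ j := by linarith

end Symbols

/-! ### The Lipschitz constant of the velocity field -/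

section Velocity

/-- By Rademacher's theorem the derivative exists and is bounded by the essential supremum off a
null set. By Fubini almost every line in direction x - y meets that set in a null set of parameters,
and the fundamental theorem of calculus applies on such lines. Density and continuity give the
remaining lines. -/
theorem LipschitzWith.norm_sub_le_of_eLpNorm_fderiv {f : R3 → R3} {L : ℝ≥0} (hf : LipschitzWith L f)
    (x y : R3) :
    ‖f x - f y‖ ≤ (eLpNorm (fderiv ℝ f) ∞ (volume : Measure R3)).toReal * ‖x - y‖ := by
  set M := (eLpNorm (fderiv ℝ f) ∞ (volume : Measure R3)).toReal with hM
  have hfin : eLpNorm (fderiv ℝ f) ∞ (volume : Measure R3) ≠ ∞ := by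
    refine ne_top_of_le_ne_top (ENNReal.ofReal_ne_top (r := L)) ?_
    exact eLpNormEssSup_le_of_ae_bound (.of_forall fun x => norm_fderiv_le_of_lipschitz ℝ hf)
  have hM0 : 0 ≤ M := ENNReal.toReal_nonneg
  have hgood : ∀ᵐ z : R3, DifferentiableAt ℝ f z ∧ ‖fderiv ℝ f z‖ ≤ M := by
    filter_upwards [hf.ae_differentiableAt, ae_le_eLpNormEssSup (f := fderiv ℝ f)] with z h1 h2
    refine ⟨h1, ?_⟩
    rw [hM, ← toReal_enorm]
    exact ENNReal.toReal_mono hfin h2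
  obtain ⟨N, hN, hNm, hN0⟩ := exists_measurable_superset_of_null (ae_iff.1 hgood)
  have hN' : ∀ z ∉ N, DifferentiableAt ℝ f z ∧ ‖fderiv ℝ f z‖ ≤ M := fun z hz => by
    by_contra h
    exact hz (hN h)
  set h := x - y with hh
  have h1 : ∀ t : ℝ, ∀ᵐ z : R3, z + t • h ∉ N := fun t =>
    (measurePreserving_add_right volume (t • h)).quasiMeasurePreserving.ae
      (measure_eq_zero_iff_ae_notMem.1 hN0)
  have h2 : ∀ᵐ z : R3, ∀ᵐ t : ℝ, z + t • h ∉ N := by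
    have hms : MeasurableSet {p : ℝ × R3 | p.2 + p.1 • h ∉ N} :=
      (show Measurable fun p : ℝ × R3 => p.2 + p.1 • h by fun_prop) hNm.compl
    exact (Measure.ae_ae_comm hms).1 (.of_forall h1)
  have h3 : ∀ᵐ z : R3, ‖f (z + h) - f z‖ ≤ M * ‖h‖ := by
    filter_upwards [h2] with z hz
    set w := f (z + h) - f z with hw
    -- Testing against the increment `w` itself reduces to a scalar function whose increment over
    -- [0,1] is ‖w‖².
    set φ : ℝ → ℝ := fun t => inner ℝ w (f (z + t • h)) with hφ
    have hφL : LipschitzWith (‖w‖₊ * (L * ‖h‖₊)) φ := by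
      refine LipschitzWith.of_dist_le_mul fun s t => ?_
      rw [hφ, Real.dist_eq, ← inner_sub_right]
      refine (abs_real_inner_le_norm _ _).trans ?_
      push_cast
      rw [mul_assoc]
      gcongr
      refine (hf.norm_sub_le _ _).trans ?_
      rw [add_sub_add_left_eq_sub, ← sub_smul, norm_smul, dist_eq_norm, mul_comm ‖s - t‖]
      exact (mul_assoc _ _ _).ge
    have hac : AbsolutelyContinuousOnInterval φ 0 1 :=
      (hφL.lipschitzOnWith).absolutelyContinuousOnInterval
    have hint := hac.integral_deriv_eq_sub
    have hd : ∀ᵐ t : ℝ, t ∈ uIoc (0 : ℝ) 1 → ‖deriv φ t‖ ≤ ‖w‖ * (M * ‖h‖) := by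
      filter_upwards [hz] with t ht _
      obtain ⟨hd1, hd2⟩ := hN' _ ht
      have hline : HasDerivAt (fun s : ℝ => z + s • h) h t := by
        simpa using ((hasDerivAt_id t).smul_const h).const_add z
      have := (hd1.hasFDerivAt.comp_hasDerivAt t hline)
      have h4 : HasDerivAt φ (inner ℝ w (fderiv ℝ f (z + t • h) h)) t := by
        simpa [hφ] using (hasDerivAt_const t w).inner ℝ this
      rw [h4.deriv]
      refine (abs_real_inner_le_norm _ _).trans ?_
      gcongr
      exact (ContinuousLinearMap.le_opNorm _ _).trans (by gcongr)
    have := intervalIntegral.norm_integral_le_of_norm_le_const_ae hd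
    rw [hint] at this
    have h5 : φ 1 - φ 0 = ‖w‖ ^ 2 := by
      simp only [hφ, one_smul, zero_smul, add_zero]
      rw [← inner_sub_right, ← hw, real_inner_self_eq_norm_sq]
    rw [h5, Real.norm_of_nonneg (by positivity)] at this
    rcases eq_or_ne w 0 with h0 | h0
    · rw [h0, norm_zero]; positivity
    · have h6 : 0 < ‖w‖ := norm_pos_iff.2 h0
      simp only [sub_zero, abs_one, mul_one] at this
      nlinarith
  have hcl : IsClosed {z : R3 | ‖f (z + h) - f z‖ ≤ M * ‖h‖} :=
    isClosed_le (by have := hf.continuous; fun_prop) continuous_const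
  have h4 := (Measure.dense_of_ae h3).closure_eq
  rw [hcl.closure_eq] at h4
  have h5 : y ∈ {z : R3 | ‖f (z + h) - f z‖ ≤ M * ‖h‖} := h4 ▸ mem_univ y
  simpa [hh] using h5

/-- The Lipschitz constant `‖∇v(τ)‖_{L^∞}` of the velocity field. -/
def lipConst (v : ℝ → R3 → R3) (τ : ℝ) : ℝ :=
  (eLpNorm (fderiv ℝ (v τ)) ∞ (volume : Measure R3)).toReal

theorem lipConst_nonneg (v : ℝ → R3 → R3) (τ : ℝ) : 0 ≤ lipConst v τ := ENNReal.toReal_nonneg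

variable {T : ℝ} {v : ℝ → R3 → R3}

/-- This is for measurability in time: with `D` countable, ‖∇v(τ)‖_∞ becomes a countable supremum of
functions that are measurable in τ. -/
theorem eLpNorm_fderiv_eq_iSup {f : R3 → R3} {L : ℝ≥0} (hf : LipschitzWith L f) {D : Set R3}
    (hD : Dense D) :
    eLpNorm (fderiv ℝ f) ∞ (volume : Measure R3) =
      ⨆ x ∈ D, ⨆ y ∈ D, ‖f x - f y‖ₑ / ‖x - y‖ₑ := by
  have hfin : eLpNorm (fderiv ℝ f) ∞ (volume : Measure R3) ≠ ∞ := by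
    refine ne_top_of_le_ne_top (ENNReal.ofReal_ne_top (r := L)) ?_
    exact eLpNormEssSup_le_of_ae_bound (.of_forall fun x => norm_fderiv_le_of_lipschitz ℝ hf)
  apply le_antisymm
  · obtain ⟨S, hS⟩ : ∃ S, S = ⨆ x ∈ D, ⨆ y ∈ D, ‖f x - f y‖ₑ / ‖x - y‖ₑ := ⟨_, rfl⟩
    rw [← hS]
    rcases eq_or_ne S ∞ with hS' | hS'
    · rw [hS']; exact le_top
    have h1 : ∀ x ∈ D, ∀ y ∈ D, ‖f x - f y‖ ≤ S.toReal * ‖x - y‖ := by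
      intro x hx y hy
      rcases eq_or_ne x y with rfl | hxy
      · simp
      have h2 : ‖f x - f y‖ₑ / ‖x - y‖ₑ ≤ S := hS ▸
        le_iSup₂_of_le (f := fun x _ => ⨆ y ∈ D, ‖f x - f y‖ₑ / ‖x - y‖ₑ) x hx
          (le_iSup₂_of_le (f := fun y _ => ‖f x - f y‖ₑ / ‖x - y‖ₑ) y hy le_rfl)
      rw [ENNReal.div_le_iff (by simpa [sub_eq_zero] using hxy) (by simp)] at h2
      have := ENNReal.toReal_mono (ENNReal.mul_ne_top hS' (by simp)) h2
      simpa using this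
    have h2 : LipschitzWith S.toNNReal f := by
      refine LipschitzWith.of_dist_le_mul fun x y => ?_
      have hcl : IsClosed {p : R3 × R3 | dist (f p.1) (f p.2) ≤ S.toReal * dist p.1 p.2} :=
        isClosed_le (by have := hf.continuous; fun_prop) (by fun_prop)
      have hd : Dense (D ×ˢ D) := hD.prod hD
      have hsub : D ×ˢ D ⊆ {p : R3 × R3 | dist (f p.1) (f p.2) ≤ S.toReal * dist p.1 p.2} := by
        rintro ⟨x, y⟩ ⟨hx, hy⟩
        rw [mem_ofPred_eq, dist_eq_norm, dist_eq_norm]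
        exact h1 x hx y hy
      have h7 : (x, y) ∈ {p : R3 × R3 | dist (f p.1) (f p.2) ≤ S.toReal * dist p.1 p.2} :=
        hcl.closure_subset_iff.2 hsub (hd (x, y))
      rw [mem_ofPred_eq] at h7
      exact h7
    have h3 : eLpNorm (fderiv ℝ f) ∞ (volume : Measure R3) ≤ ENNReal.ofReal S.toNNReal :=
      eLpNormEssSup_le_of_ae_bound (.of_forall fun x => norm_fderiv_le_of_lipschitz ℝ h2)
    rwa [ENNReal.ofReal_coe_nnreal, ENNReal.coe_toNNReal hS'] at h3
  · refine iSup₂_le fun x _ => iSup₂_le fun y _ => ?_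
    rcases eq_or_ne x y with rfl | hxy
    · simp
    rw [ENNReal.div_le_iff (by simpa [sub_eq_zero] using hxy) (by simp)]
    have := hf.norm_sub_le_of_eLpNorm_fderiv x y
    rw [← ofReal_norm, ← ofReal_norm, ← ENNReal.ofReal_toReal hfin,
      ← ENNReal.ofReal_mul ENNReal.toReal_nonneg]
    exact ENNReal.ofReal_le_ofReal this

namespace IsVelocity

theorem aemeasurable_eLpNorm (hv : IsVelocity T v) :
    AEMeasurable (fun τ => eLpNorm (fderiv ℝ (v τ)) ∞ (volume : Measure R3))
      (volume.restrict (Ioc 0 T)) := by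
  obtain ⟨D, hDc, hD⟩ := TopologicalSpace.exists_countable_dense R3
  have hx (x : R3) : AEStronglyMeasurable (fun τ => v τ x) (volume.restrict (Ioc 0 T)) := by
    exact (hv.integrable x).1.aestronglyMeasurable
  have h1 : AEMeasurable (fun τ => ⨆ x ∈ D, ⨆ y ∈ D, ‖v τ x - v τ y‖ₑ / ‖x - y‖ₑ)
      (volume.restrict (Ioc 0 T)) := by
    refine AEMeasurable.biSup D hDc fun x _ => AEMeasurable.biSup D hDc fun y _ => ?_
    exact ((hx x).sub (hx y)).enorm.div_const _
  refine h1.congr ?_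
  filter_upwards [hv.lipschitz] with τ ⟨L, hL⟩
  exact (eLpNorm_fderiv_eq_iSup hL hD).symm

theorem ae_norm_sub_le (hv : IsVelocity T v) :
    ∀ᵐ τ ∂(volume.restrict (Ioc 0 T)), ∀ x y, ‖v τ x - v τ y‖ ≤ lipConst v τ * ‖x - y‖ := by
  filter_upwards [hv.lipschitz] with τ ⟨L, hL⟩ x y
  exact hL.norm_sub_le_of_eLpNorm_fderiv x y

theorem integrable_lipConst (hv : IsVelocity T v) :
    IntegrableOn (lipConst v) (Ioc 0 T) :=
  integrable_toReal_of_lintegral_ne_top hv.aemeasurable_eLpNorm hv.grad_finite.ne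

theorem gradIntegral_toReal (hv : IsVelocity T v) {t : ℝ} (ht : t ∈ Icc 0 T) :
    (gradIntegral v t).toReal = ∫ τ in (0 : ℝ)..t, lipConst v τ := by
  have hsub : Ioc 0 t ⊆ Ioc 0 T := Ioc_subset_Ioc_right ht.2
  rw [intervalIntegral.integral_of_le ht.1, gradIntegral]
  refine (integral_toReal (hv.aemeasurable_eLpNorm.mono_set hsub) ?_).symm
  exact ae_restrict_of_ae_restrict_of_subset hsub
    (ae_lt_top' hv.aemeasurable_eLpNorm hv.grad_finite.ne)

end IsVelocity

end Velocity

/-! ### Convolution kernels and the mollification of Lipschitz functions -/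

section Kernels

/-- The `L¹` norm of the kernel of the Fourier multiplier with symbol `m`. -/
def kerNorm (m : 𝓢(R3, ℂ)) : ℝ := ∫ x, ‖(𝓕⁻ m) x‖

/-- The first moment of the kernel of the Fourier multiplier with symbol `m`. -/
def kerMoment (m : 𝓢(R3, ℂ)) : ℝ := ∫ x, ‖x‖ * ‖(𝓕⁻ m) x‖

theorem kerNorm_nonneg (m : 𝓢(R3, ℂ)) : 0 ≤ kerNorm m := integral_nonneg fun _ => norm_nonneg _

theorem kerMoment_nonneg (m : 𝓢(R3, ℂ)) : 0 ≤ kerMoment m :=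
  integral_nonneg fun _ => mul_nonneg (norm_nonneg _) (norm_nonneg _)

theorem fourierInv_scale {m M : 𝓢(R3, ℂ)} {c : ℂ} {r : ℝ} (hr : 0 < r)
    (h : ∀ ξ, m ξ = c * M (r⁻¹ • ξ)) (x : R3) :
    (𝓕⁻ m) x = c * (r ^ 3 : ℝ) * (𝓕⁻ M) (r • x) := by
  rw [SchwartzMap.fourierInv_coe, SchwartzMap.fourierInv_coe, Real.fourierInv_eq,
    Real.fourierInv_eq]
  have h1 : ∀ ξ : R3, Real.fourierChar (inner ℝ ξ x) • m ξ =
      c * (fun η : R3 => Real.fourierChar (inner ℝ η (r • x)) • M η) (r⁻¹ • ξ) := by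
    intro ξ
    have h2 : inner ℝ (r⁻¹ • ξ) (r • x) = inner ℝ ξ x := by
      rw [real_inner_smul_left, real_inner_smul_right, ← mul_assoc, inv_mul_cancel₀ hr.ne', one_mul]
    simp only [h, h2, mul_smul_comm]
  simp_rw [h1]
  rw [integral_const_mul, Measure.integral_comp_inv_smul volume
    (fun η : R3 => Real.fourierChar (inner ℝ η (r • x)) • M η)]
  simp [abs_of_pos hr, mul_assoc]

/-- Dilation preserves the `L¹` norm of a kernel, so symbols obtained by rescaling a fixed one share
their constants. -/
theorem kerNorm_scale {m M : 𝓢(R3, ℂ)} {c : ℂ} {r : ℝ} (hr : 0 < r)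
    (h : ∀ ξ, m ξ = c * M (r⁻¹ • ξ)) : kerNorm m = ‖c‖ * kerNorm M := by
  have h1 : ∀ x : R3, ‖(𝓕⁻ m) x‖ = ‖c‖ * r ^ 3 * (fun y => ‖(𝓕⁻ M) y‖) (r • x) := by
    intro x
    rw [fourierInv_scale hr h, norm_mul, norm_mul, Complex.norm_real,
      Real.norm_of_nonneg (by positivity)]
  rw [kerNorm, kerNorm]
  simp_rw [h1]
  rw [integral_const_mul, Measure.integral_comp_smul volume
    (fun y : R3 => ‖(𝓕⁻ M : 𝓢(R3, ℂ)) y‖)]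
  have : (0 : ℝ) < r ^ 3 := by positivity
  simp only [finrank_euclideanSpace, Fintype.card_fin, abs_inv, abs_of_pos this, smul_eq_mul]
  field_simp

/-- Dilating frequencies by r contracts the kernel by r. The gain r⁻¹ in the first moment is what
pays for the derivative in the commutator. -/
theorem kerMoment_scale {m M : 𝓢(R3, ℂ)} {c : ℂ} {r : ℝ} (hr : 0 < r)
    (h : ∀ ξ, m ξ = c * M (r⁻¹ • ξ)) : kerMoment m = ‖c‖ * r⁻¹ * kerMoment M := by
  have h1 : ∀ x : R3, ‖x‖ * ‖(𝓕⁻ m) x‖ =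
      ‖c‖ * r ^ 2 * (fun y => ‖y‖ * ‖(𝓕⁻ M) y‖) (r • x) := by
    intro x
    rw [fourierInv_scale hr h, norm_mul, norm_mul, Complex.norm_real,
      Real.norm_of_nonneg (by positivity)]
    simp only [norm_smul, Real.norm_of_nonneg hr.le]
    ring
  rw [kerMoment, kerMoment]
  simp_rw [h1]
  rw [integral_const_mul, Measure.integral_comp_smul volume
    (fun y : R3 => ‖y‖ * ‖(𝓕⁻ M : 𝓢(R3, ℂ)) y‖)]
  have : (0 : ℝ) < r ^ 3 := by positivity
  simp only [finrank_euclideanSpace, Fintype.card_fin, abs_inv, abs_of_pos this, smul_eq_mul]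
  field_simp

theorem SchwartzMap.exists_decay {G : Type*} [NormedAddCommGroup G] [NormedSpace ℝ G]
    (H : 𝓢(R3, G)) (k : ℕ) : ∃ C, 0 ≤ C ∧ ∀ x, ‖H x‖ ≤ C * ((1 + ‖x‖) ^ k)⁻¹ := by
  have h := SchwartzMap.one_add_le_sup_seminorm_apply (𝕜 := ℝ) (m := (k, 0)) le_rfl le_rfl H
  refine ⟨_, (by positivity : (0 : ℝ) ≤ _).trans (h 0), fun x => ?_⟩
  have := h x
  rw [norm_iteratedFDeriv_zero] at this
  rw [← div_eq_mul_inv, le_div_iff₀' (by positivity)]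
  exact this

theorem integrable_one_add_norm_pow {k : ℕ} (hk : 4 ≤ k) :
    Integrable (fun x : R3 => ((1 + ‖x‖) ^ k)⁻¹) := by
  have := integrable_one_add_norm (E := R3) (μ := volume) (r := k) (by
    rw [finrank_euclideanSpace, Fintype.card_fin]
    exact_mod_cast hk)
  refine this.congr (.of_forall fun x => ?_)
  simp only [Real.rpow_neg (by positivity : (0 : ℝ) ≤ 1 + ‖x‖), Real.rpow_natCast]

theorem one_add_norm_le_mul (x y : R3) : 1 + ‖y‖ ≤ (1 + ‖x‖) * (1 + ‖x - y‖) := by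
  have h1 : ‖y‖ ≤ ‖x‖ + ‖x - y‖ := by
    have := norm_sub_le x (x - y)
    rwa [sub_sub_cancel] at this
  nlinarith [norm_nonneg x, norm_nonneg (x - y)]

/-- Of five powers of decay, one absorbs the linear growth of `f`; the other four exceed the
dimension three. -/
theorem integrable_mul_schwartz {G : Type*} [NormedAddCommGroup G] [NormedSpace ℝ G]
    (H : 𝓢(R3, G)) {f : R3 → ℝ} (hf : Continuous f) {A : ℝ} (hA : ∀ y, |f y| ≤ A * (1 + ‖y‖))
    (x : R3) : Integrable (fun y => f y • H (x - y)) := by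
  obtain ⟨C, hC0, hC⟩ := H.exists_decay 5
  have hA0 : 0 ≤ A := by
    have := (abs_nonneg _).trans (hA 0)
    simpa using this
  refine Integrable.mono' (g := fun y => A * (1 + ‖x‖) * C * ((1 + ‖x - y‖) ^ 4)⁻¹)
    (((integrable_one_add_norm_pow le_rfl).comp_sub_left x).const_mul _) ?_ (.of_forall fun y => ?_)
  · exact (hf.smul (H.continuous.comp (by fun_prop))).aestronglyMeasurable
  · rw [norm_smul, Real.norm_eq_abs]
    have h1 := hA y
    have h2 := hC (x - y)
    have h3 := one_add_norm_le_mul x y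
    calc |f y| * ‖H (x - y)‖ ≤ (A * ((1 + ‖x‖) * (1 + ‖x - y‖))) *
          (C * ((1 + ‖x - y‖) ^ 5)⁻¹) := by
          gcongr
          exact h1.trans (by gcongr)
      _ = A * (1 + ‖x‖) * C * ((1 + ‖x - y‖) ^ 4)⁻¹ := by
          have : 0 < 1 + ‖x - y‖ := by positivity
          field_simp

theorem norm_integral_mul_schwartz_le {G : Type*} [NormedAddCommGroup G] [NormedSpace ℝ G]
    (H : 𝓢(R3, G)) {f : R3 → ℝ} {A : ℝ} (hA : ∀ y, |f y| ≤ A * (1 + ‖y‖)) :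
    ∃ C, ∀ x, ‖∫ y, f y • H (x - y)‖ ≤ C * (1 + ‖x‖) := by
  obtain ⟨C, hC0, hC⟩ := H.exists_decay 5
  have hA0 : 0 ≤ A := by
    have := (abs_nonneg _).trans (hA 0)
    simpa using this
  refine ⟨A * C * ∫ y : R3, ((1 + ‖y‖) ^ 4)⁻¹, fun x => ?_⟩
  have : A * C * (∫ y : R3, ((1 + ‖y‖) ^ 4)⁻¹) * (1 + ‖x‖) =
      ∫ y : R3, A * (1 + ‖x‖) * C * ((1 + ‖x - y‖) ^ 4)⁻¹ := by
    rw [integral_const_mul, integral_sub_left_eq_self (fun y : R3 => ((1 + ‖y‖) ^ 4)⁻¹)]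
    ring
  rw [this]
  refine norm_integral_le_of_norm_le
    (((integrable_one_add_norm_pow le_rfl).comp_sub_left x).const_mul _) (.of_forall fun y => ?_)
  rw [norm_smul, Real.norm_eq_abs]
  have h1 := hA y
  have h2 := hC (x - y)
  have h3 := one_add_norm_le_mul x y
  calc |f y| * ‖H (x - y)‖ ≤ (A * ((1 + ‖x‖) * (1 + ‖x - y‖))) *
        (C * ((1 + ‖x - y‖) ^ 5)⁻¹) := by
        gcongr
        exact h1.trans (by gcongr)
    _ = A * (1 + ‖x‖) * C * ((1 + ‖x - y‖) ^ 4)⁻¹ := by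
        have : 0 < 1 + ‖x - y‖ := by positivity
        field_simp

/-- The derivative falls on the Schwartz kernel. For z in the unit ball around x, the weights 1 + ‖z
- y‖ and 1 + ‖x - y‖ are comparable up to a factor two, which gives a dominating function with the
constant 2^5. -/
theorem hasFDerivAt_integral_mul_schwartz {G : Type*} [NormedAddCommGroup G] [NormedSpace ℝ G]
    (H : 𝓢(R3, G)) {f : R3 → ℝ} (hf : Continuous f) {A : ℝ} (hA : ∀ y, |f y| ≤ A * (1 + ‖y‖))
    (x : R3) : HasFDerivAt (fun x => ∫ y, f y • H (x - y))
      (∫ y, f y • SchwartzMap.fderivCLM ℝ R3 G H (x - y)) x := by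
  set H' := SchwartzMap.fderivCLM ℝ R3 G H with hH'
  obtain ⟨C, hC0, hC⟩ := H'.exists_decay 5
  have hA0 : 0 ≤ A := by
    have := (abs_nonneg _).trans (hA 0)
    simpa using this
  refine hasFDerivAt_integral_of_dominated_of_fderiv_le (𝕜 := ℝ)
    (F := fun x y => f y • H (x - y)) (F' := fun x y => f y • H' (x - y))
    (bound := fun y => A * (1 + ‖x‖) * C * 2 ^ 5 * ((1 + ‖x - y‖) ^ 4)⁻¹)
    (Metric.ball_mem_nhds x one_pos) (.of_forall fun z =>
      (integrable_mul_schwartz H hf hA z).aestronglyMeasurable)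
    (integrable_mul_schwartz H hf hA x) (integrable_mul_schwartz H' hf hA x).aestronglyMeasurable
    (.of_forall fun y z hz => ?_)
    (((integrable_one_add_norm_pow le_rfl).comp_sub_left x).const_mul _)
    (.of_forall fun y z _ => ?_)
  · rw [norm_smul, Real.norm_eq_abs]
    have h1 := hA y
    have h2 := hC (z - y)
    have h3 := one_add_norm_le_mul x y
    have h4 : 1 + ‖x - y‖ ≤ 2 * (1 + ‖z - y‖) := by
      have h5 : ‖x - y‖ ≤ ‖z - x‖ + ‖z - y‖ := by
        have := norm_sub_le (z - y) (z - x)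
        rw [sub_sub_sub_cancel_left] at this
        linarith
      rw [Metric.mem_ball, dist_eq_norm] at hz
      linarith [norm_nonneg (z - y)]
    calc |f y| * ‖H' (z - y)‖ ≤ (A * ((1 + ‖x‖) * (1 + ‖x - y‖))) *
          (C * (((1 + ‖x - y‖) / 2) ^ 5)⁻¹) := by
          gcongr
          · exact h1.trans (by gcongr)
          · refine h2.trans ?_
            gcongr
            linarith
      _ = A * (1 + ‖x‖) * C * 2 ^ 5 * ((1 + ‖x - y‖) ^ 4)⁻¹ := by
          have : 0 < 1 + ‖x - y‖ := by positivity
          field_simp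
  · have h1 : HasFDerivAt (fun w : R3 => H (w - y)) (H' (z - y)) z :=
      (H.hasFDerivAt (z - y)).comp z ((hasFDerivAt_id z).sub_const y)
    exact h1.const_smul (f y)

/-- The codomain `G` varies in the induction: the derivative is an integral of the same form whose
kernel takes values in linear maps. -/
theorem contDiff_integral_mul_schwartz {f : R3 → ℝ} (hf : Continuous f) {A : ℝ}
    (hA : ∀ y, |f y| ≤ A * (1 + ‖y‖)) (n : ℕ) :
    ∀ {G : Type} [NormedAddCommGroup G] [NormedSpace ℝ G] (H : 𝓢(R3, G)),
      ContDiff ℝ n (fun x => ∫ y, f y • H (x - y)) ∧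
      ∃ C, ∀ x, ‖iteratedFDeriv ℝ n (fun x => ∫ y, f y • H (x - y)) x‖ ≤ C * (1 + ‖x‖) := by
  induction n with
  | zero =>
    intro G _ _ H
    refine ⟨?_, ?_⟩
    · rw [CharP.cast_eq_zero, contDiff_zero, continuous_iff_continuousAt]
      exact fun x => (hasFDerivAt_integral_mul_schwartz H hf hA x).continuousAt
    · simpa only [norm_iteratedFDeriv_zero] using norm_integral_mul_schwartz_le H hA
  | succ n ih =>
    intro G _ _ H
    obtain ⟨h1, C, hC⟩ := ih (SchwartzMap.fderivCLM ℝ R3 G H)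
    have hfd : fderiv ℝ (fun x => ∫ y, f y • H (x - y)) =
        fun x => ∫ y, f y • SchwartzMap.fderivCLM ℝ R3 G H (x - y) :=
      funext fun x => (hasFDerivAt_integral_mul_schwartz H hf hA x).fderiv
    refine ⟨?_, C, fun x => ?_⟩
    · rw [Nat.cast_succ, contDiff_succ_iff_fderiv]
      refine ⟨fun x => (hasFDerivAt_integral_mul_schwartz H hf hA x).differentiableAt, by simp, ?_⟩
      rwa [hfd]
    · rw [← norm_iteratedFDeriv_fderiv, hfd]
      exact hC x

theorem hasTemperateGrowth_integral_mul_schwartz {f : R3 → ℝ} (hf : Continuous f) {A : ℝ}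
    (hA : ∀ y, |f y| ≤ A * (1 + ‖y‖)) {G : Type} [NormedAddCommGroup G] [NormedSpace ℝ G]
    (H : 𝓢(R3, G)) : (fun x => ∫ y, f y • H (x - y)).HasTemperateGrowth := by
  refine ⟨contDiff_infty.2 fun n => (contDiff_integral_mul_schwartz hf hA n H).1, fun n => ?_⟩
  obtain ⟨C, hC⟩ := (contDiff_integral_mul_schwartz hf hA n H).2
  exact ⟨1, C, fun x => by simpa using hC x⟩

variable {χ : R3 → ℝ}

/-- The symbol of `S_j` in Mathlib's normalisation. -/
def lowS (hχ : IsLPCutoff χ) (j : ℤ) : 𝓢(R3, ℂ) :=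
  HasCompactSupport.toSchwartzMap
    (f := fun ξ : R3 => ((χ ((2 : ℝ) ^ (-j) • ((2 * Real.pi) • ξ)) : ℝ) : ℂ))
    (hasCompactSupport_of_norm (r := 4 / 3 * 2 ^ j / (2 * Real.pi)) fun ξ hξ => by
      rw [hχ.eq_zero, Complex.ofReal_zero]
      rw [norm_zpow_smul, zpow_neg, le_inv_mul_iff₀ (by positivity), norm_two_pi_smul, mul_comm]
      rwa [div_le_iff₀' (by positivity)] at hξ)
    (by
      have := hχ.smooth
      exact Complex.ofRealCLM.contDiff.comp (this.comp (by fun_prop)))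

theorem lowS_apply (hχ : IsLPCutoff χ) (j : ℤ) (ξ : R3) :
    lowS hχ j ξ = ((χ ((2 : ℝ) ^ (-j) • ((2 * Real.pi) • ξ)) : ℝ) : ℂ) := rfl

theorem lowFreq_eq (hχ : IsLPCutoff χ) (j : ℤ) (f : R3 → ℝ) (x : R3) :
    lowFreq χ j f x = ∫ y, f y • (𝓕⁻ (lowS hχ j)) (x - y) := by
  rw [lowFreq]
  refine integral_congr_ae (.of_forall fun y => ?_)
  beta_reduce
  rw [Complex.real_smul, SchwartzMap.fourierInv_coe]
  exact mul_comm _ _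

theorem abs_le_of_lipschitz {f : R3 → ℝ} {L : ℝ} (hL : 0 ≤ L)
    (hf : ∀ x y, |f x - f y| ≤ L * ‖x - y‖) (y : R3) : |f y| ≤ (|f 0| + L) * (1 + ‖y‖) := by
  have h1 := hf y 0
  rw [sub_zero] at h1
  have h2 := abs_sub_abs_le_abs_sub (f y) (f 0)
  nlinarith [abs_nonneg (f 0), norm_nonneg y]

theorem continuous_of_lipschitz {f : R3 → ℝ} {L : ℝ}
    (hf : ∀ x y, |f x - f y| ≤ L * ‖x - y‖) : Continuous f :=
  (LipschitzWith.of_dist_le' hf).continuous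

/-- Products with distributions via `smulLeftCLM` are computed only for functions of temperate
growth. A Lipschitz function need not be smooth, but its mollification is, with all derivatives
growing at most linearly. -/
theorem hasTemperateGrowth_lowFreq (hχ : IsLPCutoff χ) (j : ℤ) {f : R3 → ℝ} {L : ℝ} (hL : 0 ≤ L)
    (hf : ∀ x y, |f x - f y| ≤ L * ‖x - y‖) : (lowFreq χ j f).HasTemperateGrowth := by
  have := hasTemperateGrowth_integral_mul_schwartz (continuous_of_lipschitz hf)
    (abs_le_of_lipschitz hL hf) (𝓕⁻ (lowS hχ j))
  exact (funext (lowFreq_eq hχ j f) : lowFreq χ j f = _) ▸ this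

theorem integral_fourierInv (m : 𝓢(R3, ℂ)) : ∫ x, (𝓕⁻ m) x = m 0 := by
  have h : 𝓕 (𝓕⁻ m) = m := FourierTransform.fourier_fourierInv_eq m
  conv_rhs => rw [← h, SchwartzMap.fourier_coe, Real.fourier_eq]
  simp

/-- The kernel has integral χ(0) = 1, so S_j f(x) - f(x) integrates f(y) - f(x) against it, and the
first moment of the kernel appears. -/
theorem norm_lowFreq_sub_le (hχ : IsLPCutoff χ) (j : ℤ) {f : R3 → ℝ} {L : ℝ} (hL : 0 ≤ L)
    (hf : ∀ x y, |f x - f y| ≤ L * ‖x - y‖) (x : R3) :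
    ‖lowFreq χ j f x - f x‖ ≤ L * (kerMoment (lowS hχ 0) * (2 ^ j)⁻¹) := by
  set h := 𝓕⁻ (lowS hχ j) with hh
  have hi := integrable_mul_schwartz h (continuous_of_lipschitz hf) (abs_le_of_lipschitz hL hf) x
  have hi2 : Integrable fun y => f x • h (x - y) := (h.integrable.comp_sub_left x).smul (f x)
  have h1 : (f x : ℂ) = ∫ y, f x • h (x - y) := by
    rw [integral_smul, integral_sub_left_eq_self (fun y => h y), hh, integral_fourierInv,
      lowS_apply, smul_zero, smul_zero, hχ.eq_one 0 (by norm_num)]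
    simp
  have h2 : kerMoment (lowS hχ j) = kerMoment (lowS hχ 0) * (2 ^ j)⁻¹ := by
    rw [kerMoment_scale (M := lowS hχ 0) (c := 1) (r := 2 ^ j) (by positivity)]
    · simp [mul_comm]
    · intro ξ
      rw [one_mul, lowS_apply, lowS_apply, neg_zero, zpow_zero, one_smul, zpow_neg,
        smul_comm (2 * Real.pi)]
  have hmom : Integrable fun y => ‖y‖ * ‖h y‖ := by simpa using h.integrable_pow_mul volume 1
  rw [lowFreq_eq hχ, h1, ← integral_sub hi hi2, ← h2]
  have h3 : L * kerMoment (lowS hχ j) = ∫ y, L * (‖x - y‖ * ‖h (x - y)‖) := by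
    rw [integral_const_mul, integral_sub_left_eq_self (fun y => ‖y‖ * ‖h y‖)]
    rfl
  rw [h3]
  refine norm_integral_le_of_norm_le ((hmom.comp_sub_left x).const_mul L) (.of_forall fun y => ?_)
  rw [← sub_smul, norm_smul, ← mul_assoc]
  gcongr
  rw [norm_sub_rev x]
  exact hf y x

end Kernels

/-! ### Integral operators dominated by convolutions -/

section KernelOperators

/-- A multiplier acts on distributions through its transpose on test functions. This identifies the
transpose as an integral against the kernel. -/
theorem SchwartzMap.fourier_smulLeft_fourierInv_apply (m ψ : 𝓢(R3, ℂ)) (y : R3) :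
    (𝓕 (SchwartzMap.smulLeftCLM ℂ m (𝓕⁻ ψ)) : 𝓢(R3, ℂ)) y = ∫ x, (𝓕⁻ m) (x - y) * ψ x := by
  have hneg (f : 𝓢(R3, ℂ)) (z : R3) : (𝓕 f) z = (𝓕⁻ f) (-z) := by
    rw [SchwartzMap.fourier_coe, SchwartzMap.fourierInv_coe, Real.fourierInv_eq_fourier_neg,
      neg_neg]
  have h1 : SchwartzMap.smulLeftCLM ℂ m (𝓕⁻ ψ) =
      SchwartzMap.pairing (ContinuousLinearMap.mul ℂ ℂ) (𝓕 (𝓕⁻ m)) (𝓕 (𝓕⁻ (𝓕⁻ ψ))) := by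
    ext x
    rw [SchwartzMap.smulLeftCLM_apply_apply m.hasTemperateGrowth,
      FourierTransform.fourier_fourierInv_eq, FourierTransform.fourier_fourierInv_eq]
    simp
  rw [h1, hneg, ← SchwartzMap.fourier_convolution, FourierTransform.fourierInv_fourier_eq,
    SchwartzMap.convolution_apply, MeasureTheory.convolution]
  rw [← integral_add_right_eq_self (fun x => (𝓕⁻ m : 𝓢(R3, ℂ)) (x - y) * ψ x) y]
  refine integral_congr_ae (.of_forall fun t => ?_)
  have h2 : (𝓕⁻ (𝓕⁻ ψ)) (-y - t) = ψ (t + y) := by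
    rw [← neg_add', ← hneg, FourierTransform.fourier_fourierInv_eq, add_comm]
  simp [h2]

/-- Young's inequality for L¹ * L²: Cauchy–Schwarz after writing k as k^{1/2}·k^{1/2}, then Tonelli.
-/
theorem lintegral_sq_lintegral_le {k p : R3 → ℝ≥0∞} (hk : Measurable k) (hp : AEMeasurable p) :
    ∫⁻ x, (∫⁻ y, k (x - y) * p y) ^ (2 : ℝ) ≤ (∫⁻ x, k x) ^ (2 : ℝ) * ∫⁻ y, p y ^ (2 : ℝ) := by
  have h1 (x : R3) : (∫⁻ y, k (x - y) * p y) ^ (2 : ℝ) ≤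
      (∫⁻ y, k y) * ∫⁻ y, k (x - y) * p y ^ (2 : ℝ) := by
    have hkx : Measurable fun y => k (x - y) := hk.comp (measurable_const.sub measurable_id)
    have h2 := ENNReal.lintegral_mul_norm_pow_le (μ := (volume : Measure R3))
      (f := fun y => k (x - y)) (g := fun y => k (x - y) * p y ^ (2 : ℝ)) hkx.aemeasurable
      (hkx.aemeasurable.mul (hp.pow_const _))
      (p := 1 / 2) (q := 1 / 2) (by norm_num) (by norm_num) (by norm_num)
    have h3 (y : R3) : k (x - y) ^ (1 / 2 : ℝ) * (k (x - y) * p y ^ (2 : ℝ)) ^ (1 / 2 : ℝ) =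
        k (x - y) * p y := by
      rw [← ENNReal.mul_rpow_of_nonneg _ _ (by norm_num), ← mul_assoc, ← sq, ← ENNReal.rpow_two,
        ← ENNReal.mul_rpow_of_nonneg _ _ (by norm_num), ← ENNReal.rpow_mul]
      norm_num
    simp_rw [h3] at h2
    refine (ENNReal.rpow_le_rpow h2 (by norm_num : (0 : ℝ) ≤ 2)).trans_eq ?_
    rw [ENNReal.mul_rpow_of_nonneg _ _ (by norm_num), ← ENNReal.rpow_mul, ← ENNReal.rpow_mul,
      lintegral_sub_left_eq_self (fun y => k y)]
    norm_num
  have hmeas : AEMeasurable (fun z : R3 × R3 => k (z.1 - z.2) * p z.2 ^ (2 : ℝ))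
      (volume.prod volume) :=
    (hk.comp (measurable_fst.sub measurable_snd)).aemeasurable.mul
      ((hp.comp_quasiMeasurePreserving Measure.quasiMeasurePreserving_snd).pow_const _)
  calc ∫⁻ x, (∫⁻ y, k (x - y) * p y) ^ (2 : ℝ)
      ≤ ∫⁻ x, (∫⁻ y, k y) * ∫⁻ y, k (x - y) * p y ^ (2 : ℝ) := lintegral_mono h1
    _ = (∫⁻ y, k y) * ∫⁻ x, ∫⁻ y, k (x - y) * p y ^ (2 : ℝ) :=
        lintegral_const_mul'' _ hmeas.lintegral_prod_right'
    _ = (∫⁻ y, k y) * ∫⁻ y, ∫⁻ x, k (x - y) * p y ^ (2 : ℝ) := by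
        rw [lintegral_lintegral_swap hmeas]
    _ = (∫⁻ y, k y) * ∫⁻ y, (∫⁻ x, k x) * p y ^ (2 : ℝ) := by
        congr 1
        refine lintegral_congr fun y => ?_
        have hky : Measurable fun x => k (x - y) := hk.comp (measurable_id.sub measurable_const)
        rw [lintegral_mul_const _ hky,
          lintegral_sub_right_eq_self (fun x => k x)]
    _ = _ := by
        rw [lintegral_const_mul'' _ (hp.pow_const _), ← mul_assoc, ENNReal.rpow_two, sq]

variable {F : Type*} [NormedAddCommGroup F] [InnerProductSpace ℂ F] [CompleteSpace F]

theorem integrable_sub_mul_fst {a b : R3 → ℝ} (ha : Integrable a) (hb : Integrable b) :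
    Integrable (fun z : R3 × R3 => a (z.1 - z.2) * b z.1) (volume.prod volume) := by
  have := (hb.convolution_integrand (ContinuousLinearMap.mul ℝ ℝ) ha.comp_neg).swap
  refine this.congr (.of_forall fun z => ?_)
  simp [mul_comm]

theorem integrable_sub_mul_snd {a b : R3 → ℝ} (ha : Integrable a) (hb : Integrable b) :
    Integrable (fun z : R3 × R3 => a (z.1 - z.2) * b z.2) (volume.prod volume) := by
  have := hb.convolution_integrand (ContinuousLinearMap.mul ℝ ℝ) ha
  refine this.congr (.of_forall fun z => ?_)
  simp [mul_comm]

/-- An integral operator whose kernel is dominated by an integrable convolution kernel is bounded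
on `L²`. -/
theorem exists_kernel_operator {κ : R3 → R3 → ℂ} (hκ : Continuous (Function.uncurry κ))
    {φ : R3 → ℝ} (hφ : Integrable φ) (hφc : Continuous φ) (h : ∀ x y, ‖κ x y‖ ≤ φ (x - y))
    (P : Lp F 2 (volume : Measure R3)) :
    ∃ R : Lp F 2 (volume : Measure R3), ‖R‖ ≤ (∫ x, φ x) * ‖P‖ ∧
      ∀ ψ : R3 → ℂ, MemLp ψ 2 →
        Integrable (fun x => ψ x • R x) ∧
        Integrable (fun y => (∫ x, κ x y * ψ x) • P y) ∧
        ∫ x, ψ x • R x = ∫ y, (∫ x, κ x y * ψ x) • P y := by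
  have hφ0 (x : R3) : 0 ≤ φ x := by simpa using (norm_nonneg _).trans (h x 0)
  have hPm : AEStronglyMeasurable P volume := Lp.aestronglyMeasurable P
  have hmeas : AEStronglyMeasurable (fun z : R3 × R3 => κ z.1 z.2 • P z.2)
      (volume.prod volume) :=
    hκ.aestronglyMeasurable.smul hPm.comp_snd
  set R0 : R3 → F := fun x => ∫ y, κ x y • P y with hR0
  have hR0m : AEStronglyMeasurable R0 volume := hmeas.integral_prod_right'
  have hle : eLpNorm R0 2 volume ≤ ENNReal.ofReal ((∫ x, φ x) * ‖P‖) := by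
    rw [eLpNorm_eq_lintegral_rpow_enorm_toReal (by norm_num) (by norm_num)]
    have h1 : ∫⁻ x, ‖R0 x‖ₑ ^ (2 : ℝ) ≤
        (∫⁻ x, ENNReal.ofReal (φ x)) ^ (2 : ℝ) * ∫⁻ y, ‖P y‖ₑ ^ (2 : ℝ) := by
      refine le_trans (lintegral_mono fun x => ?_)
        (lintegral_sq_lintegral_le hφc.measurable.ennreal_ofReal hPm.enorm)
      refine ENNReal.rpow_le_rpow ?_ (by norm_num)
      refine (enorm_integral_le_lintegral_enorm _).trans (lintegral_mono fun y => ?_)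
      beta_reduce
      rw [enorm_smul]
      gcongr
      rw [← ofReal_norm]
      exact ENNReal.ofReal_le_ofReal (h x y)
    refine (ENNReal.rpow_le_rpow h1 (by norm_num)).trans_eq ?_
    rw [ENNReal.mul_rpow_of_nonneg _ _ (by norm_num), ← ENNReal.rpow_mul,
      ← ofReal_integral_eq_lintegral_ofReal hφ (.of_forall hφ0),
      ENNReal.ofReal_mul (integral_nonneg hφ0), Lp.norm_def,
      ENNReal.ofReal_toReal (Lp.eLpNorm_ne_top P),
      eLpNorm_eq_lintegral_rpow_enorm_toReal (by norm_num) (by norm_num)]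
    norm_num
  have hR0L : MemLp R0 2 volume := ⟨hR0m, hle.trans_lt ENNReal.ofReal_lt_top⟩
  refine ⟨hR0L.toLp R0, ?_, fun ψ hψ => ?_⟩
  · rw [Lp.norm_toLp]
    exact ENNReal.toReal_le_of_le_ofReal (mul_nonneg (integral_nonneg hφ0) (norm_nonneg _)) hle
  -- The bound 2|ψ||P| ≤ |ψ|² + |P|² gives integrability on the product, so Fubini is available for
  -- every ψ in `L²` and not only for Schwartz functions.
  · have hG : Integrable (fun z : R3 × R3 => (κ z.1 z.2 * ψ z.1) • P z.2)
        (volume.prod volume) := by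
      have h1 := (integrable_sub_mul_fst hφ hψ.norm.integrable_sq).add
        (integrable_sub_mul_snd hφ (Lp.memLp P).norm.integrable_sq)
      refine h1.mono' ((hκ.aestronglyMeasurable.mul hψ.1.comp_fst).smul hPm.comp_snd)
        (.of_forall fun z => ?_)
      rw [norm_smul, norm_mul]
      have h2 := h z.1 z.2
      have h3 := two_mul_le_add_sq ‖ψ z.1‖ ‖P z.2‖
      have h4 : 0 ≤ ‖ψ z.1‖ * ‖P z.2‖ := by positivity
      simp only [Pi.add_apply, ← mul_add]
      rw [mul_assoc]
      gcongr
      · exact hφ0 _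
      · linarith
    have hR : ∀ᵐ x, ψ x • (hR0L.toLp R0) x = ∫ y, (κ x y * ψ x) • P y := by
      filter_upwards [hR0L.coeFn_toLp] with x hx
      rw [hx, hR0, ← integral_smul]
      refine integral_congr_ae (.of_forall fun y => ?_)
      beta_reduce
      rw [smul_smul, mul_comm]
    have hS (y : R3) : ∫ x, (κ x y * ψ x) • P y = (∫ x, κ x y * ψ x) • P y :=
      integral_smul_const _ _
    refine ⟨hG.integral_prod_left.congr (hR.mono fun x hx => hx.symm), ?_, ?_⟩
    · exact hG.integral_prod_right.congr (.of_forall hS)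
    · rw [integral_congr_ae hR, integral_integral_swap hG]
      simp_rw [hS]

end KernelOperators

/-! ### The commutator of a multiplier with a Lipschitz function -/

section Commutator

variable {χ : R3 → ℝ} {F : Type*} [NormedAddCommGroup F] [InnerProductSpace ℂ F] [CompleteSpace F]

/-- The kernel formula is needed for test functions fψ with `f` Lipschitz and ψ Schwartz. These are
in `L²` but in general not Schwartz. -/
theorem integral_smul_multL2 (m : 𝓢(R3, ℂ)) (P : Lp F 2 (volume : Measure R3)) {ψ : R3 → ℂ}
    (hψ : MemLp ψ 2) : Integrable (fun x => ψ x • multL2 m P x) ∧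
      Integrable (fun y => (∫ x, (𝓕⁻ m) (x - y) * ψ x) • P y) ∧
      ∫ x, ψ x • multL2 m P x = ∫ y, (∫ x, (𝓕⁻ m) (x - y) * ψ x) • P y := by
  have hc : Continuous (𝓕⁻ m : 𝓢(R3, ℂ)) := (𝓕⁻ m).continuous
  obtain ⟨R, -, hR⟩ := exists_kernel_operator (κ := fun x y => (𝓕⁻ m : 𝓢(R3, ℂ)) (x - y))
    (φ := fun x => ‖(𝓕⁻ m : 𝓢(R3, ℂ)) x‖) (hc.comp (continuous_fst.sub continuous_snd))
    (𝓕⁻ m).integrable.norm hc.norm (fun x y => le_rfl) P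
  have h1 : multL2 m P = R := by
    refine toTemperedDistribution_injective ?_
    ext ψ
    rw [coe_multL2, TemperedDistribution.fourierMultiplierCLM_apply_apply,
      Lp.toTemperedDistribution_apply, Lp.toTemperedDistribution_apply, (hR ψ (ψ.memLp 2 _)).2.2]
    simp_rw [SchwartzMap.fourier_smulLeft_fourierInv_apply]
  rw [h1]
  exact hR ψ hψ

theorem memLp_smul_schwartz {f : R3 → ℝ} (hf : Continuous f) {A : ℝ}
    (hA : ∀ y, |f y| ≤ A * (1 + ‖y‖)) (ψ : 𝓢(R3, ℂ)) :
    MemLp (fun x => (f x : ℂ) * ψ x) 2 (volume : Measure R3) := by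
  obtain ⟨C, hC0, hC⟩ := ψ.exists_decay 5
  have hA0 : 0 ≤ A := by simpa using (abs_nonneg _).trans (hA 0)
  have hcont : Continuous fun x => (f x : ℂ) * ψ x :=
    (Complex.continuous_ofReal.comp hf).mul ψ.continuous
  rw [memLp_two_iff_integrable_sq_norm hcont.aestronglyMeasurable]
  refine ((integrable_one_add_norm_pow (k := 8) (by norm_num)).const_mul ((A * C) ^ 2)).mono'
    (by fun_prop) (.of_forall fun x => ?_)
  rw [norm_pow, norm_norm, norm_mul, Complex.norm_real, Real.norm_eq_abs]
  have h1 : |f x| * ‖ψ x‖ ≤ A * C * ((1 + ‖x‖) ^ 4)⁻¹ := by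
    calc |f x| * ‖ψ x‖ ≤ (A * (1 + ‖x‖)) * (C * ((1 + ‖x‖) ^ 5)⁻¹) := by
          gcongr
          exacts [hA x, hC x]
      _ = _ := by
          have : 0 < 1 + ‖x‖ := by positivity
          field_simp
  calc (|f x| * ‖ψ x‖) ^ 2 ≤ (A * C * ((1 + ‖x‖) ^ 4)⁻¹) ^ 2 := by gcongr
    _ = _ := by rw [mul_pow, inv_pow, ← pow_mul]

/-- Multiplying by a mollified Lipschitz function and applying a Fourier multiplier is the same as
applying the multiplier and multiplying by the Lipschitz function, up to a small error. -/
theorem exists_commutator (hχ : IsLPCutoff χ) (m : 𝓢(R3, ℂ)) (l : ℤ) {f : R3 → ℝ} {L : ℝ}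
    (hL : 0 ≤ L) (hf : ∀ x y, |f x - f y| ≤ L * ‖x - y‖) (P : Lp F 2 (volume : Measure R3)) :
    ∃ R : Lp F 2 (volume : Measure R3),
      ‖R‖ ≤ L * (kerMoment (lowS hχ 0) * (2 ^ l)⁻¹ * kerNorm m + kerMoment m) * ‖P‖ ∧
      ∀ ψ : 𝓢(R3, ℂ), Integrable (fun x => ((f x : ℂ) * ψ x) • multL2 m P x) ∧
        TemperedDistribution.fourierMultiplierCLM F m
          (TemperedDistribution.smulLeftCLM F (lowFreq χ l f) (P : 𝓢'(R3, F))) ψ =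
        (∫ x, ((f x : ℂ) * ψ x) • multL2 m P x) + (R : 𝓢'(R3, F)) ψ := by
  set V := lowFreq χ l f with hV
  set h : 𝓢(R3, ℂ) := 𝓕⁻ m with hh
  have hVg : V.HasTemperateGrowth := hasTemperateGrowth_lowFreq hχ l hL hf
  have hfc := continuous_of_lipschitz hf
  have hVc : Continuous V := hVg.1.continuous
  set A := L * (kerMoment (lowS hχ 0) * (2 ^ l)⁻¹) with hA
  have hA0 : 0 ≤ A := mul_nonneg hL (mul_nonneg (kerMoment_nonneg _) (by positivity))
  have hi1 : Integrable fun x => ‖h x‖ := h.integrable.norm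
  have hi2 : Integrable fun x => ‖x‖ * ‖h x‖ := by simpa using h.integrable_pow_mul volume 1
  -- The remainder m(D)(V·) - f·m(D) has the kernel h(x - y)(V(y) - f(x)). The mollification error
  -- |V(y) - f(y)| is at most A, and |f(y) - f(x)| ≤ L|x - y| is paid for by the first moment of h.
  obtain ⟨R, hRn, hR⟩ := exists_kernel_operator
    (κ := fun x y => h (x - y) * (V y - f x)) (φ := fun x => A * ‖h x‖ + L * (‖x‖ * ‖h x‖))
    (by
      have := h.continuous
      exact (this.comp (continuous_fst.sub continuous_snd)).mul ((hVc.comp continuous_snd).sub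
        (Complex.continuous_ofReal.comp (hfc.comp continuous_fst))))
    ((hi1.const_mul A).add (hi2.const_mul L))
    (by have := h.continuous; fun_prop)
    (fun x y => by
      have h1 := norm_lowFreq_sub_le hχ l hL hf y
      have h2 : ‖((f y : ℝ) : ℂ) - f x‖ ≤ L * ‖x - y‖ := by
        rw [← Complex.ofReal_sub, Complex.norm_real, Real.norm_eq_abs, norm_sub_rev]
        exact hf y x
      have h3 : ‖V y - f x‖ ≤ A + L * ‖x - y‖ := by
        rw [← sub_add_sub_cancel (V y) (f y : ℂ)]
        exact (norm_add_le _ _).trans (add_le_add h1 h2)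
      rw [norm_mul]
      calc ‖h (x - y)‖ * ‖V y - f x‖ ≤ ‖h (x - y)‖ * (A + L * ‖x - y‖) := by gcongr
        _ = _ := by ring) P
  refine ⟨R, hRn.trans_eq ?_, fun ψ => ?_⟩
  · rw [integral_add (hi1.const_mul A) (hi2.const_mul L), integral_const_mul, integral_const_mul]
    change (A * kerNorm m + L * kerMoment m) * _ = _
    rw [hA]
    ring
  · have hfψ : MemLp (fun x => (f x : ℂ) * ψ x) 2 volume :=
      memLp_smul_schwartz hfc (abs_le_of_lipschitz hL hf) ψ
    have hψ2 : MemLp ψ 2 volume := ψ.memLp 2 _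
    obtain ⟨h1, h2, h3⟩ := integral_smul_multL2 m P hfψ
    obtain ⟨h4, h5, h6⟩ := hR ψ hψ2
    refine ⟨h1, ?_⟩
    have hsplit (y : R3) : V y * (∫ x, h (x - y) * ψ x) =
        (∫ x, h (x - y) * ((f x : ℂ) * ψ x)) + ∫ x, h (x - y) * (V y - f x) * ψ x := by
      have hy : MemLp (fun x => h (x - y)) 2 volume :=
        (h.memLp 2 volume).comp_measurePreserving (measurePreserving_sub_right volume y)
      have h7 : Integrable fun x => h (x - y) * ψ x := hy.integrable_mul hψ2
      have h8 : Integrable fun x => h (x - y) * ((f x : ℂ) * ψ x) := hy.integrable_mul hfψ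
      have h9 (x : R3) : h (x - y) * (V y - f x) * ψ x =
          V y * (h (x - y) * ψ x) - h (x - y) * ((f x : ℂ) * ψ x) := by ring
      simp_rw [h9]
      rw [integral_sub (h7.const_mul _) h8, integral_const_mul]
      ring
    rw [TemperedDistribution.fourierMultiplierCLM_apply_apply,
      TemperedDistribution.smulLeftCLM_apply_apply, Lp.toTemperedDistribution_apply,
      Lp.toTemperedDistribution_apply, h3, h6, ← integral_add h2 h5]
    refine integral_congr_ae (.of_forall fun y => ?_)
    beta_reduce
    rw [SchwartzMap.smulLeftCLM_apply_apply hVg, smul_eq_mul,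
      SchwartzMap.fourier_smulLeft_fourierInv_apply, hsplit, add_smul]

end Commutator

/-! ### Spectral localization of the paraproduct terms -/

section SpectralLocalization

variable {χ : R3 → ℝ} {F : Type*} [NormedAddCommGroup F] [InnerProductSpace ℂ F] [CompleteSpace F]

/-- A translated kernel has its symbol multiplied by a character, so the frequency support does not
depend on the translation. -/
theorem SchwartzMap.fourierInv_fourierInv_comp_sub (m : 𝓢(R3, ℂ)) (y t : R3) :
    (𝓕⁻ (SchwartzMap.compSubConstCLM ℂ y (𝓕⁻ m)) : 𝓢(R3, ℂ)) t =
      Real.fourierChar (inner ℝ y t) • m (-t) := by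
  have h1 : m (-t) = (𝓕⁻ (𝓕⁻ m : 𝓢(R3, ℂ)) : 𝓢(R3, ℂ)) t := by
    conv_lhs => rw [← (FourierTransform.fourier_fourierInv_eq m : 𝓕 (𝓕⁻ m : 𝓢(R3, ℂ)) = m)]
    rw [SchwartzMap.fourier_coe, SchwartzMap.fourierInv_coe (𝓕⁻ m : 𝓢(R3, ℂ)),
      Real.fourierInv_eq_fourier_neg]
  rw [h1, SchwartzMap.fourierInv_coe, SchwartzMap.fourierInv_coe (𝓕⁻ m : 𝓢(R3, ℂ)),
    Real.fourierInv_eq, Real.fourierInv_eq, Circle.smul_def, ← integral_smul,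
    ← integral_add_right_eq_self (fun v : R3 => Real.fourierChar (inner ℝ v t) •
      SchwartzMap.compSubConstCLM ℂ y (𝓕⁻ m : 𝓢(R3, ℂ)) v) y]
  refine integral_congr_ae (.of_forall fun v => ?_)
  beta_reduce
  rw [SchwartzMap.compSubConstCLM_apply, add_sub_cancel_right, inner_add_left, AddChar.map_add_eq_mul,
    mul_comm, mul_smul, Circle.smul_def (Real.fourierChar (inner ℝ y t))]

theorem lowS_eq_zero (hχ : IsLPCutoff χ) {l : ℤ} {ξ : R3}
    (h : 4 / 3 * 2 ^ l ≤ ‖(2 * Real.pi) • ξ‖) : lowS hχ l ξ = 0 := by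
  rw [lowS_apply, hχ.eq_zero, Complex.ofReal_zero]
  rwa [norm_zpow_smul, zpow_neg, le_inv_mul_iff₀ (by positivity), mul_comm]

/-- The product becomes a convolution in frequency, of a function in the ball of radius 4/3·2^(i-1)
with one in the shell of index j. Such a convolution does not reach the shell of index i. -/
theorem phiS_mul_fourierInv_eq_zero (hχ : IsLPCutoff χ) {i j : ℤ} (hij : j + 5 ≤ i ∨ i + 5 ≤ j)
    (y ξ : R3) (g : 𝓢(R3, ℂ)) :
    phiS hχ i ξ * (𝓕⁻ (SchwartzMap.smulLeftCLM ℂ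
      (SchwartzMap.compSubConstCLM ℂ y (𝓕⁻ (lowS hχ (i - 1)) : 𝓢(R3, ℂ)))
      (𝓕 (SchwartzMap.smulLeftCLM ℂ (phiS hχ j) g) : 𝓢(R3, ℂ))) : 𝓢(R3, ℂ)) ξ = 0 := by
  set hy : 𝓢(R3, ℂ) := SchwartzMap.compSubConstCLM ℂ y (𝓕⁻ (lowS hχ (i - 1)) : 𝓢(R3, ℂ)) with hhy
  set G : 𝓢(R3, ℂ) := SchwartzMap.smulLeftCLM ℂ (phiS hχ j) g with hG
  by_cases hξ : dyadicSymbol χ i ((2 * Real.pi) • ξ) = 0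
  · simp [phiS_apply, hξ]
  have hξ1 : 3 / 4 * (2 : ℝ) ^ i < ‖(2 * Real.pi) • ξ‖ := by
    by_contra! hcon
    exact hξ (hχ.dyadicSymbol_eq_zero_of_le hcon)
  have hξ2 : ‖(2 * Real.pi) • ξ‖ < 8 / 3 * (2 : ℝ) ^ i := by
    by_contra! hcon
    exact hξ (hχ.dyadicSymbol_eq_zero_of_ge hcon)
  have h1 : SchwartzMap.smulLeftCLM ℂ hy (𝓕 G : 𝓢(R3, ℂ)) =
      𝓕 (SchwartzMap.convolution (ContinuousLinearMap.mul ℂ ℂ) (𝓕⁻ hy : 𝓢(R3, ℂ)) G) := by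
    rw [SchwartzMap.fourier_convolution, FourierTransform.fourier_fourierInv_eq]
    ext x
    rw [SchwartzMap.smulLeftCLM_apply_apply hy.hasTemperateGrowth]
    simp
  rw [h1, FourierTransform.fourierInv_fourier_eq, SchwartzMap.convolution_apply,
    MeasureTheory.convolution]
  refine mul_eq_zero_of_right _ (integral_eq_zero_of_ae (.of_forall fun t => ?_))
  beta_reduce
  rw [ContinuousLinearMap.mul_apply', hhy, SchwartzMap.fourierInv_fourierInv_comp_sub, hG,
    SchwartzMap.smulLeftCLM_apply_apply (phiS hχ j).hasTemperateGrowth]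
  rcases le_or_gt (4 / 3 * (2 : ℝ) ^ (i - 1)) ‖(2 * Real.pi) • t‖ with ht | ht
  · rw [lowS_eq_zero hχ (by rwa [smul_neg, norm_neg])]
    simp
  · have h2i : (0 : ℝ) < 2 ^ i := by positivity
    have h2j : (0 : ℝ) < 2 ^ j := by positivity
    rw [zpow_sub₀ (by norm_num), zpow_one] at ht
    have h3 := norm_sub_le ((2 * Real.pi) • ξ) ((2 * Real.pi) • t)
    have h4 := norm_sub_norm_le ((2 * Real.pi) • ξ) ((2 * Real.pi) • t)
    -- Here |2π(ξ - t)| lies between (3/4 - 2/3)2^i = 2^i/12 and (8/3 + 2/3)2^i. Since 8/3·2^(i-5) =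
    -- 2^i/12, a gap of five indices is exactly what the first case requires.
    have h5 : dyadicSymbol χ j ((2 * Real.pi) • (ξ - t)) = 0 := by
      rw [smul_sub]
      rcases hij with h | h
      · have h6 : (2 : ℝ) ^ (j + 5) ≤ 2 ^ i := zpow_le_zpow_right₀ (by norm_num) h
        rw [zpow_add₀ (by norm_num)] at h6
        norm_num at h6
        exact hχ.dyadicSymbol_eq_zero_of_ge (by linarith)
      · have h6 : (2 : ℝ) ^ (i + 5) ≤ 2 ^ j := zpow_le_zpow_right₀ (by norm_num) h
        rw [zpow_add₀ (by norm_num)] at h6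
        norm_num at h6
        exact hχ.dyadicSymbol_eq_zero_of_le (by linarith)
    simp [phiS_apply, h5]

/-- As `f` may be unbounded, its own spectrum is avoided: S_{i-1}f is a superposition of translated
kernels h(x - y) with weights f(y). By Fubini it suffices to treat each y, where the supports in
frequency are disjoint. -/
theorem lpBlock_smulLeft_lowFreq_eq_zero (hχ : IsLPCutoff χ) {i j : ℤ}
    (hij : j + 5 ≤ i ∨ i + 5 ≤ j) {f : R3 → ℝ} {L : ℝ} (hL : 0 ≤ L)
    (hf : ∀ x y, |f x - f y| ≤ L * ‖x - y‖) (P : Lp F 2 (volume : Measure R3)) :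
    lpBlock χ j (TemperedDistribution.smulLeftCLM F (lowFreq χ (i - 1) f)
      (multL2 (phiS hχ i) P : 𝓢'(R3, F))) = 0 := by
  ext ψ
  rw [lpBlock_eq hχ, TemperedDistribution.fourierMultiplierCLM_apply_apply,
    TemperedDistribution.smulLeftCLM_apply_apply]
  set η : 𝓢(R3, ℂ) := 𝓕 (SchwartzMap.smulLeftCLM ℂ (phiS hχ j) (𝓕⁻ ψ)) with hη
  set u : Lp F 2 (volume : Measure R3) := multL2 (phiS hχ i) P with hu
  set h : 𝓢(R3, ℂ) := 𝓕⁻ (lowS hχ (i - 1)) with hh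
  have hVg := hasTemperateGrowth_lowFreq hχ (i - 1) hL hf
  have hfc := continuous_of_lipschitz hf
  set A := |f 0| + L with hA
  have hA0 : 0 ≤ A := by positivity
  have hfA : ∀ y, |f y| ≤ A * (1 + ‖y‖) := abs_le_of_lipschitz hL hf
  have hum : AEStronglyMeasurable u volume := Lp.aestronglyMeasurable u
  have hG : Integrable (fun z : R3 × R3 => (f z.2 • h (z.1 - z.2) * η z.1) • u z.1)
      (volume.prod volume) := by
    have h1 : Integrable fun x => (1 + ‖x‖) * ‖h x‖ := by
      have := h.integrable.norm.add (h.integrable_pow_mul volume 1)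
      refine this.congr (.of_forall fun x => ?_)
      simp [add_mul]
    have h2 : Integrable fun x => A * ((1 + ‖x‖) * ‖η x‖) * ‖u x‖ := by
      have h3 := memLp_smul_schwartz (f := fun x : R3 => 1 + ‖x‖) (by fun_prop) (A := 1)
        (fun y => by rw [one_mul, abs_of_nonneg (by positivity)]) η
      have h4 := (h3.norm.integrable_mul (Lp.memLp u).norm).const_mul A
      refine h4.congr (.of_forall fun x => ?_)
      simp only [Pi.mul_apply]
      rw [norm_mul, Complex.norm_real, Real.norm_of_nonneg (by positivity)]
      ring
    refine (integrable_sub_mul_fst h1 h2).mono' ?_ (.of_forall fun z => ?_)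
    · have hhc := h.continuous
      have hηc := η.continuous
      refine AEStronglyMeasurable.smul (Continuous.aestronglyMeasurable ?_) hum.comp_fst
      fun_prop
    · rw [norm_smul, norm_mul, norm_smul, Real.norm_eq_abs]
      have h3 := hfA z.2
      have h4 := one_add_norm_le_mul z.1 z.2
      calc |f z.2| * ‖h (z.1 - z.2)‖ * ‖η z.1‖ * ‖u z.1‖
          ≤ (A * ((1 + ‖z.1‖) * (1 + ‖z.1 - z.2‖))) * ‖h (z.1 - z.2)‖ * ‖η z.1‖ * ‖u z.1‖ := by
            gcongr
            exact h3.trans (by gcongr)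
        _ = _ := by ring
  have hy (y : R3) : ∫ x, (f y • h (x - y) * η x) • u x = 0 := by
    have h1 : ∫ x, (f y • h (x - y) * η x) • u x = f y • (u : 𝓢'(R3, F))
        (SchwartzMap.smulLeftCLM ℂ (SchwartzMap.compSubConstCLM ℂ y h) η) := by
      rw [Lp.toTemperedDistribution_apply, ← integral_smul]
      refine integral_congr_ae (.of_forall fun x => ?_)
      beta_reduce
      rw [SchwartzMap.smulLeftCLM_apply_apply (SchwartzMap.hasTemperateGrowth _),
        SchwartzMap.compSubConstCLM_apply, smul_eq_mul, smul_mul_assoc, smul_assoc]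
    rw [h1, hu, coe_multL2, TemperedDistribution.fourierMultiplierCLM_apply_apply]
    have h2 : SchwartzMap.smulLeftCLM ℂ (phiS hχ i) (𝓕⁻ (SchwartzMap.smulLeftCLM ℂ
        (SchwartzMap.compSubConstCLM ℂ y h) η) : 𝓢(R3, ℂ)) = 0 := by
      ext ξ
      rw [SchwartzMap.smulLeftCLM_apply_apply (phiS hχ i).hasTemperateGrowth, smul_eq_mul]
      exact phiS_mul_fourierInv_eq_zero hχ hij y ξ (𝓕⁻ ψ)
    rw [h2, FourierTransform.fourier_zero, map_zero, smul_zero]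
  have hx (x : R3) : (SchwartzMap.smulLeftCLM ℂ (lowFreq χ (i - 1) f) η) x • u x =
      ∫ y, (f y • h (x - y) * η x) • u x := by
    rw [SchwartzMap.smulLeftCLM_apply_apply hVg, lowFreq_eq hχ, smul_eq_mul, ← integral_mul_const,
      ← integral_smul_const]
  rw [Lp.toTemperedDistribution_apply]
  simp_rw [hx]
  rw [integral_integral_swap hG]
  simp only [hy, integral_zero]
  rfl

end SpectralLocalization

/-! ### The localized paraconvection term -/

section Paraconvection

variable {χ : R3 → ℝ} {F : Type*} [NormedAddCommGroup F] [InnerProductSpace ℂ F]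

theorem fourierMultiplierCLM_add {g₁ g₂ : R3 → ℂ} (h₁ : g₁.HasTemperateGrowth)
    (h₂ : g₂.HasTemperateGrowth) (z : 𝓢'(R3, F)) :
    TemperedDistribution.fourierMultiplierCLM F (g₁ + g₂) z =
      TemperedDistribution.fourierMultiplierCLM F g₁ z +
        TemperedDistribution.fourierMultiplierCLM F g₂ z := by
  simp [TemperedDistribution.fourierMultiplierCLM_apply,
    TemperedDistribution.smulLeftCLM_add h₁ h₂, FourierTransform.fourierInv_add]

theorem fourierMultiplierCLM_comp {a b c : R3 → ℂ} (ha : a.HasTemperateGrowth)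
    (hb : b.HasTemperateGrowth) (h : ∀ ξ, a ξ * b ξ = c ξ) (z : 𝓢'(R3, F)) :
    TemperedDistribution.fourierMultiplierCLM F a
      (TemperedDistribution.fourierMultiplierCLM F b z) =
      TemperedDistribution.fourierMultiplierCLM F c z := by
  rw [TemperedDistribution.fourierMultiplierCLM_fourierMultiplierCLM_apply hb ha]
  congr 1
  congr 1
  funext ξ
  rw [← h, Pi.mul_apply, mul_comm]

theorem fourierMultiplierCLM_comm {a b : R3 → ℂ} (ha : a.HasTemperateGrowth)
    (hb : b.HasTemperateGrowth) (z : 𝓢'(R3, F)) :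
    TemperedDistribution.fourierMultiplierCLM F a
      (TemperedDistribution.fourierMultiplierCLM F b z) =
    TemperedDistribution.fourierMultiplierCLM F b
      (TemperedDistribution.fourierMultiplierCLM F a z) := by
  rw [fourierMultiplierCLM_comp ha hb (c := a * b) (fun _ => rfl),
    fourierMultiplierCLM_comp hb ha (c := a * b) (fun _ => mul_comm _ _)]

theorem fourierMultiplierCLM_fatS (hχ : IsLPCutoff χ) (i : ℤ) (z : 𝓢'(R3, F)) :
    TemperedDistribution.fourierMultiplierCLM F (fatS hχ i) z =
      lpBlock χ (i - 1) z + lpBlock χ i z + lpBlock χ (i + 1) z := by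
  have h : (fatS hχ i : R3 → ℂ) = (phiS hχ (i - 1) : R3 → ℂ) + phiS hχ i + phiS hχ (i + 1) := rfl
  have h1 := (phiS hχ (i - 1)).hasTemperateGrowth
  have h2 := (phiS hχ i).hasTemperateGrowth
  have h3 := (phiS hχ (i + 1)).hasTemperateGrowth
  rw [h, fourierMultiplierCLM_add (h1.add h2) h3, fourierMultiplierCLM_add h1 h2,
    ← lpBlock_eq, ← lpBlock_eq, ← lpBlock_eq]

theorem lpBlock_lineDeriv (hχ : IsLPCutoff χ) (i : ℤ) (k : Fin 3) (z : 𝓢'(R3, F)) :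
    lpBlock χ i (∂_{(EuclideanSpace.single k 1 : R3)} z) =
      TemperedDistribution.fourierMultiplierCLM F (derS hχ i k) (lpBlock χ i z) := by
  rw [TemperedDistribution.lineDeriv_eq_fourierMultiplierCLM, map_smul, lpBlock_eq hχ]
  have hin : (fun ξ : R3 => ((inner ℝ ξ (EuclideanSpace.single k 1 : R3) : ℝ) : ℂ)).HasTemperateGrowth := by
    fun_prop
  have hp := (phiS hχ i).hasTemperateGrowth
  rw [fourierMultiplierCLM_comp hp hin (c := fun ξ => phiS hχ i ξ * _) (fun ξ => rfl),
    fourierMultiplierCLM_comp (derS hχ i k).hasTemperateGrowth hp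
      (c := (2 * Real.pi * Complex.I) • fun ξ => phiS hχ i ξ * ((inner ℝ ξ (EuclideanSpace.single k 1 : R3) : ℝ) : ℂ)) (fun ξ => ?_)]
  · exact (congrArg (· z)
      (TemperedDistribution.fourierMultiplierCLM_smul (F := F) (hp.mul hin) _)).symm
  · rw [derS_apply, mul_assoc, fatS_mul_phiS, Pi.smul_apply, smul_eq_mul]
    ring

variable [CompleteSpace F]

/-- The pairing of an `L²` function with a scalar `L²` function. -/
def pairL2 {φ : R3 → ℂ} (hφ : MemLp φ 2 (volume : Measure R3)) :
    Lp F 2 (volume : Measure R3) →L[ℂ] F :=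
  ((ContinuousLinearMap.lsmul ℂ ℂ (E := F)).flip.lpPairing volume 2 2).flip (hφ.toLp φ)

theorem pairL2_apply {φ : R3 → ℂ} (hφ : MemLp φ 2 (volume : Measure R3))
    (f : Lp F 2 (volume : Measure R3)) : pairL2 hφ f = ∫ x, φ x • f x := by
  rw [pairL2, ContinuousLinearMap.flip_apply, ContinuousLinearMap.lpPairing_eq_integral]
  refine integral_congr_ae ?_
  filter_upwards [hφ.coeFn_toLp] with x hx
  simp [hx]

section

variable {z : 𝓢'(R3, F)} {Z : ℤ → Lp F 2 (volume : Measure R3)}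

theorem coe_multL2_derS (hχ : IsLPCutoff χ) (hZ : ∀ i, (Z i : 𝓢'(R3, F)) = lpBlock χ i z) (i : ℤ)
    (k : Fin 3) : (multL2 (derS hχ i k) (Z i) : 𝓢'(R3, F)) =
      lpBlock χ i (∂_{(EuclideanSpace.single k 1 : R3)} z) := by
  rw [coe_multL2, hZ, lpBlock_lineDeriv hχ]

/-- This exhibits a block as `phiS` applied to an `L²` function, the form required by
`lpBlock_smulLeft_lowFreq_eq_zero`. The distribution `z` itself need not be in `L²`. -/
theorem multL2_phiS_sum (hχ : IsLPCutoff χ) (hZ : ∀ i, (Z i : 𝓢'(R3, F)) = lpBlock χ i z) (i : ℤ) :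
    multL2 (phiS hχ i) (Z (i - 1) + Z i + Z (i + 1)) = Z i := by
  refine toTemperedDistribution_injective ?_
  rw [coe_multL2, coe_add_eq, coe_add_eq, hZ, hZ, hZ, ← fourierMultiplierCLM_fatS hχ,
    fourierMultiplierCLM_comp (phiS hχ i).hasTemperateGrowth (fatS hχ i).hasTemperateGrowth
      (fun ξ => (mul_comm _ _).trans (fatS_mul_phiS hχ i ξ)), lpBlock_eq hχ]

theorem multL2_comm (m n : 𝓢(R3, ℂ)) (f : Lp F 2 (volume : Measure R3)) :
    multL2 m (multL2 n f) = multL2 n (multL2 m f) := by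
  refine toTemperedDistribution_injective ?_
  simp only [coe_multL2]
  exact fourierMultiplierCLM_comm m.hasTemperateGrowth n.hasTemperateGrowth _

theorem paraconvBlock_eq_sum (hχ : IsLPCutoff χ) (hZ : ∀ i, (Z i : 𝓢'(R3, F)) = lpBlock χ i z)
    {v : R3 → R3} {g : ℝ} (hg : 0 ≤ g) (hv : ∀ x y, ‖v x - v y‖ ≤ g * ‖x - y‖) (j : ℤ) :
    paraconvBlock χ j v z = ∑ i ∈ Finset.Icc (j - 5) (j + 5), ∑ k : Fin 3,
      lpBlock χ j (TemperedDistribution.smulLeftCLM F (lowFreq χ (i - 1) (fun x => v x k))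
        (multL2 (derS hχ i k) (Z i) : 𝓢'(R3, F))) := by
  have hvk (k : Fin 3) (x y : R3) : |v x k - v y k| ≤ g * ‖x - y‖ := by
    refine le_trans ?_ (hv x y)
    have := PiLp.norm_apply_le (v x - v y) k
    simpa using this
  rw [paraconvBlock, tsum_eq_sum (s := Finset.Icc (j - 5) (j + 5))]
  · refine Finset.sum_congr rfl fun i _ => ?_
    rw [map_sum]
    refine Finset.sum_congr rfl fun k _ => ?_
    rw [coe_multL2_derS hχ hZ]
  · intro i hi
    rw [map_sum]
    refine Finset.sum_eq_zero fun k _ => ?_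
    rw [← coe_multL2_derS hχ hZ, ← multL2_phiS_sum hχ hZ, multL2_comm]
    refine lpBlock_smulLeft_lowFreq_eq_zero hχ ?_ hg (hvk k) _
    rw [Finset.mem_Icc] at hi
    omega

/-- On the support of the j-th symbol the blocks j - 1, j, j + 1 add up to the identity and the
others vanish. Thus the main terms left by the commutators recombine into a single derivative of the
j-th block. -/
theorem sum_multL2_derS (hχ : IsLPCutoff χ) (hZ : ∀ i, (Z i : 𝓢'(R3, F)) = lpBlock χ i z)
    {j : ℤ} {m n : 𝓢(R3, ℂ)} (hm : ∀ ξ, m ξ = n ξ * phiS hχ j ξ) (k : Fin 3) :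
    ∑ i ∈ Finset.Icc (j - 5) (j + 5), multL2 m (multL2 (derS hχ i k) (Z i)) =
      multL2 (derS hχ j k) (multL2 n (Z j)) := by
  refine toTemperedDistribution_injective ?_
  rw [coe_sum_eq]
  simp_rw [coe_multL2 m, coe_multL2_derS hχ hZ]
  set y := ∂_{(EuclideanSpace.single k 1 : R3)} z with hy
  have hmg := m.hasTemperateGrowth
  have hsub : ({j - 1, j, j + 1} : Finset ℤ) ⊆ Finset.Icc (j - 5) (j + 5) := by
    intro i hi
    simp only [Finset.mem_insert, Finset.mem_singleton] at hi
    rw [Finset.mem_Icc]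
    omega
  rw [← Finset.sum_subset hsub]
  · rw [Finset.sum_insert (by simp; omega), Finset.sum_insert (by simp), Finset.sum_singleton,
      ← map_add, ← map_add, ← add_assoc, ← fourierMultiplierCLM_fatS hχ,
      fourierMultiplierCLM_comp hmg (fatS hχ j).hasTemperateGrowth (c := m) (fun ξ => by
        rw [hm, mul_assoc, mul_comm (phiS hχ j ξ), fatS_mul_phiS]),
      ← fourierMultiplierCLM_comp n.hasTemperateGrowth (phiS hχ j).hasTemperateGrowth
        (fun ξ => (hm ξ).symm), ← lpBlock_eq hχ, hy, lpBlock_lineDeriv hχ, multL2_comm, coe_multL2,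
      coe_multL2, hZ]
  · intro i _ hi
    simp only [Finset.mem_insert, Finset.mem_singleton, not_or] at hi
    rw [lpBlock_eq hχ, fourierMultiplierCLM_comp hmg (phiS hχ i).hasTemperateGrowth
      (c := fun _ => 0) (fun ξ => ?_)]
    · rw [TemperedDistribution.fourierMultiplierCLM_const]
      simp
    · rw [hm, mul_assoc, phiS_apply, phiS_apply, ← Complex.ofReal_mul]
      rcases lt_or_gt_of_ne hi.2.1 with h | h
      · rw [mul_comm (dyadicSymbol χ j _), hχ.dyadicSymbol_mul_eq_zero (by omega)]
        simp
      · rw [hχ.dyadicSymbol_mul_eq_zero (by omega)]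
        simp

/-- The constant in the estimate of the paraconvection commutator. -/
def paraConst (hχ : IsLPCutoff χ) (M : 𝓢(R3, ℂ)) : ℝ :=
  36 * kerMoment (lowS hχ 0) * kerNorm M + 576 * kerMoment M

/-- The frequency localized paraconvection term is the transport of the localized function by the
vector field itself, up to a remainder that is controlled by the neighbouring blocks. -/
theorem exists_paraconvBlock_eq (hχ : IsLPCutoff χ) (hZ : ∀ i, (Z i : 𝓢'(R3, F)) = lpBlock χ i z)
    {j : ℤ} {n M : 𝓢(R3, ℂ)} {c : ℂ}
    (hn : ∀ ξ, n ξ * phiS hχ j ξ = c * M (((2 : ℝ) ^ j)⁻¹ • ξ))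
    {v : R3 → R3} {g : ℝ} (hg : 0 ≤ g) (hv : ∀ x y, ‖v x - v y‖ ≤ g * ‖x - y‖) :
    ∃ R : Lp F 2 (volume : Measure R3),
      ‖R‖ ≤ g * (paraConst hχ M * ‖c‖) * ∑ i ∈ Finset.Icc (j - 5) (j + 5), ‖Z i‖ ∧
      ∀ ψ : 𝓢(R3, ℂ),
        TemperedDistribution.fourierMultiplierCLM F n (paraconvBlock χ j v z) ψ =
          (∑ k : Fin 3, ∫ x, ((v x k : ℂ) * ψ x) • multL2 (derS hχ j k) (multL2 n (Z j)) x) +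
            (R : 𝓢'(R3, F)) ψ := by
  have hvk (k : Fin 3) (x y : R3) : |v x k - v y k| ≤ g * ‖x - y‖ := by
    refine le_trans ?_ (hv x y)
    have := PiLp.norm_apply_le (v x - v y) k
    simpa using this
  have h2j : (0 : ℝ) < 2 ^ j := by positivity
  set m : 𝓢(R3, ℂ) := SchwartzMap.smulLeftCLM ℂ n (phiS hχ j) with hm
  have hmx (ξ : R3) : m ξ = n ξ * phiS hχ j ξ := by
    rw [hm, SchwartzMap.smulLeftCLM_apply_apply n.hasTemperateGrowth, smul_eq_mul]
  have hms (ξ : R3) : m ξ = c * M (((2 : ℝ) ^ j)⁻¹ • ξ) := (hmx ξ).trans (hn ξ)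
  choose R hRn hR using fun (i : ℤ) (k : Fin 3) =>
    exists_commutator hχ m (i - 1) hg (hvk k) (multL2 (derS hχ i k) (Z i))
  refine ⟨∑ i ∈ Finset.Icc (j - 5) (j + 5), ∑ k : Fin 3, R i k, ?_, fun ψ => ?_⟩
  · rw [Finset.mul_sum]
    refine (norm_sum_le _ _).trans (Finset.sum_le_sum fun i hi => (norm_sum_le _ _).trans ?_)
    rw [Finset.mem_Icc] at hi
    -- One third for each component. The factor 6·2^i from ∂_k cancels against the mollification
    -- error of order 2^{-i}; against the first moment, of order 2^{-j}, it leaves 2^i·2^{-j} ≤ 32.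
    have h1 (k : Fin 3) : ‖R i k‖ ≤ g * (paraConst hχ M * ‖c‖) * ‖Z i‖ / 3 := by
      refine (hRn i k).trans ?_
      rw [kerNorm_scale h2j hms, kerMoment_scale h2j hms]
      have h2 := norm_multL2_le (norm_derS_le hχ i k) (Z i)
      have h3 : (2 : ℝ) ^ i ≤ 32 * 2 ^ j := by
        have : (2 : ℝ) ^ i ≤ 2 ^ (j + 5) := zpow_le_zpow_right₀ (by norm_num) hi.2
        rw [zpow_add₀ (by norm_num)] at this
        norm_num at this
        linarith
      have h2i : (0 : ℝ) < 2 ^ i := by positivity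
      have k1 := kerMoment_nonneg (lowS hχ 0)
      have k2 := kerMoment_nonneg M
      have k3 := kerNorm_nonneg M
      have h4 : ((2 : ℝ) ^ (i - 1))⁻¹ = 2 * (2 ^ i)⁻¹ := by
        rw [zpow_sub₀ (by norm_num)]
        field_simp
      have h5 : (2 : ℝ) ^ i * (2 ^ j)⁻¹ ≤ 32 := by
        rwa [← div_eq_mul_inv, div_le_iff₀ h2j]
      rw [h4]
      calc _ ≤ g * (kerMoment (lowS hχ 0) * (2 * (2 ^ i)⁻¹) * (‖c‖ * kerNorm M) +
            ‖c‖ * (2 ^ j)⁻¹ * kerMoment M) * (6 * 2 ^ i * ‖Z i‖) := by gcongr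
        _ = g * ‖c‖ * (12 * kerMoment (lowS hχ 0) * kerNorm M * ((2 ^ i)⁻¹ * 2 ^ i) +
            6 * kerMoment M * (2 ^ i * (2 ^ j)⁻¹)) * ‖Z i‖ := by ring
        _ ≤ g * ‖c‖ * (12 * kerMoment (lowS hχ 0) * kerNorm M * 1 +
            6 * kerMoment M * 32) * ‖Z i‖ := by
            rw [inv_mul_cancel₀ h2i.ne']
            gcongr
        _ = _ := by
            rw [paraConst]
            ring
    calc _ ≤ ∑ k : Fin 3, g * (paraConst hχ M * ‖c‖) * ‖Z i‖ / 3 :=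
          Finset.sum_le_sum fun k _ => h1 k
      _ = _ := by
          rw [Finset.sum_const, Finset.card_univ, Fintype.card_fin, nsmul_eq_mul]
          norm_num
          ring
  · have hf (k : Fin 3) := memLp_smul_schwartz (continuous_of_lipschitz (hvk k))
      (abs_le_of_lipschitz hg (hvk k)) ψ
    have hT (k : Fin 3) :
        ∫ x, ((v x k : ℂ) * ψ x) • multL2 (derS hχ j k) (multL2 n (Z j)) x =
        ∑ i ∈ Finset.Icc (j - 5) (j + 5),
          ∫ x, ((v x k : ℂ) * ψ x) • multL2 m (multL2 (derS hχ i k) (Z i)) x := by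
      simp_rw [← pairL2_apply (hf k)]
      rw [← sum_multL2_derS hχ hZ hmx k, map_sum]
    simp_rw [hT]
    rw [paraconvBlock_eq_sum hχ hZ hg hv, ← pairL_apply, map_sum, Finset.sum_comm,
      map_sum, ← Finset.sum_add_distrib]
    have happ (T : 𝓢'(R3, F)) : T ψ = PointwiseConvergenceCLM.evalCLM (RingHom.id ℂ) F ψ T := rfl
    rw [happ, map_sum]
    refine Finset.sum_congr rfl fun i _ => ?_
    rw [map_sum, map_sum, map_sum, ← Finset.sum_add_distrib]
    refine Finset.sum_congr rfl fun k _ => ?_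
    rw [← happ, lpBlock_eq hχ, fourierMultiplierCLM_comp n.hasTemperateGrowth
      (phiS hχ j).hasTemperateGrowth (fun ξ => (hmx ξ).symm), (hR i k ψ).2, pairL_apply]

end

end Paraconvection

/-! ### Multiplication by bounded functions on `L²` -/

section BoundedMultiplication

open Filter Topology

variable {F : Type*} [NormedAddCommGroup F] [InnerProductSpace ℂ F]

/-- Multiplication by a bounded real function, on `L²`. -/
def mulL {a : R3 → ℝ} (ha : MemLp a ∞ (volume : Measure R3)) :
    Lp F 2 (volume : Measure R3) →L[ℂ] Lp F 2 (volume : Measure R3) :=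
  (ContinuousLinearMap.lsmul ℂ ℂ (E := F)).holderL volume ∞ 2 2 (ha.ofReal (K := ℂ)).toLp

variable {a : R3 → ℝ} (ha : MemLp a ∞ (volume : Measure R3))

theorem coeFn_mulL (f : Lp F 2 (volume : Measure R3)) :
    mulL ha f =ᵐ[volume] fun x => (a x : ℂ) • f x := by
  have h := (ContinuousLinearMap.lsmul ℂ ℂ (E := F)).coeFn_holder (r := 2)
    ((ha.ofReal (K := ℂ)).toLp) f
  filter_upwards [h, (ha.ofReal (K := ℂ)).coeFn_toLp] with x h1 h2
  rw [mulL, ContinuousLinearMap.holderL_apply_apply, h1, h2]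
  rfl

theorem norm_mulL_le {C : ℝ} (hC : ∀ x, |a x| ≤ C) (f : Lp F 2 (volume : Measure R3)) :
    ‖mulL ha f‖ ≤ C * ‖f‖ := by
  refine Lp.norm_le_mul_norm_of_ae_le_mul ?_
  filter_upwards [coeFn_mulL ha f] with x hx
  rw [hx, norm_smul, Complex.norm_real, Real.norm_eq_abs]
  gcongr
  exact hC x

theorem pairL_mulL [CompleteSpace F] (ψ : 𝓢(R3, ℂ)) (f : Lp F 2 (volume : Measure R3)) :
    pairL ψ (mulL ha f) = ∫ x, ((a x : ℂ) * ψ x) • f x := by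
  rw [pairL_apply, Lp.toTemperedDistribution_apply]
  refine integral_congr_ae ?_
  filter_upwards [coeFn_mulL ha f] with x hx
  rw [hx, smul_smul, mul_comm]

theorem integrable_re_inner (u w : Lp F 2 (volume : Measure R3)) :
    Integrable fun x => (inner ℂ (u x) (w x)).re :=
  (L2.integrable_inner (𝕜 := ℂ) u w).re

theorem integrable_mul_re_inner {a : R3 → ℝ} (ha : MemLp a ∞ (volume : Measure R3))
    (u w : Lp F 2 (volume : Measure R3)) :
    Integrable fun x => a x * (inner ℂ (u x) (w x)).re := by
  refine (integrable_re_inner u (mulL ha w)).congr ?_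
  filter_upwards [coeFn_mulL ha w] with x hx
  rw [hx, inner_smul_right, Complex.re_ofReal_mul]

theorem re_inner_mulL (u w : Lp F 2 (volume : Measure R3)) :
    (inner ℂ u (mulL ha w)).re = ∫ x, a x * (inner ℂ (u x) (w x)).re := by
  have h1 : (inner ℂ u (mulL ha w)).re = ∫ x, (inner ℂ (u x) (mulL ha w x)).re := by
    rw [L2.inner_def]
    exact (integral_re (𝕜 := ℂ) (L2.integrable_inner u (mulL ha w))).symm
  rw [h1]
  refine integral_congr_ae ?_
  filter_upwards [coeFn_mulL ha w] with x hx
  rw [hx, inner_smul_right, Complex.re_ofReal_mul]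

theorem inner_mulL_mulL {b c : R3 → ℝ} (hb : MemLp b ∞ (volume : Measure R3))
    (hc : MemLp c ∞ (volume : Measure R3)) (h : ∀ x, a x * b x = c x)
    (u w : Lp F 2 (volume : Measure R3)) :
    inner ℂ (mulL ha u) (mulL hb w) = inner ℂ u (mulL hc w) := by
  rw [L2.inner_def, L2.inner_def]
  refine integral_congr_ae ?_
  filter_upwards [coeFn_mulL ha u, coeFn_mulL hb w, coeFn_mulL hc w] with x h1 h2 h3
  rw [h1, h2, h3, inner_smul_left, inner_smul_right, inner_smul_right, Complex.conj_ofReal,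
    ← mul_assoc, ← Complex.ofReal_mul, h]

theorem tendsto_re_inner_mulL {A : ℕ → R3 → ℝ} (hA : ∀ n, MemLp (A n) ∞ (volume : Measure R3))
    {C : ℝ} (hC : ∀ n x, |A n x| ≤ C) {a : R3 → ℝ} (ha : MemLp a ∞ (volume : Measure R3))
    (hlim : ∀ x, Tendsto (fun n => A n x) atTop (𝓝 (a x))) (u w : Lp F 2 (volume : Measure R3)) :
    Tendsto (fun n => (inner ℂ u (mulL (hA n) w)).re) atTop (𝓝 (inner ℂ u (mulL ha w)).re) := by
  simp_rw [re_inner_mulL]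
  refine tendsto_integral_of_dominated_convergence
    (fun x => C * |(inner ℂ (u x) (w x)).re|) (fun n =>
      (integrable_mul_re_inner (hA n) u w).aestronglyMeasurable)
    ((integrable_re_inner u w).norm.const_mul C) (fun n => .of_forall fun x => ?_)
    (.of_forall fun x => (hlim x).mul_const _)
  rw [Real.norm_eq_abs, abs_mul]
  gcongr
  exact hC n x

end BoundedMultiplication

/-! ### Integration by parts along a Lipschitz field -/

section TransportIdentity

variable {χ : R3 → ℝ} {F : Type*} [NormedAddCommGroup F] [InnerProductSpace ℂ F]

/-- Integration by parts between the Lipschitz function `f` and the compactly supported C¹ function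
ρ‖G‖². -/
theorem integral_transport_schwartz {f ρ : R3 → ℝ} {L : ℝ≥0} (hf : LipschitzWith L f)
    (hρ : ContDiff ℝ (⊤ : ℕ∞) ρ) (hρc : HasCompactSupport ρ) (e : R3) (G : 𝓢(R3, F)) :
    ∫ x, lineDeriv ℝ f x e * (ρ x * ‖G x‖ ^ 2) = ∫ x, -(lineDeriv ℝ ρ x e * ‖G x‖ ^ 2 +
      ρ x * (2 * (inner ℂ (G x) ((∂_{e} G) x)).re)) * f x := by
  let _ : InnerProductSpace ℝ F := InnerProductSpace.rclikeToReal ℂ F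
  have hG : ContDiff ℝ 1 G := G.smooth 1
  have hh : ContDiff ℝ 1 fun x => ρ x * ‖G x‖ ^ 2 :=
    (hρ.of_le (by exact_mod_cast le_top)).mul (hG.norm_sq ℝ)
  have hhc : HasCompactSupport fun x => ρ x * ‖G x‖ ^ 2 := hρc.mul_right
  obtain ⟨D, hD⟩ := ContDiff.lipschitzWith_of_hasCompactSupport hhc hh (by simp)
  rw [LipschitzWith.integral_lineDeriv_mul_eq hf hD hhc e]
  refine integral_congr_ae (.of_forall fun x => ?_)
  beta_reduce
  congr 1
  rw [lineDeriv_neg]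
  congr 1
  have h1 : HasLineDerivAt ℝ ρ (lineDeriv ℝ ρ x e) x e :=
    (hρ.differentiable (by simp)).differentiableAt.lineDifferentiableAt.hasLineDerivAt
  have h2 : HasLineDerivAt ℝ G ((∂_{e} G) x) x e := by
    rw [SchwartzMap.lineDerivOp_apply]
    exact (hG.differentiable (by simp)).differentiableAt.lineDifferentiableAt.hasLineDerivAt
  have h3 : HasLineDerivAt ℝ (fun x => ‖G x‖ ^ 2) (2 * (inner ℂ (G x) ((∂_{e} G) x)).re) x e := by
    have := HasDerivAt.norm_sq (h2 : HasDerivAt (fun t : ℝ => G (x + t • e)) _ 0)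
    simp only [zero_smul, add_zero] at this
    exact this
  refine HasLineDerivAt.lineDeriv ?_
  have h4 := HasDerivAt.mul (h1 : HasDerivAt (fun t : ℝ => ρ (x + t • e)) _ 0)
    (h3 : HasDerivAt (fun t : ℝ => ‖G (x + t • e)‖ ^ 2) _ 0)
  simp only [zero_smul, add_zero] at h4
  exact h4

/-- The transport operator along a Lipschitz vector field is skew-symmetric up to the divergence,
here in localized form and for one component of the field. -/
theorem re_inner_transport [CompleteSpace F] (hχ : IsLPCutoff χ) (j : ℤ) (k : Fin 3) {f ρ : R3 → ℝ} {L : ℝ≥0}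
    (hf : LipschitzWith L f) (hρ : ContDiff ℝ (⊤ : ℕ∞) ρ) (hρc : HasCompactSupport ρ)
    (h1 : MemLp (fun x => ρ x * f x) ∞ (volume : Measure R3))
    (h2 : MemLp (fun x => ρ x * lineDeriv ℝ f x (EuclideanSpace.single k 1) +
      f x * lineDeriv ℝ ρ x (EuclideanSpace.single k 1)) ∞ (volume : Measure R3))
    {u : Lp F 2 (volume : Measure R3)} (hu : multL2 (fatS hχ j) u = u) :
    2 * (inner ℂ u (mulL h1 (multL2 (derS hχ j k) u))).re = -(inner ℂ u (mulL h2 u)).re := by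
  -- Stated for all y in place of u = fatS(D)u, the identity is a closed condition, so Schwartz
  -- functions suffice. For those, `derS` is the classical derivative of the function localized by
  -- `fatS`.
  have key (y : Lp F 2 (volume : Measure R3)) :
      2 * (inner ℂ (multL2 (fatS hχ j) y) (mulL h1 (multL2 (derS hχ j k) y))).re =
        -(inner ℂ (multL2 (fatS hχ j) y) (mulL h2 (multL2 (fatS hχ j) y))).re := by
    refine (SchwartzMap.denseRange_toLpCLM (E := R3) (F := F) (p := 2) (μ := volume)
      (by norm_num)).induction_on y (isClosed_eq ?_ ?_) fun G₀ => ?_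
    · exact continuous_const.mul (Complex.continuous_re.comp (by fun_prop))
    · exact (Complex.continuous_re.comp (by fun_prop)).neg
    · set G : 𝓢(R3, F) := SchwartzMap.fourierMultiplierCLM F (fatS hχ j : R3 → ℂ) G₀ with hG
      have e1 : multL2 (fatS hχ j) (G₀.toLp 2 volume) = G.toLp 2 volume := by
        refine toTemperedDistribution_injective ?_
        rw [coe_multL2, Lp.toTemperedDistribution_toLp_eq, Lp.toTemperedDistribution_toLp_eq,
          TemperedDistribution.fourierMultiplierCLM_toTemperedDistributionCLM_eq
            (fatS hχ j).hasTemperateGrowth]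
      have e2 : multL2 (derS hχ j k) (G₀.toLp 2 volume) =
          (∂_{(EuclideanSpace.single k 1 : R3)} G).toLp 2 volume := by
        refine toTemperedDistribution_injective ?_
        rw [coe_multL2, Lp.toTemperedDistribution_toLp_eq, Lp.toTemperedDistribution_toLp_eq,
          ← TemperedDistribution.lineDerivOp_toTemperedDistributionCLM_eq,
          ← TemperedDistribution.fourierMultiplierCLM_toTemperedDistributionCLM_eq
            (fatS hχ j).hasTemperateGrowth,
          TemperedDistribution.lineDeriv_eq_fourierMultiplierCLM]
        have hin : (fun ξ : R3 =>
          ((inner ℝ ξ (EuclideanSpace.single k 1 : R3) : ℝ) : ℂ)).HasTemperateGrowth := by fun_prop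
        rw [fourierMultiplierCLM_comp hin (fatS hχ j).hasTemperateGrowth (fun ξ => rfl)]
        have hs : (derS hχ j k : R3 → ℂ) = (2 * Real.pi * Complex.I) • (fun ξ : R3 =>
            ((inner ℝ ξ (EuclideanSpace.single k 1 : R3) : ℝ) : ℂ) * fatS hχ j ξ) := by
          funext ξ
          rw [derS_apply, Pi.smul_apply, smul_eq_mul, mul_assoc]
        rw [hs]
        exact (congrArg (· (G₀ : 𝓢'(R3, F))) (TemperedDistribution.fourierMultiplierCLM_smul (F := F)
          (hin.mul (fatS hχ j).hasTemperateGrowth) _))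
      rw [SchwartzMap.toLpCLM_apply, e1, e2, re_inner_mulL, re_inner_mulL, ← integral_const_mul]
      have hGc := G.coeFn_toLp 2 volume
      have hDc := (∂_{(EuclideanSpace.single k 1 : R3)} G).coeFn_toLp 2 volume
      have i1 := (integrable_mul_re_inner h1 (G.toLp 2 volume)
        ((∂_{(EuclideanSpace.single k 1 : R3)} G).toLp 2 volume)).const_mul 2
      have i2 := integrable_mul_re_inner h2 (G.toLp 2 volume) (G.toLp 2 volume)
      have h3 := integral_transport_schwartz hf hρ hρc (EuclideanSpace.single k 1) G
      have iA : Integrable fun x => lineDeriv ℝ f x (EuclideanSpace.single k 1) *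
          (ρ x * ‖G x‖ ^ 2) := by
        refine Integrable.bdd_mul (c := L * ‖(EuclideanSpace.single k 1 : R3)‖) ?_
          (aestronglyMeasurable_lineDeriv hf.continuous _)
          (.of_forall fun x => norm_lineDeriv_le_of_lipschitz ℝ hf)
        exact (hρ.continuous.mul (G.continuous.norm.pow 2)).integrable_of_hasCompactSupport
          hρc.mul_right
      have hAB : (fun x => lineDeriv ℝ f x (EuclideanSpace.single k 1) * (ρ x * ‖G x‖ ^ 2) -
          (2 * (ρ x * f x * (inner ℂ (G.toLp 2 volume x)
            ((∂_{(EuclideanSpace.single k 1 : R3)} G).toLp 2 volume x)).re) +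
          (ρ x * lineDeriv ℝ f x (EuclideanSpace.single k 1) +
            f x * lineDeriv ℝ ρ x (EuclideanSpace.single k 1)) *
            (inner ℂ (G.toLp 2 volume x) (G.toLp 2 volume x)).re)) =ᵐ[volume]
          fun x => -(lineDeriv ℝ ρ x (EuclideanSpace.single k 1) * ‖G x‖ ^ 2 +
            ρ x * (2 * (inner ℂ (G x)
              ((∂_{(EuclideanSpace.single k 1 : R3)} G) x)).re)) * f x := by
        filter_upwards [hGc, hDc] with x hx1 hx2
        have h4 : (inner ℂ (G x) (G x)).re = ‖G x‖ ^ 2 := by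
          rw [inner_self_eq_norm_sq_to_K]
          norm_cast
        rw [hx1, hx2, h4]
        ring
      have h5 := h3.trans ((integral_congr_ae hAB).symm.trans (integral_sub iA (i1.add i2)))
      have h6 := integral_add i1 i2
      simp only at h5
      linarith
  have := key u
  rwa [hu] at this

end TransportIdentity

/-! ### Spatial cut-offs -/

section Cutoffs

open Filter Topology

variable {χ : R3 → ℝ}

/-- A spatial cut-off at scale `2^n`. -/
def cut (χ : R3 → ℝ) (n : ℕ) (x : R3) : ℝ := χ ((2 : ℝ) ^ (-(n : ℤ)) • ((2 * Real.pi) • x))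

/-- The factor 2π in `cut` is there for this coincidence: truncating a test function is
multiplication by an available Schwartz function. -/
theorem lowS_eq_cut (hχ : IsLPCutoff χ) (n : ℕ) (x : R3) : lowS hχ n x = (cut χ n x : ℂ) := rfl

theorem abs_cut_le (hχ : IsLPCutoff χ) (n : ℕ) (x : R3) : |cut χ n x| ≤ 1 := by
  rw [cut, abs_of_nonneg (hχ.nonneg _)]
  exact hχ.le_one _

theorem contDiff_cut (hχ : IsLPCutoff χ) (n : ℕ) : ContDiff ℝ (⊤ : ℕ∞) (cut χ n) := by
  have := hχ.smooth
  unfold cut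
  fun_prop

theorem cut_eq_zero (hχ : IsLPCutoff χ) {n : ℕ} {x : R3} (h : (2 : ℝ) ^ n ≤ ‖x‖) :
    cut χ n x = 0 := by
  refine hχ.eq_zero _ ?_
  rw [norm_zpow_smul, norm_two_pi_smul, zpow_neg, zpow_natCast, le_inv_mul_iff₀ (by positivity)]
  nlinarith [Real.pi_gt_three, norm_nonneg x]

theorem cut_eq_one (hχ : IsLPCutoff χ) {n : ℕ} {x : R3} (h : 2 * Real.pi * ‖x‖ ≤ 3 / 4 * 2 ^ n) :
    cut χ n x = 1 := by
  refine hχ.eq_one _ ?_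
  rw [norm_zpow_smul, norm_two_pi_smul, zpow_neg, zpow_natCast, inv_mul_le_iff₀ (by positivity)]
  linarith

theorem hasCompactSupport_cut (hχ : IsLPCutoff χ) (n : ℕ) : HasCompactSupport (cut χ n) := by
  refine HasCompactSupport.intro (isCompact_closedBall (0 : R3) (2 ^ n)) fun x hx => ?_
  rw [Metric.mem_closedBall, dist_zero_right, not_le] at hx
  exact cut_eq_zero hχ hx.le

theorem eventually_cut_eq_one (hχ : IsLPCutoff χ) (x : R3) :
    ∀ᶠ n in atTop, ∀ᶠ y in 𝓝 x, cut χ n y = 1 := by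
  have h1 : Tendsto (fun n : ℕ => 3 / 4 * (2 : ℝ) ^ n) atTop atTop :=
    (tendsto_pow_atTop_atTop_of_one_lt (by norm_num)).const_mul_atTop (by norm_num)
  filter_upwards [h1.eventually_ge_atTop (2 * Real.pi * (‖x‖ + 1))] with n hn
  filter_upwards [Metric.ball_mem_nhds x one_pos] with y hy
  refine cut_eq_one hχ (le_trans ?_ hn)
  rw [Metric.mem_ball, dist_eq_norm] at hy
  have := norm_le_norm_add_norm_sub' y x
  gcongr
  linarith

/-- All cut-offs are dilations of the one with n = 0, whose square is Lipschitz. -/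
theorem exists_lineDeriv_cut_sq_le (hχ : IsLPCutoff χ) : ∃ D : ℝ, 0 ≤ D ∧ ∀ n x e, ‖e‖ = 1 →
    |lineDeriv ℝ (fun x => cut χ n x * cut χ n x) x e| ≤ D * (2 ^ n)⁻¹ := by
  obtain ⟨D, hD⟩ := ContDiff.lipschitzWith_of_hasCompactSupport (𝕂 := ℝ)
    (hasCompactSupport_cut hχ 0).mul_right ((contDiff_cut hχ 0).mul (contDiff_cut hχ 0)) (by simp)
  refine ⟨D, D.2, fun n x e he => ?_⟩
  have hs (x : R3) : cut χ n x = cut χ 0 (((2 : ℝ) ^ n)⁻¹ • x) := by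
    simp [cut, smul_comm (2 * Real.pi)]
  have h1 : LipschitzWith (Real.toNNReal (D * (2 ^ n)⁻¹)) (fun x => cut χ n x * cut χ n x) := by
    refine LipschitzWith.of_dist_le' fun x y => ?_
    have h2 := hD.dist_le_mul (((2 : ℝ) ^ n)⁻¹ • x) (((2 : ℝ) ^ n)⁻¹ • y)
    simp only [hs]
    refine h2.trans_eq ?_
    rw [dist_smul₀, Real.norm_of_nonneg (by positivity), mul_assoc]
  have := norm_lineDeriv_le_of_lipschitz ℝ (x₀ := x) (v := e) h1
  rw [he, mul_one, Real.coe_toNNReal _ (by positivity)] at this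
  exact this

theorem lineDeriv_const_eq_zero (c : ℝ) (x e : R3) : lineDeriv ℝ (fun _ : R3 => c) x e = 0 := by
  simp [lineDeriv]

end Cutoffs

/-! ### Energy of truncated transported functions -/

section LocalEnergy

open Filter Topology

variable {χ : R3 → ℝ} {F : Type*} [NormedAddCommGroup F] [InnerProductSpace ℂ F]
  {v : R3 → R3} {g : ℝ}

theorem abs_apply_sub_le (hv : ∀ x y, ‖v x - v y‖ ≤ g * ‖x - y‖) (k : Fin 3) (x y : R3) :
    |v x k - v y k| ≤ g * ‖x - y‖ := by
  refine le_trans ?_ (hv x y)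
  have := PiLp.norm_apply_le (v x - v y) k
  simpa using this

theorem abs_apply_le (hv : ∀ x y, ‖v x - v y‖ ≤ g * ‖x - y‖) (k : Fin 3) (x : R3) :
    |v x k| ≤ ‖v 0‖ + g * ‖x‖ := by
  have h1 := abs_apply_sub_le hv k x 0
  rw [sub_zero] at h1
  have h2 := PiLp.norm_apply_le (v 0) k
  rw [Real.norm_eq_abs] at h2
  linarith [abs_sub_abs_le_abs_sub (v x k) (v 0 k)]

theorem continuous_component (hv : ∀ x y, ‖v x - v y‖ ≤ g * ‖x - y‖) (k : Fin 3) :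
    Continuous fun x => v x k :=
  continuous_of_lipschitz (abs_apply_sub_le hv k)

theorem lipschitzWith_apply (hv : ∀ x y, ‖v x - v y‖ ≤ g * ‖x - y‖) (hg : 0 ≤ g) (k : Fin 3) :
    LipschitzWith ⟨g, hg⟩ fun x => v x k :=
  LipschitzWith.of_dist_le_mul fun x y => by
    rw [Real.dist_eq, dist_eq_norm]
    exact abs_apply_sub_le hv k x y

theorem abs_cut_mul_le (hχ : IsLPCutoff χ) (hg : 0 ≤ g) (hv : ∀ x y, ‖v x - v y‖ ≤ g * ‖x - y‖)
    (n : ℕ) (k : Fin 3) (x : R3) : |cut χ n x * v x k| ≤ ‖v 0‖ + g * 2 ^ n := by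
  rcases le_total ((2 : ℝ) ^ n) ‖x‖ with h | h
  · rw [cut_eq_zero hχ h, zero_mul, abs_zero]
    positivity
  · rw [abs_mul]
    calc |cut χ n x| * |v x k| ≤ 1 * (‖v 0‖ + g * ‖x‖) := by
          gcongr
          exacts [abs_cut_le hχ n x, abs_apply_le hv k x]
      _ ≤ _ := by rw [one_mul]; gcongr

theorem memLp_cut (hχ : IsLPCutoff χ) (n : ℕ) : MemLp (cut χ n) ∞ (volume : Measure R3) :=
  memLp_top_of_bound (contDiff_cut hχ n).continuous.aestronglyMeasurable 1
    (.of_forall (abs_cut_le hχ n))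

theorem memLp_cut_sq (hχ : IsLPCutoff χ) (n : ℕ) :
    MemLp (fun x => cut χ n x * cut χ n x) ∞ (volume : Measure R3) := by
  have hc := (contDiff_cut hχ n).continuous
  refine memLp_top_of_bound (hc.mul hc).aestronglyMeasurable 1 (.of_forall fun x => ?_)
  rw [norm_mul, Real.norm_eq_abs]
  nlinarith [abs_cut_le hχ n x, abs_nonneg (cut χ n x)]

theorem memLp_cut_mul (hχ : IsLPCutoff χ) (hg : 0 ≤ g) (hv : ∀ x y, ‖v x - v y‖ ≤ g * ‖x - y‖)
    (n : ℕ) (k : Fin 3) : MemLp (fun x => cut χ n x * v x k) ∞ (volume : Measure R3) :=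
  memLp_top_of_bound
    ((contDiff_cut hχ n).continuous.mul (continuous_component hv k)).aestronglyMeasurable _
    (.of_forall (abs_cut_mul_le hχ hg hv n k))

theorem memLp_cut_sq_mul (hχ : IsLPCutoff χ) (hg : 0 ≤ g)
    (hv : ∀ x y, ‖v x - v y‖ ≤ g * ‖x - y‖)
    (n : ℕ) (k : Fin 3) : MemLp (fun x => cut χ n x * cut χ n x * v x k) ∞ (volume : Measure R3) := by
  have hc := (contDiff_cut hχ n).continuous
  refine memLp_top_of_bound
    ((hc.mul hc).mul (continuous_component hv k)).aestronglyMeasurable (‖v 0‖ + g * 2 ^ n)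
    (.of_forall fun x => ?_)
  rw [mul_assoc, norm_mul, Real.norm_eq_abs, Real.norm_eq_abs]
  have h1 := abs_cut_le hχ n x
  have h2 := abs_cut_mul_le hχ hg hv n k x
  nlinarith [abs_nonneg (cut χ n x * v x k), abs_nonneg (cut χ n x)]

theorem norm_single_one (k : Fin 3) : ‖(EuclideanSpace.single k 1 : R3)‖ = 1 := by simp

theorem abs_lineDeriv_apply_le (hg : 0 ≤ g) (hv : ∀ x y, ‖v x - v y‖ ≤ g * ‖x - y‖) (k : Fin 3)
    (x : R3) : |lineDeriv ℝ (fun x => v x k) x (EuclideanSpace.single k 1)| ≤ g := by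
  have := norm_lineDeriv_le_of_lipschitz ℝ (x₀ := x) (v := (EuclideanSpace.single k 1 : R3))
    (lipschitzWith_apply hv hg k)
  rw [norm_single_one, mul_one] at this
  exact this

theorem memLp_lineDeriv_apply (hg : 0 ≤ g) (hv : ∀ x y, ‖v x - v y‖ ≤ g * ‖x - y‖) (k : Fin 3) :
    MemLp (fun x => lineDeriv ℝ (fun x => v x k) x (EuclideanSpace.single k 1)) ∞
      (volume : Measure R3) :=
  memLp_top_of_bound (aestronglyMeasurable_lineDeriv (continuous_component hv k) _) g
    (.of_forall (abs_lineDeriv_apply_le hg hv k))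

/-- The `k`-th term in the divergence of the truncated vector field. -/
def cutDiv (χ : R3 → ℝ) (v : R3 → R3) (n : ℕ) (k : Fin 3) (x : R3) : ℝ :=
  cut χ n x * cut χ n x * lineDeriv ℝ (fun x => v x k) x (EuclideanSpace.single k 1) +
    v x k * lineDeriv ℝ (fun x => cut χ n x * cut χ n x) x (EuclideanSpace.single k 1)

/-- On the support of the cut-off the field grows at most like 2^n, while the gradient of the
squared cut-off is of order 2^{-n}. The bound is therefore uniform in n. -/
theorem exists_cutDiv_le (hχ : IsLPCutoff χ) : ∃ D : ℝ, 0 ≤ D ∧ ∀ {v : R3 → R3} {g : ℝ}, 0 ≤ g →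
    (∀ x y, ‖v x - v y‖ ≤ g * ‖x - y‖) → ∀ n k x, |cutDiv χ v n k x| ≤ g + D * (‖v 0‖ + g) := by
  obtain ⟨D, hD0, hD⟩ := exists_lineDeriv_cut_sq_le hχ
  refine ⟨D, hD0, fun {v g} hg hv n k x => ?_⟩
  refine (abs_add_le _ _).trans (add_le_add ?_ ?_)
  · rw [abs_mul, abs_mul]
    have h1 := abs_cut_le hχ n x
    have h2 := abs_lineDeriv_apply_le hg hv k x
    have h3 : |cut χ n x| * |cut χ n x| ≤ 1 * 1 := by gcongr
    calc _ ≤ 1 * 1 * g := by gcongr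
      _ = g := by ring
  · rcases lt_or_ge ((2 : ℝ) ^ n) ‖x‖ with h | h
    · have h1 : (fun x => cut χ n x * cut χ n x) =ᶠ[𝓝 x] fun _ => 0 := by
        filter_upwards [continuous_norm.continuousAt.eventually (lt_mem_nhds h)] with y hy
        rw [cut_eq_zero hχ (le_of_lt hy), zero_mul]
      rw [h1.lineDeriv_eq, lineDeriv_const_eq_zero, mul_zero, abs_zero]
      positivity
    · rw [abs_mul]
      have h2n : (0 : ℝ) < 2 ^ n := by positivity
      have h1 : (1 : ℝ) ≤ 2 ^ n := one_le_pow₀ (by norm_num)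
      calc _ ≤ (‖v 0‖ + g * 2 ^ n) * (D * (2 ^ n)⁻¹) := by
            gcongr
            · exact (abs_apply_le hv k x).trans (by gcongr)
            · exact hD n x _ (norm_single_one k)
        _ ≤ (‖v 0‖ * 2 ^ n + g * 2 ^ n) * (D * (2 ^ n)⁻¹) := by
            gcongr
            exact le_mul_of_one_le_right (norm_nonneg _) h1
        _ = D * (‖v 0‖ + g) := by
            field_simp

theorem memLp_cutDiv (hχ : IsLPCutoff χ) (hg : 0 ≤ g) (hv : ∀ x y, ‖v x - v y‖ ≤ g * ‖x - y‖)
    (n : ℕ) (k : Fin 3) : MemLp (cutDiv χ v n k) ∞ (volume : Measure R3) := by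
  obtain ⟨D, -, hD⟩ := exists_cutDiv_le hχ
  have hc := (contDiff_cut hχ n).continuous
  refine memLp_top_of_bound ?_ _ (.of_forall (hD hg hv n k))
  exact ((hc.mul hc).aestronglyMeasurable.mul
    (aestronglyMeasurable_lineDeriv (continuous_component hv k) _)).add
    ((continuous_component hv k).aestronglyMeasurable.mul
      (aestronglyMeasurable_lineDeriv (hc.mul hc) _))

theorem tendsto_cutDiv (hχ : IsLPCutoff χ) (v : R3 → R3) (k : Fin 3) (x : R3) :
    Tendsto (fun n => cutDiv χ v n k x) atTop
      (𝓝 (lineDeriv ℝ (fun x => v x k) x (EuclideanSpace.single k 1))) := by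
  refine tendsto_const_nhds.congr' ?_
  filter_upwards [eventually_cut_eq_one hχ x] with n hn
  have h1 : (fun x => cut χ n x * cut χ n x) =ᶠ[𝓝 x] fun _ => 1 := by
    filter_upwards [hn] with y hy
    rw [hy, one_mul]
  rw [cutDiv, h1.lineDeriv_eq, lineDeriv_const_eq_zero, hn.self_of_nhds]
  ring

theorem re_inner_self_mulL_le (U : Lp F 2 (volume : Measure R3)) {a : R3 → ℝ} (ha : MemLp a ∞ (volume : Measure R3)) {C : ℝ}
    (hC : ∀ x, |a x| ≤ C) : |(inner ℂ U (mulL ha U)).re| ≤ C * ‖U‖ ^ 2 := by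
  refine (Complex.abs_re_le_norm _).trans ((norm_inner_le_norm _ _).trans ?_)
  have := norm_mulL_le ha hC U
  nlinarith [norm_nonneg U]

theorem tendsto_re_inner_cut_sq (hχ : IsLPCutoff χ) (U Φ : Lp F 2 (volume : Measure R3)) :
    Tendsto (fun n => (inner ℂ U (mulL (memLp_cut_sq hχ n) Φ)).re) atTop
      (𝓝 (inner ℂ U Φ).re) := by
  have h1 : MemLp (fun _ : R3 => (1 : ℝ)) ∞ (volume : Measure R3) := memLp_top_const 1
  have h2 : mulL h1 Φ = Φ := by
    refine Lp.ext ?_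
    filter_upwards [coeFn_mulL h1 Φ] with x hx
    rw [hx, Complex.ofReal_one, one_smul]
  have := tendsto_re_inner_mulL (memLp_cut_sq hχ) (C := 1) (fun n x => by
    rw [abs_mul]
    nlinarith [abs_cut_le hχ n x, abs_nonneg (cut χ n x)]) h1 (fun x => by
    refine tendsto_const_nhds.congr' ?_
    filter_upwards [eventually_cut_eq_one hχ x] with n hn
    rw [hn.self_of_nhds, one_mul]) U Φ
  rwa [h2] at this

/-- The divergence form `∫ (div v) |u|²`. -/
def divForm (hg : 0 ≤ g) (hv : ∀ x y, ‖v x - v y‖ ≤ g * ‖x - y‖)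
    (U : Lp F 2 (volume : Measure R3)) : ℝ := ∑ k, (inner ℂ U (mulL (memLp_lineDeriv_apply hg hv k) U)).re

theorem abs_divForm_le (hg : 0 ≤ g) (hv : ∀ x y, ‖v x - v y‖ ≤ g * ‖x - y‖)
    (U : Lp F 2 (volume : Measure R3)) : |divForm hg hv U| ≤ 3 * g * ‖U‖ ^ 2 := by
  refine (Finset.abs_sum_le_sum_abs _ _).trans ((Finset.sum_le_sum fun k _ =>
    re_inner_self_mulL_le U _ (abs_lineDeriv_apply_le hg hv k)).trans_eq ?_)
  rw [Finset.sum_const, Finset.card_univ, Fintype.card_fin, nsmul_eq_mul]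
  push_cast
  ring

variable [CompleteSpace F]

/-- The time derivative of the truncation of a transported function. -/
def cutRhs (hχ : IsLPCutoff χ) (hg : 0 ≤ g) (hv : ∀ x y, ‖v x - v y‖ ≤ g * ‖x - y‖) (j : ℤ) (n : ℕ)
    (U Φ : Lp F 2 (volume : Measure R3)) : Lp F 2 (volume : Measure R3) :=
  mulL (memLp_cut hχ n) Φ - ∑ k, mulL (memLp_cut_mul hχ hg hv n k) (multL2 (derS hχ j k) U)

variable (hχ : IsLPCutoff χ) (hg : 0 ≤ g) (hv : ∀ x y, ‖v x - v y‖ ≤ g * ‖x - y‖) (j : ℤ) (n : ℕ)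
    (U Φ : Lp F 2 (volume : Measure R3))

theorem pairL_mulL_cut (ψ : 𝓢(R3, ℂ)) (f : Lp F 2 (volume : Measure R3)) :
    pairL ψ (mulL (memLp_cut hχ n) f) = pairL (SchwartzMap.smulLeftCLM ℂ (lowS hχ n) ψ) f := by
  rw [pairL_mulL, pairL_apply, Lp.toTemperedDistribution_apply]
  refine integral_congr_ae (.of_forall fun x => ?_)
  beta_reduce
  rw [SchwartzMap.smulLeftCLM_apply_apply (lowS hχ n).hasTemperateGrowth, lowS_eq_cut, smul_eq_mul]

theorem pairL_cutRhs (ψ : 𝓢(R3, ℂ)) : pairL ψ (cutRhs hχ hg hv j n U Φ) =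
    pairL (SchwartzMap.smulLeftCLM ℂ (lowS hχ n) ψ) Φ - ∑ k, ∫ x, ((v x k : ℂ) *
      (SchwartzMap.smulLeftCLM ℂ (lowS hχ n) ψ) x) • multL2 (derS hχ j k) U x := by
  rw [cutRhs, map_sub, map_sum, pairL_mulL_cut hχ]
  congr 1
  refine Finset.sum_congr rfl fun k _ => ?_
  rw [pairL_mulL]
  refine integral_congr_ae (.of_forall fun x => ?_)
  beta_reduce
  rw [SchwartzMap.smulLeftCLM_apply_apply (lowS hχ n).hasTemperateGrowth, lowS_eq_cut, smul_eq_mul]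
  push_cast
  ring_nf

/-- This bound deteriorates with n. It only serves to make the truncated time derivative Bochner
integrable for fixed n. -/
theorem norm_cutRhs_le : ‖cutRhs hχ hg hv j n U Φ‖ ≤
    ‖Φ‖ + 18 * 2 ^ j * ((‖v 0‖ + g * 2 ^ n) * ‖U‖) := by
  refine (norm_sub_le _ _).trans (add_le_add ?_ ?_)
  · simpa using norm_mulL_le (memLp_cut hχ n) (abs_cut_le hχ n) Φ
  · have h1 (k : Fin 3) : ‖mulL (memLp_cut_mul hχ hg hv n k) (multL2 (derS hχ j k) U)‖ ≤
        (‖v 0‖ + g * 2 ^ n) * (6 * 2 ^ j * ‖U‖) := by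
      refine (norm_mulL_le _ (abs_cut_mul_le hχ hg hv n k) _).trans ?_
      gcongr
      exact norm_multL2_le (norm_derS_le hχ j k) U
    refine (norm_sum_le _ _).trans ((Finset.sum_le_sum fun k _ => h1 k).trans_eq ?_)
    rw [Finset.sum_const, Finset.card_univ, Fintype.card_fin, nsmul_eq_mul]
    push_cast
    ring

/-- With ρ the cut-off, both factors ρ are moved to one side. Then integration by parts turns the
transport by ρ²v into the divergence of ρ²v against ‖U‖². -/
theorem re_inner_cutRhs (hU : multL2 (fatS hχ j) U = U) :
    2 * (inner ℂ (mulL (memLp_cut hχ n) U) (cutRhs hχ hg hv j n U Φ)).re =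
      2 * (inner ℂ U (mulL (memLp_cut_sq hχ n) Φ)).re +
        ∑ k, (inner ℂ U (mulL (memLp_cutDiv hχ hg hv n k) U)).re := by
  have hc := contDiff_cut hχ n
  have h1 (k : Fin 3) : 2 * (inner ℂ U (mulL (memLp_cut_sq_mul hχ hg hv n k)
      (multL2 (derS hχ j k) U))).re = -(inner ℂ U (mulL (memLp_cutDiv hχ hg hv n k) U)).re :=
    re_inner_transport hχ j k (lipschitzWith_apply hv hg k) (hc.mul hc)
      (hasCompactSupport_cut hχ n).mul_right _ _ hU
  rw [cutRhs, inner_sub_right, inner_sum, Complex.sub_re, Complex.re_sum,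
    inner_mulL_mulL _ _ (memLp_cut_sq hχ n) (fun _ => rfl)]
  simp_rw [inner_mulL_mulL (memLp_cut hχ n) _ (memLp_cut_sq_mul hχ hg hv n _)
    (fun x => (mul_assoc (cut χ n x) (cut χ n x) _).symm)]
  rw [mul_sub, Finset.mul_sum, sub_eq_add_neg, ← Finset.sum_neg_distrib]
  congr 1
  refine Finset.sum_congr rfl fun k _ => ?_
  rw [h1, neg_neg]

theorem tendsto_re_inner_cutRhs (hU : multL2 (fatS hχ j) U = U) :
    Tendsto (fun n => 2 * (inner ℂ (mulL (memLp_cut hχ n) U) (cutRhs hχ hg hv j n U Φ)).re) atTop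
      (𝓝 (2 * (inner ℂ U Φ).re + divForm hg hv U)) := by
  simp_rw [re_inner_cutRhs hχ hg hv j _ U Φ hU]
  obtain ⟨D, -, hD⟩ := exists_cutDiv_le hχ
  refine ((tendsto_re_inner_cut_sq hχ U Φ).const_mul 2).add (tendsto_finsetSum _ fun k _ => ?_)
  exact tendsto_re_inner_mulL (fun n => memLp_cutDiv hχ hg hv n k) (fun n => hD hg hv n k)
    (memLp_lineDeriv_apply hg hv k) (tendsto_cutDiv hχ v k) U U

/-- In contrast to `norm_cutRhs_le`, this bound is uniform in n and dominates the passage to the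
limit. -/
theorem exists_re_inner_cutRhs_le : ∃ D : ℝ, 0 ≤ D ∧ ∀ {v : R3 → R3} {g : ℝ} (hg : 0 ≤ g)
    (hv : ∀ x y, ‖v x - v y‖ ≤ g * ‖x - y‖) (n : ℕ) (U Φ : Lp F 2 (volume : Measure R3)),
    multL2 (fatS hχ j) U = U →
    |2 * (inner ℂ (mulL (memLp_cut hχ n) U) (cutRhs hχ hg hv j n U Φ)).re| ≤
      2 * (‖U‖ * ‖Φ‖) + 3 * ((g + D * (‖v 0‖ + g)) * ‖U‖ ^ 2) := by
  obtain ⟨D, hD0, hD⟩ := exists_cutDiv_le hχ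
  refine ⟨D, hD0, fun {v g} hg hv n U Φ hU => ?_⟩
  rw [re_inner_cutRhs hχ hg hv j n U Φ hU]
  refine (abs_add_le _ _).trans (add_le_add ?_ ?_)
  · rw [abs_mul, abs_two]
    gcongr
    refine (Complex.abs_re_le_norm _).trans ((norm_inner_le_norm _ _).trans ?_)
    gcongr
    have := norm_mulL_le (memLp_cut_sq hχ n) (C := 1) (fun x => by
      rw [abs_mul]
      nlinarith [abs_cut_le hχ n x, abs_nonneg (cut χ n x)]) Φ
    rwa [one_mul] at this
  · refine (Finset.abs_sum_le_sum_abs _ _).trans ((Finset.sum_le_sum fun k _ =>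
      re_inner_self_mulL_le U _ (hD hg hv n k)).trans_eq ?_)
    rw [Finset.sum_const, Finset.card_univ, Fintype.card_fin, nsmul_eq_mul]
    push_cast
    ring

end LocalEnergy

/-! ### The energy identity for transported functions -/

section TransportEnergy

open Filter Topology

theorem HasPrimitive.of_tendsto {T : ℝ} (hT : 0 ≤ T) {Y P : ℕ → ℝ → ℝ} {y p G : ℝ → ℝ}
    (h : ∀ n, HasPrimitive T (Y n) (P n))
    (hY : ∀ t ∈ Icc 0 T, Tendsto (fun n => Y n t) atTop (𝓝 (y t)))
    (hP : ∀ᵐ τ ∂(volume.restrict (Ioc 0 T)), Tendsto (fun n => P n τ) atTop (𝓝 (p τ)))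
    (hG : IntervalIntegrable G volume 0 T)
    (hle : ∀ n, ∀ᵐ τ ∂(volume.restrict (Ioc 0 T)), |P n τ| ≤ G τ) : HasPrimitive T y p := by
  have hm (n : ℕ) : AEStronglyMeasurable (P n) (volume.restrict (Ioc 0 T)) :=
    ((intervalIntegrable_iff_integrableOn_Ioc_of_le hT).1 (h n).integrable).aestronglyMeasurable
  have hp : IntervalIntegrable p volume 0 T := by
    rw [intervalIntegrable_iff_integrableOn_Ioc_of_le hT] at hG ⊢
    refine hG.mono' (aestronglyMeasurable_of_tendsto_ae _ hm hP) ?_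
    filter_upwards [ae_all_iff.2 hle, hP] with τ h1 h2
    exact le_of_tendsto h2.norm (.of_forall h1)
  refine ⟨hp, fun t ht => ?_⟩
  have hsub : Ioc 0 t ⊆ Ioc 0 T := Ioc_subset_Ioc_right ht.2
  refine tendsto_nhds_unique (hY t ht) ?_
  simp_rw [fun n => (h n).eq t ht]
  refine (hY 0 ⟨le_rfl, hT⟩).add ?_
  refine intervalIntegral.tendsto_integral_filter_of_dominated_convergence G
    (.of_forall fun n => ?_) (.of_forall fun n => ?_) ?_ ?_
  · rw [uIoc_of_le ht.1]
    exact (hm n).mono_set hsub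
  · rw [uIoc_of_le ht.1, ← ae_restrict_iff' measurableSet_Ioc]
    exact ae_restrict_of_ae_restrict_of_subset hsub (hle n)
  · rw [intervalIntegrable_iff_integrableOn_Ioc_of_le ht.1]
    rw [intervalIntegrable_iff_integrableOn_Ioc_of_le hT] at hG
    exact hG.mono_set hsub
  · rw [uIoc_of_le ht.1, ← ae_restrict_iff' measurableSet_Ioc]
    exact ae_restrict_of_ae_restrict_of_subset hsub hP

variable {χ : R3 → ℝ} {F : Type*} [NormedAddCommGroup F] [InnerProductSpace ℂ F] [CompleteSpace F]

theorem eq_of_pairL_eq {f g : Lp F 2 (volume : Measure R3)} (h : ∀ ψ, pairL ψ f = pairL ψ g) :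
    f = g := by
  refine toTemperedDistribution_injective ?_
  ext ψ
  rw [← pairL_apply, h, pairL_apply]

/-- A function orthogonal to the ranges of all adjoint pairings has vanishing pairings and is zero.
Hence these ranges span a dense subspace, and weak measurability against it suffices. -/
theorem aestronglyMeasurable_of_pairL [SecondCountableTopology F] {α : Type*} [MeasurableSpace α]
    {μ : Measure α} {p : α → Lp F 2 (volume : Measure R3)}
    (h : ∀ ψ, AEStronglyMeasurable (fun a => pairL ψ (p a)) μ) : AEStronglyMeasurable p μ := by
  set S : Set (Lp F 2 (volume : Measure R3)) :=
    range fun q : 𝓢(R3, ℂ) × F => ContinuousLinearMap.adjoint (pairL q.1) q.2 with hS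
  have hD : Dense (Submodule.span ℂ S : Set (Lp F 2 (volume : Measure R3))) := by
    rw [Submodule.dense_iff_topologicalClosure_eq_top, Submodule.topologicalClosure_eq_top_iff,
      Submodule.eq_bot_iff]
    intro g hg
    refine eq_of_pairL_eq fun ψ => ?_
    rw [map_zero, ← inner_self_eq_zero (𝕜 := ℂ), ← ContinuousLinearMap.adjoint_inner_left]
    exact (Submodule.mem_orthogonal _ _).1 hg _ (Submodule.subset_span ⟨(ψ, pairL ψ g), rfl⟩)
  have : Fact ((2 : ℝ≥0∞) ≠ ∞) := ⟨by norm_num⟩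
  refine aestronglyMeasurable_of_inner hD fun e he => ?_
  induction he using Submodule.span_induction with
  | mem x hx =>
    obtain ⟨q, rfl⟩ := hx
    simp_rw [ContinuousLinearMap.adjoint_inner_left]
    exact aestronglyMeasurable_const.inner (h q.1)
  | zero => simpa using aestronglyMeasurable_const
  | add x y _ _ hx hy =>
    simp_rw [inner_add_left]
    exact hx.add hy
  | smul a x _ hx =>
    simp_rw [inner_smul_left]
    exact hx.const_mul _

/-- An evolution equation tested against Schwartz functions becomes an identity of Bochner integrals
as soon as the derivative has an integrable majorant. -/
theorem HasPrimitive.of_pairL [SecondCountableTopology F] {T : ℝ} (hT : 0 ≤ T)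
    {y p : ℝ → Lp F 2 (volume : Measure R3)} {G : ℝ → ℝ}
    (h : ∀ ψ, HasPrimitive T (fun t => pairL ψ (y t)) (fun t => pairL ψ (p t)))
    (hG : IntervalIntegrable G volume 0 T)
    (hle : ∀ᵐ τ ∂(volume.restrict (Ioc 0 T)), ‖p τ‖ ≤ G τ) : HasPrimitive T y p := by
  have hp : IntervalIntegrable p volume 0 T := by
    rw [intervalIntegrable_iff_integrableOn_Ioc_of_le hT] at hG ⊢
    refine hG.mono' (aestronglyMeasurable_of_pairL fun ψ => ?_) hle
    exact ((intervalIntegrable_iff_integrableOn_Ioc_of_le hT).1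
      (h ψ).integrable).aestronglyMeasurable
  refine ⟨hp, fun t ht => eq_of_pairL_eq fun ψ => ?_⟩
  have hpt : IntervalIntegrable p volume 0 t := hp.mono_set (by
    rw [uIcc_of_le ht.1, uIcc_of_le hT]
    exact Icc_subset_Icc_right ht.2)
  rw [map_add, ← ContinuousLinearMap.intervalIntegral_comp_comm _ hpt]
  exact (h ψ).eq t ht

/-- `∂_t U + v · ∇ U = Φ` in the weak sense, for a function localized at the frequency `2^j`. -/
def IsTransport (hχ : IsLPCutoff χ) (T : ℝ) (v : ℝ → R3 → R3) (j : ℤ)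
    (U Φ : ℝ → Lp F 2 (volume : Measure R3)) : Prop :=
  ∀ ψ : 𝓢(R3, ℂ), HasPrimitive T (fun t => pairL ψ (U t)) (fun τ => pairL ψ (Φ τ) -
    ∑ k, ∫ x, ((v τ x k : ℂ) * ψ x) • multL2 (derS hχ j k) (U τ) x)

/-- The energy identity for functions that are transported by a Lipschitz vector field. -/
theorem IsTransport.exists_hasPrimitive [SecondCountableTopology F] {hχ : IsLPCutoff χ} {T : ℝ}
    (hT : 0 ≤ T) {v : ℝ → R3 → R3} (hv : IsVelocity T v) {j : ℤ}
    {U Φ : ℝ → Lp F 2 (volume : Measure R3)} (h : IsTransport hχ T v j U Φ)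
    (hU : ∀ t ∈ Icc 0 T, multL2 (fatS hχ j) (U t) = U t) {M : ℝ}
    (hM : ∀ t ∈ Icc 0 T, ‖U t‖ ≤ M) {G : ℝ → ℝ} (hG : IntervalIntegrable G volume 0 T)
    (hΦ : ∀ᵐ τ ∂(volume.restrict (Ioc 0 T)), ‖Φ τ‖ ≤ G τ) :
    ∃ q, HasPrimitive T (fun t => ‖U t‖ ^ 2) q ∧ ∀ᵐ τ ∂(volume.restrict (Ioc 0 T)),
      |q τ - 2 * (inner ℂ (U τ) (Φ τ)).re| ≤ 3 * lipConst v τ * ‖U τ‖ ^ 2 := by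
  classical
  have hM0 : 0 ≤ M := (norm_nonneg _).trans (hM 0 ⟨le_rfl, hT⟩)
  have hlip := hv.ae_norm_sub_le
  have hg0 := lipConst_nonneg v
  have hgi : IntervalIntegrable (fun τ => lipConst v τ) volume 0 T :=
    (intervalIntegrable_iff_integrableOn_Ioc_of_le hT).2 hv.integrable_lipConst
  have hv0 : IntervalIntegrable (fun τ => ‖v τ 0‖) volume 0 T := (hv.integrable 0).norm
  have hmem : ∀ᵐ τ ∂(volume.restrict (Ioc 0 T)), τ ∈ Icc 0 T := by
    filter_upwards [ae_restrict_mem measurableSet_Ioc] with τ hτ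
    exact Ioc_subset_Icc_self hτ
  -- Because v is unbounded, v·∇U need not be in `L²`, but its truncation is. The value zero covers
  -- the null set of times at which the Lipschitz bound fails.
  set P : ℕ → ℝ → Lp F 2 (volume : Measure R3) := fun n τ =>
    if hτ : ∀ x y, ‖v τ x - v τ y‖ ≤ lipConst v τ * ‖x - y‖ then
      cutRhs hχ (hg0 τ) hτ j n (U τ) (Φ τ) else 0 with hP
  set W : ℕ → ℝ → Lp F 2 (volume : Measure R3) := fun n τ => mulL (memLp_cut hχ n) (U τ) with hW
  have hWP (n : ℕ) : HasPrimitive T (W n) (P n) := by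
    refine HasPrimitive.of_pairL hT (fun ψ => ?_)
      (hG.add (((hv0.add (hgi.mul_const (2 ^ n))).mul_const M).const_mul (18 * 2 ^ j))) ?_
    · have h1 := h (SchwartzMap.smulLeftCLM ℂ (lowS hχ n) ψ)
      have h2 : ∀ᵐ τ ∂(volume.restrict (Ioc 0 T)), pairL (SchwartzMap.smulLeftCLM ℂ (lowS hχ n) ψ) (Φ τ) -
          ∑ k, ∫ x, ((v τ x k : ℂ) * SchwartzMap.smulLeftCLM ℂ (lowS hχ n) ψ x) •
            multL2 (derS hχ j k) (U τ) x = pairL ψ (P n τ) := by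
        filter_upwards [hlip] with τ hτ
        rw [hP]
        simp only [dif_pos hτ]
        rw [pairL_cutRhs]
      refine ⟨h1.integrable.congr_ae ?_, fun t ht => ?_⟩
      · rwa [uIoc_of_le hT]
      · simp only [hW, pairL_mulL_cut hχ]
        rw [h1.eq t ht]
        congr 1
        refine intervalIntegral.integral_congr_ae ?_
        rw [uIoc_of_le ht.1, ← ae_restrict_iff' measurableSet_Ioc]
        exact ae_restrict_of_ae_restrict_of_subset (Ioc_subset_Ioc_right ht.2) h2
    · filter_upwards [hlip, hΦ, hmem] with τ hτ h1 h2
      rw [hP]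
      simp only [dif_pos hτ]
      refine (norm_cutRhs_le hχ (hg0 τ) hτ j n (U τ) (Φ τ)).trans ?_
      have := hM τ h2
      have := hg0 τ
      gcongr
  obtain ⟨D, hD0, hD⟩ := exists_re_inner_cutRhs_le (F := F) hχ j
  set q : ℝ → ℝ := fun τ => 2 * (inner ℂ (U τ) (Φ τ)).re +
    if hτ : ∀ x y, ‖v τ x - v τ y‖ ≤ lipConst v τ * ‖x - y‖ then divForm (hg0 τ) hτ (U τ) else 0
    with hq
  refine ⟨q, HasPrimitive.of_tendsto hT (fun n => (hWP n).norm_sq hT) (fun t ht => ?_) ?_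
    (G := fun τ => 2 * (M * G τ) +
      3 * ((lipConst v τ + D * (‖v τ 0‖ + lipConst v τ)) * M ^ 2)) ?_ (fun n => ?_), ?_⟩
  · have h1 (n : ℕ) : ‖W n t‖ ^ 2 = (inner ℂ (U t) (mulL (memLp_cut_sq hχ n) (U t))).re := by
      rw [← inner_mulL_mulL (memLp_cut hχ n) (memLp_cut hχ n) (memLp_cut_sq hχ n) (fun _ => rfl),
        inner_self_eq_norm_sq_to_K]
      norm_cast
    have h2 : ‖U t‖ ^ 2 = (inner ℂ (U t) (U t)).re := by
      rw [inner_self_eq_norm_sq_to_K]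
      norm_cast
    simp_rw [h1]
    rw [h2]
    exact tendsto_re_inner_cut_sq hχ (U t) (U t)
  · filter_upwards [hlip, hmem] with τ hτ h2
    simp only [hP, hq, dif_pos hτ]
    exact tendsto_re_inner_cutRhs hχ (hg0 τ) hτ j (U τ) (Φ τ) (hU τ h2)
  · exact ((hG.const_mul M).const_mul 2).add
      (((hgi.add ((hv0.add hgi).const_mul D)).mul_const (M ^ 2)).const_mul 3)
  · filter_upwards [hlip, hmem, hΦ] with τ hτ h2 h3
    simp only [hP, dif_pos hτ]
    refine (hD (hg0 τ) hτ n (U τ) (Φ τ) (hU τ h2)).trans ?_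
    have := hM τ h2
    have := hg0 τ
    gcongr
  · filter_upwards [hlip] with τ hτ
    simp only [hq, dif_pos hτ, add_sub_cancel_left]
    exact abs_divForm_le (hg0 τ) hτ (U τ)

end TransportEnergy

/-! ### Energy inequalities -/

section EnergyBounds

/-- `Q` has a derivative which is bounded by `2 Ψ + 3 g Q`. -/
def EnergyBound (T : ℝ) (g Q Ψ : ℝ → ℝ) : Prop :=
  ∃ q, HasPrimitive T Q q ∧ ∀ᵐ τ ∂(volume.restrict (Ioc 0 T)), q τ ≤ 2 * Ψ τ + 3 * g τ * Q τ

namespace EnergyBound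

variable {T : ℝ} {g Q Ψ Q' Ψ' : ℝ → ℝ}

theorem add (h : EnergyBound T g Q Ψ) (h' : EnergyBound T g Q' Ψ') :
    EnergyBound T g (fun t => Q t + Q' t) (fun t => Ψ t + Ψ' t) := by
  obtain ⟨q, hq, hle⟩ := h
  obtain ⟨q', hq', hle'⟩ := h'
  refine ⟨_, hq.add hq', ?_⟩
  filter_upwards [hle, hle'] with τ h1 h2
  linarith

theorem const_mul (h : EnergyBound T g Q Ψ) {c : ℝ} (hc : 0 ≤ c) :
    EnergyBound T g (fun t => c * Q t) (fun t => c * Ψ t) := by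
  obtain ⟨q, hq, hle⟩ := h
  refine ⟨_, hq.const_mul c, ?_⟩
  filter_upwards [hle] with τ h1
  nlinarith

theorem mono (h : EnergyBound T g Q Ψ) {t : ℝ} (ht : t ∈ Icc 0 T) : EnergyBound t g Q Ψ := by
  obtain ⟨q, hq, hle⟩ := h
  exact ⟨q, hq.mono ht, ae_restrict_of_ae_restrict_of_subset (Ioc_subset_Ioc_right ht.2) hle⟩

theorem continuousOn (h : EnergyBound T g Q Ψ) : ContinuousOn Q (Icc 0 T) := by
  obtain ⟨q, hq, -⟩ := h
  exact hq.continuousOn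

/-- The hypothesis bounds half of the derivative, the divergence contributing 3/2·g·Q. Passing to √Q
makes the source enter linearly. -/
theorem sqrt_le (h : EnergyBound T g Q Ψ) (hQ : ∀ t, 0 ≤ Q t) {f : ℝ → ℝ} {r : ℝ} (hr : 0 ≤ r)
    (hf : IntervalIntegrable f volume 0 T) (hf0 : ∀ t, 0 ≤ f t)
    (hle : ∀ᵐ τ ∂(volume.restrict (Ioc 0 T)),
      Ψ τ + 3 / 2 * g τ * Q τ ≤ -r * Q τ + f τ * √(Q τ)) {t : ℝ} (ht : t ∈ Icc 0 T) :
    √(Q t) + r * ∫ τ in (0 : ℝ)..t, √(Q τ) ≤ √(Q 0) + ∫ τ in (0 : ℝ)..t, f τ := by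
  obtain ⟨q, hq, hqle⟩ := h.mono ht
  have hle' := ae_restrict_of_ae_restrict_of_subset (Ioc_subset_Ioc_right ht.2) hle
  have hq2 : HasPrimitive t (fun s => √(Q s) ^ 2) q := by
    simp_rw [fun s => Real.sq_sqrt (hQ s)]
    exact hq
  refine HasPrimitive.sqrt_le ht.1 hr (fun s => Real.sqrt_nonneg _) hq2
    (hf.mono_set (by rw [uIcc_of_le ht.1, uIcc_of_le (ht.1.trans ht.2)]
                     exact Icc_subset_Icc_right ht.2)) hf0 ?_
  have h2 : ∀ᵐ τ, τ ∈ Ioc 0 t → q τ ≤ -2 * r * √(Q τ) ^ 2 + 2 * f τ * √(Q τ) := by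
    rw [← ae_restrict_iff' measurableSet_Ioc]
    filter_upwards [hqle, hle'] with τ h1 h2
    rw [Real.sq_sqrt (hQ τ)]
    linarith
  filter_upwards [h2, Measure.ae_ne volume (0 : ℝ)] with τ h1 h3 h4
  exact h1 ⟨lt_of_le_of_ne h4.1 (Ne.symm h3), h4.2⟩

theorem continuousOn_norm {H : Type*} [NormedAddCommGroup H] {U : ℝ → H}
    (h : EnergyBound T g (fun t => ‖U t‖ ^ 2) Ψ) : ContinuousOn (fun t => ‖U t‖) (Icc 0 T) := by
  have := h.continuousOn.sqrt
  simpa [Real.sqrt_sq (norm_nonneg _)] using this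

end EnergyBound

theorem sqrt_add_four_le {a b c d : ℝ} (ha : 0 ≤ a) (hb : 0 ≤ b) (hc : 0 ≤ c) (hd : 0 ≤ d) :
    √(a ^ 2 + b ^ 2 + c ^ 2 + d ^ 2) ≤ a + b + c + d := by
  refine Real.sqrt_le_iff.2 ⟨by positivity, ?_⟩
  nlinarith [mul_nonneg ha hb, mul_nonneg ha hc, mul_nonneg ha hd, mul_nonneg hb hc,
    mul_nonneg hb hd, mul_nonneg hc hd]

end EnergyBounds

/-! ### Algebra of the coupled system on one block -/

section BlockAlgebra

variable {H : Type*} [NormedAddCommGroup H] [InnerProductSpace ℂ H] {A : H →L[ℂ] H}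

theorem re_inner_comm (x y : H) : (inner ℂ x y).re = (inner ℂ y x).re := by
  rw [← inner_conj_symm, Complex.conj_re]

theorem re_inner_le (x y : H) : (inner ℂ x y).re ≤ ‖x‖ * ‖y‖ :=
  (Complex.re_le_norm _).trans (norm_inner_le_norm _ _)

theorem neg_re_inner_le (x y : H) : -(inner ℂ x y).re ≤ ‖x‖ * ‖y‖ := by
  have := re_inner_le x (-y)
  rwa [inner_neg_right, Complex.neg_re, norm_neg] at this

theorem re_inner_self_eq (x : H) : (inner ℂ x x).re = ‖x‖ ^ 2 := by
  rw [inner_self_eq_norm_sq_to_K]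
  norm_cast

/-- The cancellation of the coupling terms between `b` and `d`. -/
theorem block_identity (hA : ∀ x y, inner ℂ (A x) y = inner ℂ x (A y)) (a : ℝ)
    (b d θ Sb SA Sd : H) :
    a * (inner ℂ b (Sb - A d)).re + (inner ℂ (A b - d) (SA - Sd - A b - A θ)).re +
      (a - 1) * (inner ℂ d (Sd - A (A d) + A (b + θ))).re =
    -‖A b‖ ^ 2 - (a - 1) * ‖A d‖ ^ 2 + a * (inner ℂ b Sb).re + (inner ℂ (A b - d) (SA - Sd)).re +
      (a - 1) * (inner ℂ d Sd).re - (inner ℂ (A b - d) (A θ)).re +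
      (a - 1) * (inner ℂ d (A θ)).re := by
  rw [← re_inner_self_eq, ← re_inner_self_eq]
  have h1 := re_inner_comm (A b) d
  have h2 : (inner ℂ b (A d)).re = (inner ℂ (A b) d).re := by rw [hA]
  have h3 : (inner ℂ d (A (A d))).re = (inner ℂ (A d) (A d)).re := by rw [hA]
  simp only [map_add, inner_sub_right, inner_sub_left, inner_add_right, Complex.sub_re,
    Complex.add_re, h2, h3]
  -- The terms ⟨b, Ad⟩ come with the coefficients -a from b, 1 from Ab - d and a - 1 from d.
  linear_combination (-a) * h1

theorem heat_identity (hA : ∀ x y, inner ℂ (A x) y = inner ℂ x (A y)) (κ : ℝ) (θ S : H) :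
    (inner ℂ θ (S - (κ : ℂ) • A (A θ))).re = (inner ℂ θ S).re - κ * ‖A θ‖ ^ 2 := by
  rw [← re_inner_self_eq, inner_sub_right, inner_smul_right, Complex.sub_re, Complex.re_ofReal_mul,
    hA]

/-- The source terms and the divergence term are at most a multiple of F·q, with q standing for the
square root of the energy. After division by q they are linear in `F`, and 9 is independent of α. -/
theorem re_inner_source_le {α g q N F : ℝ} {b d Sb SA Sd e : H} (hα : 1 ≤ α) (hg : 0 ≤ g) (hq : 0 ≤ q)
    (hb : α * ‖b‖ ≤ q) (he : ‖e‖ ≤ q) (hd : (α ^ 2 - 1) * ‖d‖ ≤ α * q) (hqN : q ≤ 6 * N)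
    (hF : α * ‖Sb‖ + ‖SA‖ + α * ‖Sd‖ + g * N ≤ F) :
    α ^ 2 * (inner ℂ b Sb).re + (inner ℂ e (SA - Sd)).re + (α ^ 2 - 1) * (inner ℂ d Sd).re +
      3 / 2 * g * q ^ 2 ≤ 9 * F * q := by
  have hα2 : 0 ≤ α ^ 2 - 1 := by nlinarith
  have h1 : α ^ 2 * (inner ℂ b Sb).re ≤ q * (α * ‖Sb‖) := by
    calc _ ≤ α ^ 2 * (‖b‖ * ‖Sb‖) := by gcongr; exact re_inner_le _ _
      _ = (α * ‖b‖) * (α * ‖Sb‖) := by ring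
      _ ≤ _ := by gcongr
  have h2 : (inner ℂ e (SA - Sd)).re ≤ q * (‖SA‖ + ‖Sd‖) := by
    refine (re_inner_le _ _).trans ?_
    gcongr
    exact norm_sub_le _ _
  have h3 : (α ^ 2 - 1) * (inner ℂ d Sd).re ≤ q * (α * ‖Sd‖) := by
    calc _ ≤ (α ^ 2 - 1) * (‖d‖ * ‖Sd‖) := by gcongr; exact re_inner_le _ _
      _ = ((α ^ 2 - 1) * ‖d‖) * ‖Sd‖ := by ring
      _ ≤ (α * q) * ‖Sd‖ := by gcongr
      _ = _ := by ring
  have h4 : 3 / 2 * g * q ^ 2 ≤ q * (9 * (g * N)) := by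
    calc _ = 3 / 2 * g * q * q := by ring
      _ ≤ 3 / 2 * g * q * (6 * N) := by gcongr
      _ = _ := by ring
  have h5 : ‖Sd‖ ≤ α * ‖Sd‖ := le_mul_of_one_le_left (norm_nonneg _) hα
  have hN : 0 ≤ N := by linarith
  have h6 : q * (α * ‖Sb‖ + (‖SA‖ + ‖Sd‖) + α * ‖Sd‖ + 9 * (g * N)) ≤ q * (9 * F) := by
    gcongr
    nlinarith [norm_nonneg SA, norm_nonneg Sd, mul_nonneg (zero_le_one.trans hα) (norm_nonneg Sb),
      mul_nonneg hg hN]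
  nlinarith

end BlockAlgebra

/-! ### Low and high frequency estimates of a block -/

section BlockEstimates

variable {H : Type*} [NormedAddCommGroup H] [InnerProductSpace ℂ H] {A : H →L[ℂ] H}
  {T : ℝ} {g F : ℝ → ℝ} {b d θ Sb SA Sd Sθ : ℝ → H} {α κ lam : ℝ}

/-- The hypotheses of the block estimates: `b`, `d`, `θ` solve the linear system on a block of
frequency `lam`, with sources that are dominated by `F`. -/
structure BlockSystem (A : H →L[ℂ] H) (T : ℝ) (g F : ℝ → ℝ) (b d θ Sb SA Sd Sθ : ℝ → H)
    (α κ lam γ : ℝ) : Prop where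
  symm : ∀ x y, inner ℂ (A x) y = inner ℂ x (A y)
  T_nonneg : 0 ≤ T
  g_nonneg : ∀ t, 0 ≤ g t
  F_nonneg : ∀ t, 0 ≤ F t
  F_integrable : IntervalIntegrable F volume 0 T
  le_α : 10 ^ 8 ≤ α
  le_κ : 1 ≤ α ^ 2 * κ
  lam_pos : 0 < lam
  γ_pos : 0 < γ
  norm_le : ∀ t ∈ Icc 0 T, ∀ u ∈ ({b t, d t, θ t} : Set H),
    lam / 3 * ‖u‖ ≤ ‖A u‖ ∧ ‖A u‖ ≤ 6 * lam * ‖u‖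
  energy_b : EnergyBound T g (fun t => ‖b t‖ ^ 2) (fun t => (inner ℂ (b t) (Sb t - A (d t))).re)
  energy_e : EnergyBound T g (fun t => ‖A (b t) - d t‖ ^ 2)
    (fun t => (inner ℂ (A (b t) - d t) (SA t - Sd t - A (b t) - A (θ t))).re)
  energy_d : EnergyBound T g (fun t => ‖d t‖ ^ 2)
    (fun t => (inner ℂ (d t) (Sd t - A (A (d t)) + A (b t + θ t))).re)
  energy_θ : EnergyBound T g (fun t => ‖θ t‖ ^ 2)
    (fun t => (inner ℂ (θ t) (Sθ t - A (d t) - (κ : ℂ) • A (A (θ t)))).re)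
  source_le : ∀ᵐ τ ∂(volume.restrict (Ioc 0 T)),
    (α + lam) * ‖Sb τ‖ + ‖SA τ‖ + α * ‖Sd τ‖ + γ * ‖Sθ τ‖ +
      g τ * ((α + lam) * ‖b τ‖ + α * ‖d τ‖ + γ * ‖θ τ‖) ≤ F τ

/-- The quadratic functional in `b` and `d`. -/
def quadBD (A : H →L[ℂ] H) (α : ℝ) (b d : H) : ℝ :=
  α ^ 2 * ‖b‖ ^ 2 + ‖A b - d‖ ^ 2 + (α ^ 2 - 1) * ‖d‖ ^ 2

theorem quadBD_nonneg (hα : 1 ≤ α) (b d : H) : 0 ≤ quadBD A α b d := by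
  have hα2 : 0 ≤ α ^ 2 - 1 := by nlinarith
  unfold quadBD
  positivity

/-- Each norm is controlled by the energy with constants independent of α, since α² - 1 ≥ α²/4 and
Ab = (Ab - d) + d. This independence keeps α out of the Grönwall rate. -/
theorem le_sqrt_quad (hα : 10 ^ 8 ≤ α) {b d : H}
    (hb : lam / 3 * ‖b‖ ≤ ‖A b‖) {Q : ℝ} (hQ : quadBD A α b d ≤ Q) :
    α * ‖b‖ ≤ √Q ∧ ‖A b - d‖ ≤ √Q ∧ (α ^ 2 - 1) * ‖d‖ ≤ α * √Q ∧ α * ‖d‖ ≤ 2 * √Q ∧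
      ‖A b‖ ≤ 2 * √Q ∧ lam * ‖b‖ ≤ 6 * √Q := by
  have hα1 : 1 ≤ α := by linarith
  have hα0 : 0 < α := by linarith
  have hQ0 : 0 ≤ Q := (quadBD_nonneg hα1 b d).trans hQ
  have hs := Real.sq_sqrt hQ0
  have hs0 := Real.sqrt_nonneg Q
  have hα2 : 4 ≤ α ^ 2 := by nlinarith
  unfold quadBD at hQ
  have p1 : 0 ≤ α ^ 2 * ‖b‖ ^ 2 := by positivity
  have p2 : 0 ≤ ‖A b - d‖ ^ 2 := by positivity
  have p3 : 0 ≤ (α ^ 2 - 1) * ‖d‖ ^ 2 := mul_nonneg (by linarith) (by positivity)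
  have h1 : α * ‖b‖ ≤ √Q := by
    refine Real.le_sqrt_of_sq_le ?_
    rw [mul_pow]
    linarith
  have h2 : ‖A b - d‖ ≤ √Q := Real.le_sqrt_of_sq_le (by linarith)
  have h3 : (α ^ 2 - 1) * ‖d‖ ≤ α * √Q := by
    refine le_of_sq_le_sq ?_ (by positivity)
    rw [mul_pow, mul_pow, hs]
    nlinarith
  have h4 : α * ‖d‖ ≤ 2 * √Q := by
    refine le_of_sq_le_sq ?_ (by positivity)
    rw [mul_pow, mul_pow, hs]
    nlinarith [sq_nonneg ‖d‖]
  have h5 : ‖A b‖ ≤ 2 * √Q := by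
    have h6 : ‖A b‖ ≤ ‖A b - d‖ + ‖d‖ := by
      have := norm_add_le (A b - d) d
      rwa [sub_add_cancel] at this
    have h7 : 2 * ‖d‖ ≤ α * ‖d‖ := by
      gcongr
      linarith
    linarith
  exact ⟨h1, h2, h3, h4, h5, by linarith⟩

theorem sqrt_quad_le (hα : 10 ^ 8 ≤ α) {b d : H}
    (hb : ‖A b‖ ≤ 6 * lam * ‖b‖) {x : ℝ} (hx : 0 ≤ x) :
    √(quadBD A α b d + x ^ 2) ≤ 6 * ((α + lam) * ‖b‖ + α * ‖d‖ + x) := by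
  have hα0 : 0 < α := by linarith
  have h1 : quadBD A α b d + x ^ 2 ≤ (α * ‖b‖) ^ 2 + ‖A b - d‖ ^ 2 + (α * ‖d‖) ^ 2 + x ^ 2 := by
    unfold quadBD
    nlinarith [sq_nonneg ‖d‖]
  refine (Real.sqrt_le_sqrt h1).trans ((sqrt_add_four_le (by positivity) (by positivity)
    (by positivity) hx).trans ?_)
  have h2 := norm_sub_le (A b) d
  have h3 : ‖d‖ ≤ α * ‖d‖ := le_mul_of_one_le_left (norm_nonneg _) (by linarith)
  have h4 : 0 ≤ α * ‖b‖ := by positivity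
  nlinarith

/-- The weighted norm of a block. -/
def blockWeight (α lam γ : ℝ) (b d θ : H) : ℝ := (α + lam) * ‖b‖ + α * ‖d‖ + γ * ‖θ‖

/-- The weighted norm of a block after parabolic smoothing. -/
def blockGain (α lam γ : ℝ) (b d θ : H) : ℝ :=
  min 1 (lam ^ 2) * ((α + lam) * ‖b‖) + lam ^ 2 * (α * ‖d‖ + γ * ‖θ‖)

/-- The letters x, y, z stand for ‖Ab‖, ‖Ad‖, ‖Aθ‖. Only e ≤ x + d is not smoothed directly: λ²x² is
bounded by α⁴x² because λ ≤ α², whence the power α⁴ in the dissipation constant. -/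
theorem low_dissipation {b d θ e x y z : ℝ} (hα : 10 ^ 8 ≤ α) (hlam0 : 0 < lam)
    (hlam : lam ≤ α ^ 2) (hb0 : 0 ≤ b) (hd0 : 0 ≤ d) (hθ0 : 0 ≤ θ) (he0 : 0 ≤ e)
    (hb : lam / 3 * b ≤ x) (hd : lam / 3 * d ≤ y) (hθ : lam / 3 * θ ≤ z) (he : e ≤ x + d) :
    lam ^ 2 * (α ^ 2 * b ^ 2 + e ^ 2 + (α ^ 2 - 1) * d ^ 2 + α ^ 2 * θ ^ 2) ≤
      (18 * (α ^ 2 + 1) + 4 * α ^ 4) * (x ^ 2 / 2 + (α ^ 2 - 1) * y ^ 2 + z ^ 2 / 2) := by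
  have hα2 : 4 ≤ α ^ 2 := by nlinarith
  have sq (u w : ℝ) (hu : 0 ≤ u) (h : lam / 3 * u ≤ w) : lam ^ 2 * u ^ 2 ≤ 9 * w ^ 2 := by
    have := pow_le_pow_left₀ (by positivity) h 2
    nlinarith
  have hb2 := sq b x hb0 hb
  have hd2 := sq d y hd0 hd
  have hθ2 := sq θ z hθ0 hθ
  have hl2 : lam ^ 2 ≤ α ^ 4 := by
    have := pow_le_pow_left₀ hlam0.le hlam 2
    nlinarith
  have he2 : e ^ 2 ≤ 2 * x ^ 2 + 2 * d ^ 2 := by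
    have := pow_le_pow_left₀ he0 he 2
    nlinarith [sq_nonneg (x - d)]
  have k1 : α ^ 2 * (lam ^ 2 * b ^ 2) ≤ α ^ 2 * (9 * x ^ 2) := by gcongr
  have k2 : lam ^ 2 * e ^ 2 ≤ 2 * (α ^ 4 * x ^ 2) + 2 * (9 * y ^ 2) := by
    calc lam ^ 2 * e ^ 2 ≤ lam ^ 2 * (2 * x ^ 2 + 2 * d ^ 2) := by gcongr
      _ = 2 * (lam ^ 2 * x ^ 2) + 2 * (lam ^ 2 * d ^ 2) := by ring
      _ ≤ _ := by gcongr
  have k3 : (α ^ 2 - 1) * (lam ^ 2 * d ^ 2) ≤ (α ^ 2 - 1) * (9 * y ^ 2) := by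
    have : 0 ≤ α ^ 2 - 1 := by linarith
    gcongr
  have k4 : α ^ 2 * (lam ^ 2 * θ ^ 2) ≤ α ^ 2 * (9 * z ^ 2) := by gcongr
  have k5 : (9 * α ^ 2 + 9) * y ^ 2 ≤ (18 * (α ^ 2 + 1) + 4 * α ^ 4) * ((α ^ 2 - 1) * y ^ 2) := by
    rw [← mul_assoc]
    gcongr
    nlinarith [mul_nonneg (sq_nonneg α) (sq_nonneg α)]
  have k6 : 0 ≤ α ^ 4 * z ^ 2 := by positivity
  nlinarith [sq_nonneg x, sq_nonneg y, sq_nonneg z]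

/-- For λ ≥ α² the terms in b and d are small compared with ‖Ab‖ and ‖Ad‖, and e is essentially Ab.
The decay rate is of order one instead of λ²: at high frequencies b is only damped. -/
theorem high_dissipation {b d e x y : ℝ} (hα : 10 ^ 8 ≤ α)
    (hlam : α ^ 2 ≤ lam) (hb0 : 0 ≤ b) (hd0 : 0 ≤ d) (he0 : 0 ≤ e)
    (hb : lam / 3 * b ≤ x) (hd : lam / 3 * d ≤ y) (he : e ≤ x + d) :
    1 / 3 * (α ^ 2 * b ^ 2 + e ^ 2 + (α ^ 2 - 1) * d ^ 2) ≤ x ^ 2 + (α ^ 2 - 1) * y ^ 2 := by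
  have hα2 : 100 ≤ α ^ 2 := by nlinarith
  have sq (u w : ℝ) (hu : 0 ≤ u) (h : lam / 3 * u ≤ w) : 100 * (α ^ 2 * u ^ 2) ≤ 9 * w ^ 2 := by
    have h1 : α ^ 2 / 3 * u ≤ w := le_trans (by gcongr) h
    have := pow_le_pow_left₀ (by positivity) h1 2
    have h2 : 100 * (α ^ 2 * u ^ 2) ≤ α ^ 2 * (α ^ 2 * u ^ 2) := by gcongr
    nlinarith
  have hb2 := sq b x hb0 hb
  have hd2 := sq d y hd0 hd
  have he2 : e ^ 2 ≤ 2 * x ^ 2 + 2 * d ^ 2 := by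
    have := pow_le_pow_left₀ he0 he 2
    nlinarith [sq_nonneg (x - d)]
  have k1 : 100 * d ^ 2 ≤ α ^ 2 * d ^ 2 := by gcongr
  have k2 : 99 * y ^ 2 ≤ (α ^ 2 - 1) * y ^ 2 := by
    gcongr
    linarith
  nlinarith [sq_nonneg x, sq_nonneg y]

/-- One functional carries b, d and θ, the last with the weight α². The couplings ⟨d, Aθ⟩ have
coefficients 1, α² - 1 and -α² and cancel. The remaining -⟨Ab, Aθ⟩ is split evenly between ‖Ab‖² and
‖Aθ‖², and ‖Aθ‖² ≤ α²κ‖Aθ‖². -/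
theorem BlockSystem.low {γ : ℝ} (h : BlockSystem A T g F b d θ Sb SA Sd Sθ α κ lam γ)
    (hγ : γ = α) (hlam : lam ≤ α ^ 2) {t : ℝ} (ht : t ∈ Icc 0 T) :
    blockWeight α lam γ (b t) (d t) (θ t) ≤
        10000 * (blockWeight α lam γ (b 0) (d 0) (θ 0) + ∫ τ in (0 : ℝ)..t, F τ) ∧
      ∫ τ in (0 : ℝ)..t, blockGain α lam γ (b τ) (d τ) (θ τ) ≤
        1000 * α ^ 4 * (blockWeight α lam γ (b 0) (d 0) (θ 0) + ∫ τ in (0 : ℝ)..t, F τ) := by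
  subst hγ
  obtain ⟨hA, hT, hg, hF0, hFi, hα, hκ, hl0, hγ0, hn, eb, ee, ed, eθ, hS⟩ := h
  have hα1 : 1 ≤ γ := by linarith
  have hα2 : 0 ≤ γ ^ 2 - 1 := by nlinarith
  set D : ℝ := 18 * (γ ^ 2 + 1) + 4 * γ ^ 4 with hD
  have hD0 : 0 < D := by positivity
  set Q : ℝ → ℝ := fun t => quadBD A γ (b t) (d t) + γ ^ 2 * ‖θ t‖ ^ 2 with hQ
  have hE := (((eb.const_mul (sq_nonneg γ)).add ee).add (ed.const_mul hα2)).add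
    (eθ.const_mul (sq_nonneg γ))
  have hQ0 (t : ℝ) : 0 ≤ Q t := add_nonneg (quadBD_nonneg hα1 _ _) (by positivity)
  have hqN (t : ℝ) (ht : t ∈ Icc 0 T) : √(Q t) ≤ 6 * blockWeight γ lam γ (b t) (d t) (θ t) := by
    have := sqrt_quad_le hα (d := d t) (hn t ht (b t) (by simp)).2
      (by positivity : 0 ≤ γ * ‖θ t‖)
    rwa [mul_pow] at this
  have hNq (t : ℝ) (ht : t ∈ Icc 0 T) : blockWeight γ lam γ (b t) (d t) (θ t) ≤ 10 * √(Q t) := by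
    obtain ⟨h1, -, -, h2, -, h3⟩ := le_sqrt_quad hα (d := d t) (hn t ht (b t) (by simp)).1
      (le_add_of_nonneg_right (by positivity) : quadBD A γ (b t) (d t) ≤ Q t)
    have h4 : γ * ‖θ t‖ ≤ √(Q t) := by
      refine Real.le_sqrt_of_sq_le ?_
      rw [mul_pow]
      exact le_add_of_nonneg_left (quadBD_nonneg hα1 _ _)
    unfold blockWeight
    linarith
  have key := EnergyBound.sqrt_le (Q := Q) hE hQ0 (r := lam ^ 2 / D) (f := fun τ => 10 * F τ)
    (by positivity) (hFi.const_mul 10) (fun t => by have := hF0 t; positivity) (by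
      filter_upwards [hS, ae_restrict_mem measurableSet_Ioc] with τ hSτ hτ
      have hτ' := Ioc_subset_Icc_self hτ
      have hb := (hn τ hτ' (b τ) (by simp)).1
      have hd := (hn τ hτ' (d τ) (by simp)).1
      have hθ := (hn τ hτ' (θ τ) (by simp)).1
      obtain ⟨h1, h2, h3, -⟩ := le_sqrt_quad hα (d := d τ) hb
        (le_add_of_nonneg_right (by positivity) : quadBD A γ (b τ) (d τ) ≤ Q τ)
      have h4 : γ * ‖θ τ‖ ≤ √(Q τ) := by
        refine Real.le_sqrt_of_sq_le ?_
        rw [mul_pow]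
        exact le_add_of_nonneg_left (quadBD_nonneg hα1 _ _)
      have hs := Real.sq_sqrt (hQ0 τ)
      have hN0 : 0 ≤ g τ * blockWeight γ lam γ (b τ) (d τ) (θ τ) := by
        have := hg τ
        unfold blockWeight
        positivity
      have hSθ : γ * ‖Sθ τ‖ ≤ F τ := by
        refine le_trans ?_ hSτ
        have : 0 ≤ (γ + lam) * ‖Sb τ‖ + ‖SA τ‖ + γ * ‖Sd τ‖ := by positivity
        unfold blockWeight at hN0
        linarith
      have hF1 : γ * ‖Sb τ‖ + ‖SA τ‖ + γ * ‖Sd τ‖ +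
          g τ * blockWeight γ lam γ (b τ) (d τ) (θ τ) ≤ F τ := by
        refine le_trans ?_ hSτ
        have h5 : 0 ≤ lam * ‖Sb τ‖ := by positivity
        have h6 : 0 ≤ γ * ‖Sθ τ‖ := by positivity
        unfold blockWeight
        linarith
      have hs1 := re_inner_source_le hα1 (hg τ) (Real.sqrt_nonneg (Q τ)) h1 h2 h3 (hqN τ hτ') hF1
      have hs2 : γ ^ 2 * (inner ℂ (θ τ) (Sθ τ)).re ≤ √(Q τ) * F τ := by
        calc _ ≤ γ ^ 2 * (‖θ τ‖ * ‖Sθ τ‖) := by gcongr; exact re_inner_le _ _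
          _ = (γ * ‖θ τ‖) * (γ * ‖Sθ τ‖) := by ring
          _ ≤ _ := by gcongr
      have hid := block_identity hA (γ ^ 2) (b τ) (d τ) (θ τ) (Sb τ) (SA τ) (Sd τ)
      have hid2 := heat_identity hA κ (θ τ) (Sθ τ - A (d τ))
      have hid3 : (inner ℂ (θ τ) (A (d τ))).re = (inner ℂ (d τ) (A (θ τ))).re := by
        rw [← hA, re_inner_comm]
      rw [inner_sub_right (θ τ) (Sθ τ), Complex.sub_re, hid3] at hid2
      have hid4 : (inner ℂ (A (b τ) - d τ) (A (θ τ))).re =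
          (inner ℂ (A (b τ)) (A (θ τ))).re - (inner ℂ (d τ) (A (θ τ))).re := by
        rw [inner_sub_left, Complex.sub_re]
      have hc : -(inner ℂ (A (b τ)) (A (θ τ))).re ≤ ‖A (b τ)‖ ^ 2 / 2 + ‖A (θ τ)‖ ^ 2 / 2 := by
        refine (neg_re_inner_le _ _).trans ?_
        nlinarith [sq_nonneg (‖A (b τ)‖ - ‖A (θ τ)‖)]
      have hκ' : ‖A (θ τ)‖ ^ 2 ≤ γ ^ 2 * κ * ‖A (θ τ)‖ ^ 2 :=
        le_mul_of_one_le_left (by positivity) hκ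
      have hdis := low_dissipation hα hl0 hlam (norm_nonneg _) (norm_nonneg _) (norm_nonneg _)
        (norm_nonneg _) hb hd hθ (norm_sub_le (A (b τ)) (d τ) |>.trans (le_refl _))
      have hdis2 : lam ^ 2 / D * Q τ ≤ ‖A (b τ)‖ ^ 2 / 2 + (γ ^ 2 - 1) * ‖A (d τ)‖ ^ 2 +
          ‖A (θ τ)‖ ^ 2 / 2 := by
        rw [div_mul_eq_mul_div, div_le_iff₀' hD0]
        exact hdis
      change γ ^ 2 * _ + _ + (γ ^ 2 - 1) * _ + γ ^ 2 * _ + _ ≤ _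
      rw [hs] at hs1
      rw [hid2, hid, hid4]
      linarith) ht
  have hI : 0 ≤ ∫ τ in (0 : ℝ)..t, F τ := intervalIntegral.integral_nonneg ht.1 fun τ _ => hF0 τ
  have h0 : (0 : ℝ) ∈ Icc 0 T := ⟨le_rfl, hT⟩
  have hX : 0 ≤ ∫ τ in (0 : ℝ)..t, √(Q τ) :=
    intervalIntegral.integral_nonneg ht.1 fun τ _ => Real.sqrt_nonneg _
  have hN0 : 0 ≤ blockWeight γ lam γ (b 0) (d 0) (θ 0) := by unfold blockWeight; positivity
  rw [intervalIntegral.integral_const_mul] at key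
  have hq0 := hqN 0 h0
  have hcont : ContinuousOn Q (Icc 0 T) := hE.continuousOn
  have hsub : Icc 0 t ⊆ Icc 0 T := Icc_subset_Icc_right ht.2
  have hii {f : ℝ → ℝ} (hf : ContinuousOn f (Icc 0 T)) : IntervalIntegrable f volume 0 t :=
    ContinuousOn.intervalIntegrable (by rw [uIcc_of_le ht.1]; exact hf.mono hsub)
  refine ⟨?_, ?_⟩
  · have h1 := hNq t ht
    have h2 : 0 ≤ lam ^ 2 / D * ∫ τ in (0 : ℝ)..t, √(Q τ) := by positivity
    linarith
  · have hgain : ∫ τ in (0 : ℝ)..t, blockGain γ lam γ (b τ) (d τ) (θ τ) ≤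
        ∫ τ in (0 : ℝ)..t, 10 * lam ^ 2 * √(Q τ) := by
      refine intervalIntegral.integral_mono_on ht.1 (hii ?_) (hii (by fun_prop)) fun τ hτ => ?_
      · have h1 := eb.continuousOn_norm
        have h2 := ed.continuousOn_norm
        have h3 := eθ.continuousOn_norm
        unfold blockGain
        fun_prop
      · have h1 := hNq τ (hsub hτ)
        have h2 : blockGain γ lam γ (b τ) (d τ) (θ τ) ≤
            lam ^ 2 * blockWeight γ lam γ (b τ) (d τ) (θ τ) := by
          unfold blockGain blockWeight
          have : min 1 (lam ^ 2) * ((γ + lam) * ‖b τ‖) ≤ lam ^ 2 * ((γ + lam) * ‖b τ‖) := by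
            gcongr
            exact min_le_right _ _
          linarith
        calc _ ≤ _ := h2
          _ ≤ lam ^ 2 * (10 * √(Q τ)) := by gcongr
          _ = _ := by ring
    refine hgain.trans ?_
    -- The decay rate λ²/D with D ≤ 5α⁴ turns λ²∫√Q into α⁴ times the data.
    rw [intervalIntegral.integral_const_mul]
    have h1 : lam ^ 2 / D * ∫ τ in (0 : ℝ)..t, √(Q τ) ≤ √(Q 0) + 10 * ∫ τ in (0 : ℝ)..t, F τ := by
      linarith [Real.sqrt_nonneg (Q t)]
    rw [div_mul_eq_mul_div, div_le_iff₀' hD0] at h1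
    have hD5 : D ≤ 5 * γ ^ 4 := by
      have h2 : 100 ≤ γ ^ 2 := by nlinarith
      nlinarith
    have hq2 : √(Q 0) + 10 * ∫ τ in (0 : ℝ)..t, F τ ≤
        10 * blockWeight γ lam γ (b 0) (d 0) (θ 0) + 10 * ∫ τ in (0 : ℝ)..t, F τ := by linarith
    calc 10 * lam ^ 2 * ∫ τ in (0 : ℝ)..t, √(Q τ)
        = 10 * (lam ^ 2 * ∫ τ in (0 : ℝ)..t, √(Q τ)) := by ring
      _ ≤ 10 * (D * (√(Q 0) + 10 * ∫ τ in (0 : ℝ)..t, F τ)) := by gcongr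
      _ ≤ 10 * (5 * γ ^ 4 * (10 * blockWeight γ lam γ (b 0) (d 0) (θ 0) +
            10 * ∫ τ in (0 : ℝ)..t, F τ)) := by
          gcongr
      _ = 500 * γ ^ 4 * (blockWeight γ lam γ (b 0) (d 0) (θ 0) + ∫ τ in (0 : ℝ)..t, F τ) := by
          ring
      _ ≤ _ := by
          gcongr
          norm_num

/-- Here θ cannot share a functional with b and d. Three inequalities are used: the energy of (b, d)
decays at rate 1/3 with source of order αλ‖θ‖, then ‖d‖ at rate λ²/9 with sources √Q and λ‖θ‖, and
‖θ‖ at rate κλ²/9 with source of order λ‖d‖. A linear combination closes because λ² ≥ 10⁸α³. -/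
theorem BlockSystem.high {γ : ℝ} (h : BlockSystem A T g F b d θ Sb SA Sd Sθ α κ lam γ)
    (hγ : γ * lam = α ^ 3) (hlam : α ^ 2 ≤ lam) {t : ℝ} (ht : t ∈ Icc 0 T) :
    blockWeight α lam γ (b t) (d t) (θ t) ≤
        10000 * (blockWeight α lam γ (b 0) (d 0) (θ 0) + ∫ τ in (0 : ℝ)..t, F τ) ∧
      ∫ τ in (0 : ℝ)..t, blockGain α lam γ (b τ) (d τ) (θ τ) ≤
        1000 * α ^ 4 * (blockWeight α lam γ (b 0) (d 0) (θ 0) + ∫ τ in (0 : ℝ)..t, F τ) := by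
  obtain ⟨hA, hT, hg, hF0, hFi, hα, hκ, hl0, hγ0, hn, eb, ee, ed, eθ, hS⟩ := h
  have hα1 : 1 ≤ α := by linarith
  have hα2 : 0 ≤ α ^ 2 - 1 := by nlinarith
  have hκ0 : 0 ≤ κ := by
    by_contra! hc
    nlinarith
  set Q : ℝ → ℝ := fun t => quadBD A α (b t) (d t) with hQ
  have hE := ((eb.const_mul (sq_nonneg α)).add ee).add (ed.const_mul hα2)
  have hQ0 (t : ℝ) : 0 ≤ Q t := quadBD_nonneg hα1 _ _
  have hquad (t : ℝ) (ht : t ∈ Icc 0 T) :=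
    le_sqrt_quad hα (d := d t) (hn t ht (b t) (by simp)).1 (le_refl (Q t))
  have hqN (t : ℝ) (ht : t ∈ Icc 0 T) : √(Q t) ≤ 6 * ((α + lam) * ‖b t‖ + α * ‖d t‖) := by
    simpa using sqrt_quad_le hα (d := d t) (hn t ht (b t) (by simp)).2 le_rfl
  have hsub : Icc 0 t ⊆ Icc 0 T := Icc_subset_Icc_right ht.2
  have hsubT {f : ℝ → ℝ} (hf : ContinuousOn f (Icc 0 T)) : IntervalIntegrable f volume 0 T :=
    ContinuousOn.intervalIntegrable (by rw [uIcc_of_le hT]; exact hf)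
  have hii {f : ℝ → ℝ} (hf : ContinuousOn f (Icc 0 T)) : IntervalIntegrable f volume 0 t :=
    ContinuousOn.intervalIntegrable (by rw [uIcc_of_le ht.1]; exact hf.mono hsub)
  have hFt : IntervalIntegrable F volume 0 t := hFi.mono_set (by
    rw [uIcc_of_le ht.1, uIcc_of_le hT]
    exact hsub)
  have hcQ : ContinuousOn (fun t => √(Q t)) (Icc 0 T) := hE.continuousOn.sqrt
  have hcb := eb.continuousOn_norm
  have hcd := ed.continuousOn_norm
  have hcθ := eθ.continuousOn_norm
  have hS' : ∀ᵐ τ ∂(volume.restrict (Ioc 0 T)), α * ‖Sb τ‖ + ‖SA τ‖ + α * ‖Sd τ‖ +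
      g τ * ((α + lam) * ‖b τ‖ + α * ‖d τ‖) ≤ F τ ∧ ‖Sd τ‖ ≤ F τ ∧ g τ * ‖d τ‖ ≤ F τ ∧
      ‖Sθ τ‖ ≤ F τ / γ ∧ g τ * ‖θ τ‖ ≤ F τ / γ := by
    filter_upwards [hS] with τ h
    have hgτ := hg τ
    have h1 : 0 ≤ α * ‖Sb τ‖ := by positivity
    have h2 : 0 ≤ lam * ‖Sb τ‖ := by positivity
    have h3 : 0 ≤ γ * ‖Sθ τ‖ := by positivity
    have h4 : 0 ≤ g τ * ((α + lam) * ‖b τ‖) := by positivity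
    have h5 : 0 ≤ g τ * (γ * ‖θ τ‖) := by positivity
    have h6 : ‖Sd τ‖ ≤ α * ‖Sd τ‖ := le_mul_of_one_le_left (norm_nonneg _) hα1
    have h7 : g τ * ‖d τ‖ ≤ g τ * (α * ‖d τ‖) := by
      gcongr
      exact le_mul_of_one_le_left (norm_nonneg _) hα1
    have h8 := norm_nonneg (SA τ)
    have h9 : 0 ≤ α * ‖Sd τ‖ := by positivity
    have h10 : 0 ≤ g τ * (α * ‖d τ‖) := by positivity
    refine ⟨by linarith, by linarith, by linarith, ?_, ?_⟩
    · rw [le_div_iff₀' hγ0]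
      linarith
    · rw [le_div_iff₀' hγ0]
      linarith
  have key1 := EnergyBound.sqrt_le (Q := Q) hE hQ0 (r := 1 / 3)
    (f := fun τ => 12 * α * lam * ‖θ τ‖ + 9 * F τ)
    (by positivity) ((hsubT (by fun_prop)).add (hFi.const_mul 9))
    (fun t => by have := hF0 t; positivity) (by
      filter_upwards [hS', ae_restrict_mem measurableSet_Ioc] with τ ⟨hSτ, _⟩ hτ
      have hτ' := Ioc_subset_Icc_self hτ
      have hb := (hn τ hτ' (b τ) (by simp)).1
      have hd := (hn τ hτ' (d τ) (by simp)).1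
      have hθ := (hn τ hτ' (θ τ) (by simp)).2
      obtain ⟨h1, h2, h3, -⟩ := hquad τ hτ'
      have hs := Real.sq_sqrt (hQ0 τ)
      have hs1 := re_inner_source_le hα1 (hg τ) (Real.sqrt_nonneg (Q τ)) h1 h2 h3 (hqN τ hτ') hSτ
      have hid := block_identity hA (α ^ 2) (b τ) (d τ) (θ τ) (Sb τ) (SA τ) (Sd τ)
      have hc1 : -(inner ℂ (A (b τ) - d τ) (A (θ τ))).re ≤ √(Q τ) * (6 * lam * ‖θ τ‖) := by
        refine (neg_re_inner_le _ _).trans ?_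
        gcongr
      have hc2 : (α ^ 2 - 1) * (inner ℂ (d τ) (A (θ τ))).re ≤ α * √(Q τ) * (6 * lam * ‖θ τ‖) := by
        calc _ ≤ (α ^ 2 - 1) * (‖d τ‖ * ‖A (θ τ)‖) := by gcongr; exact re_inner_le _ _
          _ = ((α ^ 2 - 1) * ‖d τ‖) * ‖A (θ τ)‖ := by ring
          _ ≤ _ := by gcongr
      have hc3 : √(Q τ) * (6 * lam * ‖θ τ‖) ≤ α * (√(Q τ) * (6 * lam * ‖θ τ‖)) :=
        le_mul_of_one_le_left (by positivity) hα1
      have hdis : 1 / 3 * Q τ ≤ ‖A (b τ)‖ ^ 2 + (α ^ 2 - 1) * ‖A (d τ)‖ ^ 2 :=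
        high_dissipation hα hlam (norm_nonneg _) (norm_nonneg _) (norm_nonneg _) hb hd
          (norm_sub_le (A (b τ)) (d τ))
      change α ^ 2 * _ + _ + (α ^ 2 - 1) * _ + _ ≤ _
      rw [hs] at hs1
      rw [hid]
      linarith) ht
  have key2 := ed.sqrt_le (fun _ => sq_nonneg _) (r := lam ^ 2 / 9)
    (f := fun τ => 2 * √(Q τ) + 6 * lam * ‖θ τ‖ + 3 * F τ)
    (by positivity) ((hsubT (by fun_prop)).add (hFi.const_mul 3))
    (fun t => by have := hF0 t; positivity) (by
      filter_upwards [hS', ae_restrict_mem measurableSet_Ioc] with τ ⟨_, hSd, hgd, _⟩ hτ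
      have hτ' := Ioc_subset_Icc_self hτ
      have hd := (hn τ hτ' (d τ) (by simp)).1
      have hθ := (hn τ hτ' (θ τ) (by simp)).2
      have hAb := (hquad τ hτ').2.2.2.2.1
      have hd2 := pow_le_pow_left₀ (by positivity) hd 2
      have h1 : (inner ℂ (d τ) (Sd τ)).re ≤ ‖d τ‖ * F τ :=
        (re_inner_le _ _).trans (by gcongr)
      have h2 : (inner ℂ (d τ) (A (b τ))).re ≤ ‖d τ‖ * (2 * √(Q τ)) :=
        (re_inner_le _ _).trans (by gcongr)
      have h3 : (inner ℂ (d τ) (A (θ τ))).re ≤ ‖d τ‖ * (6 * lam * ‖θ τ‖) :=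
        (re_inner_le _ _).trans (by gcongr)
      have h4 : (g τ * ‖d τ‖) * ‖d τ‖ ≤ F τ * ‖d τ‖ := by gcongr
      have h5 : (inner ℂ (d τ) (A (A (d τ)))).re = ‖A (d τ)‖ ^ 2 := by
        rw [← hA, re_inner_self_eq]
      have h6 : 0 ≤ F τ * ‖d τ‖ := mul_nonneg (hF0 τ) (norm_nonneg _)
      rw [Real.sqrt_sq (norm_nonneg _)]
      simp only [map_add, inner_sub_right, inner_add_right, Complex.sub_re, Complex.add_re, h5]
      linarith) ht
  have key3 := eθ.sqrt_le (fun _ => sq_nonneg _) (r := κ * lam ^ 2 / 9)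
    (f := fun τ => 6 * lam * ‖d τ‖ + 3 * (F τ / γ))
    (by positivity) ((hsubT (by fun_prop)).add ((hFi.div_const γ).const_mul 3))
    (fun t => by have := hF0 t; positivity) (by
      filter_upwards [hS', ae_restrict_mem measurableSet_Ioc] with τ ⟨_, _, _, hSθ, hgθ⟩ hτ
      have hτ' := Ioc_subset_Icc_self hτ
      have hd := (hn τ hτ' (d τ) (by simp)).2
      have hθ := (hn τ hτ' (θ τ) (by simp)).1
      have hθ2 : κ * (lam / 3 * ‖θ τ‖) ^ 2 ≤ κ * ‖A (θ τ)‖ ^ 2 := by gcongr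
      have h1 : (inner ℂ (θ τ) (Sθ τ)).re ≤ ‖θ τ‖ * (F τ / γ) :=
        (re_inner_le _ _).trans (by gcongr)
      have h3 : -(inner ℂ (θ τ) (A (d τ))).re ≤ ‖θ τ‖ * (6 * lam * ‖d τ‖) :=
        (neg_re_inner_le _ _).trans (by gcongr)
      have h4 : (g τ * ‖θ τ‖) * ‖θ τ‖ ≤ F τ / γ * ‖θ τ‖ := by gcongr
      have h6 : 0 ≤ F τ / γ * ‖θ τ‖ := mul_nonneg (div_nonneg (hF0 τ) hγ0.le) (norm_nonneg _)
      rw [Real.sqrt_sq (norm_nonneg _), heat_identity hA]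
      simp only [inner_sub_right, Complex.sub_re]
      linarith) ht
  simp only [Real.sqrt_sq (norm_nonneg _)] at key2 key3
  have hiQ := hii hcQ
  have hid := hii hcd
  have hiθ := hii hcθ
  rw [intervalIntegral.integral_add (hiθ.const_mul _) (hFt.const_mul _),
    intervalIntegral.integral_const_mul, intervalIntegral.integral_const_mul] at key1
  rw [intervalIntegral.integral_add ((hiQ.const_mul _).add (hiθ.const_mul _)) (hFt.const_mul _),
    intervalIntegral.integral_add (hiQ.const_mul _) (hiθ.const_mul _),
    intervalIntegral.integral_const_mul, intervalIntegral.integral_const_mul,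
    intervalIntegral.integral_const_mul] at key2
  rw [intervalIntegral.integral_add (hid.const_mul _) ((hFt.div_const _).const_mul _),
    intervalIntegral.integral_const_mul, intervalIntegral.integral_const_mul,
    intervalIntegral.integral_div] at key3
  have hgain : ∫ τ in (0 : ℝ)..t, blockGain α lam γ (b τ) (d τ) (θ τ) ≤
      ∫ τ in (0 : ℝ)..t, (7 * √(Q τ) + lam ^ 2 * α * ‖d τ‖ + lam ^ 2 * γ * ‖θ τ‖) := by
    refine intervalIntegral.integral_mono_on ht.1 (hii ?_) (hii (by fun_prop)) fun τ hτ => ?_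
    · unfold blockGain
      fun_prop
    · obtain ⟨h1, -, -, -, -, h3⟩ := hquad τ (hsub hτ)
      have : min 1 (lam ^ 2) * ((α + lam) * ‖b τ‖) ≤ 1 * ((α + lam) * ‖b τ‖) := by
        gcongr
        exact min_le_left _ _
      unfold blockGain
      linarith
  rw [intervalIntegral.integral_add ((hiQ.const_mul _).add (hid.const_mul _)) (hiθ.const_mul _),
    intervalIntegral.integral_add (hiQ.const_mul _) (hid.const_mul _),
    intervalIntegral.integral_const_mul, intervalIntegral.integral_const_mul,
    intervalIntegral.integral_const_mul] at hgain
  have hI : 0 ≤ ∫ τ in (0 : ℝ)..t, F τ := intervalIntegral.integral_nonneg ht.1 fun τ _ => hF0 τ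
  have hX : 0 ≤ ∫ τ in (0 : ℝ)..t, √(Q τ) :=
    intervalIntegral.integral_nonneg ht.1 fun τ _ => Real.sqrt_nonneg _
  have hY : 0 ≤ ∫ τ in (0 : ℝ)..t, ‖d τ‖ :=
    intervalIntegral.integral_nonneg ht.1 fun τ _ => norm_nonneg _
  have hZ : 0 ≤ ∫ τ in (0 : ℝ)..t, ‖θ τ‖ :=
    intervalIntegral.integral_nonneg ht.1 fun τ _ => norm_nonneg _
  have h0 := hqN 0 ⟨le_rfl, hT⟩
  obtain ⟨m1, -, -, m2, -, m3⟩ := hquad t ht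
  generalize (∫ τ in (0 : ℝ)..t, F τ) = I at *
  generalize (∫ τ in (0 : ℝ)..t, √(Q τ)) = X at *
  generalize (∫ τ in (0 : ℝ)..t, ‖d τ‖) = Y at *
  generalize (∫ τ in (0 : ℝ)..t, ‖θ τ‖) = Z at *
  have hlam2 : 10 ^ 8 * α ^ 3 ≤ lam ^ 2 := by
    calc 10 ^ 8 * α ^ 3 ≤ α * α ^ 3 := by gcongr
      _ = (α ^ 2) ^ 2 := by ring
      _ ≤ _ := by gcongr
  have c1 : 216 * 1380 * α ^ 3 * Y ≤ lam ^ 2 * Y := by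
    gcongr
    linarith [pow_nonneg (zero_le_one.trans hα1) 3]
  have c2 : α * lam * Z ≤ α * lam * Z * (α ^ 2 * κ) := le_mul_of_one_le_right (by positivity) hκ
  have c3 : lam * Z ≤ α * lam * Z := by
    rw [mul_assoc]
    exact le_mul_of_one_le_left (by positivity) hα1
  -- Multiplication by γ with γλ = α³ makes the source of θ equal to 6α³Y, without λ, hence small
  -- compared with λ²Y.
  have key4 : γ * ‖θ t‖ + α ^ 3 * κ * lam / 9 * Z ≤ γ * ‖θ 0‖ + 6 * α ^ 3 * Y + 3 * I := by
    have := mul_le_mul_of_nonneg_left key3 hγ0.le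
    have e1 : γ * (3 * (I / γ)) = 3 * I := by field_simp
    have e2 : γ * (κ * lam ^ 2 / 9 * Z) = (γ * lam) * κ * lam / 9 * Z := by ring
    have e3 : γ * (6 * lam * Y) = 6 * (γ * lam) * Y := by ring
    rw [mul_add, mul_add, mul_add, e1, e2, e3, hγ] at this
    linarith
  have n1 : 0 ≤ (α + lam) * ‖b 0‖ := by positivity
  have n2 : 0 ≤ γ * ‖θ 0‖ := by positivity
  have n3 : ‖d 0‖ ≤ α * ‖d 0‖ := le_mul_of_one_le_left (norm_nonneg _) hα1
  have n4 := norm_nonneg (d 0)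
  have n5 := norm_nonneg (d t)
  have n6 : 0 ≤ γ * ‖θ t‖ := by positivity
  have n7 := Real.sqrt_nonneg (Q t)
  have n8 : 0 ≤ lam ^ 2 * Y := by positivity
  have n9 : 0 ≤ α * lam * Z := by positivity
  -- This is `key1` + `key2`/12 + 230·`key4`. In X one keeps 1/3 - 1/6; in Y, `c1` absorbs 1380α³
  -- into half of λ²/108; in αλZ, 230/9 exceeds 12 + 1/2 + 13; in I, 9 + 1/4 + 690 ≤ 700.
  have main : √(Q t) + 230 * (γ * ‖θ t‖) + X / 6 + lam ^ 2 / 216 * Y + 13 * (α * lam * Z) ≤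
      700 * (blockWeight α lam γ (b 0) (d 0) (θ 0) + I) := by
    unfold blockWeight
    linarith
  have hN0 : 0 ≤ blockWeight α lam γ (b 0) (d 0) (θ 0) + I := by
    unfold blockWeight
    linarith
  refine ⟨?_, hgain.trans ?_⟩
  · rw [blockWeight]
    linarith
  · have e1 : lam ^ 2 * γ * Z = α ^ 2 * (α * lam * Z) := by
      calc lam ^ 2 * γ * Z = (γ * lam) * lam * Z := by ring
        _ = _ := by rw [hγ]; ring
    have e2 : lam ^ 2 * α * Y ≤ α ^ 2 * (lam ^ 2 / 216 * Y) := by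
      have : 216 * (α * (lam ^ 2 / 216 * Y)) ≤ α * (α * (lam ^ 2 / 216 * Y)) := by
        gcongr
        linarith
      linarith
    have e3 : 42 * (X / 6) ≤ α ^ 2 * (X / 6) := by
      gcongr
      nlinarith
    have e4 : α ^ 2 * (X / 6 + lam ^ 2 / 216 * Y + 13 * (α * lam * Z)) ≤
        α ^ 2 * (700 * (blockWeight α lam γ (b 0) (d 0) (θ 0) + I)) := by
      gcongr
      linarith
    have e5 : 0 ≤ α ^ 2 * (α * lam * Z) := by positivity
    have e6 : α ^ 2 * (blockWeight α lam γ (b 0) (d 0) (θ 0) + I) ≤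
        α ^ 4 * (blockWeight α lam γ (b 0) (d 0) (θ 0) + I) := by
      gcongr
      norm_num
    have e7 : 0 ≤ α ^ 4 * (blockWeight α lam γ (b 0) (d 0) (θ 0) + I) := by positivity
    rw [e1]
    linarith

/-- The estimate of a block of a solution of a heat equation. -/
theorem EnergyBound.heat {H : Type*} [NormedAddCommGroup H] [InnerProductSpace ℂ H] {A : H →L[ℂ] H}
    {T : ℝ} {g F : ℝ → ℝ} {w S : ℝ → H} {μ lam : ℝ}
    (hA : ∀ x y, inner ℂ (A x) y = inner ℂ x (A y)) (hμ : 0 ≤ μ) (hlam : 0 < lam)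
    (hF0 : ∀ t, 0 ≤ F t) (hFi : IntervalIntegrable F volume 0 T)
    (hn : ∀ t ∈ Icc 0 T, lam / 3 * ‖w t‖ ≤ ‖A (w t)‖)
    (h : EnergyBound T g (fun t => ‖w t‖ ^ 2)
      (fun t => (inner ℂ (w t) (S t - (μ : ℂ) • A (A (w t)))).re))
    (hS : ∀ᵐ τ ∂(volume.restrict (Ioc 0 T)), ‖S τ‖ + 3 / 2 * g τ * ‖w τ‖ ≤ F τ)
    {t : ℝ} (ht : t ∈ Icc 0 T) :
    ‖w t‖ + μ * lam ^ 2 / 9 * ∫ τ in (0 : ℝ)..t, ‖w τ‖ ≤ ‖w 0‖ + ∫ τ in (0 : ℝ)..t, F τ := by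
  have key := h.sqrt_le (fun _ => sq_nonneg _) (r := μ * lam ^ 2 / 9) (f := F)
    (by positivity) hFi hF0 (by
      filter_upwards [hS, ae_restrict_mem measurableSet_Ioc] with τ hSτ hτ
      have h1 : (inner ℂ (w τ) (S τ)).re ≤ ‖w τ‖ * ‖S τ‖ := re_inner_le _ _
      have h2 : μ * (lam / 3 * ‖w τ‖) ^ 2 ≤ μ * ‖A (w τ)‖ ^ 2 := by
        have := hn τ (Ioc_subset_Icc_self hτ)
        gcongr
      have h3 : (‖S τ‖ + 3 / 2 * g τ * ‖w τ‖) * ‖w τ‖ ≤ F τ * ‖w τ‖ := by gcongr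
      rw [Real.sqrt_sq (norm_nonneg _), heat_identity hA]
      linarith) ht
  simpa only [Real.sqrt_sq (norm_nonneg _)] using key

end BlockEstimates

/-! ### Measurable `L²` representatives of blocks -/

section BlockRepresentatives

variable {χ : R3 → ℝ} {F : Type*} [NormedAddCommGroup F] [InnerProductSpace ℂ F] [CompleteSpace F]

open Classical in
/-- The block `Δ_j z` as an `L²` function, or zero if it is not in `L²`. -/
def l2Block (χ : R3 → ℝ) (j : ℤ) (z : 𝓢'(R3, F)) : Lp F 2 (volume : Measure R3) :=
  if h : ∃ f : Lp F 2 (volume : Measure R3), (f : 𝓢'(R3, F)) = lpBlock χ j z then h.choose else 0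

theorem coe_l2Block {j : ℤ} {z : 𝓢'(R3, F)} (h : l2Norm (lpBlock χ j z) ≠ ∞) :
    (l2Block χ j z : 𝓢'(R3, F)) = lpBlock χ j z := by
  have h' := exists_eq_coe_of_l2Norm_ne_top h
  rw [l2Block, dif_pos h', h'.choose_spec]

theorem enorm_l2Block {j : ℤ} {z : 𝓢'(R3, F)} (h : l2Norm (lpBlock χ j z) ≠ ∞) :
    ‖l2Block χ j z‖ₑ = l2Norm (lpBlock χ j z) := by
  rw [← coe_l2Block h, l2Norm_coe]

theorem ofReal_norm_l2Block {j : ℤ} {z : 𝓢'(R3, F)} (h : l2Norm (lpBlock χ j z) ≠ ∞) :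
    ENNReal.ofReal ‖l2Block χ j z‖ = l2Norm (lpBlock χ j z) := by
  rw [ofReal_norm, enorm_l2Block h]

theorem multL2_fatS_l2Block (hχ : IsLPCutoff χ) (j : ℤ) (z : 𝓢'(R3, F)) :
    multL2 (fatS hχ j) (l2Block χ j z) = l2Block χ j z := by
  by_cases h' : ∃ f : Lp F 2 (volume : Measure R3), (f : 𝓢'(R3, F)) = lpBlock χ j z
  · refine toTemperedDistribution_injective ?_
    rw [coe_multL2, l2Block, dif_pos h', h'.choose_spec, lpBlock_eq hχ,
      fourierMultiplierCLM_comp (fatS hχ j).hasTemperateGrowth (phiS hχ j).hasTemperateGrowth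
        (fatS_mul_phiS hχ j)]
  · rw [l2Block, dif_neg h', map_zero]

/-- The function `f` is not assumed measurable, as is the case for `l2Norm` along a family of
distributions. Measurability of a set on which `f` is infinite is enough. -/
theorem measure_eq_zero_of_lintegral_ne_top {α : Type*} [MeasurableSpace α] {μ : Measure α}
    {f : α → ℝ≥0∞} (hf : ∫⁻ a, f a ∂μ ≠ ∞) {A : Set α} (hA : NullMeasurableSet A μ)
    (h : ∀ a ∈ A, f a = ∞) : μ A = 0 := by
  by_contra hne
  refine hf (eq_top_iff.2 ?_)
  calc ∞ = ∞ * μ A := (ENNReal.top_mul hne).symm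
    _ = ∫⁻ a, A.indicator (fun _ => ∞) a ∂μ := by rw [lintegral_indicator_const₀ hA]
    _ ≤ ∫⁻ a, f a ∂μ := by
      refine lintegral_mono fun a => ?_
      by_cases ha : a ∈ A
      · simp [h a ha]
      · simp [ha]

/-- By separability of `L²`, countably many Schwartz functions approximate all others in `L²`, hence
separate points. -/
theorem exists_seq_pairL_injective :
    ∃ ψ : ℕ → 𝓢(R3, ℂ), Function.Injective
      (fun (f : Lp F 2 (volume : Measure R3)) (n : ℕ) => pairL (ψ n) f) := by
  have : Fact ((2 : ℝ≥0∞) ≠ ∞) := ⟨by norm_num⟩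
  obtain ⟨D, hDs, hDc, hD⟩ := (TopologicalSpace.IsSeparable.of_separableSpace
    (range fun ψ : 𝓢(R3, ℂ) => ψ.toLp 2 (volume : Measure R3))).exists_countable_dense_subset
  have hne : D.Nonempty := by
    by_contra hcon
    rw [not_nonempty_iff_eq_empty] at hcon
    rw [hcon, closure_empty] at hD
    exact hD ⟨0, rfl⟩
  obtain ⟨d, rfl⟩ := hDc.exists_eq_range hne
  choose ψ hψ using fun n => hDs ⟨n, rfl⟩
  refine ⟨ψ, fun f g hfg => eq_of_pairL_eq fun φ => ?_⟩
  set L : Lp ℂ 2 (volume : Measure R3) →L[ℂ] F :=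
    ((ContinuousLinearMap.lsmul ℂ ℂ (E := F)).flip.lpPairing volume 2 2) (f - g) with hL
  have h1 (η : 𝓢(R3, ℂ)) : L (η.toLp 2 volume) = pairL η f - pairL η g := by
    rw [← map_sub]
    rfl
  have hcl : IsClosed {y | L y = 0} := isClosed_eq L.continuous continuous_const
  have h2 : range d ⊆ {y | L y = 0} := by
    rintro _ ⟨n, rfl⟩
    rw [mem_ofPred_eq, ← hψ]
    exact (h1 _).trans (sub_eq_zero.2 (congrFun hfg n))
  have h3 : φ.toLp 2 (volume : Measure R3) ∈ {y | L y = 0} :=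
    hcl.closure_subset_iff.2 h2 (hD ⟨φ, rfl⟩)
  rw [mem_ofPred_eq, h1, sub_eq_zero] at h3
  exact h3

/-- A weakly measurable family of tempered distributions whose `L²` norm has a finite integral is
represented by a measurable family of `L²` functions. -/
theorem exists_representative [SecondCountableTopology F] {α : Type*} [MeasurableSpace α]
    {μ : Measure α} {z : α → 𝓢'(R3, F)} (hz : ∀ ψ, AEStronglyMeasurable (fun a => z a ψ) μ)
    (hfin : ∫⁻ a, l2Norm (z a) ∂μ ≠ ∞) :
    ∃ Z : α → Lp F 2 (volume : Measure R3), AEStronglyMeasurable Z μ ∧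
      (∀ a, ‖Z a‖ₑ ≤ l2Norm (z a)) ∧ ∀ ψ, ∀ᵐ a ∂μ, z a ψ = pairL ψ (Z a) := by
  have : Fact ((2 : ℝ≥0∞) ≠ ∞) := ⟨by norm_num⟩
  obtain ⟨η, hη⟩ := exists_seq_pairL_injective (F := F)
  borelize F
  let _ : MeasurableSpace (Lp F 2 (volume : Measure R3)) := borel _
  have : BorelSpace (Lp F 2 (volume : Measure R3)) := ⟨rfl⟩
  -- By the Lusin–Souslin theorem a continuous injection between Polish spaces has a measurable
  -- inverse on its range. So the `L²` representative is a measurable function of countably many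
  -- pairings.
  have he : MeasurableEmbedding
      (fun (f : Lp F 2 (volume : Measure R3)) (n : ℕ) => pairL (η n) f) :=
    Continuous.measurableEmbedding (by fun_prop) hη
  set Z : α → Lp F 2 (volume : Measure R3) := fun a => he.invFun fun n => z a (η n) with hZ
  have hZm : AEStronglyMeasurable Z μ := by
    refine AEMeasurable.aestronglyMeasurable ?_
    refine he.measurable_invFun.comp_aemeasurable (aemeasurable_pi_lambda _ fun n => ?_)
    exact (hz _).aemeasurable
  have hZe (a : α) (ha : l2Norm (z a) ≠ ∞) : (Z a : 𝓢'(R3, F)) = z a := by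
    obtain ⟨f, hf⟩ := exists_eq_coe_of_l2Norm_ne_top ha
    have : (fun n => z a (η n)) = fun n => pairL (η n) f := by
      funext n
      rw [pairL_apply, hf]
    rw [hZ]
    beta_reduce
    rw [this, he.leftInverse_invFun f, hf]
  refine ⟨Z, hZm, fun a => ?_, fun ψ => ?_⟩
  · rcases eq_or_ne (l2Norm (z a)) ∞ with ha | ha
    · rw [ha]
      exact le_top
    · rw [← hZe a ha, l2Norm_coe]
  · refine measure_eq_zero_of_lintegral_ne_top hfin ?_ fun a ha => ?_
    · exact (AEStronglyMeasurable.nullMeasurableSet_eq_fun (hz ψ)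
        ((pairL ψ).continuous.comp_aestronglyMeasurable hZm)).compl
    · by_contra hne
      refine ha ?_
      rw [mem_ofPred_eq, pairL_apply, hZe a hne]

end BlockRepresentatives

/-! ### Λ and the Laplacian on a block -/

section BlockOperators

variable {χ : R3 → ℝ} {F : Type*} [NormedAddCommGroup F] [InnerProductSpace ℂ F]

theorem lambdaBlock_eq (hχ : IsLPCutoff χ) (j : ℤ) (z : 𝓢'(R3, F)) :
    lambdaBlock χ j z = TemperedDistribution.fourierMultiplierCLM F (lamS hχ j) (lpBlock χ j z) := by
  rw [lpBlock_eq hχ, fourierMultiplierCLM_comp (lamS hχ j).hasTemperateGrowth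
    (phiS hχ j).hasTemperateGrowth (fun ξ => rfl), lambdaBlock, symbolD]
  congr 2
  funext ξ
  rw [lamS, radS_apply, mul_assoc, fatS_mul_phiS, phiS_apply, Complex.ofReal_mul]

/-- In this normalisation the Laplacian has the symbol -(2π|ξ|)², and the two factors `fatS`
contained in Λ² are one on the block. -/
theorem lpBlock_laplacian (hχ : IsLPCutoff χ) (j : ℤ) (z : 𝓢'(R3, F)) :
    lpBlock χ j (Δ z) = -TemperedDistribution.fourierMultiplierCLM F (lamS hχ j)
      (TemperedDistribution.fourierMultiplierCLM F (lamS hχ j) (lpBlock χ j z)) := by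
  have hn : (fun ξ : R3 => Complex.ofReal (‖ξ‖ ^ 2)).HasTemperateGrowth := by fun_prop
  have hl := (lamS hχ j).hasTemperateGrowth
  have hp := (phiS hχ j).hasTemperateGrowth
  have hlp : (fun ξ => lamS hχ j ξ * phiS hχ j ξ).HasTemperateGrowth := hl.mul hp
  have hpn : (fun ξ => phiS hχ j ξ * Complex.ofReal (‖ξ‖ ^ 2)).HasTemperateGrowth := hp.mul hn
  have hg : (fun ξ => lamS hχ j ξ * (lamS hχ j ξ * phiS hχ j ξ)) = (((2 * Real.pi) ^ 2 : ℝ) : ℂ) •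
      fun ξ => phiS hχ j ξ * Complex.ofReal (‖ξ‖ ^ 2) := by
    funext ξ
    rw [lamS, radS_apply, norm_two_pi_smul, Pi.smul_apply, smul_eq_mul]
    push_cast
    linear_combination (2 * Real.pi * ‖ξ‖ : ℂ) ^ 2 * (fatS hχ j ξ + 1) * fatS_mul_phiS hχ j ξ
  rw [TemperedDistribution.laplacian_eq_fourierMultiplierCLM, lpBlock_eq hχ,
    fourierMultiplierCLM_comp hl hp (fun ξ => rfl),
    fourierMultiplierCLM_comp hl hlp (fun ξ => rfl), hg,
    TemperedDistribution.fourierMultiplierCLM_smul hpn, neg_smul, map_neg,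
    ← Complex.coe_smul, map_smul, fourierMultiplierCLM_comp hp hn (fun ξ => rfl)]
  rfl

variable [CompleteSpace F]

/-- The product of `invLamS` and `lamS` is the square of `fatS`, which acts as the identity on `f`.
This gives the lower bound. -/
theorem norm_multL2_lamS (hχ : IsLPCutoff χ) {j : ℤ} {f : Lp F 2 (volume : Measure R3)}
    (hf : multL2 (fatS hχ j) f = f) :
    2 ^ j / 3 * ‖f‖ ≤ ‖multL2 (lamS hχ j) f‖ ∧ ‖multL2 (lamS hχ j) f‖ ≤ 6 * 2 ^ j * ‖f‖ := by
  refine ⟨?_, norm_multL2_le (norm_lamS_le hχ j) f⟩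
  have h1 : multL2 (invLamS hχ j) (multL2 (lamS hχ j) f) = f := by
    have hl := (lamS hχ j).hasTemperateGrowth
    have hi := (invLamS hχ j).hasTemperateGrowth
    have hg := (fatS hχ j).hasTemperateGrowth
    have h2 : multL2 (invLamS hχ j) (multL2 (lamS hχ j) f) =
        multL2 (fatS hχ j) (multL2 (fatS hχ j) f) := by
      refine toTemperedDistribution_injective ?_
      simp only [coe_multL2]
      rw [fourierMultiplierCLM_comp hi hl (c := fun ξ => fatS hχ j ξ * fatS hχ j ξ) (fun ξ => ?_),
        fourierMultiplierCLM_comp hg hg (fun ξ => rfl)]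
      simp only [lamS, invLamS, radS_apply]
      rcases eq_or_ne ‖(2 * Real.pi) • ξ‖ 0 with h0 | h0
      · rw [fatS_eq_zero_of_le hχ (by rw [h0]; positivity)]
        simp
      · have : ((‖(2 * Real.pi) • ξ‖ : ℝ) : ℂ) ≠ 0 := by exact_mod_cast h0
        push_cast
        field_simp
    rw [h2, hf, hf]
  have h3 := norm_multL2_le (norm_invLamS_le hχ j) (multL2 (lamS hχ j) f)
  rw [h1] at h3
  have h0 : (0 : ℝ) < 2 ^ j := by positivity
  calc 2 ^ j / 3 * ‖f‖ ≤ 2 ^ j / 3 * (3 * (2 ^ j)⁻¹ * ‖multL2 (lamS hχ j) f‖) := by gcongr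
    _ = _ := by field_simp

end BlockOperators

/-! ### From the evolution equations to transport equations -/

section BlockTransport

variable {χ : R3 → ℝ} {F : Type*} [NormedAddCommGroup F] [InnerProductSpace ℂ F] [CompleteSpace F]

/-- The frequency localization of a paralinear evolution equation is a transport equation. -/
theorem EvolvesBy.exists_isTransport {hχ : IsLPCutoff χ} {T : ℝ} {v : ℝ → R3 → R3}
    {u : ℝ → 𝓢'(R3, F)} {rhs : ℝ → ℤ → 𝓢'(R3, F)} (hT : 0 ≤ T) (hv : IsVelocity T v)
    (hu : EvolvesBy χ T u rhs) (hfin : ∀ t ∈ Icc 0 T, ∀ i, l2Norm (lpBlock χ i (u t)) ≠ ∞)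
    {j : ℤ} {n M : 𝓢(R3, ℂ)} {c : ℂ} (hn : ∀ ξ, n ξ * phiS hχ j ξ = c * M (((2 : ℝ) ^ j)⁻¹ • ξ))
    {S : ℝ → Lp F 2 (volume : Measure R3)}
    (hS : ∀ ψ, ∀ᵐ τ ∂(volume.restrict (Ioc 0 T)),
      rhs τ j ψ = pairL ψ (S τ) - paraconvBlock χ j (v τ) (u τ) ψ) :
    ∃ R : ℝ → Lp F 2 (volume : Measure R3),
      (∀ᵐ τ ∂(volume.restrict (Ioc 0 T)), ‖R τ‖ ≤ lipConst v τ * (paraConst hχ M * ‖c‖) *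
        ∑ i ∈ Finset.Icc (j - 5) (j + 5), ‖l2Block χ i (u τ)‖) ∧
      IsTransport hχ T v j (fun t => multL2 n (l2Block χ j (u t)))
        (fun τ => multL2 n (S τ) - R τ) := by
  have hR (τ : ℝ) : ∃ R : Lp F 2 (volume : Measure R3), τ ∈ Icc 0 T →
      (∀ x y, ‖v τ x - v τ y‖ ≤ lipConst v τ * ‖x - y‖) →
      ‖R‖ ≤ lipConst v τ * (paraConst hχ M * ‖c‖) *
        ∑ i ∈ Finset.Icc (j - 5) (j + 5), ‖l2Block χ i (u τ)‖ ∧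
      ∀ ψ : 𝓢(R3, ℂ),
        TemperedDistribution.fourierMultiplierCLM F n (paraconvBlock χ j (v τ) (u τ)) ψ =
          (∑ k : Fin 3, ∫ x, ((v τ x k : ℂ) * ψ x) •
            multL2 (derS hχ j k) (multL2 n (l2Block χ j (u τ))) x) + (R : 𝓢'(R3, F)) ψ := by
    by_cases h : τ ∈ Icc 0 T ∧ ∀ x y, ‖v τ x - v τ y‖ ≤ lipConst v τ * ‖x - y‖
    · obtain ⟨R, hR⟩ := exists_paraconvBlock_eq hχ (fun i => coe_l2Block (hfin τ h.1 i)) hn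
        (lipConst_nonneg v τ) h.2
      exact ⟨R, fun _ _ => hR⟩
    · exact ⟨0, fun h1 h2 => absurd ⟨h1, h2⟩ h⟩
  choose R hR using hR
  refine ⟨R, ?_, fun ψ => ?_⟩
  · filter_upwards [hv.ae_norm_sub_le, ae_restrict_mem measurableSet_Ioc] with τ h1 h2
    exact (hR τ (Ioc_subset_Icc_self h2) h1).1
  -- With φ the image of ψ under the transpose of n(D), the equation of Δ_j u tested against φ is
  -- the equation of n(D)Δ_j u tested against ψ.
  obtain ⟨φ, hφ⟩ : ∃ φ : 𝓢(R3, ℂ), ∀ z : 𝓢'(R3, F),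
      TemperedDistribution.fourierMultiplierCLM F n z ψ = z φ :=
    ⟨_, fun z => TemperedDistribution.fourierMultiplierCLM_apply_apply _ _ _⟩
  have hpair (f : Lp F 2 (volume : Measure R3)) : pairL φ f = pairL ψ (multL2 n f) := by
    rw [pairL_apply, pairL_apply, coe_multL2, hφ]
  have hae : ∀ᵐ τ ∂(volume.restrict (Ioc 0 T)), rhs τ j φ =
      pairL ψ (multL2 n (S τ) - R τ) - ∑ k, ∫ x, ((v τ x k : ℂ) * ψ x) •
        multL2 (derS hχ j k) (multL2 n (l2Block χ j (u τ))) x := by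
    filter_upwards [hv.ae_norm_sub_le, ae_restrict_mem measurableSet_Ioc, hS φ] with τ h1 h2 h3
    rw [h3, hpair, ← hφ, (hR τ (Ioc_subset_Icc_self h2) h1).2, map_sub, pairL_apply ψ (R τ)]
    abel
  have hU (t : ℝ) (ht : t ∈ Icc 0 T) :
      pairL ψ (multL2 n (l2Block χ j (u t))) = lpBlock χ j (u t) φ := by
    rw [← hpair, pairL_apply, coe_l2Block (hfin t ht j)]
  refine ⟨(hu j φ).1.congr_ae ?_, fun t ht => ?_⟩
  · rwa [uIoc_of_le hT]
  · rw [hU t ht, hU 0 ⟨le_rfl, hT⟩, (hu j φ).2 t ht]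
    congr 1
    refine intervalIntegral.integral_congr_ae ?_
    rw [uIoc_of_le ht.1, ← ae_restrict_iff' measurableSet_Ioc]
    exact ae_restrict_of_ae_restrict_of_subset (Ioc_subset_Ioc_right ht.2) hae

theorem IsTransport.congr {hχ : IsLPCutoff χ} {T : ℝ} {v : ℝ → R3 → R3} {j : ℤ}
    {U U' Φ Φ' : ℝ → Lp F 2 (volume : Measure R3)} (h : IsTransport hχ T v j U Φ)
    (hU : ∀ t, U t = U' t) (hΦ : ∀ t, Φ t = Φ' t) : IsTransport hχ T v j U' Φ' := by
  rwa [← funext hU, ← funext hΦ]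

/-- This yields the equation of Λb - d. Splitting the transport integrals requires v^k ψ in `L²`,
which holds at almost every time. -/
theorem IsTransport.sub {hχ : IsLPCutoff χ} {T : ℝ} {v : ℝ → R3 → R3} {j : ℤ}
    {U U' Φ Φ' : ℝ → Lp F 2 (volume : Measure R3)} (hT : 0 ≤ T) (hv : IsVelocity T v)
    (h : IsTransport hχ T v j U Φ) (h' : IsTransport hχ T v j U' Φ') :
    IsTransport hχ T v j (fun t => U t - U' t) (fun t => Φ t - Φ' t) := by
  intro ψ
  have hp := h ψ
  have hp' := h' ψ
  have hae : ∀ᵐ τ ∂(volume.restrict (Ioc 0 T)),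
      ((pairL ψ (Φ τ) - ∑ k, ∫ x, ((v τ x k : ℂ) * ψ x) • multL2 (derS hχ j k) (U τ) x) -
        (pairL ψ (Φ' τ) - ∑ k, ∫ x, ((v τ x k : ℂ) * ψ x) • multL2 (derS hχ j k) (U' τ) x)) =
      pairL ψ (Φ τ - Φ' τ) - ∑ k, ∫ x, ((v τ x k : ℂ) * ψ x) •
        multL2 (derS hχ j k) (U τ - U' τ) x := by
    filter_upwards [hv.ae_norm_sub_le] with τ hτ
    have hvk (k : Fin 3) (x y : R3) : |v τ x k - v τ y k| ≤ lipConst v τ * ‖x - y‖ := by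
      refine le_trans ?_ (hτ x y)
      have := PiLp.norm_apply_le (v τ x - v τ y) k
      simpa using this
    have hf (k : Fin 3) := memLp_smul_schwartz (continuous_of_lipschitz (hvk k))
      (abs_le_of_lipschitz (lipConst_nonneg v τ) (hvk k)) ψ
    simp_rw [← pairL2_apply (hf _), map_sub, Finset.sum_sub_distrib]
    abel
  have hint := hp.integrable.sub hp'.integrable
  refine ⟨hint.congr_ae (by rwa [uIoc_of_le hT]), fun t ht => ?_⟩
  have h0 : (0 : ℝ) ∈ Icc 0 T := ⟨le_rfl, hT⟩
  simp only [map_sub]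
  rw [hp.eq t ht, hp'.eq t ht, add_sub_add_comm,
    ← intervalIntegral.integral_sub (hp.integrable_sub h0 ht) (hp'.integrable_sub h0 ht)]
  congr 1
  refine intervalIntegral.integral_congr_ae ?_
  rw [uIoc_of_le ht.1, ← ae_restrict_iff' measurableSet_Ioc]
  simp only [map_sub] at hae
  exact ae_restrict_of_ae_restrict_of_subset (Ioc_subset_Ioc_right ht.2) hae

end BlockTransport

/-! ### Evaluation of sums of distributions -/

section Distributions

variable {F : Type*} [NormedAddCommGroup F] [NormedSpace ℂ F]

theorem distribution_add_apply (f g : 𝓢'(R3, F)) (ψ : 𝓢(R3, ℂ)) : (f + g) ψ = f ψ + g ψ := rfl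

theorem distribution_sub_apply (f g : 𝓢'(R3, F)) (ψ : 𝓢(R3, ℂ)) : (f - g) ψ = f ψ - g ψ := rfl

theorem distribution_neg_apply (f : 𝓢'(R3, F)) (ψ : 𝓢(R3, ℂ)) : (-f) ψ = -f ψ := rfl

theorem distribution_smul_apply (c : ℂ) (f : 𝓢'(R3, F)) (ψ : 𝓢(R3, ℂ)) :
    (c • f) ψ = c • f ψ := rfl

end Distributions

/-! ### Equations and energy bounds for single blocks -/

section BlockEnergy

variable {χ : R3 → ℝ} {F : Type*} [NormedAddCommGroup F] [InnerProductSpace ℂ F] [CompleteSpace F]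
  {T : ℝ} {v : ℝ → R3 → R3} {j : ℤ}

theorem paraConst_nonneg (hχ : IsLPCutoff χ) (M : 𝓢(R3, ℂ)) : 0 ≤ paraConst hχ M := by
  have h1 := kerMoment_nonneg (lowS hχ 0)
  have h2 := kerMoment_nonneg M
  have h3 := kerNorm_nonneg M
  unfold paraConst
  positivity

/-- A constant for the commutators with `Δ_j` and with `Λ Δ_j`. -/
def blockConst (hχ : IsLPCutoff χ) : ℝ :=
  paraConst hχ (phiS hχ 0) +
    paraConst hχ (SchwartzMap.smulLeftCLM ℂ (lamS hχ 0 : R3 → ℂ) (phiS hχ 0))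

theorem blockConst_nonneg (hχ : IsLPCutoff χ) : 0 ≤ blockConst hχ :=
  add_nonneg (paraConst_nonneg hχ _) (paraConst_nonneg hχ _)

theorem phiS_eq_smul (hχ : IsLPCutoff χ) (j : ℤ) (ξ : R3) :
    phiS hχ j ξ = phiS hχ 0 (((2 : ℝ) ^ j)⁻¹ • ξ) := by
  have h := IsLPCutoff.dyadicSymbol_add (χ := χ) 0 j ((2 * Real.pi) • ξ)
  rw [add_zero] at h
  rw [phiS_apply, phiS_apply, h, smul_comm, zpow_neg]

theorem lamS_mul_phiS (hχ : IsLPCutoff χ) (j : ℤ) (ξ : R3) :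
    lamS hχ j ξ * phiS hχ j ξ = ((‖(2 * Real.pi) • ξ‖ : ℝ) : ℂ) * phiS hχ j ξ := by
  rw [lamS, radS_apply, mul_assoc, fatS_mul_phiS]

/-- The symbol of ΛΔ_j is 2^j times a dilation of a fixed Schwartz function, so its commutator
constant is 2^j times one that does not depend on j. -/
theorem lamS_mul_phiS_eq_smul (hχ : IsLPCutoff χ) (j : ℤ) (ξ : R3) :
    lamS hχ j ξ * phiS hχ j ξ = (((2 : ℝ) ^ j : ℝ) : ℂ) *
      SchwartzMap.smulLeftCLM ℂ (lamS hχ 0 : R3 → ℂ) (phiS hχ 0) (((2 : ℝ) ^ j)⁻¹ • ξ) := by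
  have h0 : (0 : ℝ) < 2 ^ j := by positivity
  rw [SchwartzMap.smulLeftCLM_apply_apply (lamS hχ 0).hasTemperateGrowth, smul_eq_mul,
    lamS_mul_phiS, lamS_mul_phiS, ← phiS_eq_smul, smul_comm, norm_smul ((2 : ℝ) ^ j)⁻¹,
    ← mul_assoc, ← Complex.ofReal_mul, Real.norm_of_nonneg (by positivity), ← mul_assoc,
    mul_inv_cancel₀ h0.ne', one_mul]

section

variable {hχ : IsLPCutoff χ} {u : ℝ → 𝓢'(R3, F)} {rhs : ℝ → ℤ → 𝓢'(R3, F)}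
  {X Y : ℝ → Lp F 2 (volume : Measure R3)}

/-- Taking `fatS` as the extra multiplier leaves the block unchanged. `X` is the external source,
which is only estimated; the localized part `Y` is kept exactly because the energy cancellations use
it. -/
theorem EvolvesBy.exists_block (hT : 0 ≤ T) (hv : IsVelocity T v) (hu : EvolvesBy χ T u rhs)
    (hfin : ∀ t ∈ Icc 0 T, ∀ i, l2Norm (lpBlock χ i (u t)) ≠ ∞)
    (hS : ∀ ψ, ∀ᵐ τ ∂(volume.restrict (Ioc 0 T)),
      rhs τ j ψ = pairL ψ (X τ + Y τ) - paraconvBlock χ j (v τ) (u τ) ψ)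
    (hY : ∀ t, multL2 (fatS hχ j) (Y t) = Y t) :
    ∃ S : ℝ → Lp F 2 (volume : Measure R3),
      (∀ᵐ τ ∂(volume.restrict (Ioc 0 T)), ‖S τ‖ ≤ ‖X τ‖ + lipConst v τ * blockConst hχ *
        ∑ i ∈ Finset.Icc (j - 5) (j + 5), ‖l2Block χ i (u τ)‖) ∧
      IsTransport hχ T v j (fun t => l2Block χ j (u t)) (fun τ => S τ + Y τ) := by
  obtain ⟨R, hR, hR'⟩ := hu.exists_isTransport hT hv hfin (n := fatS hχ j) (M := phiS hχ 0) (c := 1)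
    (fun ξ => by rw [fatS_mul_phiS, one_mul, phiS_eq_smul]) hS
  refine ⟨fun τ => multL2 (fatS hχ j) (X τ) - R τ, ?_, hR'.congr
    (fun t => multL2_fatS_l2Block hχ j _) fun t => ?_⟩
  · filter_upwards [hR] with τ hτ
    have h1 := norm_multL2_le (norm_fatS_le hχ j) (X τ)
    rw [one_mul] at h1
    have h2 := lipConst_nonneg v τ
    have h3 : paraConst hχ (phiS hχ 0) * ‖(1 : ℂ)‖ ≤ blockConst hχ := by
      rw [norm_one, mul_one]
      exact le_add_of_nonneg_right (paraConst_nonneg hχ _)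
    have hN : 0 ≤ ∑ i ∈ Finset.Icc (j - 5) (j + 5), ‖l2Block χ i (u τ)‖ :=
      Finset.sum_nonneg fun _ _ => norm_nonneg _
    calc _ ≤ _ := norm_sub_le _ _
      _ ≤ ‖X τ‖ + lipConst v τ * blockConst hχ *
          ∑ i ∈ Finset.Icc (j - 5) (j + 5), ‖l2Block χ i (u τ)‖ := by
        refine add_le_add h1 (hτ.trans ?_)
        generalize (∑ i ∈ Finset.Icc (j - 5) (j + 5), ‖l2Block χ i (u τ)‖) = N at hN ⊢
        generalize blockConst hχ = K at *
        generalize paraConst hχ (phiS hχ 0) * ‖(1 : ℂ)‖ = K' at *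
        gcongr
  · rw [map_add, hY, add_sub_right_comm]

/-- Localizing with ΛΔ_j at once, instead of applying Λ afterwards, bounds the commutator by
2^j‖∇v‖_∞ without second derivatives of v. -/
theorem EvolvesBy.exists_lambda_block (hT : 0 ≤ T) (hv : IsVelocity T v) (hu : EvolvesBy χ T u rhs)
    (hfin : ∀ t ∈ Icc 0 T, ∀ i, l2Norm (lpBlock χ i (u t)) ≠ ∞)
    (hS : ∀ ψ, ∀ᵐ τ ∂(volume.restrict (Ioc 0 T)),
      rhs τ j ψ = pairL ψ (X τ + Y τ) - paraconvBlock χ j (v τ) (u τ) ψ) :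
    ∃ S : ℝ → Lp F 2 (volume : Measure R3),
      (∀ᵐ τ ∂(volume.restrict (Ioc 0 T)),
        ‖S τ‖ ≤ 2 ^ j * (6 * ‖X τ‖ + lipConst v τ * blockConst hχ *
          ∑ i ∈ Finset.Icc (j - 5) (j + 5), ‖l2Block χ i (u τ)‖)) ∧
      IsTransport hχ T v j (fun t => multL2 (lamS hχ j) (l2Block χ j (u t)))
        (fun τ => S τ + multL2 (lamS hχ j) (Y τ)) := by
  obtain ⟨R, hR, hR'⟩ := hu.exists_isTransport hT hv hfin (n := lamS hχ j)
    (lamS_mul_phiS_eq_smul hχ j) hS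
  refine ⟨fun τ => multL2 (lamS hχ j) (X τ) - R τ, ?_, hR'.congr (fun t => rfl) fun t => ?_⟩
  · filter_upwards [hR] with τ hτ
    have h1 := norm_multL2_le (norm_lamS_le hχ j) (X τ)
    have h0 : (0 : ℝ) < 2 ^ j := by positivity
    rw [Complex.norm_real, Real.norm_of_nonneg h0.le] at hτ
    have h2 := lipConst_nonneg v τ
    have h3 : paraConst hχ (SchwartzMap.smulLeftCLM ℂ (lamS hχ 0 : R3 → ℂ) (phiS hχ 0)) ≤
        blockConst hχ := le_add_of_nonneg_left (paraConst_nonneg hχ _)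
    calc _ ≤ _ := norm_sub_le _ _
      _ ≤ 6 * 2 ^ j * ‖X τ‖ + lipConst v τ * (blockConst hχ * 2 ^ j) *
          ∑ i ∈ Finset.Icc (j - 5) (j + 5), ‖l2Block χ i (u τ)‖ := by
        refine add_le_add h1 (hτ.trans ?_)
        gcongr
      _ = _ := by ring
  · rw [map_add, add_sub_right_comm]

/-- In the majorant, `f` is for sources integrable in time and `C` for the linear terms, which are
bounded on a fixed block. -/
theorem IsTransport.energyBound [SecondCountableTopology F] (hT : 0 ≤ T) (hv : IsVelocity T v)
    {U Φ : ℝ → Lp F 2 (volume : Measure R3)} (h : IsTransport hχ T v j U Φ)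
    (hU : ∀ t, multL2 (fatS hχ j) (U t) = U t) {M : ℝ}
    (hM : ∀ t ∈ Icc 0 T, ‖U t‖ ≤ M) {f : ℝ → ℝ} (hf : IntervalIntegrable f volume 0 T) {C : ℝ}
    (hΦ : ∀ᵐ τ ∂(volume.restrict (Ioc 0 T)), ‖Φ τ‖ ≤ f τ + C) :
    EnergyBound T (lipConst v) (fun t => ‖U t‖ ^ 2) (fun t => (inner ℂ (U t) (Φ t)).re) := by
  obtain ⟨q, hq, hle⟩ := h.exists_hasPrimitive hT hv (fun t _ => hU t) hM
    (hf.add intervalIntegrable_const) hΦ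
  refine ⟨q, hq, ?_⟩
  filter_upwards [hle] with τ hτ
  linarith [(abs_le.1 hτ).2]

end

theorem lambdaBlock_apply (hχ : IsLPCutoff χ) {z : 𝓢'(R3, F)} (hz : l2Norm (lpBlock χ j z) ≠ ∞)
    (ψ : 𝓢(R3, ℂ)) : lambdaBlock χ j z ψ = pairL ψ (multL2 (lamS hχ j) (l2Block χ j z)) := by
  rw [pairL_apply, coe_multL2, coe_l2Block hz, lambdaBlock_eq hχ]

theorem lpBlock_laplacian_apply (hχ : IsLPCutoff χ) {z : 𝓢'(R3, F)}
    (hz : l2Norm (lpBlock χ j z) ≠ ∞) (ψ : 𝓢(R3, ℂ)) : lpBlock χ j (Δ z) ψ =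
      -pairL ψ (multL2 (lamS hχ j) (multL2 (lamS hχ j) (l2Block χ j z))) := by
  rw [pairL_apply, coe_multL2, coe_multL2, coe_l2Block hz, lpBlock_laplacian hχ,
    distribution_neg_apply]

/-- The functions that are invariant under the fattened block. -/
def fatSpace (hχ : IsLPCutoff χ) (F : Type*) [NormedAddCommGroup F] [InnerProductSpace ℂ F]
    [CompleteSpace F] (j : ℤ) : Submodule ℂ (Lp F 2 (volume : Measure R3)) :=
  LinearMap.eqLocus (multL2 (F := F) (fatS hχ j)).toLinearMap LinearMap.id

theorem mem_fatSpace {hχ : IsLPCutoff χ} {f : Lp F 2 (volume : Measure R3)} :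
    f ∈ fatSpace hχ F j ↔ multL2 (fatS hχ j) f = f := Iff.rfl

theorem l2Block_mem_fatSpace (hχ : IsLPCutoff χ) (j : ℤ) (z : 𝓢'(R3, F)) :
    l2Block χ j z ∈ fatSpace hχ F j := multL2_fatS_l2Block hχ j z

theorem multL2_mem_fatSpace {hχ : IsLPCutoff χ} (m : 𝓢(R3, ℂ)) {f : Lp F 2 (volume : Measure R3)}
    (hf : f ∈ fatSpace hχ F j) : multL2 m f ∈ fatSpace hχ F j := by
  rw [mem_fatSpace] at hf ⊢
  rw [multL2_comm, hf]

end BlockEnergy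

/-! ### Assembling the hypotheses of the block estimates -/

section BlockSystems

variable {H : Type*} [NormedAddCommGroup H] [InnerProductSpace ℂ H] {A : H →L[ℂ] H}
  {T : ℝ} {g f : ℝ → ℝ} {b d θ Sb SA Sd Sθ : ℝ → H} {α κ lam γ M : ℝ}

/-- A predicate that satisfies energy estimates on a subspace provides block systems. -/
theorem BlockSystem.of_energy {V : Submodule ℂ H} {P : (ℝ → H) → (ℝ → H) → Prop}
    (hsub : ∀ {U U' Φ Φ'}, P U Φ → P U' Φ' → P (fun t => U t - U' t) (fun t => Φ t - Φ' t))
    (hE : ∀ {U Φ M} {f : ℝ → ℝ} {C}, P U Φ → (∀ t, U t ∈ V) → (∀ t ∈ Icc 0 T, ‖U t‖ ≤ M) →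
      IntervalIntegrable f volume 0 T →
      (∀ᵐ τ ∂(volume.restrict (Ioc 0 T)), ‖Φ τ‖ ≤ f τ + C) →
      EnergyBound T g (fun t => ‖U t‖ ^ 2) (fun t => (inner ℂ (U t) (Φ t)).re))
    (symm : ∀ x y, inner ℂ (A x) y = inner ℂ x (A y)) (hAV : ∀ u ∈ V, A u ∈ V)
    (hn : ∀ u ∈ V, lam / 3 * ‖u‖ ≤ ‖A u‖ ∧ ‖A u‖ ≤ 6 * lam * ‖u‖)
    (hT : 0 ≤ T) (hg : ∀ t, 0 ≤ g t) (hf0 : ∀ t, 0 ≤ f t)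
    (hfi : IntervalIntegrable f volume 0 T) (hα : 10 ^ 8 ≤ α) (hκ : 1 ≤ α ^ 2 * κ)
    (hlam : 0 < lam) (hγ : 0 < γ) (hb : ∀ t, b t ∈ V) (hd : ∀ t, d t ∈ V) (hθ : ∀ t, θ t ∈ V)
    (hM : ∀ t ∈ Icc 0 T, ‖b t‖ ≤ M ∧ ‖d t‖ ≤ M ∧ ‖θ t‖ ≤ M)
    (pb : P b (fun t => Sb t + -A (d t)))
    (pA : P (fun t => A (b t)) (fun t => SA t + A (-A (d t))))
    (pd : P d (fun t => Sd t + (-A (A (d t)) + A (b t + θ t))))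
    (pθ : P θ (fun t => Sθ t + (-((κ : ℂ) • A (A (θ t))) + -A (d t))))
    (hsrc : ∀ᵐ τ ∂(volume.restrict (Ioc 0 T)),
      (α + lam) * ‖Sb τ‖ + ‖SA τ‖ + α * ‖Sd τ‖ + γ * ‖Sθ τ‖ +
        g τ * ((α + lam) * ‖b τ‖ + α * ‖d τ‖ + γ * ‖θ τ‖) ≤ f τ) :
    BlockSystem A T g f b d θ Sb SA Sd Sθ α κ lam γ := by
  have hα0 : 0 < α := by linarith
  have hbd {u : H} (hu : u ∈ V) (h : ‖u‖ ≤ M) : ‖A u‖ ≤ 6 * lam * M := by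
    refine (hn u hu).2.trans ?_
    gcongr
  have hbd2 {u : H} (hu : u ∈ V) (h : ‖u‖ ≤ M) : ‖A (A u)‖ ≤ 6 * lam * (6 * lam * M) := by
    refine (hn _ (hAV u hu)).2.trans ?_
    have := hbd hu h
    gcongr
  have hsrc' : ∀ᵐ τ ∂(volume.restrict (Ioc 0 T)), τ ∈ Icc 0 T ∧ ‖Sb τ‖ ≤ f τ ∧ ‖SA τ‖ ≤ f τ ∧
      ‖Sd τ‖ ≤ f τ ∧ ‖Sθ τ‖ ≤ f τ / γ := by
    filter_upwards [hsrc, ae_restrict_mem measurableSet_Ioc] with τ h1 h2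
    have := hg τ
    have k1 : 0 ≤ g τ * ((α + lam) * ‖b τ‖ + α * ‖d τ‖ + γ * ‖θ τ‖) := by positivity
    have k2 : ‖Sb τ‖ ≤ (α + lam) * ‖Sb τ‖ := le_mul_of_one_le_left (norm_nonneg _) (by linarith)
    have k3 : ‖Sd τ‖ ≤ α * ‖Sd τ‖ := le_mul_of_one_le_left (norm_nonneg _) (by linarith)
    have k4 : 0 ≤ γ * ‖Sθ τ‖ := by positivity
    have k5 := norm_nonneg (Sb τ)
    have k6 := norm_nonneg (Sd τ)
    have k7 := norm_nonneg (SA τ)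
    refine ⟨Ioc_subset_Icc_self h2, by linarith, by linarith, by linarith, ?_⟩
    rw [le_div_iff₀' hγ]
    linarith
  refine ⟨symm, hT, hg, hf0, hfi, hα, hκ, hlam, hγ, ?_, ?_, ?_, ?_, ?_, hsrc⟩
  · rintro t - u hu
    simp only [mem_insert_iff, mem_singleton_iff] at hu
    rcases hu with rfl | rfl | rfl
    exacts [hn _ (hb t), hn _ (hd t), hn _ (hθ t)]
  · simp_rw [sub_eq_add_neg]
    refine hE pb hb (fun t ht => (hM t ht).1) hfi (C := 6 * lam * M) ?_
    filter_upwards [hsrc'] with τ ⟨h1, h2, _⟩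
    refine (norm_add_le _ _).trans (add_le_add h2 ?_)
    rw [norm_neg]
    exact hbd (hd τ) (hM τ h1).2.1
  -- Subtracting the equation of d from that of Ab removes A²d and leaves the damping -Ab.
  · have hΦ : (fun t => SA t + A (-A (d t)) - (Sd t + (-A (A (d t)) + A (b t + θ t)))) =
        fun t => SA t - Sd t - A (b t) - A (θ t) := by
      funext t
      rw [map_neg, map_add]
      abel
    have p := hsub pA pd
    rw [hΦ] at p
    refine hE p (fun t => V.sub_mem (hAV _ (hb t)) (hd t)) (M := 6 * lam * M + M)
      (fun t ht => ?_) (hfi.const_mul 2) (C := 6 * lam * M + 6 * lam * M) ?_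
    · exact (norm_sub_le _ _).trans (add_le_add (hbd (hb t) (hM t ht).1) (hM t ht).2.1)
    · filter_upwards [hsrc'] with τ ⟨h1, h2, h3, h4, _⟩
      have k1 := hbd (hb τ) (hM τ h1).1
      have k2 := hbd (hθ τ) (hM τ h1).2.2
      have k3 := norm_sub_le (SA τ - Sd τ - A (b τ)) (A (θ τ))
      have k4 := norm_sub_le (SA τ - Sd τ) (A (b τ))
      have k5 := norm_sub_le (SA τ) (Sd τ)
      linarith
  · have hΦ : (fun t => Sd t + (-A (A (d t)) + A (b t + θ t))) =
        fun t => Sd t - A (A (d t)) + A (b t + θ t) := by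
      funext t
      abel
    rw [hΦ] at pd
    refine hE pd hd (fun t ht => (hM t ht).2.1) hfi
      (C := 6 * lam * (6 * lam * M) + (6 * lam * M + 6 * lam * M)) ?_
    filter_upwards [hsrc'] with τ ⟨h1, _, _, h4, _⟩
    have k1 := hbd (hb τ) (hM τ h1).1
    have k2 := hbd (hθ τ) (hM τ h1).2.2
    have k3 := hbd2 (hd τ) (hM τ h1).2.1
    have k4 := norm_add_le (Sd τ - A (A (d τ))) (A (b τ + θ τ))
    have k5 := norm_sub_le (Sd τ) (A (A (d τ)))
    have k6 : ‖A (b τ + θ τ)‖ ≤ ‖A (b τ)‖ + ‖A (θ τ)‖ := by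
      rw [map_add]
      exact norm_add_le _ _
    linarith
  · have hΦ : (fun t => Sθ t + (-((κ : ℂ) • A (A (θ t))) + -A (d t))) =
        fun t => Sθ t - A (d t) - (κ : ℂ) • A (A (θ t)) := by
      funext t
      abel
    rw [hΦ] at pθ
    refine hE pθ hθ (fun t ht => (hM t ht).2.2) (hfi.div_const γ)
      (C := 6 * lam * M + |κ| * (6 * lam * (6 * lam * M))) ?_
    filter_upwards [hsrc'] with τ ⟨h1, _, _, _, h5⟩
    have k1 := hbd (hd τ) (hM τ h1).2.1
    have k3 : ‖(κ : ℂ) • A (A (θ τ))‖ ≤ |κ| * (6 * lam * (6 * lam * M)) := by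
      rw [norm_smul, Complex.norm_real, Real.norm_eq_abs]
      have := hbd2 (hθ τ) (hM τ h1).2.2
      gcongr
    have k4 := norm_sub_le (Sθ τ - A (d τ)) ((κ : ℂ) • A (A (θ τ)))
    have k5 := norm_sub_le (Sθ τ) (A (d τ))
    linarith

end BlockSystems

/-! ### Heat estimates from energy bounds -/

section HeatBlocks

/-- A predicate that satisfies energy estimates on a subspace provides heat estimates. -/
theorem EnergyBound.heat_of_energy {H : Type*} [NormedAddCommGroup H] [InnerProductSpace ℂ H]
    {A : H →L[ℂ] H} {T : ℝ} {g f : ℝ → ℝ} {w S : ℝ → H} {μ lam M : ℝ} {V : Submodule ℂ H}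
    {P : (ℝ → H) → (ℝ → H) → Prop}
    (hE : ∀ {U Φ M} {f : ℝ → ℝ} {C}, P U Φ → (∀ t, U t ∈ V) → (∀ t ∈ Icc 0 T, ‖U t‖ ≤ M) →
      IntervalIntegrable f volume 0 T →
      (∀ᵐ τ ∂(volume.restrict (Ioc 0 T)), ‖Φ τ‖ ≤ f τ + C) →
      EnergyBound T g (fun t => ‖U t‖ ^ 2) (fun t => (inner ℂ (U t) (Φ t)).re))
    (symm : ∀ x y, inner ℂ (A x) y = inner ℂ x (A y)) (hAV : ∀ u ∈ V, A u ∈ V)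
    (hn : ∀ u ∈ V, lam / 3 * ‖u‖ ≤ ‖A u‖ ∧ ‖A u‖ ≤ 6 * lam * ‖u‖)
    (hg : ∀ t, 0 ≤ g t) (hf0 : ∀ t, 0 ≤ f t)
    (hfi : IntervalIntegrable f volume 0 T) (hμ : 0 ≤ μ) (hlam : 0 < lam) (hw : ∀ t, w t ∈ V)
    (hM : ∀ t ∈ Icc 0 T, ‖w t‖ ≤ M)
    (pw : P w (fun t => S t + (-((μ : ℂ) • A (A (w t))) + 0)))
    (hS : ∀ᵐ τ ∂(volume.restrict (Ioc 0 T)), ‖S τ‖ + 3 / 2 * g τ * ‖w τ‖ ≤ f τ) :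
    ContinuousOn (fun t => ‖w t‖) (Icc 0 T) ∧ ∀ t ∈ Icc 0 T,
      ‖w t‖ + μ * lam ^ 2 / 9 * ∫ τ in (0 : ℝ)..t, ‖w τ‖ ≤ ‖w 0‖ + ∫ τ in (0 : ℝ)..t, f τ := by
  simp_rw [add_zero, ← sub_eq_add_neg] at pw
  have he := hE pw hw hM hfi (C := μ * (6 * lam * (6 * lam * M))) (by
    filter_upwards [hS, ae_restrict_mem measurableSet_Ioc] with τ h1 h2
    have h3 : 0 ≤ 3 / 2 * g τ * ‖w τ‖ := by
      have := hg τ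
      positivity
    have h4 := hM τ (Ioc_subset_Icc_self h2)
    refine (norm_sub_le _ _).trans (add_le_add (by linarith) ?_)
    rw [norm_smul, Complex.norm_real, Real.norm_of_nonneg hμ]
    have h5 := (hn _ (hAV _ (hw τ))).2
    have h6 := (hn _ (hw τ)).2
    gcongr
    refine h5.trans ?_
    gcongr
    exact h6.trans (by gcongr))
  exact ⟨he.continuousOn_norm, fun t ht =>
    EnergyBound.heat symm hμ hlam hf0 hfi (fun t _ => (hn _ (hw t)).1) he hS ht⟩

end HeatBlocks

/-! ### The blocks of the paralinearized system -/

section ParalinearBlocks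

variable {χ : R3 → ℝ} {T : ℝ} {v : ℝ → R3 → R3} {j : ℤ}

section

variable {F : Type*} [NormedAddCommGroup F] [InnerProductSpace ℂ F] [CompleteSpace F]

/-- The bound of the remainder of the localized paraconvection term. -/
def commBound (hχ : IsLPCutoff χ) (v : ℝ → R3 → R3) (j : ℤ) (u : ℝ → 𝓢'(R3, F)) (τ : ℝ) : ℝ :=
  lipConst v τ * blockConst hχ * ∑ i ∈ Finset.Icc (j - 5) (j + 5), ‖l2Block χ i (u τ)‖

theorem commBound_nonneg (hχ : IsLPCutoff χ) (v : ℝ → R3 → R3) (j : ℤ) (u : ℝ → 𝓢'(R3, F))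
    (τ : ℝ) : 0 ≤ commBound hχ v j u τ :=
  mul_nonneg (mul_nonneg (lipConst_nonneg v τ) (blockConst_nonneg hχ))
    (Finset.sum_nonneg fun _ _ => norm_nonneg _)

/-- Used for d with κ = 1, for θ and for w; `Y` holds the coupling terms. -/
theorem exists_transport_heat (hχ : IsLPCutoff χ) (hT : 0 ≤ T) (hv : IsVelocity T v) {κ : ℝ}
    {θ : ℝ → 𝓢'(R3, F)} {rhs : ℝ → ℤ → 𝓢'(R3, F)} (h : EvolvesBy χ T θ rhs)
    (hθ : ∀ t ∈ Icc 0 T, ∀ i, l2Norm (lpBlock χ i (θ t)) ≠ ∞)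
    {X Y : ℝ → Lp F 2 (volume : Measure R3)} (hY : ∀ t, Y t ∈ fatSpace hχ F j)
    (hS : ∀ ψ, ∀ᵐ τ ∂(volume.restrict (Ioc 0 T)), rhs τ j ψ =
      pairL ψ (X τ) + κ • lpBlock χ j (Δ (θ τ)) ψ + pairL ψ (Y τ) -
        paraconvBlock χ j (v τ) (θ τ) ψ) :
    ∃ S : ℝ → Lp F 2 (volume : Measure R3),
      (∀ᵐ τ ∂(volume.restrict (Ioc 0 T)), ‖S τ‖ ≤ ‖X τ‖ + commBound hχ v j θ τ) ∧
      IsTransport hχ T v j (fun t => l2Block χ j (θ t)) (fun τ => S τ +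
        (-((κ : ℂ) • multL2 (lamS hχ j) (multL2 (lamS hχ j) (l2Block χ j (θ τ)))) + Y τ)) := by
  refine h.exists_block hT hv hθ (fun ψ => ?_) fun t => ?_
  · filter_upwards [hS ψ, ae_restrict_mem measurableSet_Ioc] with τ h1 h2
    rw [h1, lpBlock_laplacian_apply hχ (hθ τ (Ioc_subset_Icc_self h2) j), map_add, map_add, map_neg,
      map_smul, Complex.coe_smul, smul_neg, add_assoc]
  · exact mem_fatSpace.1 (Submodule.add_mem _ (Submodule.neg_mem _ (Submodule.smul_mem _ _
      (multL2_mem_fatSpace _ (multL2_mem_fatSpace _ (l2Block_mem_fatSpace hχ j _))))) (hY t))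

end

variable {μ κ : ℝ} {B D G : ℝ → 𝓢'(R3, ℂ)} {W : ℝ → 𝓢'(R3, EuclideanSpace ℂ (Fin 3))}
  {b d θ : ℝ → 𝓢'(R3, ℂ)} {w : ℝ → 𝓢'(R3, EuclideanSpace ℂ (Fin 3))}
  {SB SD SG : ℝ → Lp ℂ 2 (volume : Measure R3)}

namespace IsParalinearSolution

theorem exists_transport_b (hχ : IsLPCutoff χ) (hT : 0 ≤ T) (hv : IsVelocity T v)
    (h : IsParalinearSolution χ T μ κ v B D G W b d θ w)
    (hb : ∀ t ∈ Icc 0 T, ∀ i, l2Norm (lpBlock χ i (b t)) ≠ ∞)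
    (hd : ∀ t ∈ Icc 0 T, ∀ i, l2Norm (lpBlock χ i (d t)) ≠ ∞)
    (hSB : ∀ ψ, ∀ᵐ τ ∂(volume.restrict (Ioc 0 T)), lpBlock χ j (B τ) ψ = pairL ψ (SB τ)) :
    ∃ Sb SA : ℝ → Lp ℂ 2 (volume : Measure R3),
      (∀ᵐ τ ∂(volume.restrict (Ioc 0 T)), ‖Sb τ‖ ≤ ‖SB τ‖ + commBound hχ v j b τ ∧
        ‖SA τ‖ ≤ 2 ^ j * (6 * ‖SB τ‖ + commBound hχ v j b τ)) ∧
      IsTransport hχ T v j (fun t => l2Block χ j (b t))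
        (fun τ => Sb τ + -multL2 (lamS hχ j) (l2Block χ j (d τ))) ∧
      IsTransport hχ T v j (fun t => multL2 (lamS hχ j) (l2Block χ j (b t)))
        (fun τ => SA τ + multL2 (lamS hχ j) (-multL2 (lamS hχ j) (l2Block χ j (d τ)))) := by
  have hS (ψ : 𝓢(R3, ℂ)) : ∀ᵐ τ ∂(volume.restrict (Ioc 0 T)),
      (lpBlock χ j (B τ) - lambdaBlock χ j (d τ) - paraconvBlock χ j (v τ) (b τ)) ψ =
        pairL ψ (SB τ + -multL2 (lamS hχ j) (l2Block χ j (d τ))) -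
          paraconvBlock χ j (v τ) (b τ) ψ := by
    filter_upwards [hSB ψ, ae_restrict_mem measurableSet_Ioc] with τ h1 h2
    rw [distribution_sub_apply, distribution_sub_apply, h1,
      lambdaBlock_apply hχ (hd τ (Ioc_subset_Icc_self h2) j), map_add, map_neg, sub_eq_add_neg (pairL ψ (SB τ))]
  obtain ⟨Sb, h1, h2⟩ := h.eq_b.exists_block (hχ := hχ) (j := j) hT hv hb hS fun t =>
    mem_fatSpace.1 (Submodule.neg_mem _ (multL2_mem_fatSpace _ (l2Block_mem_fatSpace hχ j _)))
  obtain ⟨SA, h3, h4⟩ := h.eq_b.exists_lambda_block (hχ := hχ) (j := j) hT hv hb hS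
  exact ⟨Sb, SA, h1.and h3, h2, h4⟩

theorem exists_transport_d (hχ : IsLPCutoff χ) (hT : 0 ≤ T) (hv : IsVelocity T v)
    (h : IsParalinearSolution χ T μ κ v B D G W b d θ w)
    (hb : ∀ t ∈ Icc 0 T, ∀ i, l2Norm (lpBlock χ i (b t)) ≠ ∞)
    (hd : ∀ t ∈ Icc 0 T, ∀ i, l2Norm (lpBlock χ i (d t)) ≠ ∞)
    (hθ : ∀ t ∈ Icc 0 T, ∀ i, l2Norm (lpBlock χ i (θ t)) ≠ ∞)
    (hSD : ∀ ψ, ∀ᵐ τ ∂(volume.restrict (Ioc 0 T)), lpBlock χ j (D τ) ψ = pairL ψ (SD τ)) :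
    ∃ Sd : ℝ → Lp ℂ 2 (volume : Measure R3),
      (∀ᵐ τ ∂(volume.restrict (Ioc 0 T)), ‖Sd τ‖ ≤ ‖SD τ‖ + commBound hχ v j d τ) ∧
      IsTransport hχ T v j (fun t => l2Block χ j (d t)) (fun τ => Sd τ +
        (-multL2 (lamS hχ j) (multL2 (lamS hχ j) (l2Block χ j (d τ))) +
          multL2 (lamS hχ j) (l2Block χ j (b τ) + l2Block χ j (θ τ)))) := by
  obtain ⟨Sd, h1, h2⟩ := exists_transport_heat hχ hT hv h.eq_d hd (κ := 1) (X := SD)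
    (Y := fun τ => multL2 (lamS hχ j) (l2Block χ j (b τ) + l2Block χ j (θ τ)))
    (fun t => multL2_mem_fatSpace _ (Submodule.add_mem _ (l2Block_mem_fatSpace hχ j _)
      (l2Block_mem_fatSpace hχ j _))) (fun ψ => by
      filter_upwards [hSD ψ, ae_restrict_mem measurableSet_Ioc] with τ h1 h2
      have h3 := Ioc_subset_Icc_self h2
      rw [distribution_sub_apply, distribution_add_apply, distribution_add_apply, h1, one_smul,
        map_add (lambdaBlock χ j), distribution_add_apply, lambdaBlock_apply hχ (hb τ h3 j),
        lambdaBlock_apply hχ (hθ τ h3 j), map_add, map_add])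
  refine ⟨Sd, h1, h2.congr (fun t => rfl) fun t => ?_⟩
  rw [Complex.ofReal_one, one_smul]

theorem exists_transport_θ (hχ : IsLPCutoff χ) (hT : 0 ≤ T) (hv : IsVelocity T v)
    (h : IsParalinearSolution χ T μ κ v B D G W b d θ w)
    (hd : ∀ t ∈ Icc 0 T, ∀ i, l2Norm (lpBlock χ i (d t)) ≠ ∞)
    (hθ : ∀ t ∈ Icc 0 T, ∀ i, l2Norm (lpBlock χ i (θ t)) ≠ ∞)
    (hSG : ∀ ψ, ∀ᵐ τ ∂(volume.restrict (Ioc 0 T)), lpBlock χ j (G τ) ψ = pairL ψ (SG τ)) :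
    ∃ Sθ : ℝ → Lp ℂ 2 (volume : Measure R3),
      (∀ᵐ τ ∂(volume.restrict (Ioc 0 T)), ‖Sθ τ‖ ≤ ‖SG τ‖ + commBound hχ v j θ τ) ∧
      IsTransport hχ T v j (fun t => l2Block χ j (θ t)) (fun τ => Sθ τ +
        (-((κ : ℂ) • multL2 (lamS hχ j) (multL2 (lamS hχ j) (l2Block χ j (θ τ)))) +
          -multL2 (lamS hχ j) (l2Block χ j (d τ)))) :=
  exists_transport_heat hχ hT hv h.eq_θ hθ (X := SG)
    (Y := fun τ => -multL2 (lamS hχ j) (l2Block χ j (d τ)))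
    (fun t => Submodule.neg_mem _ (multL2_mem_fatSpace _ (l2Block_mem_fatSpace hχ j _)))
    (fun ψ => by
      filter_upwards [hSG ψ, ae_restrict_mem measurableSet_Ioc] with τ h1 h2
      have h3 := Ioc_subset_Icc_self h2
      rw [distribution_sub_apply, distribution_sub_apply, distribution_add_apply,
        distribution_smul_apply, h1, lambdaBlock_apply hχ (hd τ h3 j), map_neg, Complex.coe_smul,
        sub_eq_add_neg (_ + _)])

/-- The blocks of a solution of the paralinearized system satisfy the block estimates. -/
theorem exists_blockSystem (hχ : IsLPCutoff χ) (hT : 0 ≤ T) (hv : IsVelocity T v)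
    (h : IsParalinearSolution χ T μ κ v B D G W b d θ w)
    (hb : ∀ t ∈ Icc 0 T, ∀ i, l2Norm (lpBlock χ i (b t)) ≠ ∞)
    (hd : ∀ t ∈ Icc 0 T, ∀ i, l2Norm (lpBlock χ i (d t)) ≠ ∞)
    (hθ : ∀ t ∈ Icc 0 T, ∀ i, l2Norm (lpBlock χ i (θ t)) ≠ ∞) {M : ℝ}
    (hM : ∀ t ∈ Icc 0 T, ‖l2Block χ j (b t)‖ ≤ M ∧ ‖l2Block χ j (d t)‖ ≤ M ∧
      ‖l2Block χ j (θ t)‖ ≤ M)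
    (hSB : ∀ ψ, ∀ᵐ τ ∂(volume.restrict (Ioc 0 T)), lpBlock χ j (B τ) ψ = pairL ψ (SB τ))
    (hSD : ∀ ψ, ∀ᵐ τ ∂(volume.restrict (Ioc 0 T)), lpBlock χ j (D τ) ψ = pairL ψ (SD τ))
    (hSG : ∀ ψ, ∀ᵐ τ ∂(volume.restrict (Ioc 0 T)), lpBlock χ j (G τ) ψ = pairL ψ (SG τ))
    {α γ : ℝ} (hα : 10 ^ 8 ≤ α) (hκ : 1 ≤ α ^ 2 * κ) (hγ : 0 < γ) {f : ℝ → ℝ} (hf0 : ∀ t, 0 ≤ f t)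
    (hfi : IntervalIntegrable f volume 0 T)
    (hf : ∀ᵐ τ ∂(volume.restrict (Ioc 0 T)),
      (α + 7 * 2 ^ j) * (‖SB τ‖ + commBound hχ v j b τ) + α * (‖SD τ‖ + commBound hχ v j d τ) +
      γ * (‖SG τ‖ + commBound hχ v j θ τ) + lipConst v τ * ((α + 2 ^ j) * ‖l2Block χ j (b τ)‖ +
        α * ‖l2Block χ j (d τ)‖ + γ * ‖l2Block χ j (θ τ)‖) ≤ f τ) :
    ∃ Sb SA Sd Sθ, BlockSystem (multL2 (lamS hχ j)) T (lipConst v) f (fun t => l2Block χ j (b t))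
      (fun t => l2Block χ j (d t)) (fun t => l2Block χ j (θ t)) Sb SA Sd Sθ α κ (2 ^ j) γ := by
  obtain ⟨Sb, SA, hb1, hb2, hA2⟩ := h.exists_transport_b hχ hT hv hb hd hSB
  obtain ⟨Sd, hd1, hd2⟩ := h.exists_transport_d hχ hT hv hb hd hθ hSD
  obtain ⟨Sθ, hθ1, hθ2⟩ := h.exists_transport_θ hχ hT hv hd hθ hSG
  have h2j : (0 : ℝ) < 2 ^ j := by positivity
  have hα0 : 0 < α := by linarith
  refine ⟨Sb, SA, Sd, Sθ, BlockSystem.of_energy (V := fatSpace hχ ℂ j)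
    (P := IsTransport hχ T v j) (fun p p' => p.sub hT hv p')
    (fun p hU hM hf hΦ => p.energyBound hT hv hU hM hf hΦ)
    (inner_multL2_left (conj_radS _ hχ j)) (fun u hu => multL2_mem_fatSpace _ hu)
    (fun u hu => norm_multL2_lamS hχ hu) hT (lipConst_nonneg v) hf0 hfi hα hκ h2j hγ
    (fun t => l2Block_mem_fatSpace hχ j _) (fun t => l2Block_mem_fatSpace hχ j _)
    (fun t => l2Block_mem_fatSpace hχ j _) hM hb2 hA2 hd2 hθ2 ?_⟩
  -- In α + 7·2^j, one 2^j is the weight of b and six come from Λ acting on the source in the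
  -- equation of Λb.
  filter_upwards [hb1, hd1, hθ1, hf] with τ h1 h3 h4 h5
  have h6 := mul_le_mul_of_nonneg_left h1.1 (by positivity : 0 ≤ α + 2 ^ j)
  have h7 := mul_le_mul_of_nonneg_left h3 hα0.le
  have h8 := mul_le_mul_of_nonneg_left h4 hγ.le
  have h9 : 0 ≤ 2 ^ j * commBound hχ v j b τ := mul_nonneg h2j.le (commBound_nonneg _ _ _ _ _)
  linarith [h1.2]

end IsParalinearSolution

/-- The estimate of the blocks of a solution of the paralinearized heat equation. -/
theorem EvolvesBy.heat_block {F : Type*} [NormedAddCommGroup F] [InnerProductSpace ℂ F]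
    [CompleteSpace F] [SecondCountableTopology F] (hχ : IsLPCutoff χ) (hT : 0 ≤ T)
    (hv : IsVelocity T v) {μ : ℝ} (hμ : 0 ≤ μ) {W w : ℝ → 𝓢'(R3, F)}
    (h : EvolvesBy χ T w (fun τ j =>
      lpBlock χ j (W τ) + (μ : ℂ) • lpBlock χ j (Δ (w τ)) - paraconvBlock χ j (v τ) (w τ)))
    (hw : ∀ t ∈ Icc 0 T, ∀ i, l2Norm (lpBlock χ i (w t)) ≠ ∞) {M : ℝ}
    (hM : ∀ t ∈ Icc 0 T, ‖l2Block χ j (w t)‖ ≤ M)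
    {SW : ℝ → Lp F 2 (volume : Measure R3)}
    (hSW : ∀ ψ, ∀ᵐ τ ∂(volume.restrict (Ioc 0 T)), lpBlock χ j (W τ) ψ = pairL ψ (SW τ))
    {f : ℝ → ℝ} (hf0 : ∀ t, 0 ≤ f t) (hfi : IntervalIntegrable f volume 0 T)
    (hf : ∀ᵐ τ ∂(volume.restrict (Ioc 0 T)), ‖SW τ‖ + commBound hχ v j w τ +
        3 / 2 * lipConst v τ * ‖l2Block χ j (w τ)‖ ≤ f τ) :
    ContinuousOn (fun t => ‖l2Block χ j (w t)‖) (Icc 0 T) ∧ ∀ t ∈ Icc 0 T,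
      ‖l2Block χ j (w t)‖ + μ * (2 ^ j) ^ 2 / 9 * ∫ τ in (0 : ℝ)..t, ‖l2Block χ j (w τ)‖ ≤
        ‖l2Block χ j (w 0)‖ + ∫ τ in (0 : ℝ)..t, f τ := by
  obtain ⟨S, hS1, hS2⟩ := exists_transport_heat (j := j) hχ hT hv h hw (X := SW) (Y := fun τ => 0)
    (fun t => Submodule.zero_mem _) (fun ψ => by
      filter_upwards [hSW ψ] with τ h1
      rw [distribution_sub_apply, distribution_add_apply, distribution_smul_apply, h1, map_zero,
        add_zero, Complex.coe_smul])
  refine EnergyBound.heat_of_energy (V := fatSpace hχ F j) (P := IsTransport hχ T v j)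
    (fun p hU hM hf hΦ => p.energyBound hT hv hU hM hf hΦ)
    (inner_multL2_left (conj_radS _ hχ j)) (fun u hu => multL2_mem_fatSpace _ hu)
    (fun u hu => norm_multL2_lamS hχ hu) (lipConst_nonneg v) hf0 hfi hμ (by positivity)
    (fun t => l2Block_mem_fatSpace hχ j _) hM hS2 ?_
  filter_upwards [hS1, hf] with τ h1 h2
  linarith

end ParalinearBlocks

/-! ### Grönwall's inequality for interacting blocks -/

section SequenceGronwall

theorem ofReal_intervalIntegral {a b : ℝ} (hab : a ≤ b) {f : ℝ → ℝ}
    (hf : IntervalIntegrable f volume a b)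
    (h0 : ∀ᵐ τ ∂(volume.restrict (Ioc a b)), 0 ≤ f τ) :
    ENNReal.ofReal (∫ τ in a..b, f τ) = ∫⁻ τ in Ioc a b, ENNReal.ofReal (f τ) := by
  rw [intervalIntegral.integral_of_le hab, ofReal_integral_eq_lintegral_ofReal
    ((intervalIntegrable_iff_integrableOn_Ioc_of_le hab).1 hf) h0]

theorem tsum_sum_Icc (q : ℤ → ℝ≥0∞) :
    ∑' j : ℤ, ∑ i ∈ Finset.Icc (j - 5) (j + 5), q i = 11 * ∑' j, q j := by
  have h1 (j : ℤ) : ∑ i ∈ Finset.Icc (j - 5) (j + 5), q i =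
      ∑ k ∈ Finset.Icc (-5 : ℤ) 5, q (j + k) := by
    refine (Finset.sum_bij' (fun k _ => j + k) (fun i _ => i - j) ?_ ?_ ?_ ?_ ?_).symm <;> intros <;>
      simp_all <;> omega
  simp_rw [h1]
  rw [Summable.tsum_finsetSum fun _ _ => ENNReal.summable]
  have h2 (k : ℤ) : ∑' j : ℤ, q (j + k) = ∑' j, q j := (Equiv.addRight k).tsum_eq q
  simp_rw [h2]
  rw [Finset.sum_const, nsmul_eq_mul]
  rfl

variable {T : ℝ} {g V : ℝ → ℝ} {p : ℤ → ℝ} {P : ℝ} {M S : ℤ → ℝ → ℝ} {C₀ C₁ : ℝ}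

/-- Weights of neighbours are comparable by `P`, and every block is counted eleven times. -/
theorem tsum_ofReal_source_le (hp : ∀ j, 0 ≤ p j) (hP0 : 0 ≤ P)
    (hP : ∀ j, ∀ i ∈ Finset.Icc (j - 5) (j + 5), p j ≤ P * p i) {S M : ℤ → ℝ} (hM0 : ∀ j, 0 ≤ M j)
    (hS0 : ∀ j, 0 ≤ S j) {c : ℝ} (hc : 0 ≤ c) (hS : ∑' j, ENNReal.ofReal (p j * S j) ≠ ∞)
    (hM : ∑' j, ENNReal.ofReal (p j * M j) ≠ ∞) :
    ∑' j, ENNReal.ofReal (p j * (S j + c * ∑ i ∈ Finset.Icc (j - 5) (j + 5), M i)) ≤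
      ENNReal.ofReal ((∑' j, ENNReal.ofReal (p j * S j)).toReal +
        11 * P * c * (∑' j, ENNReal.ofReal (p j * M j)).toReal) := by
  have h1 (j : ℤ) : ENNReal.ofReal (p j * (S j + c * ∑ i ∈ Finset.Icc (j - 5) (j + 5), M i)) ≤
      ENNReal.ofReal (p j * S j) + ENNReal.ofReal (P * c) *
        ∑ i ∈ Finset.Icc (j - 5) (j + 5), ENNReal.ofReal (p i * M i) := by
    have hp' (i : ℤ) : 0 ≤ p i * M i := mul_nonneg (hp i) (hM0 i)
    rw [← ENNReal.ofReal_sum_of_nonneg fun i _ => hp' i,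
      ← ENNReal.ofReal_mul (by positivity),
      ← ENNReal.ofReal_add (mul_nonneg (hp j) (hS0 j))
        (mul_nonneg (by positivity) (Finset.sum_nonneg fun i _ => hp' i))]
    refine ENNReal.ofReal_le_ofReal ?_
    have h2 : p j * ∑ i ∈ Finset.Icc (j - 5) (j + 5), M i ≤
        P * ∑ i ∈ Finset.Icc (j - 5) (j + 5), p i * M i := by
      rw [Finset.mul_sum, Finset.mul_sum]
      refine Finset.sum_le_sum fun i hi => ?_
      rw [← mul_assoc]
      exact mul_le_mul_of_nonneg_right (hP j i hi) (hM0 i)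
    nlinarith
  refine (ENNReal.tsum_le_tsum h1).trans ?_
  rw [ENNReal.tsum_add, ENNReal.tsum_mul_left, tsum_sum_Icc,
    ENNReal.ofReal_add ENNReal.toReal_nonneg (by positivity), ENNReal.ofReal_toReal hS,
    ENNReal.ofReal_mul (p := 11 * P * c) (by positivity), ENNReal.ofReal_toReal hM,
    mul_assoc 11 P c, ENNReal.ofReal_mul (p := 11) (by norm_num), ENNReal.ofReal_ofNat,
    ← mul_assoc, mul_comm _ (11 : ℝ≥0∞)]

/-- The Gronwall lemma for a sequence of functions with interactions between neighbours. -/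
theorem tsum_gronwall (hV : HasPrimitive T V g) (hV0 : ∀ t, 0 ≤ V t) (hV00 : V 0 = 0)
    (hg0 : ∀ t, 0 ≤ g t) (hp : ∀ j, 0 ≤ p j) (hP0 : 0 ≤ P)
    (hP : ∀ j, ∀ i ∈ Finset.Icc (j - 5) (j + 5), p j ≤ P * p i)
    (hM0 : ∀ j t, 0 ≤ M j t) (hMc : ∀ j, ContinuousOn (M j) (Icc 0 T))
    (hS0 : ∀ j t, 0 ≤ S j t) (hSi : ∀ j, IntervalIntegrable (S j) volume 0 T)
    (hC₀ : 0 ≤ C₀) (hC₁ : 0 ≤ C₁)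
    (hle : ∀ j, ∀ t ∈ Icc 0 T, M j t ≤ C₀ * (M j 0 + ∫ τ in (0 : ℝ)..t,
      (S j τ + C₁ * g τ * ∑ i ∈ Finset.Icc (j - 5) (j + 5), M i τ)))
    {A : ℝ≥0∞} (hA : A ≠ ∞) (hMA : ∀ t ∈ Icc 0 T, ∑' j, ENNReal.ofReal (p j * M j t) ≤ A)
    (hS : ∫⁻ τ in Ioc 0 T, ∑' j, ENNReal.ofReal (p j * S j τ) ≠ ∞) {t : ℝ} (ht : t ∈ Icc 0 T) :
    ∑' j, ENNReal.ofReal (p j * (M j 0 + ∫ τ in (0 : ℝ)..t,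
      (S j τ + C₁ * g τ * ∑ i ∈ Finset.Icc (j - 5) (j + 5), M i τ))) ≤
    ENNReal.ofReal (Real.exp (11 * P * C₁ * C₀ * V t)) * (∑' j, ENNReal.ofReal (p j * M j 0) +
      ∫⁻ τ in Ioc 0 t, ENNReal.ofReal (Real.exp (-(11 * P * C₁ * C₀ * V τ))) *
        ∑' j, ENNReal.ofReal (p j * S j τ)) := by
  have hT : 0 ≤ T := ht.1.trans ht.2
  have h0T : (0 : ℝ) ∈ Icc 0 T := ⟨le_rfl, hT⟩
  set N : ℝ → ℝ≥0∞ := fun τ => ∑' j, ENNReal.ofReal (p j * M j τ) with hN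
  set R : ℝ → ℝ≥0∞ := fun τ => ∑' j, ENNReal.ofReal (p j * S j τ) with hR
  have hNfin (τ : ℝ) (hτ : τ ∈ Icc 0 T) : N τ ≠ ∞ := ne_top_of_le_ne_top hA (hMA τ hτ)
  have hSm (j : ℤ) : AEMeasurable (S j) (volume.restrict (Ioc 0 T)) :=
    ((intervalIntegrable_iff_integrableOn_Ioc_of_le hT).1 (hSi j)).aemeasurable
  have hMm (j : ℤ) : AEMeasurable (M j) (volume.restrict (Ioc 0 T)) :=
    ((hMc j).mono Ioc_subset_Icc_self).aemeasurable measurableSet_Ioc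
  have hgi := (intervalIntegrable_iff_integrableOn_Ioc_of_le hT).1 hV.integrable
  have hNm : AEMeasurable N (volume.restrict (Ioc 0 T)) :=
    AEMeasurable.tsum fun j => ((hMm j).const_mul (p j)).ennreal_ofReal
  have hRm : AEMeasurable R (volume.restrict (Ioc 0 T)) :=
    AEMeasurable.tsum fun j => ((hSm j).const_mul (p j)).ennreal_ofReal
  have hRfin : ∀ᵐ τ ∂(volume.restrict (Ioc 0 T)), R τ < ∞ := ae_lt_top' hRm hS
  have hRi : IntervalIntegrable (fun τ => (R τ).toReal) volume 0 T :=
    (intervalIntegrable_iff_integrableOn_Ioc_of_le hT).2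
      (integrable_toReal_of_lintegral_ne_top hRm hS)
  have hgN : IntervalIntegrable (fun τ => g τ * (N τ).toReal) volume 0 T := by
    rw [intervalIntegrable_iff_integrableOn_Ioc_of_le hT]
    refine (hgi.mul_const A.toReal).mono'
      (hgi.aestronglyMeasurable.mul hNm.ennreal_toReal.aestronglyMeasurable) ?_
    filter_upwards [ae_restrict_mem measurableSet_Ioc] with τ hτ
    rw [Real.norm_of_nonneg (mul_nonneg (hg0 τ) ENNReal.toReal_nonneg)]
    exact mul_le_mul_of_nonneg_left
      (ENNReal.toReal_mono hA (hMA τ (Ioc_subset_Icc_self hτ))) (hg0 τ)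
  have hfi (j : ℤ) : IntervalIntegrable
      (fun τ => S j τ + C₁ * g τ * ∑ i ∈ Finset.Icc (j - 5) (j + 5), M i τ) volume 0 T := by
    refine (hSi j).add ((hV.integrable.const_mul C₁).mul_continuousOn ?_)
    rw [uIcc_of_le hT]
    exact continuousOn_finsetSum _ fun i _ => hMc i
  set y : ℝ → ℝ := fun τ => (R τ).toReal + 11 * P * C₁ * (g τ * (N τ).toReal) with hy
  have hyi : IntervalIntegrable y volume 0 T := hRi.add (hgN.const_mul _)
  have hy0 (τ : ℝ) : 0 ≤ y τ := by
    have := hg0 τ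
    positivity
  set Y : ℝ → ℝ := fun t => (N 0).toReal + ∫ τ in (0 : ℝ)..t, y τ with hY
  have hYp : HasPrimitive T Y y := ⟨hyi, fun t _ => by simp [hY]⟩
  have hsub {t : ℝ} (ht : t ∈ Icc 0 T) : Ioc 0 t ⊆ Ioc 0 T := Ioc_subset_Ioc_right ht.2
  have hmono {f : ℝ → ℝ} (hf : IntervalIntegrable f volume 0 T) {t : ℝ} (ht : t ∈ Icc 0 T) :
      IntervalIntegrable f volume 0 t := hf.mono_set (by
    rw [uIcc_of_le ht.1, uIcc_of_le hT]
    exact Icc_subset_Icc_right ht.2)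
  have hf0 (j : ℤ) (τ : ℝ) :
      0 ≤ S j τ + C₁ * g τ * ∑ i ∈ Finset.Icc (j - 5) (j + 5), M i τ := by
    have h1 := hg0 τ
    have h2 := hS0 j τ
    have h3 : 0 ≤ ∑ i ∈ Finset.Icc (j - 5) (j + 5), M i τ := Finset.sum_nonneg fun i _ => hM0 i τ
    positivity
  have hY0 {t : ℝ} (ht : t ∈ Icc 0 T) : 0 ≤ Y t :=
    add_nonneg ENNReal.toReal_nonneg (intervalIntegral.integral_nonneg ht.1 fun τ _ => hy0 τ)
  have hE {t : ℝ} (ht : t ∈ Icc 0 T) : ∑' j, ENNReal.ofReal (p j * (M j 0 + ∫ τ in (0 : ℝ)..t,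
      (S j τ + C₁ * g τ * ∑ i ∈ Finset.Icc (j - 5) (j + 5), M i τ))) ≤ ENNReal.ofReal (Y t) := by
    have h1 (j : ℤ) : ENNReal.ofReal (p j * (M j 0 + ∫ τ in (0 : ℝ)..t,
        (S j τ + C₁ * g τ * ∑ i ∈ Finset.Icc (j - 5) (j + 5), M i τ))) =
        ENNReal.ofReal (p j * M j 0) + ∫⁻ τ in Ioc 0 t, ENNReal.ofReal (p j *
          (S j τ + C₁ * g τ * ∑ i ∈ Finset.Icc (j - 5) (j + 5), M i τ)) := by
      rw [mul_add, ← intervalIntegral.integral_const_mul, ENNReal.ofReal_add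
        (mul_nonneg (hp j) (hM0 j 0)) (intervalIntegral.integral_nonneg ht.1 fun τ _ =>
          mul_nonneg (hp j) (hf0 j τ)), ofReal_intervalIntegral ht.1
          ((hmono (hfi j) ht).const_mul _) (.of_forall fun τ => mul_nonneg (hp j) (hf0 j τ))]
    simp_rw [h1]
    rw [ENNReal.tsum_add, ← lintegral_tsum, hY,
      ENNReal.ofReal_add ENNReal.toReal_nonneg
        (intervalIntegral.integral_nonneg ht.1 fun τ _ => hy0 τ), ENNReal.ofReal_toReal (hNfin 0 h0T),
      ofReal_intervalIntegral ht.1 (hmono hyi ht) (.of_forall hy0)]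
    · refine add_le_add_right (lintegral_mono_ae ?_) _
      filter_upwards [ae_restrict_of_ae_restrict_of_subset (hsub ht) hRfin,
        ae_restrict_mem measurableSet_Ioc] with τ h2 h3
      refine (tsum_ofReal_source_le hp hP0 hP (fun j => hM0 j τ) (fun j => hS0 j τ)
        (mul_nonneg hC₁ (hg0 τ)) h2.ne (hNfin τ (Ioc_subset_Icc_self (hsub ht h3)))).trans_eq ?_
      rw [hy]
      congr 1
      ring
    · intro j
      exact (((intervalIntegrable_iff_integrableOn_Ioc_of_le ht.1).1
        (hmono (hfi j) ht)).aemeasurable.const_mul _).ennreal_ofReal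
  have hNY {t : ℝ} (ht : t ∈ Icc 0 T) : (N t).toReal ≤ C₀ * Y t := by
    refine ENNReal.toReal_le_of_le_ofReal (mul_nonneg hC₀ (hY0 ht)) ?_
    rw [ENNReal.ofReal_mul hC₀]
    refine le_trans ?_ (mul_le_mul_right (hE ht) _)
    rw [← ENNReal.tsum_mul_left]
    refine ENNReal.tsum_le_tsum fun j => ?_
    rw [← ENNReal.ofReal_mul hC₀]
    refine ENNReal.ofReal_le_ofReal ?_
    have := mul_le_mul_of_nonneg_left (hle j t ht) (hp j)
    linarith
  refine (hE ht).trans ?_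
  have hgr := HasPrimitive.gronwall ht.1 (c := 11 * P * C₁ * C₀) (by positivity) (hYp.mono ht)
    (hV.mono ht) hV0 (hmono hRi ht) (.of_forall fun τ hτ => by
      have h1 := hNY (t := τ) ⟨hτ.1, hτ.2.trans ht.2⟩
      have h2 : 11 * P * C₁ * (g τ * (N τ).toReal) ≤ 11 * P * C₁ * (g τ * (C₀ * Y τ)) := by
        have := hg0 τ
        gcongr
      linarith)
  have hY00 : Y 0 = (N 0).toReal := by simp [hY]
  rw [hV00, mul_zero, neg_zero, Real.exp_zero, one_mul, hY00, Real.exp_neg,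
    inv_mul_le_iff₀ (Real.exp_pos _)] at hgr
  refine (ENNReal.ofReal_le_ofReal hgr).trans_eq ?_
  have hVc : ContinuousOn V (uIcc 0 t) := by
    rw [uIcc_of_le ht.1]
    exact hV.continuousOn.mono (Icc_subset_Icc_right ht.2)
  have hei : IntervalIntegrable
      (fun τ => Real.exp (-(11 * P * C₁ * C₀ * V τ)) * (R τ).toReal) volume 0 t :=
    (hmono hRi ht).continuousOn_mul (by fun_prop)
  rw [ENNReal.ofReal_mul (Real.exp_pos _).le, ENNReal.ofReal_add ENNReal.toReal_nonneg
    (intervalIntegral.integral_nonneg ht.1 fun τ _ => by positivity),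
    ENNReal.ofReal_toReal (hNfin 0 h0T), ofReal_intervalIntegral ht.1 hei
    (.of_forall fun τ => by positivity)]
  congr 2
  refine lintegral_congr_ae ?_
  filter_upwards [ae_restrict_of_ae_restrict_of_subset (hsub ht) hRfin] with τ h2
  rw [ENNReal.ofReal_mul (Real.exp_pos _).le, ENNReal.ofReal_toReal h2.ne]

end SequenceGronwall

/-! ### Comparison of weights -/

section Weights

/-- The weight `2^{js}`. -/
def dyadicWeight (s : ℝ) (j : ℤ) : ℝ := (2 : ℝ) ^ ((j : ℝ) * s)

theorem dyadicWeight_pos (s : ℝ) (j : ℤ) : 0 < dyadicWeight s j := Real.rpow_pos_of_pos two_pos _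

theorem dyadicWeight_add_intCast (s : ℝ) (k j : ℤ) :
    (2 : ℝ) ^ ((j : ℝ) * (s + k)) = dyadicWeight s j * (2 ^ j) ^ k := by
  rw [dyadicWeight, mul_add, Real.rpow_add two_pos, ← Int.cast_mul, Real.rpow_intCast, zpow_mul]

theorem hybridWeight_one (s : ℝ) (k σ j : ℤ) :
    hybridWeight 1 (s + k) σ j =
      ENNReal.ofReal (dyadicWeight s j * ((2 ^ j) ^ k * (min 1 (2 ^ j)) ^ σ)) := by
  rw [hybridWeight, dyadicWeight_add_intCast, inv_one, mul_assoc]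

theorem dyadicWeight_le (s : ℝ) {i j : ℤ} (h : i ∈ Finset.Icc (j - 5) (j + 5)) :
    dyadicWeight s j ≤ (2 : ℝ) ^ (5 * |s|) * dyadicWeight s i := by
  rw [dyadicWeight, dyadicWeight, ← Real.rpow_add two_pos]
  refine Real.rpow_le_rpow_of_exponent_le one_le_two ?_
  rw [Finset.mem_Icc] at h
  have h1 : |(j : ℝ) - i| ≤ 5 := by
    rw [abs_le]
    constructor
    · have := h.2
      have : (i : ℝ) ≤ j + 5 := by exact_mod_cast this
      linarith
    · have := h.1
      have : (j : ℝ) - 5 ≤ i := by exact_mod_cast this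
      linarith
  have h2 : ((j : ℝ) - i) * s ≤ 5 * |s| :=
    (le_abs_self _).trans (by rw [abs_mul]; gcongr)
  linarith

/-- The weight of `θ` in the block estimates. -/
def thetaWeight (α : ℝ) (j : ℤ) : ℝ := α * min 1 (α ^ 2 / 2 ^ j)

variable {α : ℝ} {i j : ℤ}

theorem thetaWeight_pos (hα : 0 < α) (j : ℤ) : 0 < thetaWeight α j := by
  unfold thetaWeight
  positivity

theorem thetaWeight_of_le (h : 2 ^ j ≤ α ^ 2) : thetaWeight α j = α := by
  rw [thetaWeight, min_eq_left, mul_one]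
  rwa [one_le_div (by positivity)]

theorem thetaWeight_mul (h : α ^ 2 ≤ 2 ^ j) : thetaWeight α j * 2 ^ j = α ^ 3 := by
  have h0 : (0 : ℝ) < 2 ^ j := by positivity
  rw [thetaWeight, min_eq_right]
  · field_simp
  · rwa [div_le_one h0]

theorem zpow_le_of_mem_Icc (h : i ∈ Finset.Icc (j - 5) (j + 5)) :
    (2 : ℝ) ^ j ≤ 32 * 2 ^ i ∧ (2 : ℝ) ^ i ≤ 32 * 2 ^ j := by
  rw [Finset.mem_Icc] at h
  have h1 : (2 : ℝ) ^ j ≤ 2 ^ (i + 5) := zpow_le_zpow_right₀ (by norm_num) (by omega)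
  have h2 : (2 : ℝ) ^ i ≤ 2 ^ (j + 5) := zpow_le_zpow_right₀ (by norm_num) h.2
  rw [zpow_add₀ (by norm_num)] at h1 h2
  norm_num at h1 h2
  exact ⟨by linarith, by linarith⟩

/-- The weight depends on 2^j only through a minimum of powers of degree 0 and -1, so five steps
cost at most 2^5, uniformly in α. -/
theorem thetaWeight_le (hα : 0 < α) (h : i ∈ Finset.Icc (j - 5) (j + 5)) :
    thetaWeight α j ≤ 32 * thetaWeight α i := by
  have hi : (0 : ℝ) < 2 ^ i := by positivity
  have hj : (0 : ℝ) < 2 ^ j := by positivity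
  have h1 : min 1 (α ^ 2 / 2 ^ j) ≤ 32 * min 1 (α ^ 2 / 2 ^ i) := by
    rw [mul_min_of_nonneg _ _ (by norm_num)]
    refine min_le_min (by norm_num) ?_
    rw [div_le_iff₀ hj, mul_assoc, div_mul_eq_mul_div, ← mul_div_assoc, le_div_iff₀ hi]
    have := (zpow_le_of_mem_Icc h).2
    nlinarith [sq_nonneg α]
  unfold thetaWeight
  nlinarith

/-- The weights max(1, 2^j), 1, min(1, 2^{-j}) are those of b, d, θ in the norms of the data. The
lower bounds are free of α, and the factor 2α³ of the upper bounds enters only K. -/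
theorem weights_le (hα : 1 ≤ α) (j : ℤ) :
    max 1 (2 ^ j) ≤ α + 2 ^ j ∧ α + 2 ^ j ≤ 2 * α ^ 3 * max 1 (2 ^ j) ∧ α ≤ 2 * α ^ 3 ∧
      min 1 (2 ^ j)⁻¹ ≤ thetaWeight α j ∧ thetaWeight α j ≤ 2 * α ^ 3 * min 1 (2 ^ j)⁻¹ := by
  have h0 : (0 : ℝ) < 2 ^ j := by positivity
  have hα3 : α ≤ α ^ 3 := le_self_pow₀ hα (by norm_num)
  have hα2 : 1 ≤ α ^ 2 := one_le_pow₀ hα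
  refine ⟨?_, ?_, by linarith, ?_, ?_⟩
  · refine max_le (by linarith) (by linarith)
  · have h1 : (1 : ℝ) ≤ max 1 (2 ^ j) := le_max_left _ _
    have h2 : (2 : ℝ) ^ j ≤ max 1 (2 ^ j) := le_max_right _ _
    nlinarith
  · unfold thetaWeight
    have h1 : min 1 ((2 : ℝ) ^ j)⁻¹ ≤ min 1 (α ^ 2 / 2 ^ j) := by
      refine min_le_min le_rfl ?_
      rw [inv_eq_one_div]
      gcongr
    exact h1.trans (le_mul_of_one_le_left (by positivity) hα)
  · unfold thetaWeight
    have h1 : min 1 (α ^ 2 / 2 ^ j) ≤ α ^ 2 * min 1 ((2 : ℝ) ^ j)⁻¹ := by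
      rw [mul_min_of_nonneg _ _ (by positivity), mul_one, ← div_eq_mul_inv]
      exact min_le_min hα2 le_rfl
    have h2 : 0 ≤ α ^ 3 * min 1 ((2 : ℝ) ^ j)⁻¹ := by positivity
    nlinarith

/-- The left side is the weight of the integrated norms of b and θ, relative to 2^{js}: quadratic in
2^j at low frequency and linear at high frequency. -/
theorem gain_weights_le (hα : 1 ≤ α) (j : ℤ) :
    2 ^ j * min 1 (2 ^ j) ≤ min 1 ((2 ^ j) ^ 2) * (α + 2 ^ j) ∧
      2 ^ j * min 1 (2 ^ j) ≤ (2 ^ j) ^ 2 * thetaWeight α j := by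
  have h0 : (0 : ℝ) < 2 ^ j := by positivity
  have h1 := (weights_le hα j).2.2.2.1
  generalize (2 : ℝ) ^ j = x at *
  rcases le_total x 1 with h | h
  · rw [min_eq_right h, min_eq_right (by nlinarith)]
    rw [min_eq_left (by rwa [one_le_inv₀ h0])] at h1
    constructor <;> nlinarith [sq_nonneg x]
  · rw [min_eq_left h, min_eq_left (by nlinarith)]
    rw [min_eq_right (inv_le_one_of_one_le₀ h)] at h1
    refine ⟨by linarith, ?_⟩
    calc x * 1 = x ^ 2 * x⁻¹ := by field_simp
      _ ≤ _ := by gcongr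

theorem zpow_one_mul_min_zpow_neg_one (j : ℤ) :
    ((2 : ℝ) ^ j) ^ (1 : ℤ) * (min 1 (2 ^ j)) ^ (-1 : ℤ) = max 1 (2 ^ j) := by
  have h0 : (0 : ℝ) < 2 ^ j := by positivity
  rw [zpow_one, zpow_neg_one]
  rcases le_total ((2 : ℝ) ^ j) 1 with h | h
  · rw [min_eq_right h, max_eq_left h, mul_inv_cancel₀ h0.ne']
  · rw [min_eq_left h, max_eq_right h, inv_one, mul_one]

theorem zpow_neg_one_mul_min_zpow_one (j : ℤ) :
    ((2 : ℝ) ^ j) ^ (-1 : ℤ) * (min 1 (2 ^ j)) ^ (1 : ℤ) = min 1 (2 ^ j)⁻¹ := by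
  have h0 : (0 : ℝ) < 2 ^ j := by positivity
  rw [zpow_one, zpow_neg_one, mul_min_of_nonneg _ _ (by positivity), mul_one,
    inv_mul_cancel₀ h0.ne', min_comm]

end Weights

/-! ### The hybrid norms as sums over blocks -/

section ParaNorm

variable {χ : R3 → ℝ} {s α : ℝ}

/-- The sum of the norms of the data. -/
def paraNorm (χ : R3 → ℝ) (s : ℝ) (b d θ : 𝓢'(R3, ℂ)) (w : 𝓢'(R3, EuclideanSpace ℂ (Fin 3))) :
    ℝ≥0∞ :=
  hybridNorm χ 1 (s + 1) (-1) b + (besovNorm χ s d + besovNorm χ s w) + hybridNorm χ 1 (s - 1) 1 θ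

theorem hybridWeight_neg_one (s : ℝ) (j : ℤ) : hybridWeight 1 (s + 1) (-1) j =
    ENNReal.ofReal (dyadicWeight s j * max 1 (2 ^ j)) := by
  have := hybridWeight_one s 1 (-1) j
  rwa [zpow_one_mul_min_zpow_neg_one, Int.cast_one] at this

theorem hybridWeight_sub_one (s : ℝ) (j : ℤ) : hybridWeight 1 (s - 1) 1 j =
    ENNReal.ofReal (dyadicWeight s j * min 1 (2 ^ j)⁻¹) := by
  have := hybridWeight_one s (-1) 1 j
  rwa [zpow_neg_one_mul_min_zpow_one, Int.cast_neg, Int.cast_one, ← sub_eq_add_neg] at this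

theorem hybridWeight_add_one (s : ℝ) (j : ℤ) : hybridWeight 1 (s + 1) 1 j =
    ENNReal.ofReal (dyadicWeight s j * (2 ^ j * min 1 (2 ^ j))) := by
  have := hybridWeight_one s 1 1 j
  rwa [zpow_one, zpow_one, Int.cast_one] at this

theorem rpow_add_two (s : ℝ) (j : ℤ) :
    (2 : ℝ) ^ ((j : ℝ) * (s + 2)) = dyadicWeight s j * (2 ^ j) ^ 2 := by
  have := dyadicWeight_add_intCast s 2 j
  rwa [Int.cast_ofNat] at this

theorem paraNorm_eq (χ : R3 → ℝ) (s : ℝ) (b d θ : 𝓢'(R3, ℂ))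
    (w : 𝓢'(R3, EuclideanSpace ℂ (Fin 3))) :
    paraNorm χ s b d θ w = ∑' j : ℤ,
      (ENNReal.ofReal (dyadicWeight s j * max 1 (2 ^ j)) * l2Norm (lpBlock χ j b) +
        (ENNReal.ofReal (dyadicWeight s j) * l2Norm (lpBlock χ j d) +
          ENNReal.ofReal (dyadicWeight s j) * l2Norm (lpBlock χ j w)) +
        ENNReal.ofReal (dyadicWeight s j * min 1 (2 ^ j)⁻¹) * l2Norm (lpBlock χ j θ)) := by
  rw [ENNReal.tsum_add, ENNReal.tsum_add, ENNReal.tsum_add, paraNorm]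
  simp only [hybridNorm, besovNorm, hybridWeight_neg_one, hybridWeight_sub_one]
  rfl

/-- The numbers are only required to lie below the block norms, so that the bound applies to the
solution and also to the measurable representatives of the sources. -/
theorem tsum_blockWeight_le_paraNorm (hα : 1 ≤ α) {b d θ : 𝓢'(R3, ℂ)}
    {w : 𝓢'(R3, EuclideanSpace ℂ (Fin 3))} {x y z u : ℤ → ℝ} (hx0 : ∀ j, 0 ≤ x j)
    (hy0 : ∀ j, 0 ≤ y j) (hz0 : ∀ j, 0 ≤ z j) (hu0 : ∀ j, 0 ≤ u j)
    (hx : ∀ j, ENNReal.ofReal (x j) ≤ l2Norm (lpBlock χ j b))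
    (hy : ∀ j, ENNReal.ofReal (y j) ≤ l2Norm (lpBlock χ j d))
    (hz : ∀ j, ENNReal.ofReal (z j) ≤ l2Norm (lpBlock χ j θ))
    (hu : ∀ j, ENNReal.ofReal (u j) ≤ l2Norm (lpBlock χ j w)) :
    ∑' j, ENNReal.ofReal (dyadicWeight s j *
      ((α + 2 ^ j) * x j + α * y j + thetaWeight α j * z j + u j)) ≤
      ENNReal.ofReal (2 * α ^ 3) * paraNorm χ s b d θ w := by
  rw [paraNorm_eq, ← ENNReal.tsum_mul_left]
  refine ENNReal.tsum_le_tsum fun j => ?_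
  have hp := dyadicWeight_pos s j
  obtain ⟨-, h2, h3, -, h5⟩ := weights_le hα j
  have hα3 : (1 : ℝ) ≤ 2 * α ^ 3 := by linarith
  have hx' := hx0 j
  have hy' := hy0 j
  have hz' := hz0 j
  have hu' := hu0 j
  calc ENNReal.ofReal (dyadicWeight s j *
        ((α + 2 ^ j) * x j + α * y j + thetaWeight α j * z j + u j))
      ≤ ENNReal.ofReal (2 * α ^ 3 * (dyadicWeight s j * max 1 (2 ^ j) * x j +
          (dyadicWeight s j * y j + dyadicWeight s j * u j) +
          dyadicWeight s j * min 1 (2 ^ j)⁻¹ * z j)) := by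
        refine ENNReal.ofReal_le_ofReal ?_
        calc _ ≤ dyadicWeight s j * (2 * α ^ 3 * max 1 (2 ^ j) * x j + 2 * α ^ 3 * y j +
              2 * α ^ 3 * min 1 (2 ^ j)⁻¹ * z j + 2 * α ^ 3 * u j) := by
              gcongr
              exact le_mul_of_one_le_left hu' hα3
          _ = _ := by ring
    _ = ENNReal.ofReal (2 * α ^ 3) *
          (ENNReal.ofReal (dyadicWeight s j * max 1 (2 ^ j)) * ENNReal.ofReal (x j) +
          (ENNReal.ofReal (dyadicWeight s j) * ENNReal.ofReal (y j) +
            ENNReal.ofReal (dyadicWeight s j) * ENNReal.ofReal (u j)) +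
          ENNReal.ofReal (dyadicWeight s j * min 1 (2 ^ j)⁻¹) * ENNReal.ofReal (z j)) := by
        rw [ENNReal.ofReal_mul (by positivity), ENNReal.ofReal_add (by positivity) (by positivity),
          ENNReal.ofReal_add (by positivity) (by positivity),
          ENNReal.ofReal_add (by positivity) (by positivity),
          ENNReal.ofReal_mul (p := dyadicWeight s j * max 1 (2 ^ j)) (by positivity),
          ENNReal.ofReal_mul (q := y j) hp.le, ENNReal.ofReal_mul (q := u j) hp.le,
          ENNReal.ofReal_mul (p := dyadicWeight s j * min 1 (2 ^ j)⁻¹) (by positivity)]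
    _ ≤ _ := by
        gcongr
        exacts [hx j, hy j, hu j, hz j]

variable {F : Type*} [NormedAddCommGroup F] [InnerProductSpace ℂ F] [CompleteSpace F]

theorem ofReal_mul_blockSup_le {t : ℝ} {j : ℤ} {u : ℝ → 𝓢'(R3, F)} {p c X : ℝ} (hp : 0 ≤ p)
    (hc : 0 < c) (hu : ∀ τ ∈ Ioc 0 t, l2Norm (lpBlock χ j (u τ)) ≠ ∞)
    (h : ∀ τ ∈ Ioc 0 t, c * ‖l2Block χ j (u τ)‖ ≤ X) :
    ENNReal.ofReal (p * c) * blockSup χ t j u ≤ ENNReal.ofReal (p * X) := by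
  have h1 : blockSup χ t j u ≤ ENNReal.ofReal (X / c) := by
    refine essSup_le_of_ae_le _ ?_
    filter_upwards [ae_restrict_mem measurableSet_Ioc] with τ hτ
    rw [← ofReal_norm_l2Block (hu τ hτ)]
    refine ENNReal.ofReal_le_ofReal ?_
    rw [le_div_iff₀' hc]
    exact h τ hτ
  refine (mul_le_mul_right h1 _).trans_eq ?_
  rw [← ENNReal.ofReal_mul (by positivity)]
  congr 1
  field_simp

theorem exists_block_representatives [SecondCountableTopology F] {T : ℝ} {B : ℝ → 𝓢'(R3, F)}
    (hB : WeaklyMeasurable χ T B) {c : ℤ → ℝ} (hc : ∀ j, 0 < c j) {f : ℝ → ℝ≥0∞}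
    (hle : ∀ τ j, ENNReal.ofReal (c j) * l2Norm (lpBlock χ j (B τ)) ≤ f τ)
    (hf : ∫⁻ τ in Ioc 0 T, f τ ≠ ∞) :
    ∃ S : ℤ → ℝ → Lp F 2 (volume : Measure R3),
      (∀ j, IntegrableOn (fun τ => ‖S j τ‖) (Ioc 0 T)) ∧
      (∀ j τ, ENNReal.ofReal ‖S j τ‖ ≤ l2Norm (lpBlock χ j (B τ))) ∧
      ∀ j ψ, ∀ᵐ τ ∂(volume.restrict (Ioc 0 T)), lpBlock χ j (B τ) ψ = pairL ψ (S j τ) := by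
  have hfin (j : ℤ) : ∫⁻ τ in Ioc 0 T, l2Norm (lpBlock χ j (B τ)) ≠ ∞ := by
    intro h
    have h1 : ENNReal.ofReal (c j) * ∫⁻ τ in Ioc 0 T, l2Norm (lpBlock χ j (B τ)) ≤
        ∫⁻ τ in Ioc 0 T, f τ := by
      rw [← lintegral_const_mul' _ _ ENNReal.ofReal_ne_top]
      exact lintegral_mono fun τ => hle τ j
    rw [h, ENNReal.mul_top (by simpa using hc j)] at h1
    exact hf (top_le_iff.1 h1)
  choose S hS1 hS2 hS3 using fun j => exists_representative (hB j) (hfin j)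
  refine ⟨S, fun j => ⟨(hS1 j).norm, ?_⟩, fun j τ => ?_, hS3⟩
  · refine lt_of_le_of_lt (lintegral_mono fun τ => ?_) (lt_top_iff_ne_top.2 (hfin j))
    rw [enorm_norm]
    exact hS2 j τ
  · rw [ofReal_norm]
    exact hS2 j τ

end ParaNorm

/-! ### The complete estimate of a block -/

section BlockNorm

variable {χ : R3 → ℝ} {T μ κ : ℝ} {v : ℝ → R3 → R3} {B D G b d θ : ℝ → 𝓢'(R3, ℂ)}
  {W w : ℝ → 𝓢'(R3, EuclideanSpace ℂ (Fin 3))} {j : ℤ} {α : ℝ}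

/-- The weighted norm of the dyadic blocks of `(b, d, θ, w)`. -/
def blockNorm (χ : R3 → ℝ) (α : ℝ) (j : ℤ) (b d θ : 𝓢'(R3, ℂ))
    (w : 𝓢'(R3, EuclideanSpace ℂ (Fin 3))) : ℝ :=
  blockWeight α (2 ^ j) (thetaWeight α j) (l2Block χ j b) (l2Block χ j d) (l2Block χ j θ) +
    ‖l2Block χ j w‖

/-- The weighted norm of the dyadic blocks of `(b, d, θ, w)` which is integrated in time. -/
def blockDissipation (χ : R3 → ℝ) (α : ℝ) (j : ℤ) (b d θ : 𝓢'(R3, ℂ))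
    (w : 𝓢'(R3, EuclideanSpace ℂ (Fin 3))) : ℝ :=
  blockGain α (2 ^ j) (thetaWeight α j) (l2Block χ j b) (l2Block χ j d) (l2Block χ j θ) +
    (2 ^ j) ^ 2 * ‖l2Block χ j w‖

theorem blockNorm_nonneg (hα : 0 < α) (j : ℤ) (b d θ : 𝓢'(R3, ℂ))
    (w : 𝓢'(R3, EuclideanSpace ℂ (Fin 3))) : 0 ≤ blockNorm χ α j b d θ w := by
  have := thetaWeight_pos hα j
  unfold blockNorm blockWeight
  positivity

theorem blockDissipation_nonneg (hα : 0 < α) (j : ℤ) (b d θ : 𝓢'(R3, ℂ))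
    (w : 𝓢'(R3, EuclideanSpace ℂ (Fin 3))) : 0 ≤ blockDissipation χ α j b d θ w := by
  have := thetaWeight_pos hα j
  unfold blockDissipation blockGain
  positivity

theorem le_blockNorm (hα : 0 < α) (j : ℤ) (b d θ : 𝓢'(R3, ℂ))
    (w : 𝓢'(R3, EuclideanSpace ℂ (Fin 3))) :
    (α + 2 ^ j) * ‖l2Block χ j b‖ ≤ blockNorm χ α j b d θ w ∧
      α * ‖l2Block χ j d‖ ≤ blockNorm χ α j b d θ w ∧
      thetaWeight α j * ‖l2Block χ j θ‖ ≤ blockNorm χ α j b d θ w ∧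
      ‖l2Block χ j w‖ ≤ blockNorm χ α j b d θ w := by
  have h0 := thetaWeight_pos hα j
  have h1 : 0 ≤ (α + 2 ^ j) * ‖l2Block χ j b‖ := by positivity
  have h2 : 0 ≤ α * ‖l2Block χ j d‖ := by positivity
  have h3 : 0 ≤ thetaWeight α j * ‖l2Block χ j θ‖ := by positivity
  have h4 := norm_nonneg (l2Block χ j w)
  unfold blockNorm blockWeight
  refine ⟨?_, ?_, ?_, ?_⟩ <;> linarith

/-- The source terms and the remainders in the equations of the blocks of index `j`. -/
def blockSource (hχ : IsLPCutoff χ) (α : ℝ) (v : ℝ → R3 → R3) (j : ℤ) (b d θ : ℝ → 𝓢'(R3, ℂ))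
    (w : ℝ → 𝓢'(R3, EuclideanSpace ℂ (Fin 3))) (SB SD SG SW τ : ℝ) : ℝ :=
  (α + 7 * 2 ^ j) * (SB + commBound hχ v j b τ) + α * (SD + commBound hχ v j d τ) +
    thetaWeight α j * (SG + commBound hχ v j θ τ) + lipConst v τ *
      blockWeight α (2 ^ j) (thetaWeight α j) (l2Block χ j (b τ)) (l2Block χ j (d τ))
        (l2Block χ j (θ τ)) +
    (SW + commBound hχ v j w τ + 3 / 2 * lipConst v τ * ‖l2Block χ j (w τ)‖)

/-- The constant 224 is 7·32: seven from α + 7·2^j and 32 from weights of neighbouring blocks. The 2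
covers the terms with ‖∇v‖_∞ that involve only the block itself. -/
theorem blockSource_le (hχ : IsLPCutoff χ) (hα : 1 ≤ α) (v : ℝ → R3 → R3) (j : ℤ)
    (b d θ : ℝ → 𝓢'(R3, ℂ)) (w : ℝ → 𝓢'(R3, EuclideanSpace ℂ (Fin 3))) {SB SD SG SW : ℝ} (τ : ℝ)
    (hB : 0 ≤ SB) (hD : 0 ≤ SD) (hG : 0 ≤ SG) (hW : 0 ≤ SW) :
    blockSource hχ α v j b d θ w SB SD SG SW τ ≤
      7 * ((α + 2 ^ j) * SB + α * SD + thetaWeight α j * SG + SW) +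
        (2 + 224 * blockConst hχ) * lipConst v τ *
          ∑ i ∈ Finset.Icc (j - 5) (j + 5), blockNorm χ α i (b τ) (d τ) (θ τ) (w τ) := by
  have hα0 : 0 < α := by linarith
  have hg := lipConst_nonneg v τ
  have hc := blockConst_nonneg hχ
  have hγ := thetaWeight_pos hα0 j
  have hj : (0 : ℝ) < 2 ^ j := by positivity
  have hsum : (α + 7 * 2 ^ j) * ∑ i ∈ Finset.Icc (j - 5) (j + 5), ‖l2Block χ i (b τ)‖ +
      α * ∑ i ∈ Finset.Icc (j - 5) (j + 5), ‖l2Block χ i (d τ)‖ +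
      thetaWeight α j * ∑ i ∈ Finset.Icc (j - 5) (j + 5), ‖l2Block χ i (θ τ)‖ +
      ∑ i ∈ Finset.Icc (j - 5) (j + 5), ‖l2Block χ i (w τ)‖ ≤
      224 * ∑ i ∈ Finset.Icc (j - 5) (j + 5), blockNorm χ α i (b τ) (d τ) (θ τ) (w τ) := by
    rw [Finset.mul_sum, Finset.mul_sum, Finset.mul_sum, Finset.mul_sum, ← Finset.sum_add_distrib,
      ← Finset.sum_add_distrib, ← Finset.sum_add_distrib]
    refine Finset.sum_le_sum fun i hi => ?_
    have h1 := (zpow_le_of_mem_Icc hi).1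
    have h2 := thetaWeight_le hα0 hi
    have h3 : 0 < thetaWeight α i := thetaWeight_pos hα0 i
    have h4 : (0 : ℝ) < 2 ^ i := by positivity
    have e1 := mul_le_mul_of_nonneg_right (show α + 7 * 2 ^ j ≤ 224 * (α + 2 ^ i) by linarith)
      (norm_nonneg (l2Block χ i (b τ)))
    have e2 := mul_le_mul_of_nonneg_right (show α ≤ 224 * α by linarith)
      (norm_nonneg (l2Block χ i (d τ)))
    have e3 := mul_le_mul_of_nonneg_right
      (show thetaWeight α j ≤ 224 * thetaWeight α i by linarith) (norm_nonneg (l2Block χ i (θ τ)))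
    have e4 := norm_nonneg (l2Block χ i (w τ))
    unfold blockNorm blockWeight
    linarith
  have hself : blockNorm χ α j (b τ) (d τ) (θ τ) (w τ) ≤
      ∑ i ∈ Finset.Icc (j - 5) (j + 5), blockNorm χ α i (b τ) (d τ) (θ τ) (w τ) :=
    Finset.single_le_sum (f := fun i => blockNorm χ α i (b τ) (d τ) (θ τ) (w τ))
      (fun i _ => blockNorm_nonneg hα0 i _ _ _ _) (Finset.mem_Icc.2 ⟨by omega, by omega⟩)
  have h1 := mul_le_mul_of_nonneg_left hsum (mul_nonneg hg hc)
  have h2 := mul_le_mul_of_nonneg_left hself hg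
  have h3 : 0 ≤ lipConst v τ * blockNorm χ α j (b τ) (d τ) (θ τ) (w τ) :=
    mul_nonneg hg (blockNorm_nonneg hα0 _ _ _ _ _)
  have h4 : lipConst v τ *
      blockWeight α (2 ^ j) (thetaWeight α j) (l2Block χ j (b τ)) (l2Block χ j (d τ))
        (l2Block χ j (θ τ)) + 3 / 2 * lipConst v τ * ‖l2Block χ j (w τ)‖ ≤
      2 * (lipConst v τ * blockNorm χ α j (b τ) (d τ) (θ τ) (w τ)) := by
    have h5 : 0 ≤ lipConst v τ *
      blockWeight α (2 ^ j) (thetaWeight α j) (l2Block χ j (b τ)) (l2Block χ j (d τ))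
        (l2Block χ j (θ τ)) := mul_nonneg hg (by unfold blockWeight; positivity)
    have h6 : 0 ≤ lipConst v τ * ‖l2Block χ j (w τ)‖ := mul_nonneg hg (norm_nonneg _)
    unfold blockNorm
    rw [mul_add (lipConst v τ)]
    linarith
  have h7 : (α + 7 * 2 ^ j) * SB ≤ 7 * ((α + 2 ^ j) * SB) := by
    rw [← mul_assoc]
    exact mul_le_mul_of_nonneg_right (by linarith) hB
  have h8 : 0 ≤ α * SD := mul_nonneg hα0.le hD
  have h9 : 0 ≤ thetaWeight α j * SG := mul_nonneg hγ.le hG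
  unfold blockSource commBound
  generalize ∑ i ∈ Finset.Icc (j - 5) (j + 5), ‖l2Block χ i (b τ)‖ = xb at *
  generalize ∑ i ∈ Finset.Icc (j - 5) (j + 5), ‖l2Block χ i (d τ)‖ = xd at *
  generalize ∑ i ∈ Finset.Icc (j - 5) (j + 5), ‖l2Block χ i (θ τ)‖ = xθ at *
  generalize ∑ i ∈ Finset.Icc (j - 5) (j + 5), ‖l2Block χ i (w τ)‖ = xw at *
  generalize ∑ i ∈ Finset.Icc (j - 5) (j + 5), blockNorm χ α i (b τ) (d τ) (θ τ) (w τ) = X at *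
  linarith

/-- The estimate of the dyadic blocks of a solution of the paralinearized system. -/
theorem IsParalinearSolution.block_estimate (hχ : IsLPCutoff χ) (hT : 0 ≤ T) (hv : IsVelocity T v)
    (hμ : 0 < μ) (h : IsParalinearSolution χ T μ κ v B D G W b d θ w)
    (hb : ∀ t ∈ Icc 0 T, ∀ i, l2Norm (lpBlock χ i (b t)) ≠ ∞)
    (hd : ∀ t ∈ Icc 0 T, ∀ i, l2Norm (lpBlock χ i (d t)) ≠ ∞)
    (hθ : ∀ t ∈ Icc 0 T, ∀ i, l2Norm (lpBlock χ i (θ t)) ≠ ∞)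
    (hw : ∀ t ∈ Icc 0 T, ∀ i, l2Norm (lpBlock χ i (w t)) ≠ ∞)
    (hα : 10 ^ 8 ≤ α) (hκ : 1 ≤ α ^ 2 * κ) {A : ℝ}
    (hA : ∀ t ∈ Icc 0 T, blockNorm χ α j (b t) (d t) (θ t) (w t) ≤ A)
    {SB SD SG : ℝ → Lp ℂ 2 (volume : Measure R3)}
    {SW : ℝ → Lp (EuclideanSpace ℂ (Fin 3)) 2 (volume : Measure R3)}
    (hSB : ∀ ψ, ∀ᵐ τ ∂(volume.restrict (Ioc 0 T)), lpBlock χ j (B τ) ψ = pairL ψ (SB τ))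
    (hSD : ∀ ψ, ∀ᵐ τ ∂(volume.restrict (Ioc 0 T)), lpBlock χ j (D τ) ψ = pairL ψ (SD τ))
    (hSG : ∀ ψ, ∀ᵐ τ ∂(volume.restrict (Ioc 0 T)), lpBlock χ j (G τ) ψ = pairL ψ (SG τ))
    (hSW : ∀ ψ, ∀ᵐ τ ∂(volume.restrict (Ioc 0 T)), lpBlock χ j (W τ) ψ = pairL ψ (SW τ))
    {f : ℝ → ℝ} (hf0 : ∀ t, 0 ≤ f t) (hfi : IntervalIntegrable f volume 0 T)
    (hf : ∀ᵐ τ ∂(volume.restrict (Ioc 0 T)),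
      blockSource hχ α v j b d θ w ‖SB τ‖ ‖SD τ‖ ‖SG τ‖ ‖SW τ‖ τ ≤ f τ) :
    ContinuousOn (fun t => blockNorm χ α j (b t) (d t) (θ t) (w t)) (Icc 0 T) ∧
    ContinuousOn (fun t => blockDissipation χ α j (b t) (d t) (θ t) (w t)) (Icc 0 T) ∧
    ∀ t ∈ Icc 0 T,
      blockNorm χ α j (b t) (d t) (θ t) (w t) ≤
        10001 * (blockNorm χ α j (b 0) (d 0) (θ 0) (w 0) + ∫ τ in (0 : ℝ)..t, f τ) ∧
      ∫ τ in (0 : ℝ)..t, blockDissipation χ α j (b τ) (d τ) (θ τ) (w τ) ≤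
        (1000 * α ^ 4 + 9 / μ) *
          (blockNorm χ α j (b 0) (d 0) (θ 0) (w 0) + ∫ τ in (0 : ℝ)..t, f τ) := by
  have hα1 : 1 ≤ α := by linarith
  have hα0 : 0 < α := by linarith
  have hγ := thetaWeight_pos hα0 j
  have hj : (0 : ℝ) < 2 ^ j := by positivity
  have hM (t : ℝ) (ht : t ∈ Icc 0 T) : ‖l2Block χ j (b t)‖ ≤ max A (A / thetaWeight α j) ∧
      ‖l2Block χ j (d t)‖ ≤ max A (A / thetaWeight α j) ∧
      ‖l2Block χ j (θ t)‖ ≤ max A (A / thetaWeight α j) := by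
    obtain ⟨h1, h2, h3, -⟩ := le_blockNorm (χ := χ) hα0 j (b t) (d t) (θ t) (w t)
    have h4 := hA t ht
    refine ⟨le_max_of_le_left (le_trans ?_ (h1.trans h4)),
      le_max_of_le_left (le_trans ?_ (h2.trans h4)), le_max_of_le_right ?_⟩
    · exact le_mul_of_one_le_left (norm_nonneg _) (by linarith)
    · exact le_mul_of_one_le_left (norm_nonneg _) hα1
    · rw [le_div_iff₀' hγ]
      exact h3.trans h4
  have hg := lipConst_nonneg v
  have hparts : ∀ᵐ τ ∂(volume.restrict (Ioc 0 T)),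
      ((α + 7 * 2 ^ j) * (‖SB τ‖ + commBound hχ v j b τ) + α * (‖SD τ‖ + commBound hχ v j d τ) +
      thetaWeight α j * (‖SG τ‖ + commBound hχ v j θ τ) + lipConst v τ *
        ((α + 2 ^ j) * ‖l2Block χ j (b τ)‖ + α * ‖l2Block χ j (d τ)‖ +
          thetaWeight α j * ‖l2Block χ j (θ τ)‖) ≤ f τ) ∧
      (‖SW τ‖ + commBound hχ v j w τ + 3 / 2 * lipConst v τ * ‖l2Block χ j (w τ)‖ ≤ f τ) := by
    filter_upwards [hf] with τ h1
    unfold blockSource blockWeight at h1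
    have c1 := add_nonneg (norm_nonneg (SB τ)) (commBound_nonneg hχ v j b τ)
    have c2 := add_nonneg (norm_nonneg (SD τ)) (commBound_nonneg hχ v j d τ)
    have c3 := add_nonneg (norm_nonneg (SG τ)) (commBound_nonneg hχ v j θ τ)
    have c4 := add_nonneg (norm_nonneg (SW τ)) (commBound_nonneg hχ v j w τ)
    have d1 := mul_nonneg (show 0 ≤ α + 7 * 2 ^ j by positivity) c1
    have d2 := mul_nonneg hα0.le c2
    have d3 := mul_nonneg hγ.le c3
    have d4 := mul_nonneg (hg τ) (norm_nonneg (l2Block χ j (w τ)))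
    have d5 : 0 ≤ lipConst v τ *
        ((α + 2 ^ j) * ‖l2Block χ j (b τ)‖ + α * ‖l2Block χ j (d τ)‖ +
          thetaWeight α j * ‖l2Block χ j (θ τ)‖) := mul_nonneg (hg τ) (by positivity)
    constructor <;> linarith
  obtain ⟨Sb, SA, Sd, Sθ, hsys⟩ := h.exists_blockSystem hχ hT hv hb hd hθ hM hSB hSD hSG hα hκ hγ
    hf0 hfi (hparts.mono fun τ h => h.1)
  obtain ⟨hcw, hheat⟩ := h.eq_w.heat_block hχ hT hv hμ.le hw
    (fun t ht => (le_blockNorm hα0 j (b t) (d t) (θ t) (w t)).2.2.2.trans (hA t ht)) hSW hf0 hfi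
    (hparts.mono fun τ h => h.2)
  have hcb := hsys.energy_b.continuousOn_norm
  have hcd := hsys.energy_d.continuousOn_norm
  have hcθ := hsys.energy_θ.continuousOn_norm
  have hcG : ContinuousOn (fun t => blockGain α (2 ^ j) (thetaWeight α j) (l2Block χ j (b t))
      (l2Block χ j (d t)) (l2Block χ j (θ t))) (Icc 0 T) :=
    (((hcb.const_mul _).const_mul _)).add
      (((hcd.const_mul _).add (hcθ.const_mul _)).const_mul _)
  refine ⟨(((hcb.const_mul _).add (hcd.const_mul _)).add (hcθ.const_mul _)).add hcw,
    hcG.add (hcw.const_mul _), fun t ht => ?_⟩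
  have hsub : Icc 0 t ⊆ Icc 0 T := Icc_subset_Icc_right ht.2
  have hii {u : ℝ → ℝ} (hu : ContinuousOn u (Icc 0 T)) : IntervalIntegrable u volume 0 t :=
    (hu.mono hsub).intervalIntegrable_of_Icc ht.1
  have hI : 0 ≤ ∫ τ in (0 : ℝ)..t, f τ := intervalIntegral.integral_nonneg ht.1 fun τ _ => hf0 τ
  -- Frequencies are split at 2^j = α², where both expressions for `thetaWeight` agree.
  have hBS := (le_total ((2 : ℝ) ^ j) (α ^ 2)).elim
    (fun h => hsys.low (thetaWeight_of_le h) h ht) (fun h => hsys.high (thetaWeight_mul h) h ht)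
  have hht := hheat t ht
  have hIw : 0 ≤ ∫ τ in (0 : ℝ)..t, ‖l2Block χ j (w τ)‖ :=
    intervalIntegral.integral_nonneg ht.1 fun τ _ => norm_nonneg _
  have hw0 := norm_nonneg (l2Block χ j (w 0))
  have hwt := norm_nonneg (l2Block χ j (w t))
  have hX0 : 0 ≤ blockWeight α (2 ^ j) (thetaWeight α j) (l2Block χ j (b 0)) (l2Block χ j (d 0))
      (l2Block χ j (θ 0)) := by
    unfold blockWeight
    positivity
  constructor
  -- The constant 10001 is 10000 for (b, d, θ) and 1 for w.
  · have h1 : 0 ≤ μ * (2 ^ j) ^ 2 / 9 * ∫ τ in (0 : ℝ)..t, ‖l2Block χ j (w τ)‖ := by positivity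
    unfold blockNorm
    linarith [hBS.1]
  · have h1 : (2 ^ j) ^ 2 * ∫ τ in (0 : ℝ)..t, ‖l2Block χ j (w τ)‖ ≤
        9 / μ * (‖l2Block χ j (w 0)‖ + ∫ τ in (0 : ℝ)..t, f τ) := by
      calc _ = 9 / μ * (μ * (2 ^ j) ^ 2 / 9 * ∫ τ in (0 : ℝ)..t, ‖l2Block χ j (w τ)‖) := by
            field_simp
        _ ≤ _ := mul_le_mul_of_nonneg_left (by linarith) (by positivity)
    unfold blockDissipation
    rw [intervalIntegral.integral_add (hii hcG) ((hii hcw).const_mul _),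
      intervalIntegral.integral_const_mul]
    unfold blockNorm
    generalize blockWeight α (2 ^ j) (thetaWeight α j) (l2Block χ j (b 0)) (l2Block χ j (d 0))
      (l2Block χ j (θ 0)) = X at *
    have h2 : 0 ≤ 9 / μ * X := by positivity
    have h3 : 0 ≤ 1000 * α ^ 4 * ‖l2Block χ j (w 0)‖ := by positivity
    linarith [hBS.2]

end BlockNorm

/-! ### Summation over the blocks -/

section Conclusion

variable {χ : R3 → ℝ} {s T μ κ : ℝ} {v : ℝ → R3 → R3} {B D G b d θ : ℝ → 𝓢'(R3, ℂ)}
  {W w : ℝ → 𝓢'(R3, EuclideanSpace ℂ (Fin 3))} {α : ℝ}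

theorem ne_top_of_mul_le {c : ℝ} (hc : 0 < c) {x y : ℝ≥0∞} (h : ENNReal.ofReal c * x ≤ y)
    (hy : y ≠ ∞) : x ≠ ∞ := by
  rintro rfl
  rw [ENNReal.mul_top (by simpa using hc)] at h
  exact hy (top_le_iff.1 h)

theorem term_le_paraNorm (χ : R3 → ℝ) (s : ℝ) (b d θ : 𝓢'(R3, ℂ))
    (w : 𝓢'(R3, EuclideanSpace ℂ (Fin 3))) (j : ℤ) :
    ENNReal.ofReal (dyadicWeight s j * max 1 (2 ^ j)) * l2Norm (lpBlock χ j b) ≤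
        paraNorm χ s b d θ w ∧
      ENNReal.ofReal (dyadicWeight s j) * l2Norm (lpBlock χ j d) ≤ paraNorm χ s b d θ w ∧
      ENNReal.ofReal (dyadicWeight s j * min 1 (2 ^ j)⁻¹) * l2Norm (lpBlock χ j θ) ≤
        paraNorm χ s b d θ w ∧
      ENNReal.ofReal (dyadicWeight s j) * l2Norm (lpBlock χ j w) ≤ paraNorm χ s b d θ w := by
  rw [paraNorm_eq]
  refine ⟨le_trans ?_ (ENNReal.le_tsum j), le_trans ?_ (ENNReal.le_tsum j),
    le_trans ?_ (ENNReal.le_tsum j), le_trans ?_ (ENNReal.le_tsum j)⟩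
  · exact le_self_add.trans le_self_add
  · exact le_self_add.trans (le_add_self.trans le_self_add)
  · exact le_add_self
  · exact le_add_self.trans (le_add_self.trans le_self_add)

theorem l2Norm_ne_top_of_paraNorm {b d θ : 𝓢'(R3, ℂ)} {w : 𝓢'(R3, EuclideanSpace ℂ (Fin 3))}
    (h : paraNorm χ s b d θ w ≠ ∞) (j : ℤ) :
    l2Norm (lpBlock χ j b) ≠ ∞ ∧ l2Norm (lpBlock χ j d) ≠ ∞ ∧ l2Norm (lpBlock χ j θ) ≠ ∞ ∧
      l2Norm (lpBlock χ j w) ≠ ∞ := by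
  obtain ⟨h1, h2, h3, h4⟩ := term_le_paraNorm χ s b d θ w j
  have hp := dyadicWeight_pos s j
  exact ⟨ne_top_of_mul_le (by positivity) h1 h, ne_top_of_mul_le hp h2 h,
    ne_top_of_mul_le (by positivity) h3 h, ne_top_of_mul_le hp h4 h⟩

theorem tsum_blockNorm_le (hα : 1 ≤ α) {b d θ : 𝓢'(R3, ℂ)}
    {w : 𝓢'(R3, EuclideanSpace ℂ (Fin 3))} (h : paraNorm χ s b d θ w ≠ ∞) :
    ∑' j, ENNReal.ofReal (dyadicWeight s j * blockNorm χ α j b d θ w) ≤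
      ENNReal.ofReal (2 * α ^ 3) * paraNorm χ s b d θ w :=
  tsum_blockWeight_le_paraNorm hα (fun _ => norm_nonneg _) (fun _ => norm_nonneg _)
    (fun _ => norm_nonneg _) (fun _ => norm_nonneg _)
    (fun j => (ofReal_norm_l2Block (l2Norm_ne_top_of_paraNorm h j).1).le)
    (fun j => (ofReal_norm_l2Block (l2Norm_ne_top_of_paraNorm h j).2.1).le)
    (fun j => (ofReal_norm_l2Block (l2Norm_ne_top_of_paraNorm h j).2.2.1).le)
    (fun j => (ofReal_norm_l2Block (l2Norm_ne_top_of_paraNorm h j).2.2.2).le)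

theorem dissipation_norm_le (hα : 1 ≤ α) {b d θ : 𝓢'(R3, ℂ)}
    {w : 𝓢'(R3, EuclideanSpace ℂ (Fin 3))} (h : paraNorm χ s b d θ w ≠ ∞) :
    hybridNorm χ 1 (s + 1) 1 b + (besovNorm χ (s + 2) d + besovNorm χ (s + 2) w) +
        hybridNorm χ 1 (s + 1) 1 θ ≤
      ∑' j, ENNReal.ofReal (dyadicWeight s j * blockDissipation χ α j b d θ w) := by
  simp only [hybridNorm, besovNorm, hybridWeight_add_one, rpow_add_two]
  rw [← ENNReal.tsum_add, ← ENNReal.tsum_add, ← ENNReal.tsum_add]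
  refine ENNReal.tsum_le_tsum fun j => ?_
  obtain ⟨h1, h2, h3, h4⟩ := l2Norm_ne_top_of_paraNorm h j
  rw [← ofReal_norm_l2Block h1, ← ofReal_norm_l2Block h2, ← ofReal_norm_l2Block h3,
    ← ofReal_norm_l2Block h4]
  have hp := dyadicWeight_pos s j
  obtain ⟨g1, g2⟩ := gain_weights_le hα j
  have hγ := thetaWeight_pos (zero_lt_one.trans_le hα) j
  have n1 := norm_nonneg (l2Block χ j b)
  have n2 := norm_nonneg (l2Block χ j d)
  have n3 := norm_nonneg (l2Block χ j θ)
  have n4 := norm_nonneg (l2Block χ j w)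
  unfold blockDissipation blockGain
  generalize ‖l2Block χ j b‖ = x at *
  generalize ‖l2Block χ j d‖ = y at *
  generalize ‖l2Block χ j θ‖ = z at *
  generalize ‖l2Block χ j w‖ = u at *
  rw [← ENNReal.ofReal_mul (by positivity), ← ENNReal.ofReal_mul (by positivity),
    ← ENNReal.ofReal_mul (by positivity), ← ENNReal.ofReal_mul (by positivity),
    ← ENNReal.ofReal_add (by positivity) (by positivity),
    ← ENNReal.ofReal_add (by positivity) (by positivity),
    ← ENNReal.ofReal_add (by positivity) (by positivity)]
  refine ENNReal.ofReal_le_ofReal ?_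
  have e1 := mul_le_mul_of_nonneg_right g1 n1
  have e2 := mul_le_mul_of_nonneg_right g2 n3
  have e3 : (2 ^ j) ^ 2 * y ≤ (2 ^ j) ^ 2 * (α * y) :=
    mul_le_mul_of_nonneg_left (le_mul_of_one_le_left n2 hα) (by positivity)
  have := mul_le_mul_of_nonneg_left (add_le_add (add_le_add e1 e2) e3) hp.le
  linarith

/-- The sum and the time integral are exchanged by Tonelli, measurability being due to the
continuity of each block dissipation. -/
theorem lintegral_dissipation_norm_le (hα : 1 ≤ α) {K t : ℝ} (ht : 0 ≤ t) {E : ℤ → ℝ}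
    (hfin : ∀ τ ∈ Icc 0 t, paraNorm χ s (b τ) (d τ) (θ τ) (w τ) ≠ ∞)
    (hc : ∀ j, ContinuousOn (fun τ => blockDissipation χ α j (b τ) (d τ) (θ τ) (w τ)) (Icc 0 t))
    (hE : ∀ j, ∫ τ in (0 : ℝ)..t, blockDissipation χ α j (b τ) (d τ) (θ τ) (w τ) ≤ K * E j)
    (hK : 0 ≤ K) :
    ∫⁻ τ in Ioc 0 t, (hybridNorm χ 1 (s + 1) 1 (b τ) +
        (besovNorm χ (s + 2) (d τ) + besovNorm χ (s + 2) (w τ)) +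
        hybridNorm χ 1 (s + 1) 1 (θ τ)) ≤
      ENNReal.ofReal K * ∑' j, ENNReal.ofReal (dyadicWeight s j * E j) := by
  have hα0 : 0 < α := by linarith
  calc _ ≤ ∫⁻ τ in Ioc 0 t, ∑' j, ENNReal.ofReal
        (dyadicWeight s j * blockDissipation χ α j (b τ) (d τ) (θ τ) (w τ)) := by
        refine setLIntegral_mono' measurableSet_Ioc fun τ hτ => ?_
        exact dissipation_norm_le hα (hfin τ ⟨hτ.1.le, hτ.2⟩)
    _ = ∑' j, ∫⁻ τ in Ioc 0 t, ENNReal.ofReal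
        (dyadicWeight s j * blockDissipation χ α j (b τ) (d τ) (θ τ) (w τ)) := by
        refine lintegral_tsum fun j => ENNReal.measurable_ofReal.comp_aemeasurable ?_
        exact ((((hc j).mono Ioc_subset_Icc_self).aestronglyMeasurable
          measurableSet_Ioc).aemeasurable).const_mul _
    _ ≤ _ := by
        rw [← ENNReal.tsum_mul_left]
        refine ENNReal.tsum_le_tsum fun j => ?_
        have hp := dyadicWeight_pos s j
        rw [← ofReal_intervalIntegral ht
          (((hc j).intervalIntegrable_of_Icc ht).const_mul _)
          (ae_of_all _ fun τ => mul_nonneg hp.le (blockDissipation_nonneg hα0 _ _ _ _ _)),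
          intervalIntegral.integral_const_mul, ← ENNReal.ofReal_mul hK]
        refine ENNReal.ofReal_le_ofReal ?_
        have := mul_le_mul_of_nonneg_left (hE j) hp.le
        linarith

/-- The bound of each block holds at all times up to t, so the supremum in time may be taken before
the sum. The factor 4 counts the unknowns. -/
theorem tilde_norm_le (hα : 1 ≤ α) {K t : ℝ} {E : ℤ → ℝ}
    (hfin : ∀ τ ∈ Ioc 0 t, paraNorm χ s (b τ) (d τ) (θ τ) (w τ) ≠ ∞)
    (hE : ∀ j, ∀ τ ∈ Ioc 0 t, blockNorm χ α j (b τ) (d τ) (θ τ) (w τ) ≤ K * E j) (hK : 0 ≤ K) :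
    tildeHybridNorm χ t 1 (s + 1) (-1) b + (tildeBesovNorm χ t s d + tildeBesovNorm χ t s w) +
        tildeHybridNorm χ t 1 (s - 1) 1 θ ≤
      ENNReal.ofReal (4 * K) * ∑' j, ENNReal.ofReal (dyadicWeight s j * E j) := by
  have hα0 : 0 < α := by linarith
  have hK4 : ENNReal.ofReal (4 * K) = ENNReal.ofReal K + (ENNReal.ofReal K + ENNReal.ofReal K) +
      ENNReal.ofReal K := by
    rw [← ENNReal.ofReal_add hK hK, ← ENNReal.ofReal_add hK (by positivity),
      ← ENNReal.ofReal_add (by positivity) hK]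
    congr 1
    ring
  have hp (j : ℤ) := dyadicWeight_pos s j
  have hmul (j : ℤ) : ENNReal.ofReal (dyadicWeight s j * (K * E j)) =
      ENNReal.ofReal K * ENNReal.ofReal (dyadicWeight s j * E j) := by
    rw [← ENNReal.ofReal_mul hK]
    congr 1
    ring
  have hbes (j : ℤ) : ENNReal.ofReal ((2 : ℝ) ^ ((j : ℝ) * s)) =
      ENNReal.ofReal (dyadicWeight s j * 1) := by rw [mul_one, dyadicWeight]
  have hle (j : ℤ) (τ : ℝ) := le_blockNorm (χ := χ) hα0 j (b τ) (d τ) (θ τ) (w τ)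
  have hfin' (j : ℤ) (τ : ℝ) (hτ : τ ∈ Ioc 0 t) := l2Norm_ne_top_of_paraNorm (hfin τ hτ) j
  rw [hK4, add_mul, add_mul, add_mul]
  simp only [tildeHybridNorm, tildeBesovNorm, hybridWeight_neg_one, hybridWeight_sub_one, hbes]
  simp only [← ENNReal.tsum_mul_left, ← hmul]
  refine add_le_add (add_le_add (ENNReal.tsum_le_tsum fun j => ?_) (add_le_add
    (ENNReal.tsum_le_tsum fun j => ?_) (ENNReal.tsum_le_tsum fun j => ?_)))
    (ENNReal.tsum_le_tsum fun j => ?_)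
  · refine ofReal_mul_blockSup_le (hp j).le (by positivity) (fun τ hτ => (hfin' j τ hτ).1)
      fun τ hτ => le_trans ?_ ((hle j τ).1.trans (hE j τ hτ))
    exact mul_le_mul_of_nonneg_right (weights_le hα j).1 (norm_nonneg _)
  · refine ofReal_mul_blockSup_le (hp j).le one_pos (fun τ hτ => (hfin' j τ hτ).2.1)
      fun τ hτ => le_trans ?_ ((hle j τ).2.1.trans (hE j τ hτ))
    exact mul_le_mul_of_nonneg_right hα (norm_nonneg _)
  · refine ofReal_mul_blockSup_le (hp j).le one_pos (fun τ hτ => (hfin' j τ hτ).2.2.2)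
      fun τ hτ => le_trans ?_ ((hle j τ).2.2.2.trans (hE j τ hτ))
    rw [one_mul]
  · refine ofReal_mul_blockSup_le (hp j).le (by positivity) (fun τ hτ => (hfin' j τ hτ).2.2.1)
      fun τ hτ => le_trans ?_ ((hle j τ).2.2.1.trans (hE j τ hτ))
    exact mul_le_mul_of_nonneg_right (weights_le hα j).2.2.2.1 (norm_nonneg _)

/-- The rate of exponential growth in the estimate. -/
def growthConst (hχ : IsLPCutoff χ) (s : ℝ) : ℝ :=
  11 * (2 : ℝ) ^ (5 * |s|) * (2 + 224 * blockConst hχ) * 10001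

/-- Summation of the block estimates. -/
theorem IsParalinearSolution.exists_block_bounds (hχ : IsLPCutoff χ) (hT : 0 ≤ T)
    (hv : IsVelocity T v) (hμ : 0 < μ) (h : IsParalinearSolution χ T μ κ v B D G W b d θ w)
    (hα : 10 ^ 8 ≤ α) (hκ : 1 ≤ α ^ 2 * κ) {A : ℝ≥0∞} (hA : A ≠ ∞)
    (hbd : ∀ t ∈ Icc 0 T, paraNorm χ s (b t) (d t) (θ t) (w t) ≤ A)
    (hB : WeaklyMeasurable χ T B) (hD : WeaklyMeasurable χ T D) (hG : WeaklyMeasurable χ T G)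
    (hW : WeaklyMeasurable χ T W)
    (hS : ∫⁻ τ in Ioc 0 T, paraNorm χ s (B τ) (D τ) (G τ) (W τ) ≠ ∞) {t : ℝ} (ht : t ∈ Icc 0 T) :
    ∃ E : ℤ → ℝ,
      (∀ j, ∀ τ ∈ Icc 0 t, blockNorm χ α j (b τ) (d τ) (θ τ) (w τ) ≤ 10001 * E j) ∧
      (∀ j, ContinuousOn (fun τ => blockDissipation χ α j (b τ) (d τ) (θ τ) (w τ)) (Icc 0 t)) ∧
      (∀ j, ∫ τ in (0 : ℝ)..t, blockDissipation χ α j (b τ) (d τ) (θ τ) (w τ) ≤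
        (1000 * α ^ 4 + 9 / μ) * E j) ∧
      ∑' j, ENNReal.ofReal (dyadicWeight s j * E j) ≤
        ENNReal.ofReal (14 * α ^ 3) *
        (ENNReal.ofReal (Real.exp (growthConst hχ s * (gradIntegral v t).toReal)) *
          (paraNorm χ s (b 0) (d 0) (θ 0) (w 0) + ∫⁻ τ in Ioc 0 t,
            ENNReal.ofReal (Real.exp (-(growthConst hχ s * (gradIntegral v τ).toReal))) *
              paraNorm χ s (B τ) (D τ) (G τ) (W τ))) := by
  have hα1 : 1 ≤ α := by linarith
  have hα0 : 0 < α := by linarith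
  have hp (j : ℤ) := dyadicWeight_pos s j
  have hc := blockConst_nonneg hχ
  have hfin (t : ℝ) (ht : t ∈ Icc 0 T) : paraNorm χ s (b t) (d t) (θ t) (w t) ≠ ∞ :=
    ne_top_of_le_ne_top hA (hbd t ht)
  obtain ⟨SB, hSBi, hSBle, hSB⟩ := exists_block_representatives hB
    (fun j => mul_pos (hp j) (by positivity)) (fun τ j => (term_le_paraNorm χ s (B τ) (D τ) (G τ)
      (W τ) j).1) hS
  obtain ⟨SD, hSDi, hSDle, hSD⟩ := exists_block_representatives hD
    hp (fun τ j => (term_le_paraNorm χ s (B τ) (D τ) (G τ) (W τ) j).2.1) hS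
  obtain ⟨SG, hSGi, hSGle, hSG⟩ := exists_block_representatives hG
    (fun j => mul_pos (hp j) (by positivity)) (fun τ j => (term_le_paraNorm χ s (B τ) (D τ) (G τ)
      (W τ) j).2.2.1) hS
  obtain ⟨SW, hSWi, hSWle, hSW⟩ := exists_block_representatives hW
    hp (fun τ j => (term_le_paraNorm χ s (B τ) (D τ) (G τ) (W τ) j).2.2.2) hS
  set C₁ : ℝ := 2 + 224 * blockConst hχ with hC₁
  have hC₁0 : 0 ≤ C₁ := by positivity
  set M : ℤ → ℝ → ℝ := fun j τ => blockNorm χ α j (b τ) (d τ) (θ τ) (w τ) with hM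
  set S : ℤ → ℝ → ℝ := fun j τ => 7 * ((α + 2 ^ j) * ‖SB j τ‖ + α * ‖SD j τ‖ +
    thetaWeight α j * ‖SG j τ‖ + ‖SW j τ‖) with hSdef
  have hM0 (j : ℤ) (τ : ℝ) : 0 ≤ M j τ := blockNorm_nonneg hα0 _ _ _ _ _
  have hg := lipConst_nonneg v
  have hgi : IntervalIntegrable (lipConst v) volume 0 T :=
    (intervalIntegrable_iff_integrableOn_Ioc_of_le hT).2 hv.integrable_lipConst
  have hS0 (j : ℤ) (τ : ℝ) : 0 ≤ S j τ := by
    have := thetaWeight_pos hα0 j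
    simp only [hSdef]
    positivity
  have hSi (j : ℤ) : IntervalIntegrable (S j) volume 0 T :=
    (intervalIntegrable_iff_integrableOn_Ioc_of_le hT).2
      (((((hSBi j).const_mul _).add ((hSDi j).const_mul _)).add ((hSGi j).const_mul _)).add
        (hSWi j) |>.const_mul _)
  have hMA (t : ℝ) (ht : t ∈ Icc 0 T) : ∑' j, ENNReal.ofReal (dyadicWeight s j * M j t) ≤
      ENNReal.ofReal (2 * α ^ 3) * A :=
    (tsum_blockNorm_le hα1 (hfin t ht)).trans (mul_le_mul_right (hbd t ht) _)
  have hA' : ENNReal.ofReal (2 * α ^ 3) * A ≠ ∞ := ENNReal.mul_ne_top ENNReal.ofReal_ne_top hA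
  set a : ℤ → ℝ := fun j => (ENNReal.ofReal (2 * α ^ 3) * A).toReal / dyadicWeight s j with ha
  have hMa (j : ℤ) (t : ℝ) (ht : t ∈ Icc 0 T) : M j t ≤ a j := by
    rw [ha, le_div_iff₀' (hp j)]
    exact (ENNReal.ofReal_le_iff_le_toReal hA').1 ((ENNReal.le_tsum j).trans (hMA t ht))
  have hSsum (τ : ℝ) : ∑' j, ENNReal.ofReal (dyadicWeight s j * S j τ) ≤
      ENNReal.ofReal (14 * α ^ 3) * paraNorm χ s (B τ) (D τ) (G τ) (W τ) := by
    have h1 := tsum_blockWeight_le_paraNorm (s := s) hα1 (fun j => norm_nonneg (SB j τ))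
      (fun j => norm_nonneg (SD j τ)) (fun j => norm_nonneg (SG j τ))
      (fun j => norm_nonneg (SW j τ)) (fun j => hSBle j τ) (fun j => hSDle j τ)
      (fun j => hSGle j τ) (fun j => hSWle j τ)
    have h2 (j : ℤ) : ENNReal.ofReal (dyadicWeight s j * S j τ) = ENNReal.ofReal 7 *
        ENNReal.ofReal (dyadicWeight s j * ((α + 2 ^ j) * ‖SB j τ‖ + α * ‖SD j τ‖ +
          thetaWeight α j * ‖SG j τ‖ + ‖SW j τ‖)) := by
      rw [← ENNReal.ofReal_mul (by norm_num)]
      congr 1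
      simp only [hSdef]
      ring
    rw [tsum_congr h2, ENNReal.tsum_mul_left]
    refine (mul_le_mul_right h1 _).trans_eq ?_
    rw [← mul_assoc, ← ENNReal.ofReal_mul (by norm_num)]
    congr 2
    ring
  have hest (j : ℤ) (f : ℝ → ℝ) := h.block_estimate (f := f) hχ hT hv hμ
    (fun t ht i => (l2Norm_ne_top_of_paraNorm (hfin t ht) i).1)
    (fun t ht i => (l2Norm_ne_top_of_paraNorm (hfin t ht) i).2.1)
    (fun t ht i => (l2Norm_ne_top_of_paraNorm (hfin t ht) i).2.2.1)
    (fun t ht i => (l2Norm_ne_top_of_paraNorm (hfin t ht) i).2.2.2) hα hκ (hMa j) (hSB j) (hSD j)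
    (hSG j) (hSW j)
  have hsrc (j : ℤ) (τ : ℝ) : blockSource hχ α v j b d θ w ‖SB j τ‖ ‖SD j τ‖ ‖SG j τ‖ ‖SW j τ‖ τ ≤
      S j τ + C₁ * lipConst v τ * ∑ i ∈ Finset.Icc (j - 5) (j + 5), M i τ :=
    blockSource_le hχ hα1 v j b d θ w τ (norm_nonneg _) (norm_nonneg _) (norm_nonneg _)
      (norm_nonneg _)
  have ha0 (j : ℤ) : 0 ≤ a j := (hM0 j 0).trans (hMa j 0 ⟨le_rfl, hT⟩)
  -- The block estimate is used twice. Here the neighbours in the source are replaced by their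
  -- constant bounds `a i`, only to obtain continuity of the block norms; after that the true source
  -- is known to be integrable.
  have hMc (j : ℤ) : ContinuousOn (M j) (Icc 0 T) := by
    refine (hest j (fun τ => S j τ + C₁ * lipConst v τ *
      ∑ i ∈ Finset.Icc (j - 5) (j + 5), a i) (fun τ => ?_) ?_ ?_).1
    · exact add_nonneg (hS0 j τ) (mul_nonneg (mul_nonneg hC₁0 (hg τ))
        (Finset.sum_nonneg fun i _ => ha0 i))
    · exact (hSi j).add ((hgi.const_mul _).mul_const _)
    · filter_upwards [ae_restrict_mem measurableSet_Ioc] with τ hτ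
      refine (hsrc j τ).trans (add_le_add le_rfl (mul_le_mul_of_nonneg_left
        (Finset.sum_le_sum fun i _ => hMa i τ ⟨hτ.1.le, hτ.2⟩) (mul_nonneg hC₁0 (hg τ))))
  set f : ℤ → ℝ → ℝ := fun j τ => S j τ + C₁ * lipConst v τ *
    ∑ i ∈ Finset.Icc (j - 5) (j + 5), M i τ with hf
  have hf0 (j : ℤ) (τ : ℝ) : 0 ≤ f j τ := add_nonneg (hS0 j τ) (mul_nonneg
    (mul_nonneg hC₁0 (hg τ)) (Finset.sum_nonneg fun i _ => hM0 i τ))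
  have hfi (j : ℤ) : IntervalIntegrable (f j) volume 0 T := by
    refine (hSi j).add ((hgi.const_mul _).mul_continuousOn ?_)
    rw [uIcc_of_le hT]
    exact continuousOn_finsetSum _ fun i _ => hMc i
  have hest' (j : ℤ) := hest j (f j) (hf0 j) (hfi j) (ae_of_all _ (hsrc j))
  -- The integrand is nonnegative, so the value at t bounds the block norm on all of [0, t].
  refine ⟨fun j => M j 0 + ∫ τ in (0 : ℝ)..t, f j τ, fun j τ hτ => ?_, fun j => ?_, fun j => ?_, ?_⟩
  · refine ((hest' j).2.2 τ ⟨hτ.1, hτ.2.trans ht.2⟩).1.trans ?_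
    have h1 : ∫ τ in (0 : ℝ)..τ, f j τ ≤ ∫ τ in (0 : ℝ)..t, f j τ :=
      intervalIntegral.integral_mono_interval le_rfl hτ.1 hτ.2 (ae_of_all _ (hf0 j))
        ((hfi j).mono_set (by rw [uIcc_of_le ht.1, uIcc_of_le hT]; exact Icc_subset_Icc_right ht.2))
    linarith
  · exact (hest' j).2.1.mono (Icc_subset_Icc_right ht.2)
  · exact ((hest' j).2.2 t ht).2
  · have hV : HasPrimitive T (fun t => (gradIntegral v t).toReal) (lipConst v) := by
      refine ⟨hgi, fun t ht => ?_⟩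
      rw [hv.gradIntegral_toReal ht, hv.gradIntegral_toReal ⟨le_rfl, hT⟩,
        intervalIntegral.integral_same, zero_add]
    have hV0 : (gradIntegral v 0).toReal = 0 := by
      rw [hv.gradIntegral_toReal ⟨le_rfl, hT⟩, intervalIntegral.integral_same]
    have hSint : ∫⁻ τ in Ioc 0 T, ∑' j, ENNReal.ofReal (dyadicWeight s j * S j τ) ≠ ∞ := by
      refine ne_top_of_le_ne_top ?_ (lintegral_mono hSsum)
      rw [lintegral_const_mul' _ _ ENNReal.ofReal_ne_top]
      exact ENNReal.mul_ne_top ENNReal.ofReal_ne_top hS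
    refine (tsum_gronwall hV (fun _ => ENNReal.toReal_nonneg) hV0 hg (fun j => (hp j).le)
      (by positivity) (fun j i hi => dyadicWeight_le s hi) hM0 hMc hS0 hSi (by norm_num) hC₁0
      (fun j t ht => ((hest' j).2.2 t ht).1) hA' hMA hSint ht).trans ?_
    rw [mul_left_comm]
    refine mul_le_mul_right ?_ _
    rw [mul_add (ENNReal.ofReal (14 * α ^ 3)), ← lintegral_const_mul' _ _ ENNReal.ofReal_ne_top]
    refine add_le_add ((tsum_blockNorm_le hα1 (hfin 0 ⟨le_rfl, hT⟩)).trans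
      (mul_le_mul_left (ENNReal.ofReal_le_ofReal ?_) _)) (lintegral_mono fun τ => ?_)
    · have : 0 ≤ α ^ 3 := by positivity
      linarith
    · rw [mul_left_comm]
      exact mul_le_mul_right (hSsum τ) _

end Conclusion

end

theorem mainTheorem4 (χ : R3 → ℝ) (hχ : IsLPCutoff χ) (s : ℝ) :
    ∃ (C : ℝ) (K : ℝ → ℝ → ℝ), 0 < C ∧ (∀ x y, 0 < K x y) ∧
      ∀ (μ κ : ℝ), 0 < μ → 0 < κ →
      ∀ (T : ℝ) (v : ℝ → R3 → R3), IsVelocity T v →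
      ∀ (B D G : ℝ → 𝓢'(R3, ℂ)) (W : ℝ → 𝓢'(R3, EuclideanSpace ℂ (Fin 3))),
      WeaklyMeasurable χ T B → WeaklyMeasurable χ T D →
      WeaklyMeasurable χ T G → WeaklyMeasurable χ T W →
      (∫⁻ τ in Ioc 0 T, (hybridNorm χ 1 (s + 1) (-1) (B τ)
        + (besovNorm χ s (D τ) + besovNorm χ s (W τ))
        + hybridNorm χ 1 (s - 1) 1 (G τ))) < ∞ →
      ∀ (b d θ : ℝ → 𝓢'(R3, ℂ)) (w : ℝ → 𝓢'(R3, EuclideanSpace ℂ (Fin 3))),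
      IsParalinearSolution χ T μ κ v B D G W b d θ w →
      (⨆ τ ∈ Icc (0 : ℝ) T, (hybridNorm χ 1 (s + 1) (-1) (b τ)
        + (besovNorm χ s (d τ) + besovNorm χ s (w τ))
        + hybridNorm χ 1 (s - 1) 1 (θ τ))) < ∞ →
      ∀ t ∈ Icc (0 : ℝ) T,
        tildeHybridNorm χ t 1 (s + 1) (-1) b
          + (tildeBesovNorm χ t s d + tildeBesovNorm χ t s w)
          + tildeHybridNorm χ t 1 (s - 1) 1 θ
          + (∫⁻ τ in Ioc 0 t, (hybridNorm χ 1 (s + 1) 1 (b τ)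
              + (besovNorm χ (s + 2) (d τ) + besovNorm χ (s + 2) (w τ))
              + hybridNorm χ 1 (s + 1) 1 (θ τ)))
        ≤ ENNReal.ofReal (K μ (min 1 κ) * Real.exp (C * (gradIntegral v t).toReal)) *
          (hybridNorm χ 1 (s + 1) (-1) (b 0)
            + (besovNorm χ s (d 0) + besovNorm χ s (w 0))
            + hybridNorm χ 1 (s - 1) 1 (θ 0)
            + ∫⁻ τ in Ioc 0 t, ENNReal.ofReal (Real.exp (-(C * (gradIntegral v τ).toReal))) *
                (hybridNorm χ 1 (s + 1) (-1) (B τ)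
                  + (besovNorm χ s (D τ) + besovNorm χ s (W τ))
                  + hybridNorm χ 1 (s - 1) 1 (G τ))) := by
  -- Here 10⁸/y is α and x is μ. The terms 4·10001 and 1000α⁴ + 9/μ belong to the supremum and the
  -- integral on the left, and 14α³ to the data. The maximum with 1 makes K positive for all
  -- arguments.
  refine ⟨growthConst hχ s, fun x y => max 1
    ((4 * 10001 + (1000 * (10 ^ 8 / y) ^ 4 + 9 / x)) * (14 * (10 ^ 8 / y) ^ 3)), ?_,
    fun x y => lt_max_of_lt_left one_pos, ?_⟩
  · have := blockConst_nonneg hχ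
    unfold growthConst
    positivity
  intro μ κ hμ hκ T v hv B D G W hB hD hG hW hS b d θ w h hbd t ht
  have hT : 0 ≤ T := ht.1.trans ht.2
  set α : ℝ := 10 ^ 8 / min 1 κ with hα
  have hκ' : 0 < min 1 κ := lt_min one_pos hκ
  have hα8 : 10 ^ 8 ≤ α := by
    rw [hα, le_div_iff₀ hκ']
    exact mul_le_of_le_one_right (by norm_num) (min_le_left _ _)
  have hα1 : 1 ≤ α := by linarith
  have hακ : 1 ≤ α ^ 2 * κ := by
    have h1 : 10 ^ 8 ≤ α * κ := by
      rw [hα, div_mul_eq_mul_div, le_div_iff₀ hκ']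
      exact mul_le_mul_of_nonneg_left (min_le_right _ _) (by norm_num)
    nlinarith
  have hbd' (τ : ℝ) (hτ : τ ∈ Icc 0 T) : paraNorm χ s (b τ) (d τ) (θ τ) (w τ) ≤
      ⨆ τ ∈ Icc (0 : ℝ) T, paraNorm χ s (b τ) (d τ) (θ τ) (w τ) :=
    le_iSup₂ (f := fun τ (_ : τ ∈ Icc (0 : ℝ) T) => paraNorm χ s (b τ) (d τ) (θ τ) (w τ)) τ hτ
  obtain ⟨E, hE, hc, hdiss, hsum⟩ := h.exists_block_bounds hχ hT hv hμ hα8 hακ hbd.ne hbd'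
    hB hD hG hW hS.ne ht
  have hfin (τ : ℝ) (hτ : τ ∈ Icc 0 t) : paraNorm χ s (b τ) (d τ) (θ τ) (w τ) ≠ ∞ :=
    ne_top_of_le_ne_top hbd.ne (hbd' τ ⟨hτ.1, hτ.2.trans ht.2⟩)
  have h1 := tilde_norm_le hα1 (fun τ hτ => hfin τ ⟨hτ.1.le, hτ.2⟩)
    (fun j τ hτ => hE j τ ⟨hτ.1.le, hτ.2⟩) (by norm_num)
  have h2 := lintegral_dissipation_norm_le hα1 ht.1 hfin hc hdiss (by positivity)
  refine (add_le_add h1 h2).trans ?_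
  rw [← add_mul, ← ENNReal.ofReal_add (by norm_num) (by positivity)]
  refine (mul_le_mul_right hsum _).trans ?_
  rw [← mul_assoc, ← mul_assoc, ← ENNReal.ofReal_mul (by positivity),
    ← ENNReal.ofReal_mul (by positivity)]
  refine mul_le_mul_left (ENNReal.ofReal_le_ofReal ?_) _
  exact mul_le_mul_of_nonneg_right (le_max_right _ _) (Real.exp_nonneg _)
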